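/- **Setting.** Let $m,n,h,r\ge 1$. Let $W_2\in\mathbb R^{m\times h}$, $W_1\in\mathbb R^{h\times n}$, $Y_{\mathrm{pre}}=W_2W_1$, and suppose there are singular value decompositions (the singular values being listed in any order) $$W_2=U\Sigma_{W_2}G^\top,\quad W_1=G\Sigma_{W_1}V^\top,\quad Y_{\mathrm{pre}}=U\Sigma_{\mathrm{pre}}V^\top,\quad \Delta Y:=Y_{\mathrm{ft}}-Y_{\mathrm{pre}}=U\Sigma_{\Delta Y}V^\top$$ with common orthogonal matrices $U,G,V$. Assume that $\Delta Y=\sigma uv^\top$ has rank one, where $\sigma>0$ and $u,v$ are the $k$-th columns of $U,V$, with $k\le h$. Let $g$ be the $k$-th column of $G$, let $\sigma_{W_1},\sigma_{W_2}$ be the $k$-th diagonal entries of $\Sigma_{W_1},\Sigma_{W_2}$, and assume $\sigma_{W_2}>0$ and $\delta_w:=\sigma_{W_1}/\sigma_{W_2}<1$. For $A_1\in\mathbb R^{r\times n}$, $B_1\in\mathbb R^{h\times r}$, $A_2\in\mathbb R^{r\times h}$, $B_2\in\mathbb R^{m\times r}$ put $$L(A_1,A_2,B_1,B_2)=\tfrac12\lVert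 Y_{\mathrm{ft}}-(W_2+B_2A_2)(W_1+B_1A_1)\rVert_F^2,\quad Z_1=\begin{pmatrix}B_1\\A_1^\top\end{pmatrix},\ Z_2=\begin{pmatrix}B_2\\A_2^\top\end{pmatrix},\ \gamma_1=\begin{pmatrix}g\\v\end{pmatrix}.$$ Consider the gradient flow $\dot A_i=-\partial L/\partial A_i$, $\dot B_i=-\partial L/\partial B_i$ ($i=1,2$, $t\ge0$), started from $B_i(0)=0$, $A_i(0)=\alpha N_i$, where all entries of $N_1,N_2$ are i.i.d. standard Gaussian (so the entries of $A_i(0)$ are i.i.d. $\mathcal N(0,\alpha^2)$). Write $L(t)$ for the loss at time $t$, $\lVert\cdot\rVert$ for the spectral norm, and $U_{Z_1}^S(t)$ for a unit left singular vector of $Z_1(t)$ for its largest singular value (the statements hold for every choice). Let $T_1$, the end of the alignment phase, be the first time $t\ge0$ with $g^\top B_1(t)A_1(t)v\ge\frac{(1-\delta_w)\sigma}{4\sigma_{W_2}}$. **Theorem 2 (local convergence).** There are absolute constants $c_1,c_3>0$ such that in the above setting, for every $c_2>0$ and every $\varepsilon>0$, there are constants $c_4,\dots,c_8,\alpha^*>0$,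 which depend on $m,n,h,r$, on the matrices of the problem, on $c_2$ and on $\varepsilon$, but not on $\alpha$ and not on the random initialization, and an event of probability at least $1-\varepsilon$ for $(N_1,N_2)$ (not depending on $\alpha$), such that on this event, for every $0<\alpha\le\alpha^*$, the following holds. The time $T_1$ exists, $T_1\le\frac{c_1\log(1/\alpha)}{\sigma\sigma_{W_2}}$, and $$\cos^2(U_{Z_1}^S(T_1),\gamma_1)\ge1-c_4\alpha^{\frac{1+\delta_w}{3+\delta_w}},\qquad \frac{\lVert Z_1(T_1)\rVert^2}{\lVert Z_2(T_1)\rVert^2}\ge c_5\,\alpha^{-\frac{4(1-\delta_w)}{5-\delta_w}}.$$ With $T_2=\frac{c_2\log(\sqrt{2L(0)}/\alpha)}{\sigma\sigma_{W_2}}$, for all $t\in[T_1,T_1+T_2]$: 1. (alignment) $\cos^2(U_{Z_1}^S(t),\gamma_1)\ge\cos^{2c_6}(U_{Z_1}^S(T_1),\gamma_1)$; 2. (imbalance) $\displaystyle\frac{\lVert Z_1(t)\rVert}{\lVert Z_2(t)\rVert}\ge\Bigl(\frac{\lVert Z_1(T_1)\rVert}{\lVert Z_2(T_1)\rVert}\Bigr)^{c_7}$;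 3. (linear convergence) for every $\tau\ge0$, in particular for $\tau=T_1$ and for $\tau=T_2$, $$L(t)\le2\exp\Bigl(-\tfrac{1}{16}\Bigl(1-\tfrac{\lVert Z_2(T_1)\rVert}{\lVert Z_1(\tau)\rVert}\Bigr)(1-\delta_w)\sigma\sigma_{W_2}(t-T_1)\Bigr)L(T_1)+c_8\bigl(1-\cos^2(U_{Z_1}^S(T_1),\gamma_1)\bigr);$$ 4. (simplified rate) $L(t)\le2\exp\bigl(-\tfrac{1}{32}(1-\delta_w)\sigma\sigma_{W_2}(t-T_1)\bigr)L(T_1)+2\alpha^{c_3}$. -/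

import Mathlib

open Matrix MeasureTheory ProbabilityTheory Set

noncomputable section

/-- `S` is a (rectangular) diagonal matrix with nonnegative entries. -/
def IsSingularValueMatrix {p q : ℕ} (S : Matrix (Fin p) (Fin q) ℝ) : Prop :=
  (∀ (i : Fin p) (j : Fin q), (i : ℕ) ≠ (j : ℕ) → S i j = 0) ∧ ∀ i j, 0 ≤ S i j

/-- `M = U S Vᵀ` is a (full) singular value decomposition. The singular values are not required to
be listed in decreasing order. -/
def IsSVD {p q : ℕ} (M : Matrix (Fin p) (Fin q) ℝ) (U : Matrix (Fin p) (Fin p) ℝ)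
    (S : Matrix (Fin p) (Fin q) ℝ) (V : Matrix (Fin q) (Fin q) ℝ) : Prop :=
  U ∈ Matrix.orthogonalGroup (Fin p) ℝ ∧ V ∈ Matrix.orthogonalGroup (Fin q) ℝ ∧
    IsSingularValueMatrix S ∧ M = U * S * Vᵀ

/-- Fine-tuning of a pre-trained matrix factorization, with a rank-one change `Yft - Ypre` of the
target: the pre-trained factors factorize `Ypre` exactly, their singular vectors are aligned with
those of `Ypre`, and `Yft - Ypre` has the same singular vector matrices as `Ypre`. The index `k` is
the one of the singular direction along which the target changes. -/
structure RankOneLoRA (m n h : ℕ) where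
  Ypre : Matrix (Fin m) (Fin n) ℝ
  Yft : Matrix (Fin m) (Fin n) ℝ
  W₁ : Matrix (Fin h) (Fin n) ℝ
  W₂ : Matrix (Fin m) (Fin h) ℝ
  U : Matrix (Fin m) (Fin m) ℝ
  V : Matrix (Fin n) (Fin n) ℝ
  G : Matrix (Fin h) (Fin h) ℝ
  Spre : Matrix (Fin m) (Fin n) ℝ
  S₁ : Matrix (Fin h) (Fin n) ℝ
  S₂ : Matrix (Fin m) (Fin h) ℝ
  SΔ : Matrix (Fin m) (Fin n) ℝ
  factorization : Ypre = W₂ * W₁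
  svd_pre : IsSVD Ypre U Spre V
  svd_W₂ : IsSVD W₂ U S₂ G
  svd_W₁ : IsSVD W₁ G S₁ V
  svd_Δ : IsSVD (Yft - Ypre) U SΔ V
  rank_one : (Yft - Ypre).rank = 1
  k : ℕ
  k_lt_m : k < m
  k_lt_n : k < n
  k_lt_h : k < h
  σ_pos : 0 < SΔ ⟨k, k_lt_m⟩ ⟨k, k_lt_n⟩

namespace RankOneLoRA

variable {m n h : ℕ} (P : RankOneLoRA m n h)

/-- The nonzero singular value of `Yft - Ypre = σ u vᵀ`. -/
def σ : ℝ := P.SΔ ⟨P.k, P.k_lt_m⟩ ⟨P.k, P.k_lt_n⟩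

/-- The singular value of `W₁` for the singular vectors `g`, `v`. -/
def σW₁ : ℝ := P.S₁ ⟨P.k, P.k_lt_h⟩ ⟨P.k, P.k_lt_n⟩

/-- The singular value of `W₂` for the singular vectors `u`, `g`. -/
def σW₂ : ℝ := P.S₂ ⟨P.k, P.k_lt_m⟩ ⟨P.k, P.k_lt_h⟩

/-- The ratio of the two singular values of the pre-trained weights. -/
def δw : ℝ := P.σW₁ / P.σW₂

/-- The right singular vector of `Yft - Ypre` (and of `W₁`). -/
def v : Fin n → ℝ := fun i => P.V i ⟨P.k, P.k_lt_n⟩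

/-- The common singular vector of `W₁` (left) and `W₂` (right). -/
def g : Fin h → ℝ := fun i => P.G i ⟨P.k, P.k_lt_h⟩

/-- The direction `γ₁ = (g; v)`. -/
def γ₁ : Fin h ⊕ Fin n → ℝ := Sum.elim P.g P.v

end RankOneLoRA

/-- LoRA weights of rank `r`. -/
structure LoRAWeights (m n h r : ℕ) where
  A₁ : Matrix (Fin r) (Fin n) ℝ
  B₁ : Matrix (Fin h) (Fin r) ℝ
  A₂ : Matrix (Fin r) (Fin h) ℝ
  B₂ : Matrix (Fin m) (Fin r) ℝ

namespace LoRAWeights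

variable {m n h r : ℕ} (w : LoRAWeights m n h r)

/-- `Z₁ = (B₁; A₁ᵀ)`. -/
def Z₁ : Matrix (Fin h ⊕ Fin n) (Fin r) ℝ := Matrix.fromRows w.B₁ w.A₁ᵀ

/-- `Z₂ = (B₂; A₂ᵀ)`. -/
def Z₂ : Matrix (Fin m ⊕ Fin h) (Fin r) ℝ := Matrix.fromRows w.B₂ w.A₂ᵀ

end LoRAWeights

/-- The loss `½ ‖Yft - (W₂ + B₂ A₂) (W₁ + B₁ A₁)‖_F²`. -/
def RankOneLoRA.loss {m n h r : ℕ} (P : RankOneLoRA m n h) (w : LoRAWeights m n h r) : ℝ :=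
  1 / 2 * ∑ i, ∑ j, ((P.Yft - (P.W₂ + w.B₂ * w.A₂) * (P.W₁ + w.B₁ * w.A₁)) i j) ^ 2

/-- The matrix `∂f/∂X` of partial derivatives of a function `f` of a matrix `X`. -/
def matrixPartial {p q : ℕ} (f : Matrix (Fin p) (Fin q) ℝ → ℝ) (X : Matrix (Fin p) (Fin q) ℝ) :
    Matrix (Fin p) (Fin q) ℝ :=
  Matrix.of fun i j => deriv (fun s : ℝ => f (X + s • Matrix.single i j (1 : ℝ))) 0

/-- `w : [0, ∞) → LoRAWeights` is a gradient flow of the loss: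
`Ȧᵢ = -∂L/∂Aᵢ` and `Ḃᵢ = -∂L/∂Bᵢ` (one-sided derivative at time `0`). -/
def IsGradientFlow {m n h r : ℕ} (P : RankOneLoRA m n h) (w : ℝ → LoRAWeights m n h r) : Prop :=
  ∀ t : ℝ, 0 ≤ t →
    (∀ i j, HasDerivWithinAt (fun s => (w s).A₁ i j)
      (-matrixPartial (fun X => P.loss { w t with A₁ := X }) (w t).A₁ i j) (Ici 0) t) ∧
    (∀ i j, HasDerivWithinAt (fun s => (w s).B₁ i j)
      (-matrixPartial (fun X => P.loss { w t with B₁ := X }) (w t).B₁ i j) (Ici 0) t) ∧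
    (∀ i j, HasDerivWithinAt (fun s => (w s).A₂ i j)
      (-matrixPartial (fun X => P.loss { w t with A₂ := X }) (w t).A₂ i j) (Ici 0) t) ∧
    (∀ i j, HasDerivWithinAt (fun s => (w s).B₂ i j)
      (-matrixPartial (fun X => P.loss { w t with B₂ := X }) (w t).B₂ i j) (Ici 0) t)

/-- The law of a `p × q` matrix with independent standard Gaussian entries. -/
def stdGaussianMatrix (p q : ℕ) : Measure (Fin p → Fin q → ℝ) :=
  Measure.pi fun _ => Measure.pi fun _ => gaussianReal 0 1

/-- The LoRA initialization of scale `α` obtained from `N = (N₁, N₂)`: `Aᵢ = α Nᵢ` and `Bᵢ = 0`.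
If the entries of `N₁` and `N₂` are i.i.d. standard Gaussian, then those of `A₁` and `A₂` are
i.i.d. with law `𝒩(0, α²)`. -/
def loraInit {m n h r : ℕ} (α : ℝ) (N : (Fin r → Fin n → ℝ) × (Fin r → Fin h → ℝ)) :
    LoRAWeights m n h r where
  A₁ := α • Matrix.of N.1
  B₁ := 0
  A₂ := α • Matrix.of N.2
  B₂ := 0

section
open scoped Matrix.Norms.L2Operator

/-- The spectral norm of a matrix. -/
def specNorm {ι κ : Type*} [Fintype ι] [Fintype κ] [DecidableEq κ] (M : Matrix ι κ ℝ) : ℝ := ‖M‖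

end

/-- `q` is a unit left singular vector of `M` for its largest singular value. -/
def IsTopLeftSingularVector {ι κ : Type*} [Fintype ι] [Fintype κ] [DecidableEq κ]
    (M : Matrix ι κ ℝ) (q : ι → ℝ) : Prop :=
  q ⬝ᵥ q = 1 ∧ (M * Mᵀ) *ᵥ q = specNorm M ^ 2 • q

/-- The squared cosine of the angle between two nonzero vectors. -/
def cosSq {ι : Type*} [Fintype ι] (x y : ι → ℝ) : ℝ := (x ⬝ᵥ y) ^ 2 / ((x ⬝ᵥ x) * (y ⬝ᵥ y))

/-- `T₁` is the end of the alignment phase: the first time at which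
`gᵀ B₁ A₁ v ≥ (1 - δw) σ / (4 σW₂)`. -/
def IsAlignmentTime {m n h r : ℕ} (P : RankOneLoRA m n h) (w : ℝ → LoRAWeights m n h r)
    (T₁ : ℝ) : Prop :=
  IsLeast {t : ℝ | 0 ≤ t ∧
    (1 - P.δw) * P.σ / (4 * P.σW₂) ≤ P.g ⬝ᵥ (((w t).B₁ * (w t).A₁) *ᵥ P.v)} T₁

end

/-! Everything is split along the distinguished directions u, g, v. Put a = A₁v, b = B₁ᵀg, c = A₂g,
y = B₂ᵀu, p = ⟨a, b⟩, and let e be the component of the residual along uvᵀ. Up to small errors the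
flow reads a' = σ₂e b, b' = σ₂e a, c' = e(σ₁+p) y, y' = e(σ₁+p) c. While p is small, a + b grows at
rate σ₂e and c + y only at about σ₁e. The gap σ₁ < σ₂ is what keeps the second pair of weights much
smaller than the first.

Four estimates carry the upper bounds. The parts of the weights orthogonal to u, g, v stay of order
α, because in the velocity of their total square every term that is not a negative square carries a
factor from the second pair (`Bounded.off_velocity_le`). Comparing the growth of the second pair
with that of log ‖a + b‖² bounds its squared norm by a multiple of κ⁴, where κ² = α^(1-δ) and δ =
σ₁/σ₂ (`size_le`). The conserved matrix A₁A₁ᵀ - B₁ᵀB₁ forces ‖a - b‖ = O(α), so Z₁ is within O(α) of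
a multiple of (g; v)(a + b)ᵀ, and the singular vector equation turns this into 1 - cos² = O(α²)
(`IsTop.defect_le`). After T₁ the product p stays above half its threshold, so e² decays at a fixed
rate up to forcing by the rest of the residual (`e_sq_le`). Hence e has bounded integral and the
second pair grows by at most a constant factor (`size_le_of_late`). The estimates depend on each
other and are closed by continuity arguments in `early` and `late`. The exponents so obtained, 2 for
the alignment and -2(1-δ) for the imbalance, are better than the stated ones.

The alignment and linear convergence claims compare later quantities with the actual value of 1 -
cos² at T₁, so this value also needs a lower bound. `Endgame` records what suffices: a scale D that
bounds the remaining residual and the later misalignment, and whose square is bounded by a multiple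
of 1 - cos² at T₁. There are three cases. If n ≥ 2, a component A₁d with d orthogonal to v keeps its
projection on a + b, and D = α. If n = 1 and h ≥ 2, the first pair has essentially rank one, the
misalignment comes from the part of B₁ orthogonal to g, and this part is produced by ⟨A₂d, y⟩ in a
last time window before T₁; here D = α‖c + y‖ at T₁. If n = h = 1, conservation alone gives D = α².

The initialization matters only through a bound K on its size and on the inverses of a few quadratic
expressions. Such expressions vanish on null sets, so K can be chosen on an event of probability at
least 1 - ε, before α. All smallness requirements then follow from C κ (1 + T)² ≤ 1 with a
logarithmic horizon T, which holds for small α. -/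

/-! ### Frobenius inner product and norm -/

section FrobeniusInner

open scoped Matrix.Norms.Frobenius

variable {ι κ μ : Type*} [Fintype ι] [Fintype κ] [Fintype μ]

/-- The Frobenius inner product of two real matrices. -/
def frobInner (X Y : Matrix ι κ ℝ) : ℝ := ∑ i, ∑ j, X i j * Y i j

theorem frobInner_self (X : Matrix ι κ ℝ) : frobInner X X = ‖X‖ ^ 2 := by
  rw [frobenius_norm_def, ← Real.sqrt_eq_rpow, Real.sq_sqrt (by positivity)]
  simp [frobInner, sq]

theorem frobInner_comm (X Y : Matrix ι κ ℝ) : frobInner X Y = frobInner Y X := by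
  simp [frobInner, mul_comm]

theorem frobInner_add_left (X Y Z : Matrix ι κ ℝ) :
    frobInner (X + Y) Z = frobInner X Z + frobInner Y Z := by
  simp [frobInner, add_mul, Finset.sum_add_distrib]

theorem frobInner_add_right (X Y Z : Matrix ι κ ℝ) :
    frobInner X (Y + Z) = frobInner X Y + frobInner X Z := by
  simp [frobInner, mul_add, Finset.sum_add_distrib]

theorem frobInner_sub_left (X Y Z : Matrix ι κ ℝ) :
    frobInner (X - Y) Z = frobInner X Z - frobInner Y Z := by
  simp [frobInner, sub_mul, Finset.sum_sub_distrib]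

theorem frobInner_sub_right (X Y Z : Matrix ι κ ℝ) :
    frobInner X (Y - Z) = frobInner X Y - frobInner X Z := by
  simp [frobInner, mul_sub, Finset.sum_sub_distrib]

theorem frobInner_neg_left (X Y : Matrix ι κ ℝ) : frobInner (-X) Y = -frobInner X Y := by
  simp [frobInner]

theorem frobInner_neg_right (X Y : Matrix ι κ ℝ) : frobInner X (-Y) = -frobInner X Y := by
  simp [frobInner]

theorem frobInner_smul_left (c : ℝ) (X Y : Matrix ι κ ℝ) :
    frobInner (c • X) Y = c * frobInner X Y := by
  simp [frobInner, Finset.mul_sum, mul_assoc]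

theorem frobInner_smul_right (c : ℝ) (X Y : Matrix ι κ ℝ) :
    frobInner X (c • Y) = c * frobInner X Y := by
  simp [frobInner, Finset.mul_sum, mul_left_comm]

theorem frobInner_zero_left (X : Matrix ι κ ℝ) : frobInner 0 X = 0 := by simp [frobInner]

theorem frobInner_zero_right (X : Matrix ι κ ℝ) : frobInner X 0 = 0 := by simp [frobInner]

theorem frobInner_transpose (X Y : Matrix ι κ ℝ) : frobInner Xᵀ Yᵀ = frobInner X Y := by
  simp only [frobInner, transpose_apply]
  exact Finset.sum_comm

/-- Left multiplication by `A` is adjoint to left multiplication by `Aᵀ`. -/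
theorem frobInner_mul_left (A : Matrix ι μ ℝ) (B : Matrix μ κ ℝ) (C : Matrix ι κ ℝ) :
    frobInner (A * B) C = frobInner B (Aᵀ * C) := by
  simp only [frobInner, mul_apply, transpose_apply, Finset.sum_mul, Finset.mul_sum]
  have : ∀ i : ι, (∑ j : κ, ∑ k : μ, A i k * B k j * C i j) =
      ∑ k : μ, ∑ j : κ, A i k * B k j * C i j := fun i => Finset.sum_comm
  simp only [this]
  rw [Finset.sum_comm]
  refine Finset.sum_congr rfl fun k _ => ?_
  rw [Finset.sum_comm]
  exact Finset.sum_congr rfl fun j _ => Finset.sum_congr rfl fun i _ => by ring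

/-- Right multiplication by `B` is adjoint to right multiplication by `Bᵀ`. -/
theorem frobInner_mul_right (A : Matrix ι μ ℝ) (B : Matrix μ κ ℝ) (C : Matrix ι κ ℝ) :
    frobInner (A * B) C = frobInner A (C * Bᵀ) := by
  rw [← frobInner_transpose, transpose_mul, frobInner_mul_left, ← frobInner_transpose]
  simp

theorem norm_sub_sq_frob (X Y : Matrix ι κ ℝ) :
    ‖X - Y‖ ^ 2 = ‖X‖ ^ 2 - 2 * frobInner X Y + ‖Y‖ ^ 2 := by
  rw [← frobInner_self, ← frobInner_self, ← frobInner_self, frobInner_sub_left,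
    frobInner_sub_right, frobInner_sub_right, frobInner_comm Y X]
  ring

theorem norm_add_sq_frob (X Y : Matrix ι κ ℝ) :
    ‖X + Y‖ ^ 2 = ‖X‖ ^ 2 + 2 * frobInner X Y + ‖Y‖ ^ 2 := by
  rw [← frobInner_self, ← frobInner_self, ← frobInner_self, frobInner_add_left,
    frobInner_add_right, frobInner_add_right, frobInner_comm Y X]
  ring

theorem abs_frobInner_le (X Y : Matrix ι κ ℝ) : |frobInner X Y| ≤ ‖X‖ * ‖Y‖ := by
  refine abs_le_of_sq_le_sq ?_ (by positivity)
  rw [mul_pow, ← frobInner_self, ← frobInner_self]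
  simp only [frobInner, ← Finset.sum_product', Finset.univ_product_univ]
  simpa [sq] using Finset.sum_mul_sq_le_sq_mul_sq Finset.univ (fun p : ι × κ => X p.1 p.2)
    (fun p : ι × κ => Y p.1 p.2)

theorem frobInner_le (X Y : Matrix ι κ ℝ) : frobInner X Y ≤ ‖X‖ * ‖Y‖ :=
  (le_abs_self _).trans (abs_frobInner_le X Y)

theorem neg_le_frobInner (X Y : Matrix ι κ ℝ) : -(‖X‖ * ‖Y‖) ≤ frobInner X Y :=
  neg_le_of_abs_le (abs_frobInner_le X Y)

theorem fro_mul_le {X : Matrix ι μ ℝ} {Y : Matrix μ κ ℝ} {x y : ℝ} (hX : ‖X‖ ≤ x)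
    (hY : ‖Y‖ ≤ y) : ‖X * Y‖ ≤ x * y :=
  (frobenius_norm_mul X Y).trans (mul_le_mul hX hY (norm_nonneg _) ((norm_nonneg _).trans hX))

/-- The product of a row and a column. -/
theorem transpose_mul_col (x y : Matrix ι Unit ℝ) : xᵀ * y = frobInner x y • (1 : Matrix Unit Unit ℝ) := by
  ext i j
  simp [frobInner, mul_apply]

theorem norm_sq_of_transpose_mul_self {x : Matrix ι Unit ℝ} (hx : xᵀ * x = 1) : ‖x‖ = 1 := by
  have h := congrFun (congrFun ((transpose_mul_col x x).symm.trans hx) ()) ()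
  rw [frobInner_self] at h
  simp at h
  rcases h with h | h
  · exact h
  · linarith [norm_nonneg x]

theorem frobInner_col_mul (u : Matrix ι Unit ℝ) (v : Matrix κ Unit ℝ) (X : Matrix ι κ ℝ) :
    frobInner (u * vᵀ) X = frobInner u (X * v) := by
  rw [frobInner_mul_right, transpose_transpose]

theorem norm_col_mul_row (u : Matrix ι Unit ℝ) (v : Matrix κ Unit ℝ) :
    ‖u * vᵀ‖ = ‖u‖ * ‖v‖ := by
  have h : ‖u * vᵀ‖ ^ 2 = (‖u‖ * ‖v‖) ^ 2 := by
    rw [← frobInner_self, frobInner_col_mul, Matrix.mul_assoc, transpose_mul_col, frobInner_self]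
    simp [frobInner_smul_right, frobInner_self]
    ring
  exact (pow_left_inj₀ (norm_nonneg _) (by positivity) two_ne_zero).1 h

theorem norm_mul_transpose_of_unit {v : Matrix κ Unit ℝ} (hv : vᵀ * v = 1) (x : Matrix ι Unit ℝ) :
    ‖x * vᵀ‖ = ‖x‖ := by
  rw [norm_col_mul_row, norm_sq_of_transpose_mul_self hv, mul_one]

end FrobeniusInner

/-! ### Calculus of matrix-valued curves on the half line -/

section EntrywiseDerivative

open scoped Matrix.Norms.Frobenius

variable {ι κ μ : Type*}

/-- Entrywise derivative of a matrix-valued function of time `t ≥ 0`. -/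
def HasMatDeriv (f : ℝ → Matrix ι κ ℝ) (f' : Matrix ι κ ℝ) (t : ℝ) : Prop :=
  ∀ i j, HasDerivWithinAt (fun s => f s i j) (f' i j) (Ici 0) t

variable {f : ℝ → Matrix ι κ ℝ} {f' : Matrix ι κ ℝ} {g : ℝ → Matrix ι κ ℝ} {g' : Matrix ι κ ℝ}
  {t : ℝ}

theorem HasMatDeriv.add (hf : HasMatDeriv f f' t) (hg : HasMatDeriv g g' t) :
    HasMatDeriv (fun s => f s + g s) (f' + g') t := fun i j => (hf i j).add (hg i j)

theorem HasMatDeriv.sub (hf : HasMatDeriv f f' t) (hg : HasMatDeriv g g' t) :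
    HasMatDeriv (fun s => f s - g s) (f' - g') t := fun i j => (hf i j).sub (hg i j)

theorem HasMatDeriv.transpose (hf : HasMatDeriv f f' t) :
    HasMatDeriv (fun s => (f s)ᵀ) f'ᵀ t := fun i j => hf j i

theorem HasMatDeriv.const (C : Matrix ι κ ℝ) (t : ℝ) : HasMatDeriv (fun _ => C) 0 t :=
  fun _ _ => hasDerivWithinAt_const _ _ _

theorem HasMatDeriv.mul [Fintype κ] {h : ℝ → Matrix κ μ ℝ} {h' : Matrix κ μ ℝ}
    (hf : HasMatDeriv f f' t) (hh : HasMatDeriv h h' t) :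
    HasMatDeriv (fun s => f s * h s) (f' * h t + f t * h') t := by
  intro i j
  simp only [mul_apply, Matrix.add_apply, ← Finset.sum_add_distrib]
  exact HasDerivWithinAt.fun_sum fun k _ => (hf i k).mul (hh k j)

theorem HasMatDeriv.const_mul [Fintype κ] {h : ℝ → Matrix κ μ ℝ} {h' : Matrix κ μ ℝ}
    (C : Matrix ι κ ℝ) (hh : HasMatDeriv h h' t) :
    HasMatDeriv (fun s => C * h s) (C * h') t := by
  simpa using (HasMatDeriv.const C t).mul hh

theorem HasMatDeriv.mul_const [Fintype κ] (hf : HasMatDeriv f f' t) (C : Matrix κ μ ℝ) :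
    HasMatDeriv (fun s => f s * C) (f' * C) t := by
  simpa using hf.mul (HasMatDeriv.const C t)

theorem HasMatDeriv.congr_deriv (hf : HasMatDeriv f f' t) (h : f' = g') : HasMatDeriv f g' t :=
  h ▸ hf

theorem HasMatDeriv.frobInner [Fintype ι] [Fintype κ] (hf : HasMatDeriv f f' t)
    (hg : HasMatDeriv g g' t) :
    HasDerivWithinAt (fun s => frobInner (f s) (g s)) (frobInner f' (g t) + frobInner (f t) g')
      (Ici 0) t := by
  simp only [_root_.frobInner, ← Finset.sum_add_distrib]
  exact HasDerivWithinAt.fun_sum fun i _ => HasDerivWithinAt.fun_sum fun j _ =>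
    (hf i j).mul (hg i j)

theorem HasMatDeriv.norm_sq [Fintype ι] [Fintype κ] (hf : HasMatDeriv f f' t) :
    HasDerivWithinAt (fun s => ‖f s‖ ^ 2) (2 * _root_.frobInner (f t) f') (Ici 0) t := by
  simp only [← frobInner_self]
  refine (hf.frobInner hf).congr_deriv ?_
  rw [frobInner_comm]
  ring

end EntrywiseDerivative

/-! ### Differential inequalities and continuity induction -/

section Comparison

/-- A function on `[t₀, t₁]` with nonpositive derivative does not increase. -/
theorem le_of_hasDerivWithinAt_nonpos {f f' : ℝ → ℝ} {t₀ t₁ : ℝ} (h₀ : 0 ≤ t₀) (h : t₀ ≤ t₁)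
    (hf : ∀ t ∈ Icc t₀ t₁, HasDerivWithinAt f (f' t) (Ici 0) t)
    (hf' : ∀ t ∈ Ioo t₀ t₁, f' t ≤ 0) : f t₁ ≤ f t₀ := by
  have hd : ∀ t ∈ Ioo t₀ t₁, HasDerivAt f (f' t) t := fun t ht =>
    (hf t ⟨ht.1.le, ht.2.le⟩).hasDerivAt (Ici_mem_nhds (h₀.trans_lt ht.1))
  refine antitoneOn_of_deriv_nonpos (convex_Icc t₀ t₁)
    (fun t ht => (hf t ht).continuousWithinAt.mono fun s hs => h₀.trans hs.1) ?_ ?_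
    (left_mem_Icc.2 h) (right_mem_Icc.2 h) h
  · rw [interior_Icc]
    exact fun t ht => (hd t ht).differentiableAt.differentiableWithinAt
  · rw [interior_Icc]
    exact fun t ht => (hd t ht).deriv ▸ hf' t ht

theorem le_of_hasDerivWithinAt_nonneg {f f' : ℝ → ℝ} {t₀ t₁ : ℝ} (h₀ : 0 ≤ t₀) (h : t₀ ≤ t₁)
    (hf : ∀ t ∈ Icc t₀ t₁, HasDerivWithinAt f (f' t) (Ici 0) t)
    (hf' : ∀ t ∈ Ioo t₀ t₁, 0 ≤ f' t) : f t₀ ≤ f t₁ :=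
  neg_le_neg_iff.1 (le_of_hasDerivWithinAt_nonpos (f := fun t => -f t) (f' := fun t => -f' t) h₀ h
    (fun t ht => (hf t ht).neg) fun t ht => neg_nonpos.2 (hf' t ht))

/-- Grönwall's inequality, with the growth rate given by its antiderivative `μ`. -/
theorem le_mul_exp_of_hasDerivWithinAt_le {f f' μ μ' : ℝ → ℝ} {t₀ t₁ : ℝ} (h₀ : 0 ≤ t₀)
    (h : t₀ ≤ t₁) (hf : ∀ t ∈ Icc t₀ t₁, HasDerivWithinAt f (f' t) (Ici 0) t)
    (hμ : ∀ t ∈ Icc t₀ t₁, HasDerivWithinAt μ (μ' t) (Ici 0) t)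
    (hf' : ∀ t ∈ Ioo t₀ t₁, f' t ≤ μ' t * f t) : f t₁ ≤ f t₀ * Real.exp (μ t₁ - μ t₀) := by
  have key := le_of_hasDerivWithinAt_nonpos (f := fun t => f t * Real.exp (-μ t))
    (f' := fun t => f' t * Real.exp (-μ t) + f t * (Real.exp (-μ t) * -μ' t)) h₀ h
    (fun t ht => (hf t ht).mul (hμ t ht).neg.exp) fun t ht => by
      have := mul_le_mul_of_nonneg_right (hf' t ht) (Real.exp_pos (-μ t)).le
      linarith
  have h2 := mul_le_mul_of_nonneg_right key (Real.exp_pos (μ t₁)).le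
  rw [mul_assoc, mul_assoc, ← Real.exp_add, ← Real.exp_add] at h2
  simpa [sub_eq_neg_add] using h2

theorem mul_exp_le_of_le_hasDerivWithinAt {f f' μ μ' : ℝ → ℝ} {t₀ t₁ : ℝ} (h₀ : 0 ≤ t₀)
    (h : t₀ ≤ t₁) (hf : ∀ t ∈ Icc t₀ t₁, HasDerivWithinAt f (f' t) (Ici 0) t)
    (hμ : ∀ t ∈ Icc t₀ t₁, HasDerivWithinAt μ (μ' t) (Ici 0) t)
    (hf' : ∀ t ∈ Ioo t₀ t₁, μ' t * f t ≤ f' t) : f t₀ * Real.exp (μ t₁ - μ t₀) ≤ f t₁ := by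
  have := le_mul_exp_of_hasDerivWithinAt_le (f := fun t => -f t) (f' := fun t => -f' t) h₀ h
    (fun t ht => (hf t ht).neg) hμ fun t ht => by linarith [hf' t ht]
  linarith

/-- The case of a constant growth rate. -/
theorem le_mul_exp_of_hasDerivWithinAt_le_const {f f' : ℝ → ℝ} {t₀ t₁ c : ℝ} (h₀ : 0 ≤ t₀)
    (h : t₀ ≤ t₁) (hf : ∀ t ∈ Icc t₀ t₁, HasDerivWithinAt f (f' t) (Ici 0) t)
    (hf' : ∀ t ∈ Ioo t₀ t₁, f' t ≤ c * f t) : f t₁ ≤ f t₀ * Real.exp (c * (t₁ - t₀)) := by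
  have := le_mul_exp_of_hasDerivWithinAt_le (μ := fun t => c * t) (μ' := fun _ => c) h₀ h hf
    (fun t _ => by simpa using (hasDerivWithinAt_id t (Ici 0)).const_mul c) hf'
  rwa [← mul_sub] at this

theorem mul_exp_le_of_le_hasDerivWithinAt_const {f f' : ℝ → ℝ} {t₀ t₁ c : ℝ} (h₀ : 0 ≤ t₀)
    (h : t₀ ≤ t₁) (hf : ∀ t ∈ Icc t₀ t₁, HasDerivWithinAt f (f' t) (Ici 0) t)
    (hf' : ∀ t ∈ Ioo t₀ t₁, c * f t ≤ f' t) : f t₀ * Real.exp (c * (t₁ - t₀)) ≤ f t₁ := by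
  have := mul_exp_le_of_le_hasDerivWithinAt (μ := fun t => c * t) (μ' := fun _ => c) h₀ h hf
    (fun t _ => by simpa using (hasDerivWithinAt_id t (Ici 0)).const_mul c) hf'
  rwa [← mul_sub] at this

/-- A bounded drift. -/
theorem le_add_mul_of_hasDerivWithinAt_le {f f' : ℝ → ℝ} {t₀ t₁ c : ℝ} (h₀ : 0 ≤ t₀)
    (h : t₀ ≤ t₁) (hf : ∀ t ∈ Icc t₀ t₁, HasDerivWithinAt f (f' t) (Ici 0) t)
    (hf' : ∀ t ∈ Ioo t₀ t₁, f' t ≤ c) : f t₁ ≤ f t₀ + c * (t₁ - t₀) := by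
  have := le_of_hasDerivWithinAt_nonpos (f := fun t => f t - c * t) (f' := fun t => f' t - c) h₀ h
    (fun t ht => (hf t ht).sub
      (by simpa using (hasDerivWithinAt_id t (Ici 0)).const_mul c)) fun t ht => by
        linarith [hf' t ht]
  linarith

theorem add_mul_le_of_le_hasDerivWithinAt {f f' : ℝ → ℝ} {t₀ t₁ c : ℝ} (h₀ : 0 ≤ t₀)
    (h : t₀ ≤ t₁) (hf : ∀ t ∈ Icc t₀ t₁, HasDerivWithinAt f (f' t) (Ici 0) t)
    (hf' : ∀ t ∈ Ioo t₀ t₁, c ≤ f' t) : f t₀ + c * (t₁ - t₀) ≤ f t₁ := by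
  have := le_add_mul_of_hasDerivWithinAt_le (f := fun t => -f t) (f' := fun t => -f' t) (c := -c)
    h₀ h (fun t ht => (hf t ht).neg) fun t ht => neg_le_neg (hf' t ht)
  linarith

/-- Relaxation towards zero, up to a forcing term. -/
theorem le_exp_add_of_hasDerivWithinAt_le {f f' : ℝ → ℝ} {t₀ t₁ c b : ℝ} (h₀ : 0 ≤ t₀)
    (h : t₀ ≤ t₁) (hc : 0 < c) (hb : 0 ≤ b)
    (hf : ∀ t ∈ Icc t₀ t₁, HasDerivWithinAt f (f' t) (Ici 0) t)
    (hf' : ∀ t ∈ Ioo t₀ t₁, f' t ≤ -c * f t + b) :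
    f t₁ ≤ Real.exp (-c * (t₁ - t₀)) * f t₀ + b / c := by
  -- Subtracting the equilibrium `b / c` removes the forcing. The leftover `-(b / c)` times the
  -- exponential has the right sign and is dropped.
  have := le_mul_exp_of_hasDerivWithinAt_le_const (f := fun t => f t - b / c) (f' := f') (c := -c)
    h₀ h (fun t ht => (hf t ht).sub_const _) fun t ht => by
      have : c * (b / c) = b := mul_div_cancel₀ b hc.ne'
      linarith [hf' t ht]
  nlinarith [mul_nonneg (div_nonneg hb hc.le) (Real.exp_pos (-c * (t₁ - t₀))).le]

/-- Induction on time: a property that is open under perturbation and follows at time `t` from its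
validity before `t` holds at all times. -/
theorem forall_Icc_of_forall_Ico {P : ℝ → Prop} {t₀ t₁ : ℝ}
    (hclosed : IsClosed {t | t ∈ Icc t₀ t₁ ∧ ¬ P t})
    (hstep : ∀ t ∈ Icc t₀ t₁, (∀ s ∈ Ico t₀ t, P s) → P t) : ∀ t ∈ Icc t₀ t₁, P t := by
  by_contra! hcon
  obtain ⟨t, ht, hPt⟩ := hcon
  have hcomp : IsCompact {t | t ∈ Icc t₀ t₁ ∧ ¬ P t} :=
    isCompact_Icc.of_isClosed_subset hclosed fun s hs => hs.1
  -- The failure set is compact, so there is a first failure time. All earlier times satisfy `P`,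
  -- and `hstep` contradicts the failure.
  obtain ⟨s, hs, hmin⟩ := hcomp.exists_isLeast ⟨t, ht, hPt⟩
  exact hs.2 (hstep s hs.1 fun x hx => by
    by_contra hPx
    exact absurd (hmin ⟨⟨hx.1, hx.2.le.trans hs.1.2⟩, hPx⟩) (not_le.2 hx.2))

/-- The set of times at which a strict inequality between continuous functions fails is closed. -/
theorem isClosed_not_lt {f : ℝ → ℝ} {t₀ t₁ c : ℝ} (hf : ContinuousOn f (Icc t₀ t₁)) :
    IsClosed {t | t ∈ Icc t₀ t₁ ∧ ¬ f t < c} := by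
  simp only [not_lt]
  exact hf.preimage_isClosed_of_isClosed isClosed_Icc isClosed_Ici

theorem isClosed_not_and {P Q : ℝ → Prop} {S : Set ℝ} (hP : IsClosed {t | t ∈ S ∧ ¬ P t})
    (hQ : IsClosed {t | t ∈ S ∧ ¬ Q t}) : IsClosed {t | t ∈ S ∧ ¬ (P t ∧ Q t)} := by
  convert hP.union hQ using 1
  ext t
  simp only [mem_ofPred_eq, mem_union]
  tauto

end Comparison

/-! ### The aligned model and the splitting of the residual -/

section Model

/-- The data of a fine-tuning problem with a rank-one change of the target, in a form that singles
out the singular direction of the change: `W₁ = σ₁ g vᵀ + R₁` and `W₂ = σ₂ u gᵀ + R₂`, where the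
remainders `R₁`, `R₂` vanish along the singled out directions. -/
structure AlignedModel (m n h : ℕ) where
  u : Matrix (Fin m) Unit ℝ
  g : Matrix (Fin h) Unit ℝ
  v : Matrix (Fin n) Unit ℝ
  R₁ : Matrix (Fin h) (Fin n) ℝ
  R₂ : Matrix (Fin m) (Fin h) ℝ
  σ : ℝ
  σ₁ : ℝ
  σ₂ : ℝ
  uu : uᵀ * u = 1
  gg : gᵀ * g = 1
  vv : vᵀ * v = 1
  R₁_v : R₁ * v = 0
  g_R₁ : gᵀ * R₁ = 0
  R₂_g : R₂ * g = 0
  u_R₂ : uᵀ * R₂ = 0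

namespace AlignedModel

variable {m n h r : ℕ} (F : AlignedModel m n h) (x : LoRAWeights m n h r)

def W₁ : Matrix (Fin h) (Fin n) ℝ := F.σ₁ • (F.g * F.vᵀ) + F.R₁

def W₂ : Matrix (Fin m) (Fin h) ℝ := F.σ₂ • (F.u * F.gᵀ) + F.R₂

/-- The first layer. -/
def X₁ : Matrix (Fin h) (Fin n) ℝ := F.W₁ + x.B₁ * x.A₁

/-- The second layer. -/
def X₂ : Matrix (Fin m) (Fin h) ℝ := F.W₂ + x.B₂ * x.A₂

/-- The residual. -/
def E : Matrix (Fin m) (Fin n) ℝ :=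
  F.σ • (F.u * F.vᵀ) - F.W₂ * (x.B₁ * x.A₁) - x.B₂ * (x.A₂ * F.X₁ x)

/-- The components of the weights along the singled out directions. -/
def a : Matrix (Fin r) Unit ℝ := x.A₁ * F.v
def b : Matrix (Fin r) Unit ℝ := x.B₁ᵀ * F.g
def c : Matrix (Fin r) Unit ℝ := x.A₂ * F.g
def y : Matrix (Fin r) Unit ℝ := x.B₂ᵀ * F.u

/-- The components of the weights orthogonal to the singled out directions. -/
def Ao₁ : Matrix (Fin r) (Fin n) ℝ := x.A₁ - F.a x * F.vᵀ
def Bo₁ : Matrix (Fin h) (Fin r) ℝ := x.B₁ - F.g * (F.b x)ᵀ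
def Ao₂ : Matrix (Fin r) (Fin h) ℝ := x.A₂ - F.c x * F.gᵀ
def Bo₂ : Matrix (Fin m) (Fin r) ℝ := x.B₂ - F.u * (F.y x)ᵀ

/-- The component of the residual along `u vᵀ`. -/
def e : ℝ := frobInner F.u (F.E x * F.v)

/-- The residual restricted to the complement of `u`. -/
def Eu : Matrix (Fin m) (Fin n) ℝ := F.R₂ * (F.Bo₁ x * x.A₁) + F.Bo₂ x * (x.A₂ * F.X₁ x)

/-- The residual restricted to the complement of `v`. -/
def Ev : Matrix (Fin m) (Fin n) ℝ := F.X₂ x * (x.B₁ * F.Ao₁ x) + x.B₂ * (F.Ao₂ x * F.R₁)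

/-- The residual without its component along `u vᵀ`. -/
def Eo : Matrix (Fin m) (Fin n) ℝ := F.E x - F.e x • (F.u * F.vᵀ)

theorem A₁_eq : x.A₁ = F.a x * F.vᵀ + F.Ao₁ x := by simp [Ao₁]
theorem B₁_eq : x.B₁ = F.g * (F.b x)ᵀ + F.Bo₁ x := by simp [Bo₁]
theorem A₂_eq : x.A₂ = F.c x * F.gᵀ + F.Ao₂ x := by simp [Ao₂]
theorem B₂_eq : x.B₂ = F.u * (F.y x)ᵀ + F.Bo₂ x := by simp [Bo₂]

theorem Ao₁_v : F.Ao₁ x * F.v = 0 := by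
  simp [Ao₁, a, Matrix.sub_mul, Matrix.mul_assoc, F.vv]

theorem Ao₂_g : F.Ao₂ x * F.g = 0 := by
  simp [Ao₂, c, Matrix.sub_mul, Matrix.mul_assoc, F.gg]

theorem g_Bo₁ : F.gᵀ * F.Bo₁ x = 0 := by
  simp [Bo₁, b, Matrix.mul_sub, ← Matrix.mul_assoc, F.gg]

theorem u_Bo₂ : F.uᵀ * F.Bo₂ x = 0 := by
  simp [Bo₂, y, Matrix.mul_sub, ← Matrix.mul_assoc, F.uu]

theorem Bo₁_g : (F.Bo₁ x)ᵀ * F.g = 0 := by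
  rw [← transpose_inj, transpose_mul, transpose_transpose, F.g_Bo₁, transpose_zero]

theorem R₂_u : F.R₂ᵀ * F.u = 0 := by
  rw [← transpose_inj, transpose_mul, transpose_transpose, F.u_R₂, transpose_zero]

theorem R₁_g : F.R₁ᵀ * F.g = 0 := by
  rw [← transpose_inj, transpose_mul, transpose_transpose, F.g_R₁, transpose_zero]

theorem uu_mul {κ : Type*} (X : Matrix Unit κ ℝ) : F.uᵀ * (F.u * X) = X := by
  rw [← Matrix.mul_assoc, F.uu, Matrix.one_mul]

theorem R₂_g_mul {κ : Type*} (X : Matrix Unit κ ℝ) : F.R₂ * (F.g * X) = 0 := by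
  rw [← Matrix.mul_assoc, F.R₂_g, Matrix.zero_mul]
theorem u_R₂_mul {κ : Type*} (X : Matrix (Fin h) κ ℝ) : F.uᵀ * (F.R₂ * X) = 0 := by
  rw [← Matrix.mul_assoc, F.u_R₂, Matrix.zero_mul]
theorem g_Bo₁_mul {κ : Type*} (X : Matrix (Fin r) κ ℝ) : F.gᵀ * (F.Bo₁ x * X) = 0 := by
  rw [← Matrix.mul_assoc, F.g_Bo₁, Matrix.zero_mul]
theorem u_Bo₂_mul {κ : Type*} (X : Matrix (Fin r) κ ℝ) : F.uᵀ * (F.Bo₂ x * X) = 0 := by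
  rw [← Matrix.mul_assoc, F.u_Bo₂, Matrix.zero_mul]

theorem A₂_R₁ : x.A₂ * F.R₁ = F.Ao₂ x * F.R₁ := by
  conv_lhs => rw [F.A₂_eq x]
  rw [Matrix.add_mul, Matrix.mul_assoc, F.g_R₁, Matrix.mul_zero, zero_add]

theorem R₂_B₁ : F.R₂ * x.B₁ = F.R₂ * F.Bo₁ x := by
  conv_lhs => rw [F.B₁_eq x]
  rw [Matrix.mul_add, F.R₂_g_mul, zero_add]

/-- Across `v`, the target change and the σ₁-part of the first layer are invisible. What remains is
linear in `Ao₁` or, since `A₂ R₁ = Ao₂ R₁`, in `Ao₂`; so this part of the residual is small with the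
orthogonal components. -/
theorem E_eq_Ev : F.E x = (F.E x * F.v) * F.vᵀ - F.Ev x := by
  have h1 : F.E x = F.σ • (F.u * F.vᵀ) - F.W₂ * (x.B₁ * (F.a x * F.vᵀ + F.Ao₁ x)) -
      x.B₂ * (x.A₂ * (F.σ₁ • (F.g * F.vᵀ) + x.B₁ * (F.a x * F.vᵀ + F.Ao₁ x))) -
      x.B₂ * (F.Ao₂ x * F.R₁) := by
    rw [← F.A₁_eq, ← A₂_R₁, E, X₁, W₁]
    simp only [Matrix.mul_add]
    abel
  rw [h1, Ev, X₂]
  simp only [Matrix.mul_add, Matrix.add_mul, Matrix.sub_mul, Matrix.mul_assoc, F.vv, F.Ao₁_v,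
    Matrix.mul_zero, Matrix.smul_mul, Matrix.mul_one, F.R₁_v, Matrix.mul_smul, add_zero, sub_zero]
  abel

/-- The mirror image on the left: across `u` only `R₂ B₁ = R₂ Bo₁` and `Bo₂` contribute. -/
theorem E_eq_Eu : F.E x = F.u * (F.uᵀ * F.E x) - F.Eu x := by
  have h1 : F.E x = F.σ • (F.u * F.vᵀ) - (F.σ₂ • (F.u * F.gᵀ)) * (x.B₁ * x.A₁) -
      F.R₂ * (F.Bo₁ x * x.A₁) - (F.u * (F.y x)ᵀ + F.Bo₂ x) * (x.A₂ * F.X₁ x) := by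
    rw [← F.B₂_eq, ← Matrix.mul_assoc F.R₂, ← R₂_B₁, E, W₂]
    simp only [Matrix.add_mul, Matrix.mul_assoc]
    abel
  rw [h1, Eu]
  simp only [Matrix.mul_add, Matrix.add_mul, Matrix.mul_sub, Matrix.mul_assoc, F.uu_mul,
    F.u_R₂_mul, F.u_Bo₂_mul, Matrix.smul_mul, Matrix.mul_smul, add_zero, sub_zero]
  abel

theorem u_E_v : F.uᵀ * (F.E x * F.v) = F.e x • 1 := by rw [transpose_mul_col, e]

/-- The residual minus its main component. -/
theorem Eo_eq : F.Eo x = -F.Eu x - F.u * (F.uᵀ * F.Ev x) := by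
  have h1 := F.E_eq_Eu x
  have h2 : F.uᵀ * F.E x = F.e x • F.vᵀ - F.uᵀ * F.Ev x := by
    conv_lhs => rw [F.E_eq_Ev x]
    rw [Matrix.mul_sub, ← Matrix.mul_assoc, u_E_v, Matrix.smul_mul, Matrix.one_mul]
  rw [h2] at h1
  rw [Eo, h1]
  simp only [Matrix.mul_sub, Matrix.mul_smul]
  abel

theorem E_v_eq : F.E x * F.v = F.e x • F.u - F.Eu x * F.v := by
  conv_lhs => rw [F.E_eq_Eu x]
  rw [Matrix.sub_mul, Matrix.mul_assoc, Matrix.mul_assoc, u_E_v, Matrix.mul_smul, Matrix.mul_one]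

theorem Et_u_eq : (F.E x)ᵀ * F.u = F.e x • F.v - (F.Ev x)ᵀ * F.u := by
  conv_lhs => rw [F.E_eq_Ev x]
  rw [transpose_sub, Matrix.sub_mul, transpose_mul, transpose_transpose, Matrix.mul_assoc,
    ← transpose_inj, transpose_sub, transpose_mul, transpose_mul, transpose_transpose, u_E_v]
  simp

end AlignedModel

end Model

/-! ### Velocities of the components and of the residual -/

section Velocity

open scoped Matrix.Norms.Frobenius

namespace AlignedModel

variable {m n h r : ℕ} (F : AlignedModel m n h) (x : LoRAWeights m n h r)

/-- The velocities of the gradient flow. -/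
def dA₁ : Matrix (Fin r) (Fin n) ℝ := (F.X₂ x * x.B₁)ᵀ * F.E x
def dB₁ : Matrix (Fin h) (Fin r) ℝ := (F.X₂ x)ᵀ * (F.E x * x.A₁ᵀ)
def dA₂ : Matrix (Fin r) (Fin h) ℝ := x.B₂ᵀ * (F.E x * (F.X₁ x)ᵀ)
def dB₂ : Matrix (Fin m) (Fin r) ℝ := F.E x * (x.A₂ * F.X₁ x)ᵀ

/-- The velocity of the residual. -/
def dE : Matrix (Fin m) (Fin n) ℝ :=
  -(F.X₂ x * (F.dB₁ x * x.A₁ + x.B₁ * F.dA₁ x)) - (F.dB₂ x * x.A₂ + x.B₂ * F.dA₂ x) * F.X₁ x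

/-- The total squared size of the components orthogonal to the singled out directions. -/
noncomputable def off : ℝ := ‖F.Ao₁ x‖ ^ 2 + ‖F.Bo₁ x‖ ^ 2 + ‖F.Ao₂ x‖ ^ 2 + ‖F.Bo₂ x‖ ^ 2

/-- The coefficient of the product of the first layer along `g vᵀ`. -/
def p : ℝ := frobInner (F.a x) (F.b x)

/-- The bounds under which the velocities are estimated. -/
structure Bounded (M ζ : ℝ) : Prop where
  one_le : 1 ≤ M
  R₁ : ‖F.R₁‖ ≤ M
  R₂ : ‖F.R₂‖ ≤ M
  X₁ : ‖F.X₁ x‖ ≤ M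
  X₂ : ‖F.X₂ x‖ ≤ M
  A₁ : ‖x.A₁‖ ≤ M
  B₁ : ‖x.B₁‖ ≤ M
  E : ‖F.E x‖ ≤ M
  σ₂_nonneg : 0 ≤ F.σ₂
  σ₂ : F.σ₂ ≤ M
  A₂ : ‖x.A₂‖ ≤ ζ
  B₂ : ‖x.B₂‖ ≤ ζ
  ζ_le : ζ ≤ 1

theorem norm_u : ‖F.u‖ = 1 := norm_sq_of_transpose_mul_self F.uu
theorem norm_g : ‖F.g‖ = 1 := norm_sq_of_transpose_mul_self F.gg
theorem norm_v : ‖F.v‖ = 1 := norm_sq_of_transpose_mul_self F.vv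

theorem norm_A₁_sq : ‖x.A₁‖ ^ 2 = ‖F.a x‖ ^ 2 + ‖F.Ao₁ x‖ ^ 2 := by
  conv_lhs => rw [F.A₁_eq x]
  rw [norm_add_sq_frob, frobInner_mul_right, transpose_transpose, F.Ao₁_v, frobInner_zero_right,
    norm_mul_transpose_of_unit F.vv]
  ring

theorem norm_A₂_sq : ‖x.A₂‖ ^ 2 = ‖F.c x‖ ^ 2 + ‖F.Ao₂ x‖ ^ 2 := by
  conv_lhs => rw [F.A₂_eq x]
  rw [norm_add_sq_frob, frobInner_mul_right, transpose_transpose, F.Ao₂_g, frobInner_zero_right,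
    norm_mul_transpose_of_unit F.gg]
  ring

theorem norm_B₁_sq : ‖x.B₁‖ ^ 2 = ‖F.b x‖ ^ 2 + ‖F.Bo₁ x‖ ^ 2 := by
  conv_lhs => rw [F.B₁_eq x]
  rw [norm_add_sq_frob, frobInner_mul_left, F.g_Bo₁, frobInner_zero_right,
    norm_col_mul_row, F.norm_g]
  ring

theorem norm_B₂_sq : ‖x.B₂‖ ^ 2 = ‖F.y x‖ ^ 2 + ‖F.Bo₂ x‖ ^ 2 := by
  conv_lhs => rw [F.B₂_eq x]
  rw [norm_add_sq_frob, frobInner_mul_left, F.u_Bo₂, frobInner_zero_right,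
    norm_col_mul_row, F.norm_u]
  ring

theorem norm_a_le : ‖F.a x‖ ≤ ‖x.A₁‖ :=
  le_of_sq_le_sq (by rw [F.norm_A₁_sq]; nlinarith [sq_nonneg ‖F.Ao₁ x‖]) (norm_nonneg _)
theorem norm_b_le : ‖F.b x‖ ≤ ‖x.B₁‖ :=
  le_of_sq_le_sq (by rw [F.norm_B₁_sq]; nlinarith [sq_nonneg ‖F.Bo₁ x‖]) (norm_nonneg _)
theorem norm_c_le : ‖F.c x‖ ≤ ‖x.A₂‖ :=
  le_of_sq_le_sq (by rw [F.norm_A₂_sq]; nlinarith [sq_nonneg ‖F.Ao₂ x‖]) (norm_nonneg _)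
theorem norm_y_le : ‖F.y x‖ ≤ ‖x.B₂‖ :=
  le_of_sq_le_sq (by rw [F.norm_B₂_sq]; nlinarith [sq_nonneg ‖F.Bo₂ x‖]) (norm_nonneg _)
theorem norm_Ao₁_le : ‖F.Ao₁ x‖ ≤ ‖x.A₁‖ :=
  le_of_sq_le_sq (by rw [F.norm_A₁_sq]; nlinarith [sq_nonneg ‖F.a x‖]) (norm_nonneg _)
theorem norm_Ao₂_le : ‖F.Ao₂ x‖ ≤ ‖x.A₂‖ :=
  le_of_sq_le_sq (by rw [F.norm_A₂_sq]; nlinarith [sq_nonneg ‖F.c x‖]) (norm_nonneg _)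

theorem off_nonneg : 0 ≤ F.off x := by unfold off; positivity

theorem norm_Ao₁_le_off : ‖F.Ao₁ x‖ ≤ √(F.off x) := Real.le_sqrt_of_sq_le (by
  unfold off; nlinarith [sq_nonneg ‖F.Bo₁ x‖, sq_nonneg ‖F.Ao₂ x‖, sq_nonneg ‖F.Bo₂ x‖])
theorem norm_Bo₁_le_off : ‖F.Bo₁ x‖ ≤ √(F.off x) := Real.le_sqrt_of_sq_le (by
  unfold off; nlinarith [sq_nonneg ‖F.Ao₁ x‖, sq_nonneg ‖F.Ao₂ x‖, sq_nonneg ‖F.Bo₂ x‖])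
theorem norm_Ao₂_le_off : ‖F.Ao₂ x‖ ≤ √(F.off x) := Real.le_sqrt_of_sq_le (by
  unfold off; nlinarith [sq_nonneg ‖F.Bo₁ x‖, sq_nonneg ‖F.Ao₁ x‖, sq_nonneg ‖F.Bo₂ x‖])
theorem norm_Bo₂_le_off : ‖F.Bo₂ x‖ ≤ √(F.off x) := Real.le_sqrt_of_sq_le (by
  unfold off; nlinarith [sq_nonneg ‖F.Bo₁ x‖, sq_nonneg ‖F.Ao₂ x‖, sq_nonneg ‖F.Ao₁ x‖])

/-- `Ao₁` kills `v`, so it sees only the part `-Ev` of the residual. The first term of `Ev` is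
exactly what `Ao₁` is paired with and yields minus a square; the other term carries `B₂` and `Ao₂`.
-/
theorem frobInner_Ao₁_dA₁ : frobInner (F.Ao₁ x) (F.dA₁ x) =
    -‖F.X₂ x * (x.B₁ * F.Ao₁ x)‖ ^ 2 -
      frobInner (F.X₂ x * (x.B₁ * F.Ao₁ x)) (x.B₂ * (F.Ao₂ x * F.R₁)) := by
  rw [dA₁, ← frobInner_mul_left, Matrix.mul_assoc]
  conv_lhs => rw [F.E_eq_Ev x]
  rw [frobInner_sub_right, frobInner_comm _ (F.E x * F.v * F.vᵀ), frobInner_mul_right,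
    transpose_transpose, Matrix.mul_assoc, Matrix.mul_assoc, F.Ao₁_v, Matrix.mul_zero,
    Matrix.mul_zero, frobInner_zero_right, Ev, frobInner_add_right, frobInner_self]
  ring

/-- The dissipative square again comes from the restricted residual. The last term appears because
`X₂ Bo₁` contains, besides `R₂ Bo₁`, a contribution quadratic in the second pair, which sees the
whole residual. -/
theorem frobInner_Bo₁_dB₁ : frobInner (F.Bo₁ x) (F.dB₁ x) =
    -‖F.R₂ * (F.Bo₁ x * x.A₁)‖ ^ 2 -
      frobInner (F.R₂ * (F.Bo₁ x * x.A₁)) (F.Bo₂ x * (x.A₂ * F.X₁ x)) +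
      frobInner (x.B₂ * (F.Ao₂ x * (F.Bo₁ x * x.A₁))) (F.E x) := by
  have h1 : F.X₂ x * F.Bo₁ x = F.R₂ * F.Bo₁ x + x.B₂ * (F.Ao₂ x * F.Bo₁ x) := by
    rw [X₂, W₂, F.A₂_eq x]
    simp [Matrix.add_mul, Matrix.mul_add, Matrix.mul_assoc, F.g_Bo₁]
  rw [dB₁, ← frobInner_mul_left, h1, frobInner_comm, frobInner_mul_right, transpose_transpose,
    frobInner_comm, Matrix.add_mul, frobInner_add_left]
  simp only [Matrix.mul_assoc]
  congr 1
  conv_lhs => rw [F.E_eq_Eu x]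
  rw [frobInner_sub_right, frobInner_comm _ (F.u * (F.uᵀ * F.E x)), frobInner_mul_left, F.u_R₂_mul,
    frobInner_zero_right, Eu, frobInner_add_right, frobInner_self]
  ring

theorem frobInner_Bo₂_dB₂ : frobInner (F.Bo₂ x) (F.dB₂ x) =
    -‖F.Bo₂ x * (x.A₂ * F.X₁ x)‖ ^ 2 -
      frobInner (F.Bo₂ x * (x.A₂ * F.X₁ x)) (F.R₂ * (F.Bo₁ x * x.A₁)) := by
  rw [dB₂, ← frobInner_mul_right]
  conv_lhs => rw [F.E_eq_Eu x]
  rw [frobInner_sub_right, frobInner_comm _ (F.u * (F.uᵀ * F.E x)), frobInner_mul_left, F.u_Bo₂_mul,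
    frobInner_zero_right, Eu, frobInner_add_right, frobInner_self]
  ring

theorem frobInner_Ao₂_dA₂ : frobInner (F.Ao₂ x) (F.dA₂ x) =
    -‖x.B₂ * (F.Ao₂ x * F.R₁)‖ ^ 2 -
      frobInner (x.B₂ * (F.Ao₂ x * F.R₁)) (F.X₂ x * (x.B₁ * F.Ao₁ x)) +
      frobInner (x.B₂ * (F.Ao₂ x * (F.Bo₁ x * x.A₁))) (F.E x) := by
  have h1 : F.Ao₂ x * F.X₁ x = F.Ao₂ x * F.R₁ + F.Ao₂ x * (F.Bo₁ x * x.A₁) := by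
    have : F.Ao₂ x * (x.B₁ * x.A₁) = F.Ao₂ x * (F.Bo₁ x * x.A₁) := by
      conv_lhs => rw [F.B₁_eq x]
      rw [Matrix.add_mul, Matrix.mul_add, ← Matrix.mul_assoc, ← Matrix.mul_assoc, F.Ao₂_g]
      simp
    rw [X₁, W₁, Matrix.mul_add, Matrix.mul_add, this, Matrix.mul_smul, ← Matrix.mul_assoc, F.Ao₂_g]
    simp
  rw [dA₂, ← frobInner_mul_left, ← frobInner_mul_right, Matrix.mul_assoc, h1, Matrix.mul_add,
    frobInner_add_left]
  congr 1
  conv_lhs => rw [F.E_eq_Ev x]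
  rw [frobInner_sub_right, frobInner_comm _ (F.E x * F.v * F.vᵀ), frobInner_mul_right,
    transpose_transpose, Matrix.mul_assoc, Matrix.mul_assoc, F.R₁_v, Matrix.mul_zero,
    Matrix.mul_zero, frobInner_zero_right, Ev, frobInner_add_right, frobInner_self]
  ring

theorem X₁_v : F.X₁ x * F.v = F.σ₁ • F.g + x.B₁ * F.a x := by
  simp [X₁, W₁, a, Matrix.add_mul, Matrix.mul_assoc, F.vv, F.R₁_v]

theorem B₁_a : x.B₁ * F.a x = F.p x • F.g + F.Bo₁ x * F.a x := by
  conv_lhs => rw [F.B₁_eq x]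
  rw [Matrix.add_mul, Matrix.mul_assoc, transpose_mul_col, frobInner_comm]
  simp [p]

theorem X₁_v' : F.X₁ x * F.v = (F.σ₁ + F.p x) • F.g + F.Bo₁ x * F.a x := by
  rw [X₁_v, B₁_a, add_smul, add_assoc]

theorem A₂_X₁_v : x.A₂ * (F.X₁ x * F.v) = (F.σ₁ + F.p x) • F.c x + F.Ao₂ x * (F.Bo₁ x * F.a x) := by
  have h1 : x.A₂ * (F.Bo₁ x * F.a x) = F.Ao₂ x * (F.Bo₁ x * F.a x) := by
    conv_lhs => rw [F.A₂_eq x]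
    rw [Matrix.add_mul, Matrix.mul_assoc, F.g_Bo₁_mul]
    simp
  rw [X₁_v', Matrix.mul_add, h1, Matrix.mul_smul, c]

theorem A₁t_b : x.A₁ᵀ * F.b x = F.p x • F.v + (F.Ao₁ x)ᵀ * F.b x := by
  conv_lhs => rw [F.A₁_eq x]
  rw [transpose_add, Matrix.add_mul, transpose_mul, transpose_transpose, Matrix.mul_assoc,
    transpose_mul_col]
  simp [p]

theorem X₁t_g : (F.X₁ x)ᵀ * F.g = (F.σ₁ + F.p x) • F.v + (F.Ao₁ x)ᵀ * F.b x := by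
  have h1 : (x.B₁ * x.A₁)ᵀ * F.g = x.A₁ᵀ * F.b x := by
    rw [transpose_mul, Matrix.mul_assoc, b]
  rw [X₁, W₁, transpose_add, transpose_add, Matrix.add_mul, Matrix.add_mul, h1, A₁t_b, F.R₁_g,
    transpose_smul, transpose_mul, transpose_transpose, Matrix.smul_mul, Matrix.mul_assoc, F.gg]
  simp [add_smul, add_assoc]

theorem X₂_g : F.X₂ x * F.g = F.σ₂ • F.u + x.B₂ * F.c x := by
  simp [X₂, W₂, c, Matrix.add_mul, Matrix.mul_assoc, F.gg, F.R₂_g]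

theorem X₂t_u : (F.X₂ x)ᵀ * F.u = F.σ₂ • F.g + x.A₂ᵀ * F.y x := by
  rw [X₂, W₂, transpose_add, transpose_add, Matrix.add_mul, Matrix.add_mul, F.R₂_u,
    transpose_smul, transpose_mul, transpose_transpose, Matrix.smul_mul, Matrix.mul_assoc, F.uu,
    transpose_mul, Matrix.mul_assoc, y]
  simp

theorem u_Eu : F.uᵀ * F.Eu x = 0 := by
  simp [Eu, Matrix.mul_add, F.u_R₂_mul, F.u_Bo₂_mul]

theorem Ev_v : F.Ev x * F.v = 0 := by
  simp [Ev, Matrix.add_mul, Matrix.mul_assoc, F.R₁_v, F.Ao₁_v]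

/-- The residual along `u vᵀ`. -/
theorem e_eq : F.e x = F.σ - F.σ₂ * F.p x - frobInner (F.y x) (x.A₂ * (F.X₁ x * F.v)) := by
  have h1 : F.uᵀ * (F.W₂ * (x.B₁ * (x.A₁ * F.v))) = (F.σ₂ * F.p x) • 1 := by
    rw [W₂, Matrix.add_mul, Matrix.mul_add, F.u_R₂_mul, Matrix.smul_mul, Matrix.mul_smul,
      Matrix.mul_assoc, F.uu_mul, ← Matrix.mul_assoc, p]
    have : F.gᵀ * x.B₁ = (F.b x)ᵀ := by simp [b]
    rw [this, ← a, transpose_mul_col, frobInner_comm (F.b x)]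
    simp [smul_smul]
  have h2 : F.e x • (1 : Matrix Unit Unit ℝ) = (F.σ - F.σ₂ * F.p x -
      frobInner (F.y x) (x.A₂ * (F.X₁ x * F.v))) • 1 := by
    rw [← u_E_v, E]
    have h3 : F.uᵀ * (x.B₂ * (x.A₂ * (F.X₁ x * F.v))) =
        frobInner (F.y x) (x.A₂ * (F.X₁ x * F.v)) • 1 := by
      rw [← transpose_mul_col, y]
      simp [Matrix.mul_assoc]
    simp only [Matrix.sub_mul, Matrix.mul_sub, Matrix.mul_assoc, h1, h3, sub_smul]
    simp [Matrix.mul_assoc, F.vv, F.uu]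
  simpa using congrFun (congrFun h2 ()) ()

/-- The parts of the velocities of `a`, `b`, `c`, `y` that vanish if the weights have no orthogonal
components and, for `a` and `b`, the second pair of weights vanishes. -/
def err_a : Matrix (Fin r) Unit ℝ := F.dA₁ x * F.v - (F.σ₂ * F.e x) • F.b x
def err_b : Matrix (Fin r) Unit ℝ := (F.dB₁ x)ᵀ * F.g - (F.σ₂ * F.e x) • F.a x
def err_c : Matrix (Fin r) Unit ℝ := F.dA₂ x * F.g - (F.e x * (F.σ₁ + F.p x)) • F.y x
def err_y : Matrix (Fin r) Unit ℝ := (F.dB₂ x)ᵀ * F.u - (F.e x * (F.σ₁ + F.p x)) • F.c x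

/-- The main part of `E v` is along `u`, which `R₂ᵀ` kills. Each remaining term therefore has either
two orthogonal factors or both `A₂` and `B₂`, so the error is of second order. -/
theorem err_a_eq : F.err_a x = -((F.Bo₁ x)ᵀ * (F.R₂ᵀ * (F.Eu x * F.v))) +
    x.B₁ᵀ * (x.A₂ᵀ * (x.B₂ᵀ * (F.E x * F.v))) := by
  have h1 : x.B₁ᵀ * F.R₂ᵀ = (F.Bo₁ x)ᵀ * F.R₂ᵀ := by
    rw [← transpose_mul, R₂_B₁, transpose_mul]
  have h2 : (F.X₂ x)ᵀ = F.σ₂ • (F.g * F.uᵀ) + F.R₂ᵀ + x.A₂ᵀ * x.B₂ᵀ := by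
    simp [X₂, W₂]
  have h3 : x.B₁ᵀ * (F.R₂ᵀ * (F.E x * F.v)) = -((F.Bo₁ x)ᵀ * (F.R₂ᵀ * (F.Eu x * F.v))) := by
    rw [← Matrix.mul_assoc, h1, E_v_eq, Matrix.mul_sub, Matrix.mul_assoc, Matrix.mul_smul,
      F.R₂_u]
    simp [Matrix.mul_assoc]
  rw [err_a, dA₁, transpose_mul, h2]
  simp only [Matrix.mul_add, Matrix.add_mul, Matrix.mul_assoc, h3, Matrix.mul_smul,
    Matrix.smul_mul, u_E_v, Matrix.mul_one, smul_smul]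
  rw [b]
  abel

theorem err_b_eq : F.err_b x = -(F.σ₂ • (F.Ao₁ x * ((F.Ev x)ᵀ * F.u))) +
    x.A₁ * ((F.E x)ᵀ * (x.B₂ * F.c x)) := by
  have h1 : x.A₁ * ((F.Ev x)ᵀ * F.u) = F.Ao₁ x * ((F.Ev x)ᵀ * F.u) := by
    have : F.vᵀ * (F.Ev x)ᵀ = 0 := by rw [← transpose_mul, Ev_v, transpose_zero]
    conv_lhs => rw [F.A₁_eq x]
    rw [Matrix.add_mul, Matrix.mul_assoc, ← Matrix.mul_assoc F.vᵀ, this]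
    simp
  rw [err_b, dB₁, transpose_mul, transpose_mul, transpose_transpose, transpose_transpose,
    Matrix.mul_assoc, X₂_g, Matrix.mul_add, Matrix.mul_assoc, Matrix.mul_assoc, Matrix.mul_smul,
    Et_u_eq, Matrix.mul_smul, Matrix.mul_sub, h1, Matrix.mul_smul, ← a]
  simp only [smul_sub, smul_smul]
  abel

theorem err_c_eq : F.err_c x = -((F.σ₁ + F.p x) • ((F.Bo₂ x)ᵀ * (F.Eu x * F.v))) +
    x.B₂ᵀ * (F.E x * ((F.Ao₁ x)ᵀ * F.b x)) := by
  have h1 : x.B₂ᵀ * (F.Eu x * F.v) = (F.Bo₂ x)ᵀ * (F.Eu x * F.v) := by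
    conv_lhs => rw [F.B₂_eq x]
    rw [transpose_add, Matrix.add_mul, transpose_mul, transpose_transpose, Matrix.mul_assoc,
      ← Matrix.mul_assoc F.uᵀ, F.u_Eu]
    simp
  rw [err_c, dA₂, Matrix.mul_assoc, Matrix.mul_assoc, X₁t_g, Matrix.mul_add, Matrix.mul_smul,
    E_v_eq, Matrix.mul_add, Matrix.mul_smul, Matrix.mul_sub, h1, Matrix.mul_smul, ← y]
  simp only [smul_sub, smul_smul, mul_comm]
  abel

theorem err_y_eq : F.err_y x = F.e x • (F.Ao₂ x * (F.Bo₁ x * F.a x)) -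
    x.A₂ * (F.X₁ x * ((F.Ev x)ᵀ * F.u)) := by
  rw [err_y, dB₂, transpose_mul, transpose_transpose, Matrix.mul_assoc, Et_u_eq, Matrix.mul_sub,
    Matrix.mul_smul, Matrix.mul_assoc, Matrix.mul_assoc, A₂_X₁_v]
  simp only [smul_add, smul_smul]
  abel

/-- The quadratic form that governs the decay of the residual. -/
def decayForm (Y Y' : Matrix (Fin m) (Fin n) ℝ) : ℝ :=
  frobInner ((F.X₂ x)ᵀ * (Y * x.A₁ᵀ)) ((F.X₂ x)ᵀ * (Y' * x.A₁ᵀ)) +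
    frobInner ((F.X₂ x * x.B₁)ᵀ * Y) ((F.X₂ x * x.B₁)ᵀ * Y') +
    frobInner (Y * (x.A₂ * F.X₁ x)ᵀ) (Y' * (x.A₂ * F.X₁ x)ᵀ) +
    frobInner (x.B₂ᵀ * (Y * (F.X₁ x)ᵀ)) (x.B₂ᵀ * (Y' * (F.X₁ x)ᵀ))

/-- The residual depends on the weights through a map whose derivative also defines the velocities,
so its velocity is minus a Gram form. The four summands belong to the four weight matrices. -/
theorem frobInner_dE (Y : Matrix (Fin m) (Fin n) ℝ) :
    frobInner Y (F.dE x) = -F.decayForm x Y (F.E x) := by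
  have h1 : frobInner Y (F.X₂ x * (F.dB₁ x * x.A₁)) =
      frobInner ((F.X₂ x)ᵀ * (Y * x.A₁ᵀ)) ((F.X₂ x)ᵀ * (F.E x * x.A₁ᵀ)) := by
    rw [frobInner_comm, frobInner_mul_left, frobInner_mul_right, frobInner_comm, dB₁,
      Matrix.mul_assoc]
  have h2 : frobInner Y (F.X₂ x * (x.B₁ * F.dA₁ x)) =
      frobInner ((F.X₂ x * x.B₁)ᵀ * Y) ((F.X₂ x * x.B₁)ᵀ * F.E x) := by
    rw [← Matrix.mul_assoc, frobInner_comm, frobInner_mul_left, frobInner_comm, dA₁]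
  have h3 : frobInner Y (F.dB₂ x * (x.A₂ * F.X₁ x)) =
      frobInner (Y * (x.A₂ * F.X₁ x)ᵀ) (F.E x * (x.A₂ * F.X₁ x)ᵀ) := by
    rw [frobInner_comm, frobInner_mul_right, frobInner_comm, dB₂]
  have h4 : frobInner Y (x.B₂ * (F.dA₂ x * F.X₁ x)) =
      frobInner (x.B₂ᵀ * (Y * (F.X₁ x)ᵀ)) (x.B₂ᵀ * (F.E x * (F.X₁ x)ᵀ)) := by
    rw [frobInner_comm, frobInner_mul_left, frobInner_mul_right, frobInner_comm, dA₂,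
      Matrix.mul_assoc]
  rw [dE, decayForm, frobInner_sub_right, frobInner_neg_right, Matrix.mul_add, Matrix.add_mul,
    frobInner_add_right, frobInner_add_right, h1, h2, Matrix.mul_assoc, Matrix.mul_assoc, h3, h4]
  ring

theorem decayForm_self_nonneg (Y : Matrix (Fin m) (Fin n) ℝ) : 0 ≤ F.decayForm x Y Y := by
  simp only [decayForm, frobInner_self]
  positivity

theorem decayForm_E (Y : Matrix (Fin m) (Fin n) ℝ) : F.decayForm x Y (F.E x) =
    F.e x * F.decayForm x Y (F.u * F.vᵀ) + F.decayForm x Y (F.Eo x) := by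
  have h1 : F.E x = F.e x • (F.u * F.vᵀ) + F.Eo x := by simp [Eo]
  conv_lhs => rw [h1]
  simp only [decayForm, Matrix.add_mul, Matrix.mul_add, frobInner_add_right, Matrix.smul_mul,
    Matrix.mul_smul, frobInner_smul_right]
  ring

end AlignedModel

end Velocity

/-! ### Bounds for the velocities and consequences of balance -/

section VelocityBounds

open scoped Matrix.Norms.Frobenius

namespace AlignedModel

variable {m n h r : ℕ} {F : AlignedModel m n h} {x : LoRAWeights m n h r} {M ζ : ℝ}

namespace Bounded

theorem M_nonneg (hx : F.Bounded x M ζ) : 0 ≤ M := zero_le_one.trans hx.one_le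
theorem ζ_nonneg (hx : F.Bounded x M ζ) : 0 ≤ ζ := (norm_nonneg _).trans hx.A₂

/-- The orthogonal components grow at a rate proportional to the size of the second pair of
weights. -/
theorem off_velocity_le (hx : F.Bounded x M ζ) :
    2 * (frobInner (F.Ao₁ x) (F.dA₁ x) + frobInner (F.Bo₁ x) (F.dB₁ x) +
      frobInner (F.Ao₂ x) (F.dA₂ x) + frobInner (F.Bo₂ x) (F.dB₂ x)) ≤ 6 * M ^ 3 * ζ * F.off x := by
  have hM := hx.M_nonneg
  have hζ := hx.ζ_nonneg
  rw [frobInner_Ao₁_dA₁, frobInner_Bo₁_dB₁, frobInner_Ao₂_dA₂, frobInner_Bo₂_dB₂, off]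
  set p := ‖F.Ao₁ x‖ with hp
  set q := ‖F.Bo₁ x‖ with hq
  set s := ‖F.Ao₂ x‖ with hs
  set w := ‖F.Bo₂ x‖ with hw
  have hp0 : 0 ≤ p := norm_nonneg _
  have hq0 : 0 ≤ q := norm_nonneg _
  have hs0 : 0 ≤ s := norm_nonneg _
  have hw0 : 0 ≤ w := norm_nonneg _
  have b1 : ‖F.X₂ x * (x.B₁ * F.Ao₁ x)‖ ≤ M * (M * p) := fro_mul_le hx.X₂ (fro_mul_le hx.B₁ le_rfl)
  have b2 : ‖x.B₂ * (F.Ao₂ x * F.R₁)‖ ≤ ζ * (s * M) := fro_mul_le hx.B₂ (fro_mul_le le_rfl hx.R₁)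
  have b3 : ‖F.R₂ * (F.Bo₁ x * x.A₁)‖ ≤ M * (q * M) := fro_mul_le hx.R₂ (fro_mul_le le_rfl hx.A₁)
  have b4 : ‖F.Bo₂ x * (x.A₂ * F.X₁ x)‖ ≤ w * (ζ * M) := fro_mul_le le_rfl (fro_mul_le hx.A₂ hx.X₁)
  have b5 : ‖x.B₂ * (F.Ao₂ x * (F.Bo₁ x * x.A₁))‖ ≤ ζ * (s * (q * M)) :=
    fro_mul_le hx.B₂ (fro_mul_le le_rfl (fro_mul_le le_rfl hx.A₁))
  have c1 := neg_le_frobInner (F.X₂ x * (x.B₁ * F.Ao₁ x)) (x.B₂ * (F.Ao₂ x * F.R₁))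
  have c1' := neg_le_frobInner (x.B₂ * (F.Ao₂ x * F.R₁)) (F.X₂ x * (x.B₁ * F.Ao₁ x))
  have c2 := neg_le_frobInner (F.R₂ * (F.Bo₁ x * x.A₁)) (F.Bo₂ x * (x.A₂ * F.X₁ x))
  have c2' := neg_le_frobInner (F.Bo₂ x * (x.A₂ * F.X₁ x)) (F.R₂ * (F.Bo₁ x * x.A₁))
  have c3 := frobInner_le (x.B₂ * (F.Ao₂ x * (F.Bo₁ x * x.A₁))) (F.E x)
  have d1 := mul_le_mul b1 b2 (norm_nonneg _) (by positivity)
  have d2 := mul_le_mul b3 b4 (norm_nonneg _) (by positivity)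
  have d3 := mul_le_mul b5 hx.E (norm_nonneg _) (by positivity)
  rw [mul_comm ‖x.B₂ * _‖] at c1'
  rw [mul_comm ‖F.Bo₂ x * _‖] at c2'
  have hM2 : ζ * s * q * (M * M) ≤ ζ * s * q * (M * M * M) := by
    refine mul_le_mul_of_nonneg_left ?_ (by positivity)
    nlinarith [hx.one_le, mul_nonneg hM hM]
  -- The mixed terms are products of two different orthogonal norms with a factor `ζ`. These squares
  -- convert them into `off` by the arithmetic-geometric mean inequality; the dissipative squares
  -- are discarded.
  have e1 : 0 ≤ M ^ 3 * ζ * (p - s) ^ 2 := by positivity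
  have e2 : 0 ≤ M ^ 3 * ζ * (q - w) ^ 2 := by positivity
  have e3 : 0 ≤ M ^ 3 * ζ * (q - s) ^ 2 := by positivity
  have e4 : 0 ≤ M ^ 3 * ζ * (p ^ 2 + w ^ 2) := by positivity
  have e5 : 0 ≤ M ^ 3 * ζ * (q ^ 2 + s ^ 2) := by positivity
  nlinarith [sq_nonneg ‖F.X₂ x * (x.B₁ * F.Ao₁ x)‖, sq_nonneg ‖F.R₂ * (F.Bo₁ x * x.A₁)‖,
    sq_nonneg ‖x.B₂ * (F.Ao₂ x * F.R₁)‖, sq_nonneg ‖F.Bo₂ x * (x.A₂ * F.X₁ x)‖]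

theorem norm_Eu_le (hx : F.Bounded x M ζ) : ‖F.Eu x‖ ≤ M ^ 2 * (‖F.Bo₁ x‖ + ‖F.Bo₂ x‖) := by
  have hM := hx.M_nonneg
  have b3 : ‖F.R₂ * (F.Bo₁ x * x.A₁)‖ ≤ M * (‖F.Bo₁ x‖ * M) :=
    fro_mul_le hx.R₂ (fro_mul_le le_rfl hx.A₁)
  have b4 : ‖F.Bo₂ x * (x.A₂ * F.X₁ x)‖ ≤ ‖F.Bo₂ x‖ * (1 * M) :=
    fro_mul_le le_rfl (fro_mul_le (hx.A₂.trans hx.ζ_le) hx.X₁)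
  have := norm_add_le (F.R₂ * (F.Bo₁ x * x.A₁)) (F.Bo₂ x * (x.A₂ * F.X₁ x))
  have h1 : ‖F.Bo₂ x‖ * M ≤ ‖F.Bo₂ x‖ * (M * M) :=
    mul_le_mul_of_nonneg_left (by nlinarith [hx.one_le]) (norm_nonneg _)
  rw [Eu]
  nlinarith

theorem norm_Ev_le (hx : F.Bounded x M ζ) : ‖F.Ev x‖ ≤ M ^ 2 * (‖F.Ao₁ x‖ + ‖F.Ao₂ x‖) := by
  have hM := hx.M_nonneg
  have b1 : ‖F.X₂ x * (x.B₁ * F.Ao₁ x)‖ ≤ M * (M * ‖F.Ao₁ x‖) :=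
    fro_mul_le hx.X₂ (fro_mul_le hx.B₁ le_rfl)
  have b2 : ‖x.B₂ * (F.Ao₂ x * F.R₁)‖ ≤ 1 * (‖F.Ao₂ x‖ * M) :=
    fro_mul_le (hx.B₂.trans hx.ζ_le) (fro_mul_le le_rfl hx.R₁)
  have := norm_add_le (F.X₂ x * (x.B₁ * F.Ao₁ x)) (x.B₂ * (F.Ao₂ x * F.R₁))
  have h1 : ‖F.Ao₂ x‖ * M ≤ ‖F.Ao₂ x‖ * (M * M) :=
    mul_le_mul_of_nonneg_left (by nlinarith [hx.one_le]) (norm_nonneg _)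
  rw [Ev]
  nlinarith

theorem norm_Eo_le_add (hx : F.Bounded x M ζ) :
    ‖F.Eo x‖ ≤ M ^ 2 * (‖F.Bo₁ x‖ + ‖F.Bo₂ x‖) + M ^ 2 * (‖F.Ao₁ x‖ + ‖F.Ao₂ x‖) := by
  have h1 : ‖F.u * (F.uᵀ * F.Ev x)‖ ≤ 1 * (1 * ‖F.Ev x‖) :=
    fro_mul_le F.norm_u.le (fro_mul_le (by rw [frobenius_norm_transpose, F.norm_u]) le_rfl)
  rw [Eo_eq]
  have := norm_sub_le (-F.Eu x) (F.u * (F.uᵀ * F.Ev x))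
  rw [norm_neg] at this
  linarith [hx.norm_Eu_le, hx.norm_Ev_le]

theorem norm_Eo_le (hx : F.Bounded x M ζ) : ‖F.Eo x‖ ≤ 4 * M ^ 2 * √(F.off x) := by
  have h := hx.norm_Eo_le_add
  have hM : 0 ≤ M ^ 2 := sq_nonneg M
  nlinarith [F.norm_Ao₁_le_off x, F.norm_Bo₁_le_off x, F.norm_Ao₂_le_off x, F.norm_Bo₂_le_off x]

theorem norm_err_a_le (hx : F.Bounded x M ζ) : ‖F.err_a x‖ ≤
    2 * M ^ 3 * (F.off x + ζ ^ 2) * (‖F.a x‖ + ‖F.b x‖ + √(F.off x)) := by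
  have hM := hx.M_nonneg
  have hζ := hx.ζ_nonneg
  set o := √(F.off x) with ho
  have ho0 : 0 ≤ o := Real.sqrt_nonneg _
  have hoo : F.off x = o ^ 2 := (Real.sq_sqrt (F.off_nonneg x)).symm
  have hB1 : ‖x.B₁‖ ≤ ‖F.b x‖ + o := by
    refine le_of_sq_le_sq ?_ (by positivity)
    rw [F.norm_B₁_sq]
    nlinarith [F.norm_Bo₁_le_off x, norm_nonneg (F.b x), norm_nonneg (F.Bo₁ x),
      mul_nonneg (norm_nonneg (F.b x)) ho0]
  have hEuv : ‖F.Eu x * F.v‖ ≤ M * (o * ‖F.a x‖) + o * (ζ * M) := by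
    have e1 : F.Eu x * F.v = F.R₂ * (F.Bo₁ x * F.a x) + F.Bo₂ x * (x.A₂ * (F.X₁ x * F.v)) := by
      simp [Eu, a, Matrix.add_mul, Matrix.mul_assoc]
    rw [e1]
    refine (norm_add_le _ _).trans (add_le_add ?_ ?_)
    · exact fro_mul_le hx.R₂ (fro_mul_le (F.norm_Bo₁_le_off x) le_rfl)
    · refine fro_mul_le (F.norm_Bo₂_le_off x) (fro_mul_le hx.A₂ ?_)
      simpa using fro_mul_le hx.X₁ F.norm_v.le
  have hT : ∀ {k l : ℕ} (Y : Matrix (Fin k) (Fin l) ℝ), ‖Yᵀ‖ = ‖Y‖ := fun Y =>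
    frobenius_norm_transpose Y
  have t1 : ‖(F.Bo₁ x)ᵀ * (F.R₂ᵀ * (F.Eu x * F.v))‖ ≤ o * (M * (M * (o * ‖F.a x‖) + o * (ζ * M))) :=
    fro_mul_le ((hT _).trans_le (F.norm_Bo₁_le_off x)) (fro_mul_le ((hT _).trans_le hx.R₂) hEuv)
  have t2 : ‖x.B₁ᵀ * (x.A₂ᵀ * (x.B₂ᵀ * (F.E x * F.v)))‖ ≤ (‖F.b x‖ + o) * (ζ * (ζ * (M * 1))) :=
    fro_mul_le ((hT _).trans_le hB1) (fro_mul_le ((hT _).trans_le hx.A₂)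
      (fro_mul_le ((hT _).trans_le hx.B₂) (fro_mul_le hx.E F.norm_v.le)))
  rw [err_a_eq]
  refine (norm_add_le _ _).trans ?_
  rw [norm_neg, hoo]
  have ha : 0 ≤ ‖F.a x‖ := norm_nonneg _
  have hb : 0 ≤ ‖F.b x‖ := norm_nonneg _
  have hM23 : M ^ 2 ≤ M ^ 3 := pow_le_pow_right₀ hx.one_le (by norm_num)
  have hM13 : M ≤ M ^ 3 := le_self_pow₀ hx.one_le (by norm_num)
  have hoz : o * o * ζ ≤ (o ^ 2 + ζ ^ 2) * o := by nlinarith [sq_nonneg (o - ζ), mul_nonneg ho0 hζ, mul_nonneg ho0 (sq_nonneg (o - ζ))]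
  have s1 : o * (M * (M * (o * ‖F.a x‖) + o * (ζ * M))) ≤
      M ^ 3 * ((o ^ 2 + ζ ^ 2) * (‖F.a x‖ + o)) := by
    calc o * (M * (M * (o * ‖F.a x‖) + o * (ζ * M))) = M ^ 2 * (o ^ 2 * ‖F.a x‖ + o * o * ζ) := by
          ring
      _ ≤ M ^ 3 * ((o ^ 2 + ζ ^ 2) * ‖F.a x‖ + (o ^ 2 + ζ ^ 2) * o) := by
          refine mul_le_mul hM23 (add_le_add ?_ hoz) (by positivity) (by positivity)
          exact mul_le_mul_of_nonneg_right (by nlinarith) ha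
      _ = _ := by ring
  have s2 : (‖F.b x‖ + o) * (ζ * (ζ * (M * 1))) ≤ M ^ 3 * ((o ^ 2 + ζ ^ 2) * (‖F.b x‖ + o)) := by
    calc (‖F.b x‖ + o) * (ζ * (ζ * (M * 1))) = M * (ζ ^ 2 * (‖F.b x‖ + o)) := by ring
      _ ≤ _ := by
        refine mul_le_mul hM13 (mul_le_mul_of_nonneg_right (by nlinarith) (by positivity))
          (by positivity) (by positivity)
  have hP : 0 ≤ M ^ 3 * ((o ^ 2 + ζ ^ 2) * (‖F.a x‖ + ‖F.b x‖)) := by positivity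
  nlinarith

theorem norm_err_b_le (hx : F.Bounded x M ζ) : ‖F.err_b x‖ ≤
    3 * M ^ 3 * (F.off x + ζ ^ 2) * (‖F.a x‖ + ‖F.b x‖ + √(F.off x)) := by
  have hM := hx.M_nonneg
  have hζ := hx.ζ_nonneg
  set o := √(F.off x) with ho
  have ho0 : 0 ≤ o := Real.sqrt_nonneg _
  have hoo : F.off x = o ^ 2 := (Real.sq_sqrt (F.off_nonneg x)).symm
  have hB1 : ‖x.B₁‖ ≤ ‖F.b x‖ + o := by
    refine le_of_sq_le_sq ?_ (by positivity)
    rw [F.norm_B₁_sq]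
    nlinarith [F.norm_Bo₁_le_off x, norm_nonneg (F.b x), norm_nonneg (F.Bo₁ x),
      mul_nonneg (norm_nonneg (F.b x)) ho0]
  have hA1 : ‖x.A₁‖ ≤ ‖F.a x‖ + o := by
    refine le_of_sq_le_sq ?_ (by positivity)
    rw [F.norm_A₁_sq]
    nlinarith [F.norm_Ao₁_le_off x, norm_nonneg (F.a x), norm_nonneg (F.Ao₁ x),
      mul_nonneg (norm_nonneg (F.a x)) ho0]
  have hT : ∀ {k l : ℕ} (Y : Matrix (Fin k) (Fin l) ℝ), ‖Yᵀ‖ = ‖Y‖ := fun Y =>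
    frobenius_norm_transpose Y
  have hEv : ‖F.Ev x‖ ≤ M * ((‖F.b x‖ + o) * o) + ζ * (o * M) := by
    rw [Ev]
    refine (norm_add_le _ _).trans (add_le_add ?_ ?_)
    · exact fro_mul_le hx.X₂ (fro_mul_le hB1 (F.norm_Ao₁_le_off x))
    · exact fro_mul_le hx.B₂ (fro_mul_le (F.norm_Ao₂_le_off x) hx.R₁)
  have t1 : ‖F.Ao₁ x * ((F.Ev x)ᵀ * F.u)‖ ≤ o * ((M * ((‖F.b x‖ + o) * o) + ζ * (o * M)) * 1) :=
    fro_mul_le (F.norm_Ao₁_le_off x) (fro_mul_le ((hT _).trans_le hEv) F.norm_u.le)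
  have t2 : ‖x.A₁ * ((F.E x)ᵀ * (x.B₂ * F.c x))‖ ≤ (‖F.a x‖ + o) * (M * (ζ * ζ)) :=
    fro_mul_le hA1 (fro_mul_le ((hT _).trans_le hx.E)
      (fro_mul_le hx.B₂ ((F.norm_c_le x).trans hx.A₂)))
  rw [err_b_eq]
  refine (norm_add_le _ _).trans ?_
  rw [norm_neg, norm_smul, Real.norm_of_nonneg hx.σ₂_nonneg, hoo]
  have t1' := mul_le_mul hx.σ₂ t1 (norm_nonneg _) hM
  have ha : 0 ≤ ‖F.a x‖ := norm_nonneg _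
  have hb : 0 ≤ ‖F.b x‖ := norm_nonneg _
  have hM23 : M ^ 2 ≤ M ^ 3 := pow_le_pow_right₀ hx.one_le (by norm_num)
  have hM13 : M ≤ M ^ 3 := le_self_pow₀ hx.one_le (by norm_num)
  have hoz : o * o * ζ ≤ (o ^ 2 + ζ ^ 2) * o := by nlinarith [sq_nonneg (o - ζ), mul_nonneg ho0 hζ, mul_nonneg ho0 (sq_nonneg (o - ζ))]
  have s1 : M * (o * ((M * ((‖F.b x‖ + o) * o) + ζ * (o * M)) * 1)) ≤
      M ^ 3 * ((o ^ 2 + ζ ^ 2) * (‖F.b x‖ + 2 * o)) := by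
    calc M * (o * ((M * ((‖F.b x‖ + o) * o) + ζ * (o * M)) * 1)) =
          M ^ 2 * (o ^ 2 * (‖F.b x‖ + o) + o * o * ζ) := by ring
      _ ≤ M ^ 3 * ((o ^ 2 + ζ ^ 2) * (‖F.b x‖ + o) + (o ^ 2 + ζ ^ 2) * o) := by
          refine mul_le_mul hM23 (add_le_add ?_ hoz) (by positivity) (by positivity)
          exact mul_le_mul_of_nonneg_right (by nlinarith) (by positivity)
      _ = _ := by ring
  have s2 : (‖F.a x‖ + o) * (M * (ζ * ζ)) ≤ M ^ 3 * ((o ^ 2 + ζ ^ 2) * (‖F.a x‖ + o)) := by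
    calc (‖F.a x‖ + o) * (M * (ζ * ζ)) = M * (ζ ^ 2 * (‖F.a x‖ + o)) := by ring
      _ ≤ _ := by
        refine mul_le_mul hM13 (mul_le_mul_of_nonneg_right (by nlinarith) (by positivity))
          (by positivity) (by positivity)
  have hP : 0 ≤ M ^ 3 * ((o ^ 2 + ζ ^ 2) * (‖F.a x‖ + ‖F.b x‖)) := by positivity
  nlinarith

theorem abs_e_le (hx : F.Bounded x M ζ) : |F.e x| ≤ M := by
  refine (abs_frobInner_le _ _).trans ?_
  simpa [F.norm_u] using fro_mul_le hx.E F.norm_v.le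

/-- The growth of the second pair of weights. -/
theorem size_velocity_le (hx : F.Bounded x M ζ) {s : ℝ} (hs : ‖x.A₂‖ ^ 2 + ‖x.B₂‖ ^ 2 = s) :
    2 * (frobInner x.A₂ (F.dA₂ x) + frobInner x.B₂ (F.dB₂ x)) ≤
      (2 * |F.e x * (F.σ₁ + F.p x)| + 10 * M ^ 3 * √(F.off x)) * s := by
  have hM := hx.M_nonneg
  have ho : 0 ≤ √(F.off x) := Real.sqrt_nonneg _
  have hs2 : 2 * (‖x.A₂‖ * ‖x.B₂‖) ≤ s := by nlinarith [sq_nonneg (‖x.A₂‖ - ‖x.B₂‖)]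
  have hAB : 0 ≤ ‖x.A₂‖ * ‖x.B₂‖ := by positivity
  -- Both weights of the second pair contribute the same scalar. Splitting the residual into `e u vᵀ
  -- + Eo` isolates its main part, a multiple of `⟨c, y⟩`.
  have e1 : frobInner x.A₂ (F.dA₂ x) = frobInner (x.B₂ * (x.A₂ * F.X₁ x)) (F.E x) := by
    rw [dA₂, ← frobInner_mul_left, ← frobInner_mul_right, Matrix.mul_assoc]
  have e2 : frobInner x.B₂ (F.dB₂ x) = frobInner (x.B₂ * (x.A₂ * F.X₁ x)) (F.E x) := by
    rw [dB₂, ← frobInner_mul_right]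
  have e3 : frobInner (x.B₂ * (x.A₂ * F.X₁ x)) (F.E x) =
      F.e x * (F.σ₁ + F.p x) * frobInner (F.c x) (F.y x) +
      F.e x * frobInner (F.Ao₂ x * (F.Bo₁ x * F.a x)) (F.y x) +
      frobInner (x.B₂ * (x.A₂ * F.X₁ x)) (F.Eo x) := by
    have h1 : F.E x = F.e x • (F.u * F.vᵀ) + F.Eo x := by simp [Eo]
    conv_lhs => rw [h1]
    rw [frobInner_add_right, frobInner_smul_right, frobInner_comm _ (F.u * F.vᵀ), frobInner_col_mul,
      Matrix.mul_assoc, Matrix.mul_assoc, A₂_X₁_v, frobInner_comm, frobInner_mul_left, ← y,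
      frobInner_add_left, frobInner_smul_left]
    ring
  have b1 : |frobInner (F.c x) (F.y x)| ≤ ‖x.A₂‖ * ‖x.B₂‖ := (abs_frobInner_le _ _).trans
    (mul_le_mul (F.norm_c_le x) (F.norm_y_le x) (norm_nonneg _) (norm_nonneg _))
  have b2 : |frobInner (F.Ao₂ x * (F.Bo₁ x * F.a x)) (F.y x)| ≤
      (‖x.A₂‖ * (√(F.off x) * M)) * ‖x.B₂‖ := (abs_frobInner_le _ _).trans
    (mul_le_mul (fro_mul_le (F.norm_Ao₂_le x) (fro_mul_le (F.norm_Bo₁_le_off x)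
      ((F.norm_a_le x).trans hx.A₁))) (F.norm_y_le x) (norm_nonneg _) (by positivity))
  have b3 : |frobInner (x.B₂ * (x.A₂ * F.X₁ x)) (F.Eo x)| ≤
      (‖x.B₂‖ * (‖x.A₂‖ * M)) * (4 * M ^ 2 * √(F.off x)) := (abs_frobInner_le _ _).trans
    (mul_le_mul (fro_mul_le le_rfl (fro_mul_le le_rfl hx.X₁)) hx.norm_Eo_le (norm_nonneg _)
      (by positivity))
  have t1 : F.e x * (F.σ₁ + F.p x) * frobInner (F.c x) (F.y x) ≤
      |F.e x * (F.σ₁ + F.p x)| * (‖x.A₂‖ * ‖x.B₂‖) := by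
    refine (le_abs_self _).trans ?_
    rw [abs_mul]
    exact mul_le_mul_of_nonneg_left b1 (abs_nonneg _)
  have t2 : F.e x * frobInner (F.Ao₂ x * (F.Bo₁ x * F.a x)) (F.y x) ≤
      M * ((‖x.A₂‖ * (√(F.off x) * M)) * ‖x.B₂‖) := by
    refine (le_abs_self _).trans ?_
    rw [abs_mul]
    exact mul_le_mul hx.abs_e_le b2 (abs_nonneg _) hM
  have t3 := (le_abs_self _).trans b3
  have hM23 : M ^ 2 ≤ M ^ 3 := pow_le_pow_right₀ hx.one_le (by norm_num)
  have t2' : M * ((‖x.A₂‖ * (√(F.off x) * M)) * ‖x.B₂‖) ≤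
      M ^ 3 * √(F.off x) * (‖x.A₂‖ * ‖x.B₂‖) := by
    calc _ = M ^ 2 * (√(F.off x) * (‖x.A₂‖ * ‖x.B₂‖)) := by ring
      _ ≤ M ^ 3 * (√(F.off x) * (‖x.A₂‖ * ‖x.B₂‖)) :=
        mul_le_mul_of_nonneg_right hM23 (by positivity)
      _ = _ := by ring
  have k1 : |F.e x * (F.σ₁ + F.p x)| * (2 * (‖x.A₂‖ * ‖x.B₂‖)) ≤ |F.e x * (F.σ₁ + F.p x)| * s :=
    mul_le_mul_of_nonneg_left hs2 (abs_nonneg _)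
  have k2 : M ^ 3 * √(F.off x) * (2 * (‖x.A₂‖ * ‖x.B₂‖)) ≤ M ^ 3 * √(F.off x) * s :=
    mul_le_mul_of_nonneg_left hs2 (by positivity)
  rw [e1, e2, e3]
  nlinarith

/-- Each of the four maps in the form has norm at most `M ^ 2`; for those involving the second pair
this uses `ζ ≤ 1`. -/
theorem abs_decayForm_le (hx : F.Bounded x M ζ) :
    |F.decayForm x (F.u * F.vᵀ) (F.Eo x)| ≤ 4 * M ^ 4 * ‖F.Eo x‖ := by
  have hM := hx.M_nonneg
  have hT : ∀ {k l : ℕ} (Y : Matrix (Fin k) (Fin l) ℝ), ‖Yᵀ‖ = ‖Y‖ := fun Y =>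
    frobenius_norm_transpose Y
  have hA2 := hx.A₂.trans hx.ζ_le
  have hB2 := hx.B₂.trans hx.ζ_le
  have huv : ‖F.u * F.vᵀ‖ ≤ 1 := by rw [norm_col_mul_row, F.norm_u, F.norm_v, mul_one]
  have q1 : ∀ Y : Matrix (Fin m) (Fin n) ℝ, ‖(F.X₂ x)ᵀ * (Y * x.A₁ᵀ)‖ ≤ M ^ 2 * ‖Y‖ := fun Y =>
    (fro_mul_le ((hT _).trans_le hx.X₂) (fro_mul_le le_rfl ((hT _).trans_le hx.A₁))).trans_eq
      (by ring)
  have q2 : ∀ Y : Matrix (Fin m) (Fin n) ℝ, ‖(F.X₂ x * x.B₁)ᵀ * Y‖ ≤ M ^ 2 * ‖Y‖ := fun Y =>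
    (fro_mul_le ((hT _).trans_le (fro_mul_le hx.X₂ hx.B₁)) le_rfl).trans_eq (by ring)
  have hM2 : 1 * M ≤ M ^ 2 := by nlinarith [hx.one_le]
  have q3 : ∀ Y : Matrix (Fin m) (Fin n) ℝ, ‖Y * (x.A₂ * F.X₁ x)ᵀ‖ ≤ M ^ 2 * ‖Y‖ := fun Y =>
    (fro_mul_le le_rfl ((hT _).trans_le ((fro_mul_le hA2 hx.X₁).trans hM2))).trans_eq (by ring)
  have q4 : ∀ Y : Matrix (Fin m) (Fin n) ℝ, ‖x.B₂ᵀ * (Y * (F.X₁ x)ᵀ)‖ ≤ M ^ 2 * ‖Y‖ := fun Y => by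
    have h1 := fro_mul_le ((hT x.B₂).trans_le hB2) (fro_mul_le (le_refl ‖Y‖)
      ((hT _).trans_le hx.X₁))
    refine h1.trans ?_
    nlinarith [norm_nonneg Y]
  have key : ∀ {k l : ℕ} (P Q : Matrix (Fin k) (Fin l) ℝ), ‖P‖ ≤ M ^ 2 → ‖Q‖ ≤ M ^ 2 * ‖F.Eo x‖ →
      |frobInner P Q| ≤ M ^ 4 * ‖F.Eo x‖ := fun P Q hP hQ =>
    (abs_frobInner_le P Q).trans ((mul_le_mul hP hQ (norm_nonneg _) (by positivity)).trans_eq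
      (by ring))
  have one : ∀ {k l : ℕ} {P : Matrix (Fin k) (Fin l) ℝ}, ‖P‖ ≤ M ^ 2 * ‖F.u * F.vᵀ‖ → ‖P‖ ≤ M ^ 2 :=
    fun hP => hP.trans (mul_le_of_le_one_right (by positivity) huv)
  rw [decayForm]
  refine (abs_add_le _ _).trans ?_
  refine (add_le_add_left (abs_add_le _ _) _).trans ?_
  refine (add_le_add_left (add_le_add_left (abs_add_le _ _) _) _).trans ?_
  have k1 := key _ _ (one (q1 _)) (q1 (F.Eo x))
  have k2 := key _ _ (one (q2 _)) (q2 (F.Eo x))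
  have k3 := key _ _ (one (q3 _)) (q3 (F.Eo x))
  have k4 := key _ _ (one (q4 _)) (q4 (F.Eo x))
  linarith

/-- Since `X₂ᵀ u` is `σ₂ g` up to order `ζ ^ 2`, the two squares that belong to the first pair give
`σ₂² ‖a‖²` and `σ₂² ‖b‖²`. The two squares from the second pair are nonnegative and dropped. -/
theorem le_decayForm (hx : F.Bounded x M ζ) :
    F.σ₂ ^ 2 * (‖F.a x‖ ^ 2 + ‖F.b x‖ ^ 2) - 4 * M ^ 4 * ζ ^ 2 ≤
      F.decayForm x (F.u * F.vᵀ) (F.u * F.vᵀ) := by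
  have hM := hx.M_nonneg
  have hζ := hx.ζ_nonneg
  have hT : ∀ {k l : ℕ} (Y : Matrix (Fin k) (Fin l) ℝ), ‖Yᵀ‖ = ‖Y‖ := fun Y =>
    frobenius_norm_transpose Y
  have hy := (F.norm_y_le x).trans hx.B₂
  have hAy : ‖x.A₂ᵀ * F.y x‖ ≤ ζ * ζ := fro_mul_le ((hT _).trans_le hx.A₂) hy
  have lower : ∀ {k : ℕ} (P Q : Matrix (Fin k) Unit ℝ), ‖P‖ ^ 2 - 2 * (‖P‖ * ‖Q‖) ≤ ‖P + Q‖ ^ 2 :=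
    fun P Q => by
      rw [norm_add_sq_frob]
      nlinarith [neg_le_frobInner P Q, sq_nonneg ‖Q‖]
  have i1 : (F.X₂ x)ᵀ * (F.u * F.vᵀ * x.A₁ᵀ) = ((F.X₂ x)ᵀ * F.u) * (F.a x)ᵀ := by
    simp [a, Matrix.mul_assoc]
  have i2 : (F.X₂ x * x.B₁)ᵀ * (F.u * F.vᵀ) = (x.B₁ᵀ * ((F.X₂ x)ᵀ * F.u)) * F.vᵀ := by
    simp [Matrix.mul_assoc]
  have t1 : F.σ₂ ^ 2 * ‖F.a x‖ ^ 2 - 2 * M ^ 4 * ζ ^ 2 ≤ ‖((F.X₂ x)ᵀ * F.u) * (F.a x)ᵀ‖ ^ 2 := by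
    rw [norm_col_mul_row, X₂t_u, mul_pow]
    have h1 := lower (F.σ₂ • F.g) (x.A₂ᵀ * F.y x)
    rw [norm_smul, F.norm_g, Real.norm_of_nonneg hx.σ₂_nonneg, mul_one] at h1
    have h2 : F.σ₂ * ‖x.A₂ᵀ * F.y x‖ ≤ M * (ζ * ζ) :=
      mul_le_mul hx.σ₂ hAy (norm_nonneg _) hM
    have ha : ‖F.a x‖ ^ 2 ≤ M ^ 2 :=
      pow_le_pow_left₀ (norm_nonneg _) ((F.norm_a_le x).trans hx.A₁) 2
    have h3 : (F.σ₂ ^ 2 - 2 * (M * (ζ * ζ))) * ‖F.a x‖ ^ 2 ≤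
        ‖F.σ₂ • F.g + x.A₂ᵀ * F.y x‖ ^ 2 * ‖F.a x‖ ^ 2 :=
      mul_le_mul_of_nonneg_right (by linarith) (sq_nonneg _)
    have h4 : M * (ζ * ζ) * ‖F.a x‖ ^ 2 ≤ M * (ζ * ζ) * M ^ 3 :=
      mul_le_mul_of_nonneg_left (ha.trans (pow_le_pow_right₀ hx.one_le (by norm_num)))
        (by positivity)
    nlinarith
  have t2 : F.σ₂ ^ 2 * ‖F.b x‖ ^ 2 - 2 * M ^ 4 * ζ ^ 2 ≤
      ‖(x.B₁ᵀ * ((F.X₂ x)ᵀ * F.u)) * F.vᵀ‖ ^ 2 := by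
    rw [norm_mul_transpose_of_unit F.vv, X₂t_u, Matrix.mul_add, Matrix.mul_smul, ← b]
    have h1 := lower (F.σ₂ • F.b x) (x.B₁ᵀ * (x.A₂ᵀ * F.y x))
    rw [norm_smul, Real.norm_of_nonneg hx.σ₂_nonneg, mul_pow] at h1
    have h2 : F.σ₂ * ‖F.b x‖ * ‖x.B₁ᵀ * (x.A₂ᵀ * F.y x)‖ ≤ (M * M) * (M * (ζ * ζ)) :=
      mul_le_mul (mul_le_mul hx.σ₂ ((F.norm_b_le x).trans hx.B₁) (norm_nonneg _) hM)
        (fro_mul_le ((hT _).trans_le hx.B₁) hAy) (norm_nonneg _) (by positivity)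
    have h3 : M ^ 3 * ζ ^ 2 ≤ M ^ 4 * ζ ^ 2 :=
      mul_le_mul_of_nonneg_right (pow_le_pow_right₀ hx.one_le (by norm_num)) (sq_nonneg _)
    nlinarith
  rw [decayForm, i1, i2, frobInner_self, frobInner_self, frobInner_self, frobInner_self]
  nlinarith [sq_nonneg ‖F.u * F.vᵀ * (x.A₂ * F.X₁ x)ᵀ‖,
    sq_nonneg ‖x.B₂ᵀ * (F.u * F.vᵀ * (F.X₁ x)ᵀ)‖]

end Bounded

/-! Consequences of the conservation law `A₁ A₁ᵀ - B₁ᵀ B₁ = S Sᵀ`. -/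

section Balance

variable {S : Matrix (Fin r) (Fin n) ℝ}

theorem norm_A₁_sq_of_balance (hS : x.A₁ * x.A₁ᵀ = x.B₁ᵀ * x.B₁ + S * Sᵀ) :
    ‖x.A₁‖ ^ 2 = ‖x.B₁‖ ^ 2 + ‖S‖ ^ 2 := by
  have key : ∀ {k l : ℕ} (Y : Matrix (Fin k) (Fin l) ℝ), (Y * Yᵀ).trace = ‖Y‖ ^ 2 := fun Y => by
    rw [← frobInner_self]
    simp [Matrix.trace, mul_apply, frobInner]
  have h := congrArg Matrix.trace hS
  have hB := key x.B₁ᵀ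
  rw [transpose_transpose, frobenius_norm_transpose] at hB
  rwa [Matrix.trace_add, key, key, hB] at h

theorem norm_A₁t_mul_sq_of_balance (hS : x.A₁ * x.A₁ᵀ = x.B₁ᵀ * x.B₁ + S * Sᵀ)
    (z : Matrix (Fin r) Unit ℝ) : ‖x.A₁ᵀ * z‖ ^ 2 = ‖x.B₁ * z‖ ^ 2 + ‖Sᵀ * z‖ ^ 2 := by
  simp only [← frobInner_self, frobInner_mul_left, transpose_transpose]
  rw [← Matrix.mul_assoc, hS, Matrix.add_mul, frobInner_add_right, Matrix.mul_assoc,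
    Matrix.mul_assoc]

theorem norm_A₁t_mul_sq (z : Matrix (Fin r) Unit ℝ) :
    ‖x.A₁ᵀ * z‖ ^ 2 = frobInner (F.a x) z ^ 2 + ‖(F.Ao₁ x)ᵀ * z‖ ^ 2 := by
  conv_lhs => rw [F.A₁_eq x]
  rw [transpose_add, Matrix.add_mul, transpose_mul, transpose_transpose, Matrix.mul_assoc,
    transpose_mul_col, norm_add_sq_frob, Matrix.mul_smul, Matrix.mul_one, frobInner_smul_left,
    frobInner_comm F.v, frobInner_mul_left, transpose_transpose, F.Ao₁_v, frobInner_zero_right,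
    norm_smul, F.norm_v]
  simp

theorem norm_B₁_mul_sq (z : Matrix (Fin r) Unit ℝ) :
    ‖x.B₁ * z‖ ^ 2 = frobInner (F.b x) z ^ 2 + ‖F.Bo₁ x * z‖ ^ 2 := by
  conv_lhs => rw [F.B₁_eq x]
  rw [Matrix.add_mul, Matrix.mul_assoc, transpose_mul_col, norm_add_sq_frob, Matrix.mul_smul,
    Matrix.mul_one, frobInner_smul_left, frobInner_comm F.g, frobInner_mul_left, F.Bo₁_g,
    frobInner_zero_right, norm_smul, F.norm_g]
  simp

/-- Testing the conservation law on `a` gives `‖a‖⁴ + ‖Ao₁ᵀ a‖² = p² + ‖Bo₁ a‖² + ‖Sᵀ a‖²`. The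
difference `‖a‖⁴ - p²` factors, and one factor `‖a‖²` cancels. -/
theorem norm_a_sq_sub_le_of_balance (hS : x.A₁ * x.A₁ᵀ = x.B₁ᵀ * x.B₁ + S * Sᵀ) :
    ‖F.a x‖ ^ 2 - |F.p x| ≤ ‖F.Bo₁ x‖ ^ 2 + ‖S‖ ^ 2 := by
  have h := norm_A₁t_mul_sq_of_balance hS (F.a x)
  rw [norm_A₁t_mul_sq (F := F), norm_B₁_mul_sq (F := F), frobInner_self, frobInner_comm (F.b x),
    ← p] at h
  have h1 : ‖F.Bo₁ x * F.a x‖ ≤ ‖F.Bo₁ x‖ * ‖F.a x‖ := frobenius_norm_mul _ _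
  have h2 : ‖Sᵀ * F.a x‖ ≤ ‖S‖ * ‖F.a x‖ := by
    simpa [frobenius_norm_transpose] using frobenius_norm_mul Sᵀ (F.a x)
  have h1' := pow_le_pow_left₀ (norm_nonneg _) h1 2
  have h2' := pow_le_pow_left₀ (norm_nonneg _) h2 2
  have h3 : (‖F.a x‖ ^ 2 - |F.p x|) * (‖F.a x‖ ^ 2 + |F.p x|) ≤
      (‖F.Bo₁ x‖ ^ 2 + ‖S‖ ^ 2) * ‖F.a x‖ ^ 2 := by
    nlinarith [sq_nonneg ‖(F.Ao₁ x)ᵀ * F.a x‖, sq_abs (F.p x)]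
  by_contra! hcon
  have hpos : 0 < ‖F.a x‖ ^ 2 := by nlinarith [abs_nonneg (F.p x), sq_nonneg ‖F.Bo₁ x‖, sq_nonneg ‖S‖]
  have h4 := mul_lt_mul_of_pos_right hcon hpos
  nlinarith [mul_nonneg (abs_nonneg (F.p x))
    (show 0 ≤ ‖F.a x‖ ^ 2 - |F.p x| by nlinarith [sq_nonneg ‖F.Bo₁ x‖, sq_nonneg ‖S‖])]

/-- The same with the test vector `b`; here `S` enters with the favourable sign. -/
theorem norm_b_sq_sub_le_of_balance (hS : x.A₁ * x.A₁ᵀ = x.B₁ᵀ * x.B₁ + S * Sᵀ) :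
    ‖F.b x‖ ^ 2 - |F.p x| ≤ ‖F.Ao₁ x‖ ^ 2 := by
  have h := norm_A₁t_mul_sq_of_balance hS (F.b x)
  rw [norm_A₁t_mul_sq (F := F), norm_B₁_mul_sq (F := F), frobInner_self, ← p] at h
  have h1 : ‖(F.Ao₁ x)ᵀ * F.b x‖ ≤ ‖F.Ao₁ x‖ * ‖F.b x‖ := by
    simpa [frobenius_norm_transpose] using frobenius_norm_mul (F.Ao₁ x)ᵀ (F.b x)
  have h1' := pow_le_pow_left₀ (norm_nonneg _) h1 2
  have h3 : (‖F.b x‖ ^ 2 - |F.p x|) * (‖F.b x‖ ^ 2 + |F.p x|) ≤ ‖F.Ao₁ x‖ ^ 2 * ‖F.b x‖ ^ 2 := by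
    nlinarith [sq_nonneg ‖F.Bo₁ x * F.b x‖, sq_nonneg ‖Sᵀ * F.b x‖, sq_abs (F.p x)]
  by_contra! hcon
  have hpos : 0 < ‖F.b x‖ ^ 2 := by nlinarith [abs_nonneg (F.p x), sq_nonneg ‖F.Ao₁ x‖]
  have h4 := mul_lt_mul_of_pos_right hcon hpos
  nlinarith [mul_nonneg (abs_nonneg (F.p x))
    (show 0 ≤ ‖F.b x‖ ^ 2 - |F.p x| by nlinarith [sq_nonneg ‖F.Ao₁ x‖])]

/-- If the first layer is positively correlated with `g vᵀ`, then `a` and `b` almost agree. -/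
theorem norm_a_sub_b_sq_le_of_balance (hS : x.A₁ * x.A₁ᵀ = x.B₁ᵀ * x.B₁ + S * Sᵀ)
    (hp : 0 ≤ F.p x) : ‖F.a x - F.b x‖ ^ 2 ≤ ‖F.Ao₁ x‖ ^ 2 + ‖F.Bo₁ x‖ ^ 2 + ‖S‖ ^ 2 := by
  have h1 := norm_a_sq_sub_le_of_balance (F := F) hS
  have h2 := norm_b_sq_sub_le_of_balance (F := F) hS
  rw [abs_of_nonneg hp] at h1 h2
  rw [norm_sub_sq_frob, ← p]
  linarith

/-- A bound for the first pair of weights in terms of the residual. -/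
theorem norm_A₁_sq_le_of_balance (hS : x.A₁ * x.A₁ᵀ = x.B₁ᵀ * x.B₁ + S * Sᵀ) {σ₂ ζ : ℝ}
    (hσ₂ : F.σ₂ = σ₂) (hσ₂_pos : 0 < σ₂) (hσ : 0 < F.σ) (hE : ‖F.E x‖ ≤ F.σ) (ho : F.off x ≤ 1)
    (hS1 : ‖S‖ ^ 2 ≤ 1) (hA₂ : ‖x.A₂‖ ≤ ζ) (hB₂ : ‖x.B₂‖ ≤ ζ) (hζ : ζ ^ 2 ≤ σ₂ / 2) :
    ‖x.A₁‖ ^ 2 ≤ 6 + 4 * F.σ / σ₂ + ‖F.W₁‖ := by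
  have hζ0 : 0 ≤ ζ := (norm_nonneg _).trans hA₂
  have h1 := norm_a_sq_sub_le_of_balance (F := F) hS
  have hB : ‖x.B₁‖ ≤ ‖x.A₁‖ := by
    refine le_of_sq_le_sq ?_ (norm_nonneg _)
    rw [norm_A₁_sq_of_balance hS]
    nlinarith [sq_nonneg ‖S‖]
  have hA : ‖x.A₁‖ ^ 2 ≤ |F.p x| + 3 := by
    rw [F.norm_A₁_sq]
    unfold off at ho
    nlinarith [sq_nonneg ‖F.Ao₁ x‖, sq_nonneg ‖F.Bo₁ x‖, sq_nonneg ‖F.Ao₂ x‖, sq_nonneg ‖F.Bo₂ x‖]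
  have hX : ‖F.X₁ x‖ ≤ ‖F.W₁‖ + ‖x.A₁‖ ^ 2 := by
    refine (norm_add_le _ _).trans (add_le_add le_rfl ?_)
    rw [sq]
    exact fro_mul_le hB le_rfl
  have he : |F.e x| ≤ F.σ := by
    refine (abs_frobInner_le _ _).trans ?_
    simpa [F.norm_u] using fro_mul_le hE F.norm_v.le
  have hy : |frobInner (F.y x) (x.A₂ * (F.X₁ x * F.v))| ≤
      ζ * (ζ * ((‖F.W₁‖ + ‖x.A₁‖ ^ 2) * 1)) := (abs_frobInner_le _ _).trans
    (mul_le_mul ((F.norm_y_le x).trans hB₂) (fro_mul_le hA₂ (fro_mul_le hX F.norm_v.le))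
      (norm_nonneg _) hζ0)
  -- Solving the formula for `e` for `p` bounds `p` by the residual and a coupling term. The latter
  -- contains `‖A₁‖²` with coefficient at most `σ₂ / 2`, so it can be absorbed on the left at the
  -- end.
  have hp : σ₂ * |F.p x| ≤ 2 * F.σ + σ₂ / 2 * (‖F.W₁‖ + ‖x.A₁‖ ^ 2) := by
    have e1 : F.σ₂ * F.p x = F.σ - F.e x - frobInner (F.y x) (x.A₂ * (F.X₁ x * F.v)) := by
      rw [F.e_eq x]; ring
    have e2 : σ₂ * |F.p x| = |F.σ₂ * F.p x| := by rw [abs_mul, hσ₂, abs_of_pos hσ₂_pos]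
    have e3 : |F.σ₂ * F.p x| ≤ F.σ + |F.e x| + |frobInner (F.y x) (x.A₂ * (F.X₁ x * F.v))| := by
      rw [e1]
      refine (abs_sub _ _).trans (add_le_add ((abs_sub _ _).trans ?_) le_rfl)
      rw [abs_of_pos hσ]
    have e4 : ζ ^ 2 * (‖F.W₁‖ + ‖x.A₁‖ ^ 2) ≤ σ₂ / 2 * (‖F.W₁‖ + ‖x.A₁‖ ^ 2) :=
      mul_le_mul_of_nonneg_right hζ (by positivity)
    rw [e2]
    linarith
  have hp' : |F.p x| ≤ 2 * F.σ / σ₂ + (‖F.W₁‖ + ‖x.A₁‖ ^ 2) / 2 := by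
    rw [← mul_le_mul_iff_right₀ hσ₂_pos]
    refine hp.trans_eq ?_
    field_simp
  have h4 : 4 * F.σ / σ₂ = 2 * (2 * F.σ / σ₂) := by ring
  linarith

end Balance

end AlignedModel

end VelocityBounds

/-! ### Derivatives along the flow and conserved quantities -/

section Flow

open scoped Matrix.Norms.Frobenius

namespace AlignedModel

variable {m n h r : ℕ}

/-- The gradient flow of the squared residual. -/
structure IsFlow (F : AlignedModel m n h) (w : ℝ → LoRAWeights m n h r) : Prop where
  A₁ : ∀ t, 0 ≤ t → HasMatDeriv (fun s => (w s).A₁) (F.dA₁ (w t)) t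
  B₁ : ∀ t, 0 ≤ t → HasMatDeriv (fun s => (w s).B₁) (F.dB₁ (w t)) t
  A₂ : ∀ t, 0 ≤ t → HasMatDeriv (fun s => (w s).A₂) (F.dA₂ (w t)) t
  B₂ : ∀ t, 0 ≤ t → HasMatDeriv (fun s => (w s).B₂) (F.dB₂ (w t)) t

/-- The squared size of the second pair of weights. -/
noncomputable def size₂ (x : LoRAWeights m n h r) : ℝ := ‖x.A₂‖ ^ 2 + ‖x.B₂‖ ^ 2

namespace IsFlow

variable {F : AlignedModel m n h} {w : ℝ → LoRAWeights m n h r} (hw : F.IsFlow w) {t : ℝ}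
  (ht : 0 ≤ t)

include hw ht

theorem a : HasMatDeriv (fun s => F.a (w s)) (F.dA₁ (w t) * F.v) t := (hw.A₁ t ht).mul_const _
theorem b : HasMatDeriv (fun s => F.b (w s)) ((F.dB₁ (w t))ᵀ * F.g) t :=
  (hw.B₁ t ht).transpose.mul_const _
theorem c : HasMatDeriv (fun s => F.c (w s)) (F.dA₂ (w t) * F.g) t := (hw.A₂ t ht).mul_const _
theorem y : HasMatDeriv (fun s => F.y (w s)) ((F.dB₂ (w t))ᵀ * F.u) t :=
  (hw.B₂ t ht).transpose.mul_const _

theorem a' : HasMatDeriv (fun s => F.a (w s))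
    ((F.σ₂ * F.e (w t)) • F.b (w t) + F.err_a (w t)) t :=
  (hw.a ht).congr_deriv (by simp [err_a])
theorem b' : HasMatDeriv (fun s => F.b (w s))
    ((F.σ₂ * F.e (w t)) • F.a (w t) + F.err_b (w t)) t :=
  (hw.b ht).congr_deriv (by simp [err_b])
theorem c' : HasMatDeriv (fun s => F.c (w s))
    ((F.e (w t) * (F.σ₁ + F.p (w t))) • F.y (w t) + F.err_c (w t)) t :=
  (hw.c ht).congr_deriv (by simp [err_c])
theorem y' : HasMatDeriv (fun s => F.y (w s))
    ((F.e (w t) * (F.σ₁ + F.p (w t))) • F.c (w t) + F.err_y (w t)) t :=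
  (hw.y ht).congr_deriv (by simp [err_y])

theorem X₁ : HasMatDeriv (fun s => F.X₁ (w s))
    (F.dB₁ (w t) * (w t).A₁ + (w t).B₁ * F.dA₁ (w t)) t := by
  exact ((HasMatDeriv.const F.W₁ t).add ((hw.B₁ t ht).mul (hw.A₁ t ht))).congr_deriv (by simp)

theorem E : HasMatDeriv (fun s => F.E (w s)) (F.dE (w t)) t := by
  have h := ((HasMatDeriv.const (F.σ • (F.u * F.vᵀ)) t).sub
    (((hw.B₁ t ht).mul (hw.A₁ t ht)).const_mul F.W₂)).sub
    ((hw.B₂ t ht).mul ((hw.A₂ t ht).mul (hw.X₁ ht)))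
  refine h.congr_deriv ?_
  simp only [dE, AlignedModel.X₂, Matrix.add_mul, Matrix.mul_add, Matrix.mul_assoc]
  abel

theorem norm_E_sq : HasDerivWithinAt (fun s => ‖F.E (w s)‖ ^ 2)
    (-2 * F.decayForm (w t) (F.E (w t)) (F.E (w t))) (Ici 0) t :=
  (hw.E ht).norm_sq.congr_deriv (by rw [frobInner_dE]; ring)

theorem e : HasDerivWithinAt (fun s => F.e (w s))
    (-F.decayForm (w t) (F.u * F.vᵀ) (F.E (w t))) (Ici 0) t := by
  have := (HasMatDeriv.const (F.u * F.vᵀ) t).frobInner (hw.E ht)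
  simp only [frobInner_col_mul, frobInner_zero_left, zero_add] at this
  refine this.congr_deriv ?_
  rw [← frobInner_col_mul, frobInner_dE]

theorem norm_Ao₁_sq : HasDerivWithinAt (fun s => ‖F.Ao₁ (w s)‖ ^ 2)
    (2 * frobInner (F.Ao₁ (w t)) (F.dA₁ (w t))) (Ici 0) t := by
  refine (((hw.A₁ t ht).sub ((hw.a ht).mul_const F.vᵀ)).norm_sq).congr_deriv ?_
  rw [frobInner_sub_right, frobInner_comm _ (_ * F.vᵀ), frobInner_mul_right, transpose_transpose,
    ← Ao₁, Ao₁_v, frobInner_zero_right, sub_zero]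

theorem norm_Ao₂_sq : HasDerivWithinAt (fun s => ‖F.Ao₂ (w s)‖ ^ 2)
    (2 * frobInner (F.Ao₂ (w t)) (F.dA₂ (w t))) (Ici 0) t := by
  refine (((hw.A₂ t ht).sub ((hw.c ht).mul_const F.gᵀ)).norm_sq).congr_deriv ?_
  rw [frobInner_sub_right, frobInner_comm _ (_ * F.gᵀ), frobInner_mul_right, transpose_transpose,
    ← Ao₂, Ao₂_g, frobInner_zero_right, sub_zero]

theorem norm_Bo₁_sq : HasDerivWithinAt (fun s => ‖F.Bo₁ (w s)‖ ^ 2)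
    (2 * frobInner (F.Bo₁ (w t)) (F.dB₁ (w t))) (Ici 0) t := by
  refine (((hw.B₁ t ht).sub ((hw.b ht).transpose.const_mul F.g)).norm_sq).congr_deriv ?_
  rw [frobInner_sub_right, frobInner_comm _ (F.g * _), frobInner_mul_left,
    ← Bo₁, g_Bo₁, frobInner_zero_right, sub_zero]

theorem norm_Bo₂_sq : HasDerivWithinAt (fun s => ‖F.Bo₂ (w s)‖ ^ 2)
    (2 * frobInner (F.Bo₂ (w t)) (F.dB₂ (w t))) (Ici 0) t := by
  refine (((hw.B₂ t ht).sub ((hw.y ht).transpose.const_mul F.u)).norm_sq).congr_deriv ?_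
  rw [frobInner_sub_right, frobInner_comm _ (F.u * _), frobInner_mul_left,
    ← Bo₂, u_Bo₂, frobInner_zero_right, sub_zero]

theorem off : HasDerivWithinAt (fun s => F.off (w s))
    (2 * (frobInner (F.Ao₁ (w t)) (F.dA₁ (w t)) + frobInner (F.Bo₁ (w t)) (F.dB₁ (w t)) +
      frobInner (F.Ao₂ (w t)) (F.dA₂ (w t)) + frobInner (F.Bo₂ (w t)) (F.dB₂ (w t)))) (Ici 0) t :=
  ((((hw.norm_Ao₁_sq ht).add (hw.norm_Bo₁_sq ht)).add (hw.norm_Ao₂_sq ht)).add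
    (hw.norm_Bo₂_sq ht)).congr_deriv (by ring)

theorem size₂ : HasDerivWithinAt (fun s => size₂ (w s))
    (2 * (frobInner (w t).A₂ (F.dA₂ (w t)) + frobInner (w t).B₂ (F.dB₂ (w t)))) (Ici 0) t :=
  ((hw.A₂ t ht).norm_sq.add (hw.B₂ t ht).norm_sq).congr_deriv (by ring)

theorem norm_A₁_sq : HasDerivWithinAt (fun s => ‖(w s).A₁‖ ^ 2)
    (2 * frobInner (w t).A₁ (F.dA₁ (w t))) (Ici 0) t := (hw.A₁ t ht).norm_sq

/-- The growth of the product along `g vᵀ`. -/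
theorem p : HasDerivWithinAt (fun s => F.p (w s))
    (F.σ₂ * F.e (w t) * (‖F.a (w t)‖ ^ 2 + ‖F.b (w t)‖ ^ 2) +
      (frobInner (F.err_a (w t)) (F.b (w t)) + frobInner (F.a (w t)) (F.err_b (w t))))
    (Ici 0) t :=
  ((hw.a' ht).frobInner (hw.b' ht)).congr_deriv (by
    rw [frobInner_add_left, frobInner_add_right, frobInner_smul_left, frobInner_smul_right,
      frobInner_self, frobInner_self]
    ring)

theorem norm_a_sq_add_norm_b_sq : HasDerivWithinAt (fun s => ‖F.a (w s)‖ ^ 2 + ‖F.b (w s)‖ ^ 2)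
    (4 * (F.σ₂ * F.e (w t) * F.p (w t)) +
      2 * (frobInner (F.a (w t)) (F.err_a (w t)) + frobInner (F.b (w t)) (F.err_b (w t))))
    (Ici 0) t :=
  ((hw.a' ht).norm_sq.add (hw.b' ht).norm_sq).congr_deriv (by
    rw [frobInner_add_right, frobInner_add_right, frobInner_smul_right, frobInner_smul_right,
      frobInner_comm (F.b (w t)) (F.a (w t)), AlignedModel.p]
    ring)

theorem a_add_b : HasMatDeriv (fun s => F.a (w s) + F.b (w s))
    ((F.σ₂ * F.e (w t)) • (F.a (w t) + F.b (w t)) + (F.err_a (w t) + F.err_b (w t))) t :=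
  ((hw.a' ht).add (hw.b' ht)).congr_deriv (by rw [smul_add]; abel)

omit ht in
/-- The balance of the first pair of weights is conserved. -/
theorem balance₁ (hB : (w 0).B₁ = 0) (ht : 0 ≤ t) : (w t).A₁ * (w t).A₁ᵀ =
    (w t).B₁ᵀ * (w t).B₁ + (w 0).A₁ * (w 0).A₁ᵀ := by
  have hd : ∀ s, 0 ≤ s → HasMatDeriv (fun s => (w s).A₁ * (w s).A₁ᵀ - (w s).B₁ᵀ * (w s).B₁) 0 s := by
    intro s hs
    refine (((hw.A₁ s hs).mul (hw.A₁ s hs).transpose).sub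
      ((hw.B₁ s hs).transpose.mul (hw.B₁ s hs))).congr_deriv ?_
    simp only [dA₁, dB₁, transpose_mul, transpose_transpose, Matrix.mul_assoc]
    abel
  have key : ∀ i j, ((w t).A₁ * (w t).A₁ᵀ - (w t).B₁ᵀ * (w t).B₁) i j =
      ((w 0).A₁ * (w 0).A₁ᵀ - (w 0).B₁ᵀ * (w 0).B₁) i j := fun i j => le_antisymm
    (le_of_hasDerivWithinAt_nonpos le_rfl ht (fun s hs => hd s hs.1 i j) fun _ _ => le_rfl)
    (le_of_hasDerivWithinAt_nonneg le_rfl ht (fun s hs => hd s hs.1 i j) fun _ _ => le_rfl)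
  have := Matrix.ext key
  rw [hB] at this
  rw [← sub_eq_iff_eq_add', this]
  simp

omit ht in
/-- The balance of the second pair of weights is conserved. -/
theorem balance₂ (hB : (w 0).B₂ = 0) (ht : 0 ≤ t) : (w t).A₂ * (w t).A₂ᵀ =
    (w t).B₂ᵀ * (w t).B₂ + (w 0).A₂ * (w 0).A₂ᵀ := by
  have hd : ∀ s, 0 ≤ s → HasMatDeriv (fun s => (w s).A₂ * (w s).A₂ᵀ - (w s).B₂ᵀ * (w s).B₂) 0 s := by
    intro s hs
    refine (((hw.A₂ s hs).mul (hw.A₂ s hs).transpose).sub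
      ((hw.B₂ s hs).transpose.mul (hw.B₂ s hs))).congr_deriv ?_
    simp only [dA₂, dB₂, transpose_mul, transpose_transpose, Matrix.mul_assoc]
    abel
  have key : ∀ i j, ((w t).A₂ * (w t).A₂ᵀ - (w t).B₂ᵀ * (w t).B₂) i j =
      ((w 0).A₂ * (w 0).A₂ᵀ - (w 0).B₂ᵀ * (w 0).B₂) i j := fun i j => le_antisymm
    (le_of_hasDerivWithinAt_nonpos le_rfl ht (fun s hs => hd s hs.1 i j) fun _ _ => le_rfl)
    (le_of_hasDerivWithinAt_nonneg le_rfl ht (fun s hs => hd s hs.1 i j) fun _ _ => le_rfl)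
  have := Matrix.ext key
  rw [hB] at this
  rw [← sub_eq_iff_eq_add', this]
  simp

omit ht in
-- The residual norm does not increase along the flow, and it starts at `σ` because `B₁` and `B₂`
-- vanish initially.
theorem norm_E_le (hB₁ : (w 0).B₁ = 0) (hB₂ : (w 0).B₂ = 0) (hσ : 0 < F.σ) (ht : 0 ≤ t) :
    ‖F.E (w t)‖ ≤ F.σ := by
  have h1 := le_of_hasDerivWithinAt_nonpos le_rfl ht (fun s hs => hw.norm_E_sq hs.1) fun s _ => by
    nlinarith [F.decayForm_self_nonneg (w s) (F.E (w s))]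
  have h0 : F.E (w 0) = F.σ • (F.u * F.vᵀ) := by simp [AlignedModel.E, hB₁, hB₂]
  rw [h0, norm_smul, norm_col_mul_row, F.norm_u, F.norm_v, Real.norm_of_nonneg hσ.le] at h1
  exact le_of_sq_le_sq (by simpa using h1) hσ.le

end IsFlow

end AlignedModel

end Flow

/-! ### The alignment phase -/

section AlignmentPhase

open scoped Matrix.Norms.Frobenius

theorem exp_le_two_of_le_half {x : ℝ} (hx : x ≤ 1 / 2) : Real.exp x ≤ 2 := by
  have h1 : Real.exp x ≤ Real.exp (1 / 2) := Real.exp_le_exp.2 hx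
  have h2 : Real.exp (1 / 2) ^ 2 = Real.exp 1 := by
    rw [← Real.exp_nat_mul]
    norm_num
  nlinarith [Real.exp_one_lt_d9, Real.exp_pos (1 / 2 : ℝ)]

/-- Lets non-strict bounds known before a time pass to that time, as needed in the continuity
arguments. -/
theorem le_of_forall_Ico_le {f : ℝ → ℝ} {t c : ℝ} (ht : 0 < t)
    (hf : ContinuousWithinAt f (Ici 0) t) (h : ∀ s ∈ Ico 0 t, f s ≤ c) : f t ≤ c := by
  have h1 : t ∈ closure (Ico 0 t) := by
    rw [closure_Ico ht.ne]
    exact right_mem_Icc.2 ht.le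
  have h2 : ContinuousWithinAt f (Ico 0 t) t := hf.mono fun s hs => hs.1
  refine isClosed_Iic.closure_subset_iff.2 ?_ (h2.mem_closure_image h1)
  rintro _ ⟨s, hs, rfl⟩
  exact h s hs

namespace AlignedModel

variable {m n h r : ℕ}

/-- The threshold that ends the alignment phase. -/
noncomputable def thr (F : AlignedModel m n h) : ℝ := (1 - F.σ₁ / F.σ₂) * F.σ / (4 * F.σ₂)

/-- A bound for the squared norm of the first pair of weights. -/
noncomputable def sizeBound (F : AlignedModel m n h) : ℝ := 6 + 4 * F.σ / F.σ₂ + ‖F.W₁‖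

/-- A bound for all matrices of the problem. -/
noncomputable def bound (F : AlignedModel m n h) : ℝ :=
  1 + F.sizeBound + 1 + ‖F.W₁‖ + ‖F.W₂‖ + ‖F.R₁‖ + ‖F.R₂‖ + F.σ + F.σ₂

/-- The constant in the bound of the error terms of the alignment phase. -/
def errC (M K : ℝ) : ℝ := 90 * M ^ 3 * K ^ 4

/-- The constant in the bound of the second pair of weights. -/
noncomputable def sizeC (F : AlignedModel m n h) (M K : ℝ) : ℝ :=
  4 * M * K ^ 4 * Real.exp (4 * M / F.σ₂ + 1)

/-- The decay rate of the squared residual after the alignment phase. -/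
noncomputable def rate (F : AlignedModel m n h) : ℝ := F.σ₂ ^ 2 * F.thr / 2

/-- The growth factor of the second pair of weights after the alignment phase. -/
noncomputable def growC (F : AlignedModel m n h) (M : ℝ) : ℝ :=
  Real.exp (8 * M ^ 2 * F.σ / F.rate + 1)

/-- The standing assumptions: a gradient flow from an initialization of scale `α` whose shape is
controlled by `K`. The small parameter `κ` satisfies `κ² = α ^ (1 - σ₁ / σ₂)`, and `T` is the time
horizon. -/
structure Setting (F : AlignedModel m n h) (w : ℝ → LoRAWeights m n h r) (K M α κ T C : ℝ) :
    Prop where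
  flow : F.IsFlow w
  σ_pos : 0 < F.σ
  σ₂_pos : 0 < F.σ₂
  σ₁_nonneg : 0 ≤ F.σ₁
  σ₁_lt : F.σ₁ < F.σ₂
  one_le_K : 1 ≤ K
  α_pos : 0 < α
  κ_pos : 0 < κ
  T_nonneg : 0 ≤ T
  B₁_zero : (w 0).B₁ = 0
  B₂_zero : (w 0).B₂ = 0
  A₁_le : ‖(w 0).A₁‖ ≤ K * α
  A₂_le : ‖(w 0).A₂‖ ≤ K * α
  le_a : α / K ≤ ‖F.a (w 0)‖
  le_c : α / K ≤ ‖F.c (w 0)‖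
  bound_le : F.bound ≤ M
  α_le : α ≤ κ ^ 2
  κ_sq : κ ^ 2 = α ^ (1 - F.σ₁ / F.σ₂)
  small : C * κ * (1 + T) ≤ 1
  C_ge_off : 12 * M ^ 3 ≤ C
  C_ge_e : 4 * M / F.σ ≤ C
  C_ge_σ₂ : 2 / F.σ₂ ≤ C
  C_ge_K : 2 * K ≤ C
  C_ge_err : 8 * errC M K / (F.σ * F.σ₂) ≤ C
  C_ge_s : 16 * errC M K ≤ C
  C_ge_size : 4 * errC M K + 20 * M ^ 3 * K ≤ C
  C_ge_sizeC : 2 * F.sizeC M K ≤ C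
  C_ge_decay : 8 * M ^ 4 / (F.σ₂ ^ 2 * F.thr) ≤ C
  C_ge_thr : 2 * (2 * M + 32 * M ^ 6 * K / F.rate) / (F.σ₂ * F.thr) ≤ C
  C_ge_late : 128 * M ^ 8 * K / F.rate + 20 * M ^ 3 * K ≤ C
  C_ge_growC : 2 * (F.growC M * F.sizeC M K) ≤ C

/-- The bounds on the weights that hold throughout, in a form stable under limits. -/
structure Good (F : AlignedModel m n h) (κ : ℝ) (x : LoRAWeights m n h r) : Prop where
  size : size₂ x ≤ κ ^ 2
  norm_A₁ : ‖x.A₁‖ ^ 2 ≤ F.sizeBound + 1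

/-- The bounds that hold during the alignment phase. -/
structure Early (F : AlignedModel m n h) (κ s₀ : ℝ) (x : LoRAWeights m n h r) : Prop
    extends F.Good κ x where
  p : -(s₀ / 16) ≤ F.p x
  s : s₀ / 2 ≤ ‖F.a x‖ ^ 2 + ‖F.b x‖ ^ 2
  p_le : F.p x ≤ F.thr

namespace Setting

variable {F : AlignedModel m n h} {w : ℝ → LoRAWeights m n h r} {K M α κ T C : ℝ}
  (S : F.Setting w K M α κ T C)

include S

theorem sizeBound_pos : 0 < F.sizeBound := by
  have := S.σ_pos
  have := S.σ₂_pos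
  unfold sizeBound
  positivity

theorem bounds : 1 ≤ M ∧ F.sizeBound + 1 ≤ M ∧ ‖F.R₁‖ ≤ M ∧ ‖F.R₂‖ ≤ M ∧ F.σ ≤ M ∧ F.σ₂ ≤ M ∧
    ‖F.W₁‖ + (F.sizeBound + 1) ≤ M ∧ ‖F.W₂‖ + 1 ≤ M := by
  have h1 := S.bound_le
  have h2 := S.sizeBound_pos
  have h3 := S.σ_pos
  have h4 := S.σ₂_pos
  unfold bound at h1
  have h5 := norm_nonneg F.W₁
  have h6 := norm_nonneg F.W₂
  have h7 := norm_nonneg F.R₁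
  have h8 := norm_nonneg F.R₂
  refine ⟨?_, ?_, ?_, ?_, ?_, ?_, ?_, ?_⟩ <;> linarith

theorem one_le_M : 1 ≤ M := S.bounds.1

theorem C_pos : 0 < C := by
  have := S.one_le_M
  have : (0 : ℝ) < 12 * M ^ 3 := by positivity
  exact this.trans_le S.C_ge_off

/-- Every smallness condition below has the form `c * κ ≤ 1`; all are read off from the single
assumption `small`. -/
theorem mul_κ_le {c : ℝ} (hc : c ≤ C) : c * κ ≤ 1 := by
  have h0 := S.κ_pos
  have hC := S.C_pos
  have hT := S.T_nonneg
  have h1 : C * κ * 1 ≤ C * κ * (1 + T) := mul_le_mul_of_nonneg_left (by linarith) (by positivity)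
  have h2 := mul_le_mul_of_nonneg_right hc h0.le
  linarith [S.small]

/-- The version for errors that accumulate over time: `κ` beats the whole horizon. -/
theorem mul_κ_mul_le {c t : ℝ} (hc : c ≤ C) (ht : t ≤ T) (ht0 : 0 ≤ t) : c * κ * t ≤ 1 := by
  have h0 := S.κ_pos
  have hC := S.C_pos
  have hT := S.T_nonneg
  have h1 : C * κ * t ≤ C * κ * (1 + T) := mul_le_mul_of_nonneg_left (by linarith) (by positivity)
  have h2 := mul_le_mul_of_nonneg_right (mul_le_mul_of_nonneg_right hc h0.le) ht0
  linarith [S.small]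

theorem κ_le : κ ≤ 1 / 12 := by
  have h1 := S.mul_κ_le S.C_ge_off
  have h2 : 1 ≤ M ^ 3 := one_le_pow₀ S.one_le_M
  nlinarith [S.κ_pos]

theorem κ_le_one : κ ≤ 1 := S.κ_le.trans (by norm_num)

theorem Kκ_le : K * κ ≤ 1 / 2 := by
  have := S.mul_κ_le S.C_ge_K
  linarith

theorem α_le_κ : α ≤ κ := S.α_le.trans (by nlinarith [S.κ_pos, S.κ_le_one])

theorem α_le_one : α ≤ 1 := S.α_le_κ.trans S.κ_le_one

theorem Kα_le : K * α ≤ κ / 2 := by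
  have h1 : K * α ≤ K * κ ^ 2 := mul_le_mul_of_nonneg_left S.α_le (by linarith [S.one_le_K])
  nlinarith [S.Kκ_le, S.κ_pos]

theorem ratio_nonneg : 0 ≤ F.σ₁ / F.σ₂ := div_nonneg S.σ₁_nonneg S.σ₂_pos.le
theorem ratio_lt : F.σ₁ / F.σ₂ < 1 := (div_lt_one S.σ₂_pos).2 S.σ₁_lt

theorem thr_pos : 0 < F.thr := by
  have h1 := S.ratio_lt
  have h2 := S.σ_pos
  have h3 := S.σ₂_pos
  exact div_pos (mul_pos (by linarith) h2) (by linarith)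

/-- The threshold uses up at most a quarter of the residual `σ`, which leaves room for `half_le_e`.
-/
theorem thr_le : F.σ₂ * F.thr ≤ F.σ / 4 := by
  have h3 := S.σ₂_pos
  have h1 := S.ratio_nonneg
  have : F.σ₂ * F.thr = (1 - F.σ₁ / F.σ₂) * F.σ / 4 := by
    unfold thr
    field_simp
  rw [this]
  nlinarith [S.σ_pos]

/-- The two a priori bounds in `Good` control all matrices: conservation gives `‖B₁‖ ≤ ‖A₁‖`, and
the monotone residual gives the bound on `E`. -/
theorem bounded {t : ℝ} (ht : 0 ≤ t) (hg : F.Good κ (w t)) : F.Bounded (w t) M κ := by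
  obtain ⟨h1, h2, h3, h4, h5, h6, h7, h8⟩ := S.bounds
  have hs := hg.size
  unfold size₂ at hs
  have hA2 : ‖(w t).A₂‖ ≤ κ := le_of_sq_le_sq (by nlinarith [sq_nonneg ‖(w t).B₂‖]) S.κ_pos.le
  have hB2 : ‖(w t).B₂‖ ≤ κ := le_of_sq_le_sq (by nlinarith [sq_nonneg ‖(w t).A₂‖]) S.κ_pos.le
  have hB : ‖(w t).B₁‖ ≤ ‖(w t).A₁‖ := by
    refine le_of_sq_le_sq ?_ (norm_nonneg _)
    rw [norm_A₁_sq_of_balance (S.flow.balance₁ S.B₁_zero ht)]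
    nlinarith [sq_nonneg ‖(w 0).A₁‖]
  have hA : ‖(w t).A₁‖ ≤ M := le_of_sq_le_sq (by nlinarith [hg.norm_A₁]) (by linarith)
  refine ⟨h1, h3, h4, ?_, ?_, hA, hB.trans hA, (S.flow.norm_E_le S.B₁_zero S.B₂_zero S.σ_pos
    ht).trans h5, S.σ₂_pos.le, h6, hA2, hB2, S.κ_le_one⟩
  · refine (norm_add_le _ _).trans ((add_le_add le_rfl (fro_mul_le hB le_rfl)).trans ?_)
    nlinarith [hg.norm_A₁]
  · refine (norm_add_le _ _).trans ((add_le_add le_rfl (fro_mul_le hB2 hA2)).trans ?_)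
    nlinarith [S.κ_le_one, S.κ_pos]

theorem off_zero : F.off (w 0) ≤ 2 * (K * α) ^ 2 := by
  have h1 := pow_le_pow_left₀ (norm_nonneg _) ((F.norm_Ao₁_le (w 0)).trans S.A₁_le) 2
  have h2 := pow_le_pow_left₀ (norm_nonneg _) ((F.norm_Ao₂_le (w 0)).trans S.A₂_le) 2
  have h3 : F.Bo₁ (w 0) = 0 := by simp [Bo₁, b, S.B₁_zero]
  have h4 : F.Bo₂ (w 0) = 0 := by simp [Bo₂, y, S.B₂_zero]
  rw [off, h3, h4]
  simp only [norm_zero]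
  linarith

/-- The orthogonal components stay of order `α`. -/
theorem off_le {t : ℝ} (ht : 0 ≤ t) (htT : t ≤ T) (hg : ∀ s ∈ Ico 0 t, F.Good κ (w s)) :
    F.off (w t) ≤ (2 * K * α) ^ 2 := by
  have h1 := le_mul_exp_of_hasDerivWithinAt_le_const (c := 6 * M ^ 3 * κ) le_rfl ht
    (fun s hs => S.flow.off hs.1)
    fun s hs => (S.bounded hs.1.le (hg s ⟨hs.1.le, hs.2⟩)).off_velocity_le
  -- The growth exponent `6 M³ κ t` is at most 1/2, so `off` at most doubles; this is where the
  -- constant 12 is used.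
  have h2 := S.mul_κ_mul_le S.C_ge_off htT ht
  have h3 : Real.exp (6 * M ^ 3 * κ * (t - 0)) ≤ 2 := exp_le_two_of_le_half (by linarith)
  have h4 : F.off (w 0) * Real.exp (6 * M ^ 3 * κ * (t - 0)) ≤ 2 * (K * α) ^ 2 * 2 :=
    mul_le_mul S.off_zero h3 (Real.exp_pos _).le (by positivity)
  nlinarith

theorem sqrt_off_le {t : ℝ} (ht : 0 ≤ t) (htT : t ≤ T) (hg : ∀ s ∈ Ico 0 t, F.Good κ (w s)) :
    √(F.off (w t)) ≤ 2 * K * α :=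
  Real.sqrt_le_iff.2 ⟨by have := S.one_le_K; have := S.α_pos; positivity, S.off_le ht htT hg⟩

theorem abs_coupling_le {t : ℝ} (ht : 0 ≤ t) (hg : F.Good κ (w t)) :
    |frobInner (F.y (w t)) ((w t).A₂ * (F.X₁ (w t) * F.v))| ≤ κ ^ 2 * M := by
  have hb := S.bounded ht hg
  refine (abs_frobInner_le _ _).trans ?_
  have := mul_le_mul ((F.norm_y_le _).trans hb.B₂) (fro_mul_le hb.A₂ (fro_mul_le hb.X₁ F.norm_v.le))
    (norm_nonneg _) S.κ_pos.le
  linarith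

theorem κM_le : κ * M ≤ F.σ / 4 := by
  have h := S.mul_κ_le S.C_ge_e
  have hσ := S.σ_pos
  rw [div_mul_eq_mul_div, div_le_one hσ] at h
  linarith

theorem abs_e_le_σ {t : ℝ} (ht : 0 ≤ t) : |F.e (w t)| ≤ F.σ := by
  refine (abs_frobInner_le _ _).trans ?_
  simpa [F.norm_u] using fro_mul_le (S.flow.norm_E_le S.B₁_zero S.B₂_zero S.σ_pos ht) F.norm_v.le

/-- Below the threshold the first pair removes at most `σ / 4` from the residual, and the coupling
with the second pair at most another `σ / 4`. -/
theorem half_le_e {t : ℝ} (ht : 0 ≤ t) (hg : F.Good κ (w t)) (hp : F.p (w t) ≤ F.thr) :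
    F.σ / 2 ≤ F.e (w t) := by
  have h1 := abs_le.1 (S.abs_coupling_le ht hg)
  have h2 := S.thr_le
  have h3 := mul_le_mul_of_nonneg_left hp S.σ₂_pos.le
  have h4 : κ ^ 2 * M ≤ F.σ / 4 := by
    nlinarith [S.κM_le, S.κ_pos, S.κ_le_one, S.σ_pos]
  rw [e_eq]
  linarith [h1.1, h1.2]

/-- Turns additive errors into relative ones. As long as `(a, b)` keeps a fixed share of its initial
size, `α` is bounded by a multiple of `R`, and so is `√off`. -/
theorem norm_err_le {t : ℝ} (hb : F.Bounded (w t) M κ) (ho : F.off (w t) ≤ (2 * K * α) ^ 2)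
    {R : ℝ} (hR0 : 0 ≤ R) (hR : ‖F.a (w t)‖ ^ 2 + ‖F.b (w t)‖ ^ 2 = R ^ 2)
    (hα : ‖F.a (w 0)‖ ^ 2 / 2 ≤ ‖F.a (w t)‖ ^ 2 + ‖F.b (w t)‖ ^ 2) :
    ‖F.err_a (w t)‖ ≤ errC M K * κ ^ 2 * R ∧ ‖F.err_b (w t)‖ ≤ errC M K * κ ^ 2 * R := by
  have hK := S.one_le_K
  have hα0 := S.α_pos
  have hM := S.one_le_M
  have hκ := S.κ_pos
  have ha : ‖F.a (w t)‖ ≤ R := le_of_sq_le_sq (by nlinarith [sq_nonneg ‖F.b (w t)‖]) hR0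
  have hb' : ‖F.b (w t)‖ ≤ R := le_of_sq_le_sq (by nlinarith [sq_nonneg ‖F.a (w t)‖]) hR0
  have h1 : α ≤ 2 * K * R := by
    have h2 := pow_le_pow_left₀ (by positivity) S.le_a 2
    rw [div_pow, div_le_iff₀ (by positivity)] at h2
    refine le_of_sq_le_sq ?_ (by positivity)
    nlinarith [sq_nonneg (K * R)]
  have h3 : √(F.off (w t)) ≤ 4 * K ^ 2 * R := by
    refine (Real.sqrt_le_iff.2 ⟨by positivity, ho⟩).trans ?_
    nlinarith
  have hα2 : α ^ 2 ≤ κ ^ 2 := pow_le_pow_left₀ hα0.le S.α_le_κ 2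
  have h4 : F.off (w t) + κ ^ 2 ≤ 5 * K ^ 2 * κ ^ 2 := by
    have : 1 * κ ^ 2 ≤ K ^ 2 * κ ^ 2 :=
      mul_le_mul_of_nonneg_right (one_le_pow₀ hK) (by positivity)
    nlinarith [mul_le_mul_of_nonneg_left hα2 (sq_nonneg K)]
  have h5 : ‖F.a (w t)‖ + ‖F.b (w t)‖ + √(F.off (w t)) ≤ 6 * K ^ 2 * R := by
    have : 1 * R ≤ K ^ 2 * R := mul_le_mul_of_nonneg_right (one_le_pow₀ hK) hR0
    linarith
  have h6 : 3 * M ^ 3 * (F.off (w t) + κ ^ 2) * (‖F.a (w t)‖ + ‖F.b (w t)‖ + √(F.off (w t))) ≤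
      errC M K * κ ^ 2 * R := by
    calc _ ≤ 3 * M ^ 3 * (5 * K ^ 2 * κ ^ 2) * (6 * K ^ 2 * R) :=
          mul_le_mul (mul_le_mul_of_nonneg_left h4 (by positivity)) h5 (by positivity)
            (by positivity)
      _ = errC M K * κ ^ 2 * R := by unfold errC; ring
  refine ⟨hb.norm_err_a_le.trans (le_trans ?_ h6), hb.norm_err_b_le.trans h6⟩
  have := F.off_nonneg (w t)
  refine mul_le_mul_of_nonneg_right (mul_le_mul_of_nonneg_right ?_ (by positivity)) (by positivity)
  nlinarith [pow_pos (zero_lt_one.trans_le hM) 3]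

theorem errC_pos : 0 < errC M K := by
  have := S.one_le_M
  have := S.one_le_K
  unfold errC
  positivity

theorem errC_κ_sq_le : errC M K * κ ^ 2 ≤ F.σ * F.σ₂ / 8 := by
  have h := S.mul_κ_le S.C_ge_err
  have h1 : 0 < F.σ * F.σ₂ := mul_pos S.σ_pos S.σ₂_pos
  rw [div_mul_eq_mul_div, div_le_one h1] at h
  have h2 : κ ^ 2 ≤ κ := by nlinarith [S.κ_pos, S.κ_le_one]
  have h3 := mul_le_mul_of_nonneg_left h2 S.errC_pos.le
  linarith

/-- Bounds during the alignment phase, valid as soon as the weights are `Early` on `[0, t]`. -/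
theorem early_facts {t : ℝ} (htT : t ≤ T)
    (hE : ∀ s ∈ Icc 0 t, F.Early κ (‖F.a (w 0)‖ ^ 2) (w s)) {s : ℝ} (hs : s ∈ Icc 0 t) :
    F.Bounded (w s) M κ ∧ F.off (w s) ≤ (2 * K * α) ^ 2 ∧ F.σ / 2 ≤ F.e (w s) ∧
      F.e (w s) ≤ F.σ ∧
      ‖F.err_a (w s)‖ ≤ errC M K * κ ^ 2 * √(‖F.a (w s)‖ ^ 2 + ‖F.b (w s)‖ ^ 2) ∧
      ‖F.err_b (w s)‖ ≤ errC M K * κ ^ 2 * √(‖F.a (w s)‖ ^ 2 + ‖F.b (w s)‖ ^ 2) := by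
  have hb := S.bounded hs.1 (hE s hs).toGood
  have ho := S.off_le hs.1 (hs.2.trans htT) fun τ hτ => (hE τ ⟨hτ.1, hτ.2.le.trans hs.2⟩).toGood
  have herr := S.norm_err_le hb ho (Real.sqrt_nonneg _) (Real.sq_sqrt (by positivity)).symm
    (hE s hs).s
  exact ⟨hb, ho, S.half_le_e hs.1 (hE s hs).toGood (hE s hs).p_le,
    (le_abs_self _).trans (S.abs_e_le_σ hs.1), herr⟩

/-- `p` starts at zero, and its driving term `σ₂ e (‖a‖² + ‖b‖²)` dominates the errors, which are
relative to the same quantity. -/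
theorem p_nonneg {t : ℝ} (ht : 0 ≤ t) (htT : t ≤ T)
    (hE : ∀ s ∈ Icc 0 t, F.Early κ (‖F.a (w 0)‖ ^ 2) (w s)) : 0 ≤ F.p (w t) := by
  have h1 := le_of_hasDerivWithinAt_nonneg le_rfl ht (fun s hs => S.flow.p hs.1) fun s hs => by
    obtain ⟨-, -, he, -, ha, hb⟩ := S.early_facts htT hE ⟨hs.1.le, hs.2.le⟩
    set R := √(‖F.a (w s)‖ ^ 2 + ‖F.b (w s)‖ ^ 2) with hR
    have hR0 : 0 ≤ R := Real.sqrt_nonneg _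
    have hRR : ‖F.a (w s)‖ ^ 2 + ‖F.b (w s)‖ ^ 2 = R ^ 2 := (Real.sq_sqrt (by positivity)).symm
    have haR : ‖F.a (w s)‖ ≤ R := le_of_sq_le_sq (by nlinarith [sq_nonneg ‖F.b (w s)‖]) hR0
    have hbR : ‖F.b (w s)‖ ≤ R := le_of_sq_le_sq (by nlinarith [sq_nonneg ‖F.a (w s)‖]) hR0
    have h1 := neg_le_frobInner (F.err_a (w s)) (F.b (w s))
    have h2 := neg_le_frobInner (F.a (w s)) (F.err_b (w s))
    have h3 := mul_le_mul ha hbR (norm_nonneg _) ((norm_nonneg _).trans ha)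
    have h4 := mul_le_mul haR hb (norm_nonneg _) hR0
    have h5 := mul_le_mul_of_nonneg_right S.errC_κ_sq_le (sq_nonneg R)
    have h6 : F.σ₂ * (F.σ / 2) * R ^ 2 ≤ F.σ₂ * F.e (w s) * R ^ 2 :=
      mul_le_mul_of_nonneg_right (mul_le_mul_of_nonneg_left he S.σ₂_pos.le) (sq_nonneg R)
    rw [hRR]
    nlinarith [mul_pos S.σ_pos S.σ₂_pos, sq_nonneg R]
  have h0 : F.p (w 0) = 0 := by simp [AlignedModel.p, b, S.B₁_zero, frobInner_zero_right]
  linarith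

/-- With `p ≥ 0` only the errors can make `‖a‖² + ‖b‖²` shrink, and over the horizon they cost at
most a quarter. This improves the share 1/2 assumed in `Early`. -/
theorem le_s {t : ℝ} (ht : 0 ≤ t) (htT : t ≤ T)
    (hE : ∀ s ∈ Icc 0 t, F.Early κ (‖F.a (w 0)‖ ^ 2) (w s)) :
    3 / 4 * ‖F.a (w 0)‖ ^ 2 ≤ ‖F.a (w t)‖ ^ 2 + ‖F.b (w t)‖ ^ 2 := by
  have h1 := mul_exp_le_of_le_hasDerivWithinAt_const (c := -(4 * errC M K * κ ^ 2)) le_rfl ht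
    (fun s hs => S.flow.norm_a_sq_add_norm_b_sq hs.1) fun s hs => by
      obtain ⟨-, -, he, -, ha, hb⟩ := S.early_facts htT hE ⟨hs.1.le, hs.2.le⟩
      have hp := S.p_nonneg hs.1.le (hs.2.le.trans htT) fun τ hτ => hE τ ⟨hτ.1, hτ.2.trans hs.2.le⟩
      set R := √(‖F.a (w s)‖ ^ 2 + ‖F.b (w s)‖ ^ 2) with hR
      have hR0 : 0 ≤ R := Real.sqrt_nonneg _
      have hRR : ‖F.a (w s)‖ ^ 2 + ‖F.b (w s)‖ ^ 2 = R ^ 2 := (Real.sq_sqrt (by positivity)).symm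
      have haR : ‖F.a (w s)‖ ≤ R := le_of_sq_le_sq (by nlinarith [sq_nonneg ‖F.b (w s)‖]) hR0
      have hbR : ‖F.b (w s)‖ ≤ R := le_of_sq_le_sq (by nlinarith [sq_nonneg ‖F.a (w s)‖]) hR0
      have h1 := neg_le_frobInner (F.a (w s)) (F.err_a (w s))
      have h2 := neg_le_frobInner (F.b (w s)) (F.err_b (w s))
      have h3 := mul_le_mul haR ha (norm_nonneg _) hR0
      have h4 := mul_le_mul hbR hb (norm_nonneg _) hR0
      have h6 : 0 ≤ F.σ₂ * F.e (w s) * F.p (w s) :=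
        mul_nonneg (mul_nonneg S.σ₂_pos.le (by linarith [S.σ_pos])) hp
      rw [hRR]
      nlinarith
  have h2 := S.mul_κ_mul_le S.C_ge_s htT ht
  have h3 := Real.add_one_le_exp (-(4 * errC M K * κ ^ 2) * (t - 0))
  have hκ2 : κ ^ 2 ≤ κ := by nlinarith [S.κ_pos, S.κ_le_one]
  have h4 : errC M K * κ ^ 2 * t ≤ errC M K * κ * t :=
    mul_le_mul_of_nonneg_right (mul_le_mul_of_nonneg_left hκ2 S.errC_pos.le) ht
  have h0 : F.b (w 0) = 0 := by simp [b, S.B₁_zero]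
  rw [h0, norm_zero] at h1
  have h5 : 3 / 4 ≤ Real.exp (-(4 * errC M K * κ ^ 2) * (t - 0)) := by linarith
  nlinarith [sq_nonneg ‖F.a (w 0)‖]

/-- The growth of `‖a + b‖²`. -/
theorem q_velocity {t : ℝ} (htT : t ≤ T)
    (hE : ∀ s ∈ Icc 0 t, F.Early κ (‖F.a (w 0)‖ ^ 2) (w s)) {s : ℝ} (hs : s ∈ Icc 0 t) :
    ∃ η, HasDerivWithinAt (fun s => ‖F.a (w s) + F.b (w s)‖ ^ 2)
      (2 * (F.σ₂ * F.e (w s)) * ‖F.a (w s) + F.b (w s)‖ ^ 2 + η) (Ici 0) s ∧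
      |η| ≤ 4 * errC M K * κ ^ 2 * ‖F.a (w s) + F.b (w s)‖ ^ 2 := by
  obtain ⟨-, -, he, -, ha, hb⟩ := S.early_facts htT hE hs
  have hp := S.p_nonneg hs.1 (hs.2.trans htT) fun τ hτ => hE τ ⟨hτ.1, hτ.2.trans hs.2⟩
  refine ⟨2 * frobInner (F.a (w s) + F.b (w s)) (F.err_a (w s) + F.err_b (w s)),
    (S.flow.a_add_b hs.1).norm_sq.congr_deriv ?_, ?_⟩
  · rw [frobInner_add_right, frobInner_smul_right, frobInner_self]
    ring
  -- Because `p ≥ 0`, the sum `a + b` dominates `(a, b)`, and the errors are also small relative to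
  -- `a + b`.
  · have hR : √(‖F.a (w s)‖ ^ 2 + ‖F.b (w s)‖ ^ 2) ≤ ‖F.a (w s) + F.b (w s)‖ := by
      refine Real.sqrt_le_iff.2 ⟨norm_nonneg _, ?_⟩
      rw [norm_add_sq_frob, ← AlignedModel.p]
      linarith
    have h1 := abs_frobInner_le (F.a (w s) + F.b (w s)) (F.err_a (w s) + F.err_b (w s))
    have h2 : ‖F.err_a (w s) + F.err_b (w s)‖ ≤
        2 * (errC M K * κ ^ 2 * ‖F.a (w s) + F.b (w s)‖) := by
      refine (norm_add_le _ _).trans ?_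
      have := mul_le_mul_of_nonneg_left hR (mul_nonneg S.errC_pos.le (sq_nonneg κ))
      linarith
    have h3 := mul_le_mul_of_nonneg_left h2 (norm_nonneg (F.a (w s) + F.b (w s)))
    rw [abs_mul, abs_two]
    nlinarith

theorem q_zero : ‖F.a (w 0) + F.b (w 0)‖ = ‖F.a (w 0)‖ := by
  have h0 : F.b (w 0) = 0 := by simp [b, S.B₁_zero]
  rw [h0, add_zero]

theorem norm_a_zero_pos : 0 < ‖F.a (w 0)‖ :=
  (div_pos S.α_pos (zero_lt_one.trans_le S.one_le_K)).trans_le S.le_a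

theorem q_pos {t : ℝ} (ht : 0 ≤ t) (htT : t ≤ T)
    (hE : ∀ s ∈ Icc 0 t, F.Early κ (‖F.a (w 0)‖ ^ 2) (w s)) :
    0 < ‖F.a (w t) + F.b (w t)‖ ^ 2 := by
  have h1 := S.p_nonneg ht htT hE
  have h2 := S.le_s ht htT hE
  rw [norm_add_sq_frob, ← AlignedModel.p]
  nlinarith [pow_pos S.norm_a_zero_pos 2]

theorem q_le {t : ℝ} (ht : 0 ≤ t) (hg : F.Good κ (w t)) :
    ‖F.a (w t) + F.b (w t)‖ ^ 2 ≤ 4 * M := by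
  have hB : ‖(w t).B₁‖ ^ 2 ≤ ‖(w t).A₁‖ ^ 2 := by
    rw [norm_A₁_sq_of_balance (S.flow.balance₁ S.B₁_zero ht)]
    nlinarith [sq_nonneg ‖(w 0).A₁‖]
  have h1 := pow_le_pow_left₀ (norm_nonneg _) (F.norm_a_le (w t)) 2
  have h2 := pow_le_pow_left₀ (norm_nonneg _) (F.norm_b_le (w t)) 2
  have h3 := hg.norm_A₁
  have h4 := S.bounds.2.1
  rw [norm_add_sq_frob]
  have h5 := frobInner_le (F.a (w t)) (F.b (w t))
  nlinarith [sq_nonneg (‖F.a (w t)‖ - ‖F.b (w t)‖)]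

/-- The growth of `‖a + b‖²` is exponential. -/
theorem le_q_velocity {e q η : ℝ} (he : F.σ / 2 ≤ e) (hq : 0 ≤ q)
    (hη : |η| ≤ 4 * errC M K * κ ^ 2 * q) :
    F.σ * F.σ₂ / 2 * q ≤ 2 * (F.σ₂ * e) * q + η := by
  have h1 := (abs_le.1 hη).1
  have h2 := mul_le_mul_of_nonneg_right S.errC_κ_sq_le hq
  have h3 : F.σ₂ * (F.σ / 2) * q ≤ F.σ₂ * e * q :=
    mul_le_mul_of_nonneg_right (mul_le_mul_of_nonneg_left he S.σ₂_pos.le) hq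
  nlinarith

/-- The second pair of weights stays much smaller than the first one. -/
theorem size_le {t : ℝ} (ht : 0 ≤ t) (htT : t ≤ T)
    (hE : ∀ s ∈ Icc 0 t, F.Early κ (‖F.a (w 0)‖ ^ 2) (w s)) :
    size₂ (w t) ≤ F.sizeC M K * κ ^ 4 := by
  have hK := S.one_le_K
  have hM := S.one_le_M
  have hα := S.α_pos
  have hσ₂ := S.σ₂_pos
  have hδ0 := S.ratio_nonneg
  have hδ1 := S.ratio_lt
  set δ := F.σ₁ / F.σ₂ with hδ
  choose! η hη using fun s (hs : s ∈ Icc 0 t) => S.q_velocity htT hE hs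
  set q : ℝ → ℝ := fun s => ‖F.a (w s) + F.b (w s)‖ ^ 2 with hq
  have hqpos : ∀ s ∈ Icc 0 t, 0 < q s := fun s hs =>
    S.q_pos hs.1 (hs.2.trans htT) fun τ hτ => hE τ ⟨hτ.1, hτ.2.trans hs.2⟩
  set q' : ℝ → ℝ := fun s => 2 * (F.σ₂ * F.e (w s)) * q s + η s with hq'
  set c' := 4 * errC M K + 20 * M ^ 3 * K with hc'
  -- The growth rate of the second pair is `2 e (σ₁ + p)` plus errors. The term `δ log q` pays for
  -- `2 e σ₁`, because `q` grows at rate about `2 σ₂ e`; the term `q / σ₂` pays for `2 e p`, because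
  -- `4 p ≤ q` and `q' ≥ σ σ₂ q / 2`; the linear term pays for the errors.
  have hμ : ∀ s ∈ Icc 0 t, HasDerivWithinAt (fun s => δ * Real.log (q s) + q s / F.σ₂ + c' * κ ^ 2 * s)
      (δ * (q' s / q s) + q' s / F.σ₂ + c' * κ ^ 2) (Ici 0) s := fun s hs =>
    ((((hη s hs).1.log (hqpos s hs).ne').const_mul δ).add ((hη s hs).1.div_const F.σ₂)).add
      (by simpa using (hasDerivWithinAt_id s (Ici 0)).const_mul (c' * κ ^ 2))
  have h1 := le_mul_exp_of_hasDerivWithinAt_le le_rfl ht (fun s hs => S.flow.size₂ hs.1) hμ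
    fun s hs => by
      have hs' : s ∈ Icc 0 t := ⟨hs.1.le, hs.2.le⟩
      obtain ⟨hb, ho, he, heσ, -, -⟩ := S.early_facts htT hE hs'
      have hp := S.p_nonneg hs.1.le (hs.2.le.trans htT) fun τ hτ => hE τ ⟨hτ.1, hτ.2.trans hs.2.le⟩
      refine (hb.size_velocity_le rfl).trans (mul_le_mul_of_nonneg_right ?_ ?_)
      · have he0 : 0 ≤ F.e (w s) := by linarith [S.σ_pos]
        rw [abs_of_nonneg (mul_nonneg he0 (add_nonneg S.σ₁_nonneg hp))]
        have hqs := hqpos s hs'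
        have hso : √(F.off (w s)) ≤ 2 * K * κ ^ 2 := by
          refine (Real.sqrt_le_iff.2 ⟨by positivity, ho⟩).trans ?_
          exact mul_le_mul_of_nonneg_left S.α_le (by positivity)
        have k1 : 10 * M ^ 3 * √(F.off (w s)) ≤ 20 * M ^ 3 * K * κ ^ 2 := by
          have := mul_le_mul_of_nonneg_left hso (show 0 ≤ 10 * M ^ 3 by positivity)
          linarith
        have k2 : 2 * F.e (w s) * F.σ₁ - 4 * errC M K * κ ^ 2 ≤ δ * (q' s / q s) := by
          have e1 : q' s / q s = 2 * (F.σ₂ * F.e (w s)) + η s / q s := by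
            simp only [hq']
            field_simp
          have e2 : -(4 * errC M K * κ ^ 2) ≤ η s / q s := by
            rw [le_div_iff₀ hqs]
            have := (abs_le.1 (hη s hs').2).1
            linarith
          have e3 : δ * F.σ₂ = F.σ₁ := div_mul_cancel₀ _ hσ₂.ne'
          have e4 : -(4 * errC M K * κ ^ 2) ≤ δ * (η s / q s) := by
            have := S.errC_pos
            have hp4 : 0 ≤ 4 * errC M K * κ ^ 2 := by positivity
            nlinarith
          rw [e1, mul_add]
          have e5 : δ * (2 * (F.σ₂ * F.e (w s))) = 2 * F.e (w s) * F.σ₁ := by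
            rw [← e3]
            ring
          linarith
        have k3 : 2 * F.e (w s) * F.p (w s) ≤ q' s / F.σ₂ := by
          have e1 := S.le_q_velocity he hqs.le (hη s hs').2
          have e2 : 4 * F.p (w s) ≤ q s := by
            have := norm_sub_sq_frob (F.a (w s)) (F.b (w s))
            have h3 := sq_nonneg ‖F.a (w s) - F.b (w s)‖
            simp only [hq]
            rw [norm_add_sq_frob, ← AlignedModel.p]
            rw [← AlignedModel.p] at this
            linarith
          rw [le_div_iff₀ hσ₂]
          have e3 : F.e (w s) * F.p (w s) ≤ F.σ * (q s / 4) :=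
            mul_le_mul heσ (by linarith) hp S.σ_pos.le
          have e4 := mul_le_mul_of_nonneg_right e3 hσ₂.le
          simp only [hq']
          linarith
        linarith
      · positivity
  have hqt : q t ≤ 4 * M := S.q_le ht (hE t ⟨ht, le_rfl⟩).toGood
  have hq0 : (α / K) ^ 2 ≤ q 0 := by
    simp only [hq]
    rw [S.q_zero]
    exact pow_le_pow_left₀ (by positivity) S.le_a 2
  have hq0' : 0 < q 0 := hqpos 0 ⟨le_rfl, ht⟩
  have hqt' : 0 < q t := hqpos t ⟨ht, le_rfl⟩
  have hs0 : size₂ (w 0) ≤ (K * α) ^ 2 := by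
    have := pow_le_pow_left₀ (norm_nonneg _) S.A₂_le 2
    rw [AlignedModel.size₂, S.B₂_zero]
    simpa using this
  have hc't : c' * κ ^ 2 * t ≤ 1 := by
    have h2 := S.mul_κ_mul_le S.C_ge_size htT ht
    have hκ2 : κ ^ 2 ≤ κ := by nlinarith [S.κ_pos, S.κ_le_one]
    have hc0 : 0 ≤ c' := by
      have := S.errC_pos
      positivity
    exact (mul_le_mul_of_nonneg_right (mul_le_mul_of_nonneg_left hκ2 hc0) ht).trans h2
  -- The quantity `q` rises from at least `(α / K)²` to at most `4 M`, and `δ` times the difference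
  -- of logarithms produces `α ^ (-2δ)`.
  have hexp : Real.exp (δ * Real.log (q t) + q t / F.σ₂ + c' * κ ^ 2 * t -
      (δ * Real.log (q 0) + q 0 / F.σ₂ + c' * κ ^ 2 * 0)) ≤
      (4 * M * K ^ 2) * (α ^ (-(2 * δ))) * Real.exp (4 * M / F.σ₂ + 1) := by
    have e1 : δ * Real.log (q t) + q t / F.σ₂ + c' * κ ^ 2 * t -
      (δ * Real.log (q 0) + q 0 / F.σ₂ + c' * κ ^ 2 * 0) ≤ δ * (Real.log (4 * M * K ^ 2) -
        2 * Real.log α) + (4 * M / F.σ₂ + 1) := by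
      have l1 : Real.log (q t) ≤ Real.log (4 * M) := Real.log_le_log hqt' hqt
      have l2 : Real.log ((α / K) ^ 2) ≤ Real.log (q 0) := Real.log_le_log (by positivity) hq0
      rw [Real.log_pow, Real.log_div hα.ne' (by positivity)] at l2
      have l3 : Real.log (4 * M * K ^ 2) = Real.log (4 * M) + 2 * Real.log K := by
        rw [Real.log_mul (by positivity) (by positivity), Real.log_pow]
        norm_num
      have l4 : Real.log (q t) - Real.log (q 0) ≤ Real.log (4 * M * K ^ 2) - 2 * Real.log α := by
        push_cast at l2
        linarith
      have l5 := mul_le_mul_of_nonneg_left l4 hδ0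
      have l6 : q t / F.σ₂ ≤ 4 * M / F.σ₂ := by gcongr
      have l7 : 0 ≤ q 0 / F.σ₂ := by positivity
      linarith
    refine (Real.exp_le_exp.2 e1).trans ?_
    rw [Real.exp_add]
    refine mul_le_mul_of_nonneg_right ?_ (Real.exp_pos _).le
    rw [mul_sub, Real.exp_sub, div_eq_mul_inv, ← Real.exp_neg]
    refine mul_le_mul ?_ ?_ (Real.exp_pos _).le (by positivity)
    · have hlog : 0 ≤ Real.log (4 * M * K ^ 2) := Real.log_nonneg (by nlinarith [one_le_pow₀ hK (n := 2)])
      refine (Real.exp_le_exp.2 (mul_le_of_le_one_left hlog hδ1.le)).trans_eq ?_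
      rw [Real.exp_log (by positivity)]
    · rw [Real.rpow_def_of_pos hα]
      exact (Real.exp_le_exp.2 (by linarith))
  refine h1.trans ((mul_le_mul hs0 hexp (Real.exp_pos _).le (by positivity)).trans_eq ?_)
  -- Initial squared size of order `α²` times growth `α ^ (-2δ)`: this identity is the reason for
  -- the choice of `κ`.
  have hκ4 : κ ^ 4 = α ^ 2 * α ^ (-(2 * δ)) := by
    have : κ ^ 4 = (κ ^ 2) ^ 2 := by ring
    rw [this, S.κ_sq, ← Real.rpow_natCast (α ^ (1 - δ)), ← Real.rpow_mul hα.le,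
      ← Real.rpow_natCast α, ← Real.rpow_add hα]
    congr 1
    push_cast
    ring
  rw [hκ4, sizeC]
  ring

/-- The bound just derived is strictly better than the one assumed in `Good`, which closes the
bootstrap. -/
theorem sizeC_κ_sq_lt : F.sizeC M K * κ ^ 4 < κ ^ 2 := by
  have h := S.mul_κ_le S.C_ge_sizeC
  have hκ := S.κ_pos
  have h1 : F.sizeC M K * κ ^ 2 ≤ 1 / 2 * κ := by nlinarith
  have h2 : F.sizeC M K * κ ^ 2 < 1 := by linarith [S.κ_le]
  nlinarith [pow_pos hκ 2]

/-- Likewise removes the slack `+ 1` from the bound on `A₁` assumed in `Good`. -/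
theorem norm_A₁_sq_le {t : ℝ} (ht : 0 ≤ t) (htT : t ≤ T) (hg : ∀ s ∈ Icc 0 t, F.Good κ (w s)) :
    ‖(w t).A₁‖ ^ 2 ≤ F.sizeBound := by
  have hb := S.bounded ht (hg t ⟨ht, le_rfl⟩)
  have ho := S.off_le ht htT fun s hs => hg s ⟨hs.1, hs.2.le⟩
  have hKα := S.Kα_le
  have hK := S.one_le_K
  have hα := S.α_pos
  have hKα0 : 0 < K * α := by positivity
  have hκ1 := S.κ_le_one
  refine norm_A₁_sq_le_of_balance (S.flow.balance₁ S.B₁_zero ht) rfl S.σ₂_pos S.σ_pos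
    (S.flow.norm_E_le S.B₁_zero S.B₂_zero S.σ_pos ht) ?_ ?_ hb.A₂ hb.B₂ ?_
  · nlinarith
  · exact (pow_le_one₀ (norm_nonneg _) (S.A₁_le.trans (by linarith)))
  · have h := S.mul_κ_le S.C_ge_σ₂
    rw [div_mul_eq_mul_div, div_le_one S.σ₂_pos] at h
    nlinarith [S.κ_pos]

/-- As long as the threshold is not exceeded, the weights are `Early`. -/
theorem early {T' : ℝ} (hT' : T' ≤ T) (hthr : ∀ s ∈ Ico 0 T', F.p (w s) ≤ F.thr) :
    ∀ t ∈ Icc 0 T', F.Early κ (‖F.a (w 0)‖ ^ 2) (w t) := by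
  have hs0 := S.norm_a_zero_pos
  have hc : ∀ {f f' : ℝ → ℝ}, (∀ t, 0 ≤ t → HasDerivWithinAt f (f' t) (Ici 0) t) →
      ContinuousOn f (Icc 0 T') := fun hf t ht =>
    (hf t ht.1).continuousWithinAt.mono fun s hs => hs.1
  -- The strict form of the assumptions, which is open. If it holds before `t`, the non-strict form
  -- holds up to `t` by continuity, and the improved estimates restore strictness at `t`. The upper
  -- bound on `p` is not part of it: it comes from `hthr`.
  let P : ℝ → Prop := fun t => ((size₂ (w t) < κ ^ 2 ∧ ‖(w t).A₁‖ ^ 2 < F.sizeBound + 1) ∧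
    (-F.p (w t) < ‖F.a (w 0)‖ ^ 2 / 16 ∧
      -(‖F.a (w t)‖ ^ 2 + ‖F.b (w t)‖ ^ 2) < -(‖F.a (w 0)‖ ^ 2 / 2)))
  have hthr' : ∀ s ∈ Icc 0 T', 0 < s → F.p (w s) ≤ F.thr := fun s hs hs0 =>
    le_of_forall_Ico_le hs0 (S.flow.p hs.1).continuousWithinAt fun τ hτ =>
      hthr τ ⟨hτ.1, hτ.2.trans_le hs.2⟩
  have hp0 : F.p (w 0) = 0 := by simp [AlignedModel.p, b, S.B₁_zero, frobInner_zero_right]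
  have hthr'' : ∀ s ∈ Icc 0 T', F.p (w s) ≤ F.thr := fun s hs => by
    rcases hs.1.eq_or_lt with h | h
    · rw [← h, hp0]
      exact S.thr_pos.le
    · exact hthr' s hs h
  have hP : ∀ t ∈ Icc 0 T', P t := by
    refine forall_Icc_of_forall_Ico (isClosed_not_and
      (isClosed_not_and (isClosed_not_lt (hc fun t ht => S.flow.size₂ ht))
        (isClosed_not_lt (hc fun t ht => S.flow.norm_A₁_sq ht)))
      (isClosed_not_and (isClosed_not_lt (hc fun t ht => (S.flow.p ht).neg))
        (isClosed_not_lt (hc fun t ht => (S.flow.norm_a_sq_add_norm_b_sq ht).neg)))) ?_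
    intro t ht hPt
    have hEarly : ∀ s ∈ Icc 0 t, F.Early κ (‖F.a (w 0)‖ ^ 2) (w s) := by
      have hb : F.b (w 0) = 0 := by simp [b, S.B₁_zero]
      intro s hs
      have hsT : s ∈ Icc 0 T' := ⟨hs.1, hs.2.trans ht.2⟩
      -- At time 0 there are no earlier times to pass to the limit from, so the initialization is
      -- checked directly.
      rcases hs.1.eq_or_lt with h | h
      · subst h
        have hKα := S.Kα_le
        have hKα0 : 0 < K * α := mul_pos (by linarith [S.one_le_K]) S.α_pos
        have h1 := pow_le_pow_left₀ (norm_nonneg _) S.A₂_le 2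
        have h2 := pow_le_pow_left₀ (norm_nonneg _) S.A₁_le 2
        refine ⟨⟨?_, ?_⟩, ?_, ?_, hthr'' 0 hsT⟩
        · rw [AlignedModel.size₂, S.B₂_zero]
          simp only [norm_zero]
          nlinarith
        · nlinarith [S.κ_le_one, S.sizeBound_pos]
        · rw [hp0]
          nlinarith
        · rw [hb, norm_zero]
          nlinarith
      · have hcl : ∀ {f : ℝ → ℝ} {f' c : ℝ}, HasDerivWithinAt f f' (Ici 0) s →
            (∀ τ ∈ Ico 0 t, f τ < c) → f s ≤ c := fun hf hτ =>
          le_of_forall_Ico_le h hf.continuousWithinAt fun τ hτ' =>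
            (hτ τ ⟨hτ'.1, hτ'.2.trans_le hs.2⟩).le
        refine ⟨⟨?_, ?_⟩, ?_, ?_, hthr'' s hsT⟩
        · exact hcl (S.flow.size₂ hs.1) fun τ hτ => (hPt τ hτ).1.1
        · exact hcl (S.flow.norm_A₁_sq hs.1) fun τ hτ => (hPt τ hτ).1.2
        · exact neg_le.1 (hcl (S.flow.p hs.1).neg fun τ hτ => (hPt τ hτ).2.1)
        · exact neg_le_neg_iff.1 (hcl (S.flow.norm_a_sq_add_norm_b_sq hs.1).neg
            fun τ hτ => (hPt τ hτ).2.2)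
    have htT : t ≤ T := ht.2.trans hT'
    have h1 := S.size_le ht.1 htT hEarly
    have h2 := S.norm_A₁_sq_le ht.1 htT fun s hs => (hEarly s hs).toGood
    have h3 := S.p_nonneg ht.1 htT hEarly
    have h4 := S.le_s ht.1 htT hEarly
    have h5 := pow_pos hs0 2
    exact ⟨⟨h1.trans_lt S.sizeC_κ_sq_lt, by linarith⟩, by linarith, by linarith⟩
  intro t ht
  have := hP t ht
  exact ⟨⟨this.1.1.le, this.1.2.le⟩, by linarith [this.2.1], by linarith [this.2.2], hthr'' t ht⟩

/-- The alignment phase ends. -/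
theorem exists_alignmentTime (hT : 6 * Real.log (1 / α) / (F.σ * F.σ₂) ≤ T)
    (hα : 4 * M * K ^ 2 * α < 1) :
    ∃ T₁ ∈ Icc 0 (6 * Real.log (1 / α) / (F.σ * F.σ₂)),
      IsLeast {t : ℝ | 0 ≤ t ∧ F.thr ≤ F.p (w t)} T₁ ∧ ∀ s ∈ Ico 0 T₁, F.p (w s) ≤ F.thr := by
  have hα0 := S.α_pos
  have hσσ : 0 < F.σ * F.σ₂ := mul_pos S.σ_pos S.σ₂_pos
  have hM := S.one_le_M
  have hK := S.one_le_K
  set Tm := 6 * Real.log (1 / α) / (F.σ * F.σ₂) with hTm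
  have hTm0 : 0 ≤ Tm := by
    have : 0 ≤ Real.log (1 / α) := Real.log_nonneg ((one_le_div hα0).2 S.α_le_one)
    positivity
  have hex : ∃ t ∈ Icc 0 Tm, F.thr ≤ F.p (w t) := by
    -- If the threshold were never reached, the weights would stay `Early` and `‖a + b‖²` would grow
    -- exponentially beyond its bound `4 M`.
    by_contra! hcon
    have hE := S.early hT fun s hs => (hcon s ⟨hs.1, hs.2.le⟩).le
    choose! η hη using fun s (hs : s ∈ Icc 0 Tm) => S.q_velocity hT hE hs
    have h1 := mul_exp_le_of_le_hasDerivWithinAt_const (c := F.σ * F.σ₂ / 2) le_rfl hTm0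
      (fun s hs => (hη s hs).1) fun s hs => by
        have hs' : s ∈ Icc 0 Tm := ⟨hs.1.le, hs.2.le⟩
        exact S.le_q_velocity (S.early_facts hT hE hs').2.2.1 (sq_nonneg _) (hη s hs').2
    have h2 := S.q_le hTm0 (hE Tm ⟨hTm0, le_rfl⟩).toGood
    -- The constant 6 times the rate `σ σ₂ / 2` gives a growth factor `α⁻³`, which overcomes the
    -- initial value of order `α²` with one power of `α` to spare.
    have h3 : F.σ * F.σ₂ / 2 * (Tm - 0) = (3 : ℕ) * Real.log (1 / α) := by
      have : F.σ * F.σ₂ * Tm = 6 * Real.log (1 / α) := by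
        rw [hTm, mul_div_cancel₀ _ hσσ.ne']
      push_cast
      linarith
    rw [h3, Real.exp_nat_mul, Real.exp_log (by positivity), S.q_zero] at h1
    have h4 := pow_le_pow_left₀ (by positivity) S.le_a 2
    have h5 : (α / K) ^ 2 * (1 / α) ^ 3 ≤ 4 * M :=
      (mul_le_mul_of_nonneg_right h4 (by positivity)).trans (h1.trans h2)
    have h6 : (α / K) ^ 2 * (1 / α) ^ 3 = 1 / (K ^ 2 * α) := by field_simp
    rw [h6, div_le_iff₀ (by positivity)] at h5
    linarith
  have hclosed : IsClosed {t | t ∈ Icc 0 Tm ∧ F.thr ≤ F.p (w t)} :=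
    ContinuousOn.preimage_isClosed_of_isClosed
      (fun t ht => (S.flow.p ht.1).continuousWithinAt.mono fun s hs => hs.1) isClosed_Icc
      isClosed_Ici
  have hcomp : IsCompact {t | t ∈ Icc 0 Tm ∧ F.thr ≤ F.p (w t)} :=
    isCompact_Icc.of_isClosed_subset hclosed fun s hs => hs.1
  obtain ⟨t, ht⟩ := hex
  obtain ⟨T₁, hT₁, hmin⟩ := hcomp.exists_isLeast ⟨t, ht⟩
  have hleast : ∀ s, 0 ≤ s → s < T₁ → F.p (w s) < F.thr := fun s hs hsT => by
    by_contra! hcon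
    exact absurd (hmin ⟨⟨hs, hsT.le.trans hT₁.1.2⟩, hcon⟩) (not_le.2 hsT)
  refine ⟨T₁, hT₁.1, ⟨⟨hT₁.1.1, hT₁.2⟩, fun s hs => ?_⟩, fun s hs => (hleast s hs.1 hs.2).le⟩
  by_contra! hcon
  exact absurd hs.2 (not_le.2 (hleast s hs.1 hcon))

end Setting

end AlignedModel

end AlignmentPhase

/-! ### Decay of the residual after the alignment phase -/

section LocalConvergence

open scoped Matrix.Norms.Frobenius

namespace AlignedModel

variable {m n h r : ℕ}

/-- The bounds that hold after the alignment phase. -/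
structure Late (F : AlignedModel m n h) (κ : ℝ) (x : LoRAWeights m n h r) : Prop
    extends F.Good κ x where
  p : F.thr / 2 ≤ F.p x

/-- The weights at the end `T₁` of the alignment phase, and before. -/
structure AlignedAt (F : AlignedModel m n h) (w : ℝ → LoRAWeights m n h r) (κ T T₁ : ℝ) :
    Prop where
  nonneg : 0 ≤ T₁
  le_T : T₁ ≤ T
  early : ∀ t ∈ Icc 0 T₁, F.Early κ (‖F.a (w 0)‖ ^ 2) (w t)
  thr_le : F.thr ≤ F.p (w T₁)

namespace Setting

variable {F : AlignedModel m n h} {w : ℝ → LoRAWeights m n h r} {K M α κ T C T₁ : ℝ}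
  (S : F.Setting w K M α κ T C) (A : F.AlignedAt w κ T T₁)

include S

theorem rate_pos : 0 < F.rate := by
  have := S.σ₂_pos
  have := S.thr_pos
  unfold rate
  positivity

include A

omit S in
/-- The bounds on `[0, t]` if the weights are `Late` on `[T₁, t]`. -/
theorem _root_.AlignedModel.AlignedAt.good_of_late {t : ℝ} (hL : ∀ s ∈ Icc T₁ t, F.Late κ (w s)) :
    ∀ s ∈ Icc 0 t, F.Good κ (w s) := fun s hs => by
  rcases le_total s T₁ with h | h
  · exact (A.early s ⟨hs.1, h⟩).toGood
  · exact (hL s ⟨h, hs.2⟩).toGood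

theorem late_off_le {t : ℝ} (htT : t ≤ T) (hL : ∀ s ∈ Icc T₁ t, F.Late κ (w s)) {s : ℝ}
    (hs : s ∈ Icc T₁ t) : √(F.off (w s)) ≤ 2 * K * α :=
  S.sqrt_off_le (A.nonneg.trans hs.1) (hs.2.trans htT) fun τ hτ =>
    A.good_of_late hL τ ⟨hτ.1, hτ.2.le.trans hs.2⟩

theorem late_bounded {t : ℝ} (hL : ∀ s ∈ Icc T₁ t, F.Late κ (w s)) {s : ℝ}
    (hs : s ∈ Icc T₁ t) : F.Bounded (w s) M κ :=
  S.bounded (A.nonneg.trans hs.1) (hL s hs).toGood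

omit A in
-- With `p ≥ thr / 2`, also `‖a‖² + ‖b‖² ≥ 2 p ≥ thr`, so the form is at least `σ₂² thr` minus an
-- error. The factor 1/2 in `rate` leaves room for that error.
theorem rate_le_decayForm {t : ℝ} (ht : 0 ≤ t) (hL : F.Late κ (w t)) :
    F.rate ≤ F.decayForm (w t) (F.u * F.vᵀ) (F.u * F.vᵀ) := by
  have hb := S.bounded ht hL.toGood
  have h1 := hb.le_decayForm
  have h2 : F.thr ≤ ‖F.a (w t)‖ ^ 2 + ‖F.b (w t)‖ ^ 2 := by
    have := norm_sub_sq_frob (F.a (w t)) (F.b (w t))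
    rw [← AlignedModel.p] at this
    nlinarith [sq_nonneg ‖F.a (w t) - F.b (w t)‖, hL.p]
  have h3 := mul_le_mul_of_nonneg_left h2 (sq_nonneg F.σ₂)
  have h4 := S.mul_κ_le S.C_ge_decay
  have h5 : 0 < F.σ₂ ^ 2 * F.thr := by
    have := S.σ₂_pos
    have := S.thr_pos
    positivity
  rw [div_mul_eq_mul_div, div_le_one h5] at h4
  have h6 : M ^ 4 * κ ^ 2 ≤ M ^ 4 * κ :=
    mul_le_mul_of_nonneg_left (by nlinarith [S.κ_pos, S.κ_le_one]) (by positivity)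
  unfold rate
  linarith

/-- The main component of the residual decays exponentially, up to a multiple of the other
components. -/
theorem e_sq_le {t Y : ℝ} (ht : T₁ ≤ t) (hL : ∀ s ∈ Icc T₁ t, F.Late κ (w s))
    (hY : ∀ s ∈ Icc T₁ t, ‖F.Eo (w s)‖ ≤ Y) :
    F.e (w t) ^ 2 ≤ Real.exp (-F.rate * (t - T₁)) * F.e (w T₁) ^ 2 +
      (4 * M ^ 4 * Y / F.rate) ^ 2 := by
  have hM := S.one_le_M
  have hr := S.rate_pos
  have h1 := le_exp_add_of_hasDerivWithinAt_le (c := F.rate) (b := (4 * M ^ 4 * Y) ^ 2 / F.rate)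
    A.nonneg ht hr (by positivity) (fun s hs => (S.flow.e (A.nonneg.trans hs.1)).pow 2)
    fun s hs => by
      have hs' : s ∈ Icc T₁ t := ⟨hs.1.le, hs.2.le⟩
      have hb := S.late_bounded A hL hs'
      have h2 := S.rate_le_decayForm (A.nonneg.trans hs.1.le) (hL s hs')
      have h3 : |F.decayForm (w s) (F.u * F.vᵀ) (F.Eo (w s))| ≤ 4 * M ^ 4 * Y :=
        hb.abs_decayForm_le.trans (mul_le_mul_of_nonneg_left (hY s hs') (by positivity))
      rw [decayForm_E]
      set e := F.e (w s)
      set ξ := F.decayForm (w s) (F.u * F.vᵀ) (F.Eo (w s))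
      set H := F.decayForm (w s) (F.u * F.vᵀ) (F.u * F.vᵀ)
      -- Young's inequality: the forcing may consume one of the two copies of `rate * e²` supplied
      -- by the decay.
      have h4 : -(2 * (e * ξ)) ≤ F.rate * e ^ 2 + (4 * M ^ 4 * Y) ^ 2 / F.rate := by
        have h5 : ξ ^ 2 ≤ (4 * M ^ 4 * Y) ^ 2 := sq_le_sq' (by linarith [(abs_le.1 h3).1])
          ((le_abs_self _).trans h3)
        have h6 : 0 ≤ (F.rate * e + ξ) ^ 2 / F.rate := by positivity
        have h7 : (F.rate * e + ξ) ^ 2 / F.rate = F.rate * e ^ 2 + 2 * (e * ξ) + ξ ^ 2 / F.rate := by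
          field_simp
          ring
        have h8 : ξ ^ 2 / F.rate ≤ (4 * M ^ 4 * Y) ^ 2 / F.rate := by gcongr
        linarith
      have h9 := mul_le_mul_of_nonneg_right h2 (sq_nonneg e)
      simp only [Nat.cast_ofNat, Nat.add_one_sub_one, pow_one, Pi.pow_apply]
      nlinarith
  refine h1.trans_eq ?_
  rw [div_pow]
  congr 1
  field_simp

theorem norm_Eo_le_of_late {t : ℝ} (htT : t ≤ T) (hL : ∀ s ∈ Icc T₁ t, F.Late κ (w s)) {s : ℝ}
    (hs : s ∈ Icc T₁ t) : ‖F.Eo (w s)‖ ≤ 8 * M ^ 2 * K * α := by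
  have h1 := (S.late_bounded A hL hs).norm_Eo_le
  have h2 := mul_le_mul_of_nonneg_left (S.late_off_le A htT hL hs) (show 0 ≤ 4 * M ^ 2 by positivity)
  linarith

/-- Takes the square root of `e_sq_le`. The point is a bound of `e` itself whose time integral is
bounded, up to a drift of order `α`. -/
theorem abs_e_le {t : ℝ} (htT : t ≤ T) (hL : ∀ s ∈ Icc T₁ t, F.Late κ (w s)) {s : ℝ}
    (hs : s ∈ Icc T₁ t) : |F.e (w s)| ≤ Real.exp (-(F.rate / 2) * (s - T₁)) * F.e (w T₁) +
      32 * M ^ 6 * K / F.rate * α := by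
  have hr := S.rate_pos
  have hM := S.one_le_M
  have hK := S.one_le_K
  have hα := S.α_pos
  have he1 : 0 ≤ F.e (w T₁) := by
    have := S.half_le_e A.nonneg (A.early T₁ ⟨A.nonneg, le_rfl⟩).toGood
      (A.early T₁ ⟨A.nonneg, le_rfl⟩).p_le
    linarith [S.σ_pos]
  have h1 := S.e_sq_le A hs.1 (fun τ hτ => hL τ ⟨hτ.1, hτ.2.trans hs.2⟩)
    fun τ hτ => S.norm_Eo_le_of_late A htT hL ⟨hτ.1, hτ.2.trans hs.2⟩
  have h2 : 4 * M ^ 4 * (8 * M ^ 2 * K * α) / F.rate = 32 * M ^ 6 * K / F.rate * α := by ring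
  rw [h2] at h1
  have h3 : Real.exp (-F.rate * (s - T₁)) = Real.exp (-(F.rate / 2) * (s - T₁)) ^ 2 := by
    rw [← Real.exp_nat_mul]
    congr 1
    push_cast
    ring
  rw [h3] at h1
  have h4 : 0 ≤ 32 * M ^ 6 * K / F.rate * α := by positivity
  have h5 : 0 ≤ Real.exp (-(F.rate / 2) * (s - T₁)) * F.e (w T₁) := by positivity
  refine abs_le_of_sq_le_sq ?_ (by positivity)
  nlinarith [mul_nonneg h4 h5]

theorem e_alignmentTime_le : F.e (w T₁) ≤ F.σ - F.σ₂ * F.thr + κ ^ 2 * M := by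
  have h1 := abs_le.1 (S.abs_coupling_le A.nonneg (A.early T₁ ⟨A.nonneg, le_rfl⟩).toGood)
  have h2 := mul_le_mul_of_nonneg_left A.thr_le S.σ₂_pos.le
  rw [e_eq]
  linarith [h1.1]

/-- Up to small terms `|e|` does not exceed its value at `T₁`, and `σ₂ p` equals `σ - e` up to the
coupling. Hence `p` can fall below the threshold only by a small amount, well before reaching half
of it. -/
theorem thr_lt_p {t : ℝ} (ht : T₁ ≤ t) (htT : t ≤ T) (hL : ∀ s ∈ Icc T₁ t, F.Late κ (w s)) :
    F.thr / 2 < F.p (w t) := by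
  have hr := S.rate_pos
  have hM := S.one_le_M
  have hK := S.one_le_K
  have hκ := S.κ_pos
  have hσ₂ := S.σ₂_pos
  have he1 : 0 ≤ F.e (w T₁) := by
    have := S.half_le_e A.nonneg (A.early T₁ ⟨A.nonneg, le_rfl⟩).toGood
      (A.early T₁ ⟨A.nonneg, le_rfl⟩).p_le
    linarith [S.σ_pos]
  have h1 := S.abs_e_le A htT hL ⟨ht, le_rfl⟩
  have h2 : Real.exp (-(F.rate / 2) * (t - T₁)) ≤ 1 := Real.exp_le_one_iff.2 (by nlinarith)
  have h3 := mul_le_mul_of_nonneg_right h2 he1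
  have h4 := abs_le.1 (S.abs_coupling_le (A.nonneg.trans ht) (hL t ⟨ht, le_rfl⟩).toGood)
  have h5 := S.e_alignmentTime_le A
  have h6 := S.mul_κ_le S.C_ge_thr
  have h7 : 0 < F.σ₂ * F.thr := mul_pos hσ₂ S.thr_pos
  rw [div_mul_eq_mul_div, div_le_one h7] at h6
  have h8 : 32 * M ^ 6 * K / F.rate * α ≤ 32 * M ^ 6 * K / F.rate * κ ^ 2 :=
    mul_le_mul_of_nonneg_left S.α_le (by positivity)
  have h9 : (2 * M + 32 * M ^ 6 * K / F.rate) * κ ^ 2 < F.σ₂ * F.thr / 2 := by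
    have h10 : (2 * M + 32 * M ^ 6 * K / F.rate) * κ ^ 2 =
        ((2 * M + 32 * M ^ 6 * K / F.rate) * κ) * κ := by ring
    rw [h10]
    nlinarith [S.κ_le]
  have h11 := (le_abs_self (F.e (w t))).trans h1
  rw [e_eq] at h11
  have : F.σ₂ * (F.thr / 2) < F.σ₂ * F.p (w t) := by linarith [h4.2]
  exact lt_of_mul_lt_mul_left this hσ₂.le

/-- The second pair of weights grows at most by a constant factor. -/
theorem size_le_of_late {t : ℝ} (ht : T₁ ≤ t) (htT : t ≤ T)
    (hL : ∀ s ∈ Icc T₁ t, F.Late κ (w s)) : size₂ (w t) ≤ F.growC M * size₂ (w T₁) := by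
  have hr := S.rate_pos
  have hM := S.one_le_M
  have hK := S.one_le_K
  have hα := S.α_pos
  have hσ := S.σ_pos
  set c₀ := 128 * M ^ 8 * K / F.rate + 20 * M ^ 3 * K with hc₀
  -- An explicit antiderivative of the growth rate: the exponential part has bounded total
  -- variation, and the drift is at most 1 over the horizon. This gives the two summands in the
  -- exponent of `growC`.
  have hμ : ∀ s ∈ Icc T₁ t, HasDerivWithinAt
      (fun s => -(8 * M ^ 2 * F.σ / F.rate) * Real.exp (-(F.rate / 2) * (s - T₁)) + c₀ * α * s)
      (4 * M ^ 2 * (F.σ * Real.exp (-(F.rate / 2) * (s - T₁))) + c₀ * α) (Ici 0) s := fun s _ => by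
    have h1 : HasDerivWithinAt (fun s => -(F.rate / 2) * (s - T₁)) (-(F.rate / 2)) (Ici 0) s := by
      simpa using ((hasDerivWithinAt_id s (Ici 0)).sub_const T₁).const_mul (-(F.rate / 2))
    have h2 : HasDerivWithinAt (fun s => c₀ * α * s) (c₀ * α) (Ici 0) s := by
      simpa using (hasDerivWithinAt_id s (Ici 0)).const_mul (c₀ * α)
    refine ((h1.exp.const_mul _).add h2).congr_deriv ?_
    field_simp
    ring
  have h1 := le_mul_exp_of_hasDerivWithinAt_le A.nonneg ht
    (fun s hs => S.flow.size₂ (A.nonneg.trans hs.1)) hμ fun s hs => by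
      have hs' : s ∈ Icc T₁ t := ⟨hs.1.le, hs.2.le⟩
      have hb := S.late_bounded A hL hs'
      refine (hb.size_velocity_le rfl).trans (mul_le_mul_of_nonneg_right ?_ (by positivity))
      have ho := mul_le_mul_of_nonneg_left (S.late_off_le A htT hL hs')
        (show 0 ≤ 10 * M ^ 3 by positivity)
      have he := S.abs_e_le A htT hL hs'
      have heT : F.e (w T₁) ≤ F.σ := (le_abs_self _).trans (S.abs_e_le_σ A.nonneg)
      have hp : |F.σ₁ + F.p (w s)| ≤ 2 * M ^ 2 := by
        have h3 : |F.p (w s)| ≤ M * M := (abs_frobInner_le _ _).trans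
          (mul_le_mul ((F.norm_a_le _).trans hb.A₁) ((F.norm_b_le _).trans hb.B₁) (norm_nonneg _)
            (by linarith))
        refine (abs_add_le _ _).trans ?_
        rw [abs_of_nonneg S.σ₁_nonneg]
        nlinarith [S.σ₁_lt, hb.σ₂]
      rw [abs_mul]
      have hexp := (Real.exp_pos (-(F.rate / 2) * (s - T₁))).le
      have h4 : |F.e (w s)| ≤ F.σ * Real.exp (-(F.rate / 2) * (s - T₁)) +
          32 * M ^ 6 * K / F.rate * α := by
        have := mul_le_mul_of_nonneg_left heT hexp
        linarith
      have h5 := mul_le_mul h4 hp (abs_nonneg _) ((abs_nonneg _).trans h4)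
      have h6 : c₀ * α = 4 * M ^ 2 * (32 * M ^ 6 * K / F.rate * α) + 20 * M ^ 3 * K * α := by
        rw [hc₀]
        ring
      rw [h6]
      linarith
  have h2 := S.mul_κ_mul_le S.C_ge_late htT (A.nonneg.trans ht)
  have hc₀0 : 0 ≤ c₀ := by positivity
  have h3 : c₀ * α * (t - T₁) ≤ 1 := by
    refine le_trans ?_ h2
    exact mul_le_mul (mul_le_mul_of_nonneg_left S.α_le_κ hc₀0) (by linarith [A.nonneg])
      (by linarith) (mul_nonneg hc₀0 S.κ_pos.le)
  have h4 : 0 ≤ 8 * M ^ 2 * F.σ / F.rate * Real.exp (-(F.rate / 2) * (t - T₁)) := by positivity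
  rw [mul_comm (F.growC M), growC]
  refine h1.trans (mul_le_mul_of_nonneg_left (Real.exp_le_exp.2 ?_)
    (by unfold AlignedModel.size₂; positivity))
  rw [sub_self, mul_zero, Real.exp_zero]
  linarith

/-- After the alignment phase, the weights are `Late`. -/
theorem late : ∀ t ∈ Icc T₁ T, F.Late κ (w t) := by
  have hthr := S.thr_pos
  have hc : ∀ {f f' : ℝ → ℝ}, (∀ t, 0 ≤ t → HasDerivWithinAt f (f' t) (Ici 0) t) →
      ContinuousOn f (Icc T₁ T) := fun hf t ht =>
    (hf t (A.nonneg.trans ht.1)).continuousWithinAt.mono fun s hs => A.nonneg.trans hs.1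
  have hE₁ := A.early T₁ ⟨A.nonneg, le_rfl⟩
  let P : ℝ → Prop := fun t => ((size₂ (w t) < κ ^ 2 ∧ ‖(w t).A₁‖ ^ 2 < F.sizeBound + 1) ∧
    -F.p (w t) < -(F.thr / 2))
  have hP : ∀ t ∈ Icc T₁ T, P t := by
    refine forall_Icc_of_forall_Ico (isClosed_not_and
      (isClosed_not_and (isClosed_not_lt (hc fun t ht => S.flow.size₂ ht))
        (isClosed_not_lt (hc fun t ht => S.flow.norm_A₁_sq ht)))
      (isClosed_not_lt (hc fun t ht => (S.flow.p ht).neg))) ?_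
    intro t ht hPt
    have hL : ∀ s ∈ Icc T₁ t, F.Late κ (w s) := by
      intro s hs
      rcases hs.1.eq_or_lt with h | h
      · subst h
        exact ⟨hE₁.toGood, by linarith [A.thr_le]⟩
      · have hcl : ∀ {f : ℝ → ℝ} {f' : ℝ → ℝ} {c : ℝ},
            (∀ t, 0 ≤ t → HasDerivWithinAt f (f' t) (Ici 0) t) →
            (∀ τ ∈ Ico T₁ t, f τ < c) → f s ≤ c := fun {f f' c} hf hτ => by
          have h1 : s ∈ closure (Ico T₁ s) := by
            rw [closure_Ico h.ne]
            exact right_mem_Icc.2 h.le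
          have h2 : ContinuousWithinAt f (Ico T₁ s) s :=
            (hf s (A.nonneg.trans hs.1)).continuousWithinAt.mono fun τ hτ => A.nonneg.trans hτ.1
          refine isClosed_Iic.closure_subset_iff.2 ?_ (h2.mem_closure_image h1)
          rintro _ ⟨τ, hτ', rfl⟩
          exact (hτ τ ⟨hτ'.1, hτ'.2.trans_le hs.2⟩).le
        refine ⟨⟨?_, ?_⟩, ?_⟩
        · exact hcl (fun τ hτ => S.flow.size₂ hτ) fun τ hτ => (hPt τ hτ).1.1
        · exact hcl (fun τ hτ => S.flow.norm_A₁_sq hτ) fun τ hτ => (hPt τ hτ).1.2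
        · exact neg_le_neg_iff.1 (hcl (fun τ hτ => (S.flow.p hτ).neg) fun τ hτ => (hPt τ hτ).2)
    have h1 := S.size_le_of_late A ht.1 ht.2 hL
    have h2 := S.norm_A₁_sq_le (A.nonneg.trans ht.1) ht.2 (A.good_of_late hL)
    have h3 := S.thr_lt_p A ht.1 ht.2 hL
    have h4 := S.size_le A.nonneg A.le_T A.early
    have hg : 0 < F.growC M := Real.exp_pos _
    have h5 : F.growC M * F.sizeC M K * κ ^ 4 < κ ^ 2 := by
      have h := S.mul_κ_le S.C_ge_growC
      have hκ := S.κ_pos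
      have h6 : F.growC M * F.sizeC M K * κ ^ 2 ≤ 1 / 2 * κ := by nlinarith
      have h7 : F.growC M * F.sizeC M K * κ ^ 2 < 1 := by linarith [S.κ_le]
      nlinarith [pow_pos hκ 2]
    have h6 := mul_le_mul_of_nonneg_left h4 hg.le
    exact ⟨⟨by linarith, by linarith⟩, by linarith⟩
  intro t ht
  have := hP t ht
  exact ⟨⟨this.1.1.le, this.1.2.le⟩, by linarith [this.2]⟩

theorem good : ∀ t ∈ Icc 0 T, F.Good κ (w t) := A.good_of_late (S.late A)

end Setting

end AlignedModel

end LocalConvergence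

/-! ### From the matrix to its top singular vector -/

section TopSingularVector

open scoped Matrix.Norms.Frobenius

namespace AlignedModel

variable {m n h r : ℕ}

/-- `(qB; qA)` is a unit left singular vector of `(B₁; A₁ᵀ)` for the largest singular value `s`. -/
structure IsTop (F : AlignedModel m n h) (x : LoRAWeights m n h r) (s : ℝ)
    (qB : Matrix (Fin h) Unit ℝ) (qA : Matrix (Fin n) Unit ℝ) : Prop where
  unit : ‖qB‖ ^ 2 + ‖qA‖ ^ 2 = 1
  mul_B : x.B₁ * (x.B₁ᵀ * qB + x.A₁ * qA) = s ^ 2 • qB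
  mul_A : x.A₁ᵀ * (x.B₁ᵀ * qB + x.A₁ * qA) = s ^ 2 • qA
  nonneg : 0 ≤ s
  le : ‖F.a x + F.b x‖ ^ 2 ≤ 2 * s ^ 2
  le_norm : s ^ 2 ≤ ‖x.A₁‖ ^ 2 + ‖x.B₁‖ ^ 2

/-- The squared sine of the angle between the unit vector `(qB; qA)` and `(g; v)`. -/
noncomputable def defect (F : AlignedModel m n h) (qB : Matrix (Fin h) Unit ℝ)
    (qA : Matrix (Fin n) Unit ℝ) : ℝ := 1 - (frobInner F.g qB + frobInner F.v qA) ^ 2 / 2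

/-- The deviation of `(B₁; A₁ᵀ)` from a multiple of `(g; v) (a + b)ᵀ`. -/
noncomputable def misalignment (F : AlignedModel m n h) (x : LoRAWeights m n h r) : ℝ :=
  ‖F.a x - F.b x‖ + ‖F.Bo₁ x‖ + ‖F.Ao₁ x‖

variable {F : AlignedModel m n h} {x : LoRAWeights m n h r} {qB dB : Matrix (Fin h) Unit ℝ}
  {qA dA : Matrix (Fin n) Unit ℝ} {s : ℝ}

/-- The component of `(qB; qA)` orthogonal to `(g; v)`. -/
theorem orthogonal_component (hq : ‖qB‖ ^ 2 + ‖qA‖ ^ 2 = 1) {τ : ℝ}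
    (hτ : frobInner F.g qB + frobInner F.v qA = τ) :
    frobInner F.g (qB - (τ / 2) • F.g) + frobInner F.v (qA - (τ / 2) • F.v) = 0 ∧
      ‖qB - (τ / 2) • F.g‖ ^ 2 + ‖qA - (τ / 2) • F.v‖ ^ 2 = F.defect qB qA := by
  have hg : frobInner F.g F.g = 1 := by rw [frobInner_self, F.norm_g, one_pow]
  have hv : frobInner F.v F.v = 1 := by rw [frobInner_self, F.norm_v, one_pow]
  constructor
  · rw [frobInner_sub_right, frobInner_sub_right, frobInner_smul_right, frobInner_smul_right, hg, hv]
    linarith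
  · rw [norm_sub_sq_frob, norm_sub_sq_frob, norm_smul, norm_smul, F.norm_g, F.norm_v,
      frobInner_smul_right, frobInner_smul_right, frobInner_comm qB, frobInner_comm qA, defect, hτ,
      mul_one, Real.norm_eq_abs, sq_abs]
    have h1 : τ / 2 * frobInner F.g qB + τ / 2 * frobInner F.v qA = τ ^ 2 / 2 := by
      rw [← mul_add, hτ]
      ring
    linarith

theorem defect_nonneg (hq : ‖qB‖ ^ 2 + ‖qA‖ ^ 2 = 1) : 0 ≤ F.defect qB qA := by
  rw [← (F.orthogonal_component hq rfl).2]
  positivity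

/-- Cauchy–Schwarz for pairs. -/
theorem abs_pair_le (X X' : Matrix (Fin h) Unit ℝ) (Y Y' : Matrix (Fin n) Unit ℝ) :
    (frobInner X X' + frobInner Y Y') ^ 2 ≤ (‖X‖ ^ 2 + ‖Y‖ ^ 2) * (‖X'‖ ^ 2 + ‖Y'‖ ^ 2) := by
  have h1 := abs_frobInner_le X X'
  have h2 := abs_frobInner_le Y Y'
  have h3 : |frobInner X X' + frobInner Y Y'| ≤ ‖X‖ * ‖X'‖ + ‖Y‖ * ‖Y'‖ :=
    (abs_add_le _ _).trans (add_le_add h1 h2)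
  have h4 := pow_le_pow_left₀ (abs_nonneg _) h3 2
  rw [sq_abs] at h4
  nlinarith [sq_nonneg (‖X‖ * ‖Y'‖ - ‖Y‖ * ‖X'‖)]

/-- The component of `(qB; qA)` along a direction orthogonal to `(g; v)` is bounded by the
defect. -/
theorem sq_le_defect (hq : ‖qB‖ ^ 2 + ‖qA‖ ^ 2 = 1) (hd : ‖dB‖ ^ 2 + ‖dA‖ ^ 2 ≤ 1)
    (h0 : frobInner F.g dB + frobInner F.v dA = 0) :
    (frobInner dB qB + frobInner dA qA) ^ 2 ≤ F.defect qB qA := by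
  set τ := frobInner F.g qB + frobInner F.v qA with hτ
  have h1 := (F.orthogonal_component hq rfl).2
  have h2 : frobInner dB qB + frobInner dA qA =
      frobInner dB (qB - (τ / 2) • F.g) + frobInner dA (qA - (τ / 2) • F.v) := by
    rw [frobInner_sub_right, frobInner_sub_right, frobInner_smul_right, frobInner_smul_right,
      frobInner_comm dB F.g, frobInner_comm dA F.v]
    linear_combination (τ / 2) * h0
  rw [h2, ← h1]
  refine (abs_pair_le _ _ _ _).trans ?_
  have : 0 ≤ ‖qB - (τ / 2) • F.g‖ ^ 2 + ‖qA - (τ / 2) • F.v‖ ^ 2 := by positivity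
  nlinarith

/-- The transpose of `(B₁; A₁ᵀ)` is small on directions orthogonal to `(g; v)`. -/
theorem norm_mul_le_misalignment {δ : ℝ} (hδ : 0 ≤ δ) (hd : ‖dB‖ ^ 2 + ‖dA‖ ^ 2 ≤ δ ^ 2)
    (h0 : frobInner F.g dB + frobInner F.v dA = 0) :
    ‖x.B₁ᵀ * dB + x.A₁ * dA‖ ≤ F.misalignment x * δ := by
  have h1 : x.B₁ᵀ * dB + x.A₁ * dA =
      frobInner F.v dA • (F.a x - F.b x) + (F.Bo₁ x)ᵀ * dB + F.Ao₁ x * dA := by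
    conv_lhs => rw [F.B₁_eq x, F.A₁_eq x]
    rw [transpose_add, Matrix.add_mul, Matrix.add_mul, transpose_mul, transpose_transpose,
      Matrix.mul_assoc, Matrix.mul_assoc, transpose_mul_col, transpose_mul_col,
      eq_neg_of_add_eq_zero_left h0]
    simp only [neg_smul, Matrix.mul_neg, Matrix.mul_smul, Matrix.mul_one, smul_sub]
    abel
  have hB : ‖dB‖ ≤ δ := le_of_sq_le_sq (by nlinarith [sq_nonneg ‖dA‖]) hδ
  have hA : ‖dA‖ ≤ δ := le_of_sq_le_sq (by nlinarith [sq_nonneg ‖dB‖]) hδ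
  have h2 : ‖frobInner F.v dA • (F.a x - F.b x)‖ ≤ δ * ‖F.a x - F.b x‖ := by
    rw [norm_smul, Real.norm_eq_abs]
    refine mul_le_mul_of_nonneg_right ((abs_frobInner_le _ _).trans ?_) (norm_nonneg _)
    rwa [F.norm_v, one_mul]
  have h3 : ‖(F.Bo₁ x)ᵀ * dB‖ ≤ ‖F.Bo₁ x‖ * δ :=
    fro_mul_le (frobenius_norm_transpose _).le hB
  have h4 : ‖F.Ao₁ x * dA‖ ≤ ‖F.Ao₁ x‖ * δ := fro_mul_le le_rfl hA
  rw [h1, misalignment]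
  refine (norm_add_le _ _).trans ((add_le_add (norm_add_le _ _) le_rfl).trans ?_)
  linarith

theorem misalignment_nonneg (F : AlignedModel m n h) (x : LoRAWeights m n h r) :
    0 ≤ F.misalignment x := by
  unfold misalignment
  positivity

namespace IsTop

variable (hx : F.IsTop x s qB qA)

include hx

/-- The singular vector equation tested against an arbitrary pair. With `Z = (B₁; A₁ᵀ)` it says `s²
⟨d, q⟩ = ⟨Zᵀ d, Zᵀ q⟩`, and it is used with various test pairs for upper and lower bounds of the
defect. -/
theorem inner_eq (dB : Matrix (Fin h) Unit ℝ) (dA : Matrix (Fin n) Unit ℝ) :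
    s ^ 2 * (frobInner dB qB + frobInner dA qA) =
      frobInner (x.B₁ᵀ * dB + x.A₁ * dA) (x.B₁ᵀ * qB + x.A₁ * qA) := by
  rw [frobInner_add_left, frobInner_mul_left, frobInner_mul_left, transpose_transpose, hx.mul_B,
    hx.mul_A, frobInner_smul_right, frobInner_smul_right]
  ring

theorem norm_image : ‖x.B₁ᵀ * qB + x.A₁ * qA‖ = s := by
  have h := hx.inner_eq qB qA
  rw [frobInner_self, frobInner_self, frobInner_self, hx.unit, mul_one] at h
  exact ((pow_left_inj₀ hx.nonneg (norm_nonneg _) two_ne_zero).1 h).symm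

/-- Test with the part of `q` orthogonal to `(g; v)`, whose squared norm is the defect `D`. Its
image is bounded by the misalignment times `√D`, and the image of `q` has norm `s`. -/
theorem defect_le : s ^ 2 * F.defect qB qA ≤ F.misalignment x ^ 2 := by
  set τ := frobInner F.g qB + frobInner F.v qA with hτ
  obtain ⟨h0, h1⟩ := F.orthogonal_component hx.unit hτ.symm
  have hD := F.defect_nonneg hx.unit
  set D := F.defect qB qA with hDdef
  have h2 := norm_mul_le_misalignment (x := x) (Real.sqrt_nonneg D)
    (by rw [h1, Real.sq_sqrt hD]) h0
  have h3 := hx.inner_eq (qB - (τ / 2) • F.g) (qA - (τ / 2) • F.v)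
  have h4 : frobInner (qB - (τ / 2) • F.g) qB + frobInner (qA - (τ / 2) • F.v) qA = D := by
    rw [← h1, ← frobInner_self, ← frobInner_self]
    simp only [frobInner_sub_right, frobInner_smul_right] at h0 ⊢
    rw [frobInner_comm _ F.g, frobInner_comm _ F.v, frobInner_sub_right, frobInner_sub_right,
      frobInner_smul_right, frobInner_smul_right]
    linear_combination (τ / 2) * h0
  rw [h4] at h3
  have h5 := h3.le.trans (frobInner_le _ _)
  rw [hx.norm_image] at h5
  have h6 : s ^ 2 * D ≤ F.misalignment x * √D * s :=
    h5.trans (mul_le_mul_of_nonneg_right h2 hx.nonneg)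
  have hsD : 0 ≤ s * √D := mul_nonneg hx.nonneg (Real.sqrt_nonneg _)
  have h7 : s ^ 2 * D = (s * √D) ^ 2 := by rw [mul_pow, Real.sq_sqrt hD]
  rw [h7] at h6 ⊢
  refine pow_le_pow_left₀ hsD ?_ 2
  rcases hsD.eq_or_lt with h8 | h8
  · rw [← h8]
    exact F.misalignment_nonneg x
  · nlinarith

/-- The right singular vector is nearly parallel to `a + b`. -/
theorem norm_image_sub_le : ‖(x.B₁ᵀ * qB + x.A₁ * qA) -
    ((frobInner F.g qB + frobInner F.v qA) / 2) • (F.a x + F.b x)‖ ≤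
      F.misalignment x * √(F.defect qB qA) := by
  set τ := frobInner F.g qB + frobInner F.v qA with hτ
  obtain ⟨h0, h1⟩ := F.orthogonal_component hx.unit hτ.symm
  have h2 := norm_mul_le_misalignment (x := x) (Real.sqrt_nonneg (F.defect qB qA))
    (by rw [h1, Real.sq_sqrt (F.defect_nonneg hx.unit)]) h0
  convert h2 using 2
  rw [Matrix.mul_sub, Matrix.mul_sub, Matrix.mul_smul, Matrix.mul_smul, ← a, ← b, smul_add]
  abel

end IsTop

end AlignedModel

end TopSingularVector

/-! ### Growth of the components of the first pair transverse to v -/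

section TransverseGrowth

open scoped Matrix.Norms.Frobenius

namespace AlignedModel

variable {m n h r : ℕ} {F : AlignedModel m n h} {x : LoRAWeights m n h r} {M ζ : ℝ}
  {d : Matrix (Fin n) Unit ℝ}

theorem A₁_mul_of_orthogonal (hd : F.vᵀ * d = 0) : x.A₁ * d = F.Ao₁ x * d := by
  conv_lhs => rw [F.A₁_eq x]
  rw [Matrix.add_mul, Matrix.mul_assoc, hd, Matrix.mul_zero, zero_add]

/-- A direction orthogonal to `v` sees only the part `-Ev` of the residual, so `A₁ d` is damped by a
Gram matrix and otherwise only driven through the second pair. -/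
theorem dA₁_mul_of_orthogonal (hd : F.vᵀ * d = 0) : F.dA₁ x * d =
    -((F.X₂ x * x.B₁)ᵀ * (F.X₂ x * x.B₁ * (x.A₁ * d) + x.B₂ * (F.Ao₂ x * (F.R₁ * d)))) := by
  rw [dA₁, Matrix.mul_assoc, E_eq_Ev, Matrix.sub_mul, Matrix.mul_assoc, hd, Matrix.mul_zero,
    zero_sub, Matrix.mul_neg, Ev, Matrix.add_mul, A₁_mul_of_orthogonal hd]
  simp only [Matrix.mul_assoc]

/-- The first layer of the adaptation acts, up to small terms, along `u`. -/
theorem Bounded.norm_X₂_B₁_sub_le (hx : F.Bounded x M ζ) (z : Matrix (Fin r) Unit ℝ) :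
    ‖F.X₂ x * x.B₁ * z - (F.σ₂ * frobInner (F.b x) z) • F.u‖ ≤
      M * (ζ ^ 2 + √(F.off x)) * ‖z‖ := by
  have hM := hx.M_nonneg
  have hζ := hx.ζ_nonneg
  have h1 : F.X₂ x * x.B₁ * z - (F.σ₂ * frobInner (F.b x) z) • F.u =
      frobInner (F.b x) z • (x.B₂ * F.c x) + F.X₂ x * (F.Bo₁ x * z) := by
    have : x.B₁ * z = frobInner (F.b x) z • F.g + F.Bo₁ x * z := by
      conv_lhs => rw [F.B₁_eq x]
      rw [Matrix.add_mul, Matrix.mul_assoc, transpose_mul_col, Matrix.mul_smul, Matrix.mul_one]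
    rw [Matrix.mul_assoc, this, Matrix.mul_add, Matrix.mul_smul, X₂_g, smul_add, smul_smul,
      mul_comm F.σ₂]
    abel
  rw [h1]
  have h2 : ‖frobInner (F.b x) z • (x.B₂ * F.c x)‖ ≤ M * ‖z‖ * (ζ * ζ) := by
    rw [norm_smul, Real.norm_eq_abs]
    exact mul_le_mul ((abs_frobInner_le _ _).trans
      (mul_le_mul_of_nonneg_right ((F.norm_b_le x).trans hx.B₁) (norm_nonneg _)))
      (fro_mul_le hx.B₂ ((F.norm_c_le x).trans hx.A₂)) (norm_nonneg _) (by positivity)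
  have h3 : ‖F.X₂ x * (F.Bo₁ x * z)‖ ≤ M * (√(F.off x) * ‖z‖) :=
    fro_mul_le hx.X₂ (fro_mul_le (F.norm_Bo₁_le_off x) le_rfl)
  refine (norm_add_le _ _).trans ((add_le_add h2 h3).trans_eq ?_)
  ring

/-- Replaces `X₂ B₁` by its leading part `σ₂ u bᵀ` in both factors, so that the damping becomes
explicit in terms of `b`. -/
theorem Bounded.abs_inner_X₂_B₁_sub_le (hx : F.Bounded x M ζ) (z z' : Matrix (Fin r) Unit ℝ) :
    |frobInner (F.X₂ x * x.B₁ * z) (F.X₂ x * x.B₁ * z') -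
      F.σ₂ ^ 2 * (frobInner (F.b x) z * frobInner (F.b x) z')| ≤
      2 * M ^ 3 * (ζ ^ 2 + √(F.off x)) * ‖z‖ * ‖z'‖ := by
  have hM := hx.M_nonneg
  have hζ := hx.ζ_nonneg
  have hP := hx.norm_X₂_B₁_sub_le z
  have hP' := hx.norm_X₂_B₁_sub_le z'
  have hYz : ‖F.X₂ x * x.B₁ * z‖ ≤ M * M * ‖z‖ := fro_mul_le (fro_mul_le hx.X₂ hx.B₁) le_rfl
  have hβ : |frobInner (F.b x) z'| ≤ M * ‖z'‖ := (abs_frobInner_le _ _).trans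
    (mul_le_mul_of_nonneg_right ((F.norm_b_le x).trans hx.B₁) (norm_nonneg _))
  generalize F.X₂ x * x.B₁ * z = Y at *
  generalize F.X₂ x * x.B₁ * z' = Y' at *
  generalize frobInner (F.b x) z = β at *
  generalize frobInner (F.b x) z' = β' at *
  have huu : frobInner F.u F.u = 1 := by rw [frobInner_self, F.norm_u, one_pow]
  have hmain : frobInner Y Y' - F.σ₂ ^ 2 * (β * β') =
      F.σ₂ * β' * frobInner (Y - (F.σ₂ * β) • F.u) F.u +
        frobInner Y (Y' - (F.σ₂ * β') • F.u) := by
    rw [frobInner_sub_left, frobInner_sub_right, frobInner_smul_left, frobInner_smul_right, huu]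
    ring
  rw [hmain]
  have h1 : |F.σ₂ * β' * frobInner (Y - (F.σ₂ * β) • F.u) F.u| ≤
      M * (M * ‖z'‖) * (M * (ζ ^ 2 + √(F.off x)) * ‖z‖) := by
    rw [abs_mul, abs_mul, abs_of_nonneg hx.σ₂_nonneg]
    refine mul_le_mul (mul_le_mul hx.σ₂ hβ (abs_nonneg _) hM) ?_ (abs_nonneg _) (by positivity)
    refine (abs_frobInner_le _ _).trans ?_
    rwa [F.norm_u, mul_one]
  have h2 : |frobInner Y (Y' - (F.σ₂ * β') • F.u)| ≤
      M * M * ‖z‖ * (M * (ζ ^ 2 + √(F.off x)) * ‖z'‖) :=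
    (abs_frobInner_le _ _).trans (mul_le_mul hYz hP' (norm_nonneg _) (by positivity))
  refine (abs_add_le _ _).trans ((add_le_add h1 h2).trans_eq ?_)
  ring

namespace Setting

variable {w : ℝ → LoRAWeights m n h r} {K α κ T C T₁ : ℝ}
  (S : F.Setting w K M α κ T C) (A : F.AlignedAt w κ T T₁)

include S

/-- Balance bounds `‖a - b‖²` by the orthogonal components and the initial weights, both of order
`α²`. -/
theorem norm_a_sub_b_le {t : ℝ} (ht : 0 ≤ t) (ho : F.off (w t) ≤ (2 * K * α) ^ 2)
    (hp : 0 ≤ F.p (w t)) : ‖F.a (w t) - F.b (w t)‖ ≤ 3 * K * α := by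
  have hK := S.one_le_K
  have hα := S.α_pos
  have h1 := norm_a_sub_b_sq_le_of_balance (S.flow.balance₁ S.B₁_zero ht) hp
  have h2 := pow_le_pow_left₀ (norm_nonneg _) S.A₁_le 2
  unfold off at ho
  refine le_of_sq_le_sq ?_ (by positivity)
  nlinarith [sq_nonneg ‖F.Ao₂ (w t)‖, sq_nonneg ‖F.Bo₂ (w t)‖, sq_nonneg (K * α)]

theorem misalignment_le {t : ℝ} (ht : 0 ≤ t) (ho : F.off (w t) ≤ (2 * K * α) ^ 2)
    (hp : 0 ≤ F.p (w t)) : F.misalignment (w t) ≤ 7 * K * α := by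
  have hK := S.one_le_K
  have hα := S.α_pos
  have h1 := S.norm_a_sub_b_le ht ho hp
  have h2 : √(F.off (w t)) ≤ 2 * K * α := Real.sqrt_le_iff.2 ⟨by positivity, ho⟩
  have h3 := F.norm_Ao₁_le_off (w t)
  have h4 := F.norm_Bo₁_le_off (w t)
  unfold misalignment
  linarith

/-- The inner product that measures the growth of the components transverse to `v`. -/
theorem transverse_velocity {t : ℝ} (htT : t ≤ T)
    (hE : ∀ s ∈ Icc 0 t, F.Early κ (‖F.a (w 0)‖ ^ 2) (w s)) (hd : F.vᵀ * d = 0) (hd1 : ‖d‖ ≤ 1)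
    {s : ℝ} (hs : s ∈ Icc 0 t) :
    ∃ η, HasDerivWithinAt (fun s => frobInner (F.a (w s) + F.b (w s)) ((w s).A₁ * d))
      ((F.σ₂ * F.e (w s) - F.σ₂ ^ 2 * frobInner (F.b (w s)) (F.a (w s) + F.b (w s)) / 2) *
        frobInner (F.a (w s) + F.b (w s)) ((w s).A₁ * d) + η) (Ici 0) s ∧
      |η| ≤ (4 * errC M K * K + 20 * M ^ 3 * K ^ 2) * κ * α * ‖F.a (w s) + F.b (w s)‖ := by
  obtain ⟨hb, ho, he, heσ, hea, heb⟩ := S.early_facts htT hE hs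
  have hp := S.p_nonneg hs.1 (hs.2.trans htT) fun τ hτ => hE τ ⟨hτ.1, hτ.2.trans hs.2⟩
  have hM := S.one_le_M
  have hK := S.one_le_K
  have hα := S.α_pos
  have hκ := S.κ_pos
  have hακ := S.α_le
  have hκ2 : κ ^ 2 ≤ κ := by nlinarith [S.κ_le_one]
  have hso : √(F.off (w s)) ≤ 2 * K * α := Real.sqrt_le_iff.2 ⟨by positivity, ho⟩
  set z := F.a (w s) + F.b (w s) with hz
  set x := (w s).A₁ * d with hx
  set ε := F.err_a (w s) + F.err_b (w s) with hε
  set Y := F.X₂ (w s) * (w s).B₁ with hY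
  set ρ := (w s).B₂ * (F.Ao₂ (w s) * (F.R₁ * d)) with hρ
  have hz0 := norm_nonneg z
  have hxn : ‖x‖ ≤ 2 * K * α := by
    rw [hx, A₁_mul_of_orthogonal hd]
    simpa using fro_mul_le ((F.norm_Ao₁_le_off (w s)).trans hso) hd1
  have hxn0 := norm_nonneg x
  have hR : √(‖F.a (w s)‖ ^ 2 + ‖F.b (w s)‖ ^ 2) ≤ ‖z‖ := by
    refine Real.sqrt_le_iff.2 ⟨norm_nonneg _, ?_⟩
    rw [hz, norm_add_sq_frob, ← AlignedModel.p]
    linarith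
  have hεn : ‖ε‖ ≤ 2 * errC M K * κ ^ 2 * ‖z‖ := by
    refine (norm_add_le _ _).trans ((add_le_add hea heb).trans ?_)
    have := mul_le_mul_of_nonneg_left hR (mul_nonneg S.errC_pos.le (sq_nonneg κ))
    linarith
  have hderiv := (S.flow.a_add_b hs.1).frobInner ((S.flow.A₁ s hs.1).mul_const d)
  refine ⟨_, hderiv.congr_deriv (add_sub_cancel _ _).symm, ?_⟩
  rw [frobInner_add_left, frobInner_smul_left, dA₁_mul_of_orthogonal hd, frobInner_neg_right,
    frobInner_comm z ((F.X₂ (w s) * (w s).B₁)ᵀ * _), frobInner_mul_left, transpose_transpose,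
    frobInner_comm _ (F.X₂ (w s) * (w s).B₁ * z), frobInner_add_right, ← hY, ← hx, ← hε, ← hρ]
  -- Since `a` and `b` almost agree, `b` is half of `z = a + b` up to order `α`. This makes the
  -- damping a multiple of the inner product under study.
  have hbx : 2 * frobInner (F.b (w s)) x = frobInner z x -
      frobInner (F.a (w s) - F.b (w s)) x := by
    rw [hz, frobInner_add_left, frobInner_sub_left]
    ring
  have hab := S.norm_a_sub_b_le hs.1 ho hp
  have hbn : ‖F.b (w s)‖ ≤ M := (F.norm_b_le _).trans hb.B₁
  have hinner := hb.abs_inner_X₂_B₁_sub_le z x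
  have hzb : |frobInner (F.b (w s)) z| ≤ M * ‖z‖ :=
    (abs_frobInner_le _ _).trans (mul_le_mul_of_nonneg_right hbn hz0)
  have hYz : ‖Y * z‖ ≤ M * M * ‖z‖ := fro_mul_le (fro_mul_le hb.X₂ hb.B₁) le_rfl
  have hρn : ‖ρ‖ ≤ κ * (2 * K * α * (M * 1)) :=
    fro_mul_le hb.B₂ (fro_mul_le ((F.norm_Ao₂_le_off _).trans hso) (fro_mul_le hb.R₁ hd1))
  have hn1 : |frobInner ε x| ≤ 4 * errC M K * K * κ * α * ‖z‖ := by
    have hC := S.errC_pos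
    refine (abs_frobInner_le _ _).trans ((mul_le_mul hεn hxn hxn0 (by positivity)).trans ?_)
    have h1 := mul_le_mul_of_nonneg_left hκ2 (show 0 ≤ 4 * errC M K * K * α * ‖z‖ by positivity)
    linarith
  have hn2 : |frobInner (Y * z) ρ| ≤ 2 * M ^ 3 * K ^ 2 * κ * α * ‖z‖ := by
    refine (abs_frobInner_le _ _).trans ((mul_le_mul hYz hρn (norm_nonneg _) (by positivity)).trans
      ?_)
    have := mul_le_mul_of_nonneg_left hK (show 0 ≤ 2 * M ^ 3 * K * κ * α * ‖z‖ by positivity)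
    linarith
  have hn3 : 2 * M ^ 3 * (κ ^ 2 + √(F.off (w s))) * ‖z‖ * ‖x‖ ≤
      12 * M ^ 3 * K ^ 2 * κ * α * ‖z‖ := by
    have h1 : √(F.off (w s)) ≤ 2 * K * κ ^ 2 :=
      hso.trans (mul_le_mul_of_nonneg_left hακ (by positivity))
    have h2 : κ ^ 2 ≤ K * κ ^ 2 := le_mul_of_one_le_left (sq_nonneg κ) hK
    have h3 : κ ^ 2 + √(F.off (w s)) ≤ 3 * K * κ := by
      have := mul_le_mul_of_nonneg_left hκ2 (show 0 ≤ 3 * K by positivity)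
      linarith
    have h4 := mul_le_mul h3 hxn hxn0 (by positivity)
    have h5 := mul_le_mul_of_nonneg_left h4 (show 0 ≤ 2 * M ^ 3 * ‖z‖ by positivity)
    linarith
  have hn5 : |F.σ₂ ^ 2 * frobInner (F.b (w s)) z * frobInner (F.a (w s) - F.b (w s)) x| ≤
      6 * M ^ 3 * K ^ 2 * κ * α * ‖z‖ := by
    have h1 : |frobInner (F.a (w s) - F.b (w s)) x| ≤ 3 * K * α * (2 * K * α) :=
      (abs_frobInner_le _ _).trans (mul_le_mul hab hxn hxn0 (by positivity))
    rw [abs_mul, abs_mul, abs_of_nonneg (sq_nonneg F.σ₂)]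
    refine (mul_le_mul (mul_le_mul (pow_le_pow_left₀ S.σ₂_pos.le hb.σ₂ 2) hzb (abs_nonneg _)
      (by positivity)) h1 (abs_nonneg _) (by positivity)).trans ?_
    have := mul_le_mul_of_nonneg_left (hακ.trans hκ2)
      (show 0 ≤ 6 * M ^ 3 * K ^ 2 * α * ‖z‖ by positivity)
    linarith
  rw [← hY] at hinner
  generalize frobInner (Y * z) (Y * x) = I at *
  generalize frobInner (F.b (w s)) z = β at *
  generalize frobInner (F.b (w s)) x = β' at *
  generalize frobInner (F.a (w s) - F.b (w s)) x = ω at *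
  generalize frobInner (Y * z) ρ = ι at *
  generalize frobInner ε x = ε' at *
  generalize frobInner z x = φ at *
  have hfin : F.σ₂ * F.e (w s) * φ + ε' + -(I + ι) -
      (F.σ₂ * F.e (w s) - F.σ₂ ^ 2 * β / 2) * φ =
      ε' - ι - (I - F.σ₂ ^ 2 * (β * β')) + F.σ₂ ^ 2 * β * ω / 2 := by
    linear_combination -(F.σ₂ ^ 2 * β / 2) * hbx
  rw [hfin]
  have h1 := abs_le.1 hn1
  have h2 := abs_le.1 hn2
  have h3 := abs_le.1 (hinner.trans hn3)
  have h5 := abs_le.1 hn5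
  rw [abs_le]
  constructor <;> linarith [h1.1, h1.2, h2.1, h2.2, h3.1, h3.2, h5.1, h5.2]

end Setting

end AlignedModel

end TransverseGrowth

/-! ### Lower bound for the defect when n is at least two -/

section TransverseLowerBound

open scoped Matrix.Norms.Frobenius

/-- The scalar computation for `φ² / q * exp (c q)`. The common growth rate `f` cancels in `φ² / q`,
and the damping `β` is compensated by the weight, because `β` is at most `c` times the velocity of
`q`. Only the errors remain. -/
theorem neg_le_ratio_velocity {φ q f β η θ c N P Q E : ℝ} (hq : 0 < q) (hE : 0 ≤ E)
    (hN : 0 ≤ N) (hφ : |φ| ≤ √q * N) (hη : |η| ≤ P * √q) (hθ : |θ| ≤ Q * q)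
    (hc : β ≤ c * (2 * f * q + θ)) :
    -((2 * N * P + Q * N ^ 2) * E) ≤
      (2 * φ * ((f - β / 2) * φ + η) * q - φ ^ 2 * (2 * f * q + θ)) / q ^ 2 * E +
        φ ^ 2 / q * (E * (c * (2 * f * q + θ))) := by
  have hqq : √q * √q = q := Real.mul_self_sqrt hq.le
  have h1 : (2 * φ * ((f - β / 2) * φ + η) * q - φ ^ 2 * (2 * f * q + θ)) / q ^ 2 * E +
        φ ^ 2 / q * (E * (c * (2 * f * q + θ))) =
      E * (φ ^ 2 / q * (c * (2 * f * q + θ) - β) + 2 * (φ * η / q) - θ * φ ^ 2 / q ^ 2) := by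
    field_simp
    ring
  have h2 : 0 ≤ φ ^ 2 / q * (c * (2 * f * q + θ) - β) :=
    mul_nonneg (by positivity) (by linarith)
  have h3 : -(N * P) ≤ φ * η / q := by
    rw [le_div_iff₀ hq]
    have : |φ * η| ≤ √q * N * (P * √q) := by
      rw [abs_mul]
      exact mul_le_mul hφ hη (abs_nonneg _) (by positivity)
    have h4 : √q * N * (P * √q) = N * P * q := by
      linear_combination (N * P) * hqq
    linarith [(abs_le.1 this).1]
  have h5 : θ * φ ^ 2 / q ^ 2 ≤ Q * N ^ 2 := by
    rw [div_le_iff₀ (by positivity)]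
    have h6 : φ ^ 2 ≤ q * N ^ 2 := by
      have := pow_le_pow_left₀ (abs_nonneg _) hφ 2
      rwa [sq_abs, mul_pow, Real.sq_sqrt hq.le] at this
    have h7 : |θ * φ ^ 2| ≤ Q * q * (q * N ^ 2) := by
      rw [abs_mul, abs_of_nonneg (sq_nonneg φ)]
      exact mul_le_mul hθ h6 (sq_nonneg _) ((abs_nonneg _).trans hθ)
    calc _ ≤ Q * q * (q * N ^ 2) := (le_abs_self _).trans h7
      _ = Q * N ^ 2 * q ^ 2 := by ring
  rw [h1]
  have := mul_le_mul_of_nonneg_left (show -(2 * N * P + Q * N ^ 2) ≤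
    φ ^ 2 / q * (c * (2 * f * q + θ) - β) + 2 * (φ * η / q) - θ * φ ^ 2 / q ^ 2 by linarith) hE
  linarith

/-- Solves the tested singular vector equation for `φ`. A defect of at most 1/2 keeps the
coefficient `τ / 2` at least 1/2 in absolute value. -/
theorem sq_le_of_mul_eq {s ι τ φ ω Δ M : ℝ} (h : s * ι = τ / 2 * φ + ω) (hτ : τ ^ 2 = 2 * (1 - Δ))
    (hΔ0 : 0 ≤ Δ) (hΔ : Δ ≤ 1 / 2) (hι : ι ^ 2 ≤ Δ) (hs0 : 0 ≤ s) (hs : s ≤ 2 * M ^ 2)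
    (hω : ω ^ 2 ≤ Δ) (hM : 1 ≤ M) : φ ^ 2 ≤ 40 * M ^ 4 * Δ := by
  have e2 : (s * ι) ^ 2 ≤ 4 * M ^ 4 * Δ := by
    rw [mul_pow]
    have h2 := pow_le_pow_left₀ hs0 hs 2
    have h3 := mul_le_mul h2 hι (sq_nonneg _) (by positivity)
    linarith
  have e3 : (τ / 2 * φ) ^ 2 ≤ 2 * (s * ι) ^ 2 + 2 * ω ^ 2 := by
    have : τ / 2 * φ = s * ι - ω := by linarith
    rw [this]
    linarith [sq_nonneg (s * ι + ω), sq_nonneg (s * ι - ω), add_sq (s * ι) ω, sub_sq (s * ι) ω]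
  have e4 : φ ^ 2 / 4 ≤ (τ / 2 * φ) ^ 2 := by
    have : (τ / 2 * φ) ^ 2 = τ ^ 2 / 4 * φ ^ 2 := by ring
    rw [this, hτ]
    have := mul_le_mul_of_nonneg_right hΔ (sq_nonneg φ)
    linarith
  have e5 : Δ ≤ M ^ 4 * Δ := le_mul_of_one_le_left hΔ0 (one_le_pow₀ hM)
  linarith

namespace AlignedModel

variable {m n h r : ℕ} {F : AlignedModel m n h} {d : Matrix (Fin n) Unit ℝ}

/-- The constant in the error term of `transverse_ratio`. -/
noncomputable def ratioC (F : AlignedModel m n h) (M K : ℝ) : ℝ :=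
  (4 * K * (4 * errC M K * K + 20 * M ^ 3 * K ^ 2) + 16 * errC M K * K ^ 2) *
    Real.exp (2 * F.σ₂ / F.σ * (4 * M))

namespace Setting

variable {w : ℝ → LoRAWeights m n h r} {K M α κ T C T₁ : ℝ}
  (S : F.Setting w K M α κ T C) (A : F.AlignedAt w κ T T₁)

include S

theorem ratioC_pos : 0 < F.ratioC M K := by
  have hM := S.one_le_M
  have hK := S.one_le_K
  have hC := S.errC_pos
  unfold ratioC
  positivity

include A

/-- The component of `A₁ d` along `a + b` does not shrink during the alignment phase. -/
theorem transverse_ratio (hd : F.vᵀ * d = 0) (hd1 : ‖d‖ ≤ 1) :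
    frobInner (F.a (w 0)) ((w 0).A₁ * d) ^ 2 / ‖F.a (w 0)‖ ^ 2 - F.ratioC M K * κ * T * α ^ 2 ≤
      frobInner (F.a (w T₁) + F.b (w T₁)) ((w T₁).A₁ * d) ^ 2 / ‖F.a (w T₁) + F.b (w T₁)‖ ^ 2 *
        Real.exp (2 * F.σ₂ / F.σ * (4 * M)) := by
  have hM := S.one_le_M
  have hK := S.one_le_K
  have hα := S.α_pos
  have hκ := S.κ_pos
  have hσ := S.σ_pos
  have hσ₂ := S.σ₂_pos
  have hC := S.errC_pos
  have hκ2 : κ ^ 2 ≤ κ := by nlinarith [S.κ_le_one]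
  have hlt := A.le_T
  choose! ηq hηq using fun s (hs : s ∈ Icc 0 T₁) => S.q_velocity hlt A.early hs
  choose! η hη using fun s (hs : s ∈ Icc 0 T₁) => S.transverse_velocity hlt A.early hd hd1 hs
  set C₁ := 4 * errC M K * K + 20 * M ^ 3 * K ^ 2 with hC₁
  have hC₁0 : 0 < C₁ := by positivity
  set q : ℝ → ℝ := fun s => ‖F.a (w s) + F.b (w s)‖ ^ 2 with hq
  set φ : ℝ → ℝ := fun s => frobInner (F.a (w s) + F.b (w s)) ((w s).A₁ * d) with hφ
  -- Chosen so that `c` times the guaranteed growth `σ σ₂ q / 2` equals `σ₂² q`, which dominates the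
  -- damping coefficient.
  set c := 2 * F.σ₂ / F.σ with hc
  have hc0 : 0 < c := by positivity
  have hqpos : ∀ s ∈ Icc 0 T₁, 0 < q s := fun s hs =>
    S.q_pos hs.1 (hs.2.trans hlt) fun τ hτ => A.early τ ⟨hτ.1, hτ.2.trans hs.2⟩
  have hexp : ∀ s ∈ Icc 0 T₁, Real.exp (c * q s) ≤ Real.exp (c * (4 * M)) := fun s hs =>
    Real.exp_le_exp.2 (mul_le_mul_of_nonneg_left (S.q_le hs.1 (A.early s hs).toGood) hc0.le)
  have h1 := add_mul_le_of_le_hasDerivWithinAt (c := -(F.ratioC M K * κ * α ^ 2)) le_rfl A.nonneg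
    (fun s hs => (((hη s hs).1.fun_pow 2).fun_div (hηq s hs).1 (hqpos s hs).ne').fun_mul
      (((hηq s hs).1.const_mul c).exp)) fun s hs => by
      have hs' : s ∈ Icc 0 T₁ := ⟨hs.1.le, hs.2.le⟩
      obtain ⟨hb, ho, he, -, -, -⟩ := S.early_facts hlt A.early hs'
      have hp := S.p_nonneg hs.1.le (hs.2.le.trans hlt) fun τ hτ =>
        A.early τ ⟨hτ.1, hτ.2.trans hs.2.le⟩
      have hsq : √(q s) = ‖F.a (w s) + F.b (w s)‖ := Real.sqrt_sq (norm_nonneg _)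
      have hx : ‖(w s).A₁ * d‖ ≤ 2 * K * α := by
        rw [A₁_mul_of_orthogonal hd]
        have hso : √(F.off (w s)) ≤ 2 * K * α := Real.sqrt_le_iff.2 ⟨by positivity, ho⟩
        simpa using fro_mul_le ((F.norm_Ao₁_le_off (w s)).trans hso) hd1
      have hbz : frobInner (F.b (w s)) (F.a (w s) + F.b (w s)) ≤ q s := by
        simp only [hq]
        rw [frobInner_add_right, frobInner_comm, ← AlignedModel.p, frobInner_self,
          norm_add_sq_frob, ← AlignedModel.p]
        nlinarith [sq_nonneg ‖F.a (w s)‖]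
      have hq' := S.le_q_velocity he (hqpos s hs').le (hηq s hs').2
      have hcq : F.σ₂ ^ 2 * frobInner (F.b (w s)) (F.a (w s) + F.b (w s)) ≤
          c * (2 * (F.σ₂ * F.e (w s)) * q s + ηq s) := by
        have e1 := mul_le_mul_of_nonneg_left hq' hc0.le
        have e2 : c * (F.σ * F.σ₂ / 2 * q s) = F.σ₂ ^ 2 * q s := by
          rw [hc]
          field_simp
        have e3 := mul_le_mul_of_nonneg_left hbz (sq_nonneg F.σ₂)
        linarith
      have key := neg_le_ratio_velocity (hqpos s hs') (Real.exp_pos (c * q s)).le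
        (show 0 ≤ 2 * K * α by positivity)
        (φ := φ s) (by
          rw [hsq]
          exact (abs_frobInner_le _ _).trans (mul_le_mul_of_nonneg_left hx (norm_nonneg _)))
        (η := η s) (by rw [hsq]; exact (hη s hs').2) (hηq s hs').2 hcq
      have e4 : (2 * (2 * K * α) * (C₁ * κ * α) + 4 * errC M K * κ ^ 2 * (2 * K * α) ^ 2) *
          Real.exp (c * q s) ≤ F.ratioC M K * κ * α ^ 2 := by
        have e5 : 2 * (2 * K * α) * (C₁ * κ * α) + 4 * errC M K * κ ^ 2 * (2 * K * α) ^ 2 ≤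
            (4 * K * C₁ + 16 * errC M K * K ^ 2) * κ * α ^ 2 := by
          have := mul_le_mul_of_nonneg_left hκ2
            (show 0 ≤ 16 * errC M K * K ^ 2 * α ^ 2 by positivity)
          linarith
        refine (mul_le_mul e5 (hexp s hs') (Real.exp_pos _).le (by positivity)).trans_eq ?_
        rw [ratioC]
        ring
      refine (neg_le_neg e4).trans (key.trans_eq ?_)
      simp only [Nat.cast_ofNat, Nat.add_one_sub_one, pow_one]
      rfl
  have h0 : F.b (w 0) = 0 := by simp [b, S.B₁_zero]
  have hφ0 : φ 0 = frobInner (F.a (w 0)) ((w 0).A₁ * d) := by simp only [hφ, h0, add_zero]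
  have hq0 : q 0 = ‖F.a (w 0)‖ ^ 2 := by simp only [hq, h0, add_zero]
  have hT : (0 : ℝ) ≤ T₁ := A.nonneg
  have h2 : φ 0 ^ 2 / q 0 * 1 ≤ φ 0 ^ 2 / q 0 * Real.exp (c * q 0) := by
    have h0' := hqpos 0 ⟨le_rfl, hT⟩
    refine mul_le_mul_of_nonneg_left (Real.one_le_exp ?_) ?_ <;> positivity
  have h3 : φ T₁ ^ 2 / q T₁ * Real.exp (c * q T₁) ≤ φ T₁ ^ 2 / q T₁ * Real.exp (c * (4 * M)) := by
    have h0' := hqpos T₁ ⟨hT, le_rfl⟩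
    exact mul_le_mul_of_nonneg_left (hexp T₁ ⟨hT, le_rfl⟩) (by positivity)
  have h4 : F.ratioC M K * κ * α ^ 2 * T₁ ≤ F.ratioC M K * κ * α ^ 2 * T := by
    have := S.ratioC_pos
    exact mul_le_mul_of_nonneg_left hlt (by positivity)
  rw [← hφ0, ← hq0]
  linarith

/-- The weights are `Early` at the alignment time, with all the bounds this entails. -/
theorem off_le_of_mem {t : ℝ} (ht : t ∈ Icc T₁ T) : F.off (w t) ≤ (2 * K * α) ^ 2 :=
  S.off_le (A.nonneg.trans ht.1) ht.2 fun s hs => S.good A s ⟨hs.1, hs.2.le.trans ht.2⟩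

theorem thr_le_sq {t : ℝ} (ht : t ∈ Icc T₁ T) {s : ℝ} {qB : Matrix (Fin h) Unit ℝ}
    {qA : Matrix (Fin n) Unit ℝ} (hx : F.IsTop (w t) s qB qA) : F.thr ≤ s ^ 2 := by
  have h1 := (S.late A t ht).p
  have h2 := hx.le
  have h3 := norm_sub_sq_frob (F.a (w t)) (F.b (w t))
  rw [norm_add_sq_frob, ← AlignedModel.p] at h2
  rw [← AlignedModel.p] at h3
  nlinarith [sq_nonneg ‖F.a (w t) - F.b (w t)‖]

theorem sq_le_of_isTop {t : ℝ} (ht : t ∈ Icc T₁ T) {s : ℝ} {qB : Matrix (Fin h) Unit ℝ}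
    {qA : Matrix (Fin n) Unit ℝ} (hx : F.IsTop (w t) s qB qA) : s ^ 2 ≤ 2 * M ^ 2 := by
  have hb := S.bounded (A.nonneg.trans ht.1) (S.late A t ht).toGood
  have h1 := pow_le_pow_left₀ (norm_nonneg _) hb.A₁ 2
  have h2 := pow_le_pow_left₀ (norm_nonneg _) hb.B₁ 2
  linarith [hx.le_norm]

theorem defect_le_of_misalignment_le {t : ℝ} (ht : t ∈ Icc T₁ T) {s : ℝ}
    {qB : Matrix (Fin h) Unit ℝ} {qA : Matrix (Fin n) Unit ℝ} (hx : F.IsTop (w t) s qB qA) {δ : ℝ}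
    (hδ : F.misalignment (w t) ≤ δ) : F.defect qB qA ≤ δ ^ 2 / F.thr := by
  have h1 := S.thr_le_sq A ht hx
  have h2 := hx.defect_le
  have h3 := pow_le_pow_left₀ (F.misalignment_nonneg (w t)) hδ 2
  rw [le_div_iff₀ S.thr_pos]
  nlinarith [F.defect_nonneg hx.unit]

/-- The lower bound for the defect at the alignment time, if there are directions transverse
to `v`. -/
theorem sq_le_defect_of_transverse (hd : F.vᵀ * d = 0) (hd1 : ‖d‖ ≤ 1)
    (hgen : α ^ 2 / K ≤ |frobInner (F.a (w 0)) ((w 0).A₁ * d)|)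
    (hC₁ : 2 * K ^ 4 * F.ratioC M K ≤ C) (hC₂ : 98 * K ^ 2 / F.thr ≤ C)
    {s : ℝ} {qB : Matrix (Fin h) Unit ℝ}
    {qA : Matrix (Fin n) Unit ℝ} (hx : F.IsTop (w T₁) s qB qA) :
    α ^ 2 ≤ 20 * M ^ 4 * K ^ 4 * Real.exp (2 * F.σ₂ / F.σ * (4 * M)) / F.thr * F.defect qB qA := by
  have hM := S.one_le_M
  have hK := S.one_le_K
  have hα := S.α_pos
  have hκ := S.κ_pos
  have hthr := S.thr_pos
  have ht : T₁ ∈ Icc T₁ T := ⟨le_rfl, A.le_T⟩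
  have h1 := S.transverse_ratio A hd hd1
  have ho := S.off_le_of_mem A ht
  have hp := A.thr_le
  have hmis := S.misalignment_le A.nonneg ho (hthr.le.trans hp)
  have hΔ0 := F.defect_nonneg hx.unit
  have hΔ := S.defect_le_of_misalignment_le A ht hx hmis
  have hε := hx.norm_image_sub_le
  -- The test pair `(0; d)` is orthogonal to `(g; v)`. Its overlap with the singular vector is at
  -- most `√Δ`, while its image pairs with `a + b` to `φ`; this bounds `φ` by the defect, and
  -- `transverse_ratio` bounds `φ` below.
  have hin := hx.inner_eq 0 d
  have hdef := F.sq_le_defect hx.unit (dB := 0) (dA := d)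
    (by simpa using hd1) (by
      have h2 := congrFun (congrFun ((transpose_mul_col F.v d).symm.trans hd) ()) ()
      rw [frobInner_zero_right, zero_add]
      simpa using h2)
  have hs := S.sq_le_of_isTop A ht hx
  have hxn : ‖(w T₁).A₁ * d‖ ≤ 2 * K * α := by
    rw [A₁_mul_of_orthogonal hd]
    have hso : √(F.off (w T₁)) ≤ 2 * K * α := Real.sqrt_le_iff.2 ⟨by positivity, ho⟩
    simpa using fro_mul_le ((F.norm_Ao₁_le_off (w T₁)).trans hso) hd1
  set B := Real.exp (2 * F.σ₂ / F.σ * (4 * M)) with hB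
  set Δ := F.defect qB qA with hΔdef
  have hτ : (frobInner F.g qB + frobInner F.v qA) ^ 2 = 2 * (1 - Δ) := by
    rw [hΔdef, defect]
    ring
  set τ := frobInner F.g qB + frobInner F.v qA
  have hΔhalf : Δ ≤ 1 / 2 := by
    have h2 := S.mul_κ_le hC₂
    have h3 : α ^ 2 ≤ κ := by nlinarith [S.α_le_κ, S.α_le_one]
    have h4 : (7 * K * α) ^ 2 / F.thr = 98 * K ^ 2 / F.thr * α ^ 2 / 2 := by ring
    have h5 := mul_le_mul_of_nonneg_left h3 (show 0 ≤ 98 * K ^ 2 / F.thr by positivity)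
    linarith
  rw [Matrix.mul_zero, zero_add, frobInner_zero_left, zero_add] at hin
  rw [frobInner_zero_left, zero_add] at hdef
  set ε := (w T₁).B₁ᵀ * qB + (w T₁).A₁ * qA - (τ / 2) • (F.a (w T₁) + F.b (w T₁)) with hεdef
  have him : (w T₁).B₁ᵀ * qB + (w T₁).A₁ * qA = (τ / 2) • (F.a (w T₁) + F.b (w T₁)) + ε := by
    simp [hεdef]
  rw [him, frobInner_add_right, frobInner_smul_right, frobInner_comm _ (F.a (w T₁) + _)] at hin
  have herr : |frobInner ((w T₁).A₁ * d) ε| ≤ 14 * (K * α) ^ 2 * √Δ := by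
    refine (abs_frobInner_le _ _).trans ((mul_le_mul hxn (hε.trans
      (mul_le_mul_of_nonneg_right hmis (Real.sqrt_nonneg _))) (norm_nonneg _)
      (by positivity)).trans_eq ?_)
    ring
  have hq : 4 * F.thr ≤ ‖F.a (w T₁) + F.b (w T₁)‖ ^ 2 := by
    have h3 := norm_sub_sq_frob (F.a (w T₁)) (F.b (w T₁))
    rw [← AlignedModel.p] at h3
    rw [norm_add_sq_frob, ← AlignedModel.p]
    nlinarith [sq_nonneg ‖F.a (w T₁) - F.b (w T₁)‖]
  generalize frobInner (F.a (w T₁) + F.b (w T₁)) ((w T₁).A₁ * d) = φ at *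
  generalize frobInner ((w T₁).A₁ * d) ε = ω at *
  generalize frobInner d qA = ι at *
  generalize ‖F.a (w T₁) + F.b (w T₁)‖ ^ 2 = q at *
  generalize frobInner (F.a (w 0)) ((w 0).A₁ * d) = φ₀ at *
  have hφ : φ ^ 2 ≤ 40 * M ^ 4 * Δ := by
    have e1 : ω ^ 2 ≤ Δ := by
      have h2 := pow_le_pow_left₀ (abs_nonneg _) herr 2
      rw [sq_abs, mul_pow, Real.sq_sqrt hΔ0] at h2
      have h3 : K * α ≤ 1 / 24 := by linarith [S.Kα_le, S.κ_le]
      have h4 : (14 * (K * α) ^ 2) ^ 2 ≤ 1 := by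
        have h5 : (K * α) ^ 2 ≤ (1 / 24) ^ 2 := pow_le_pow_left₀ (by positivity) h3 2
        refine pow_le_one₀ (by positivity) ?_
        norm_num at h5
        linarith
      exact h2.trans (mul_le_of_le_one_left hΔ0 h4)
    exact sq_le_of_mul_eq hin hτ hΔ0 hΔhalf hdef (sq_nonneg s) hs e1 hM
  have hφ₀ : α ^ 2 / K ^ 4 ≤ φ₀ ^ 2 / ‖F.a (w 0)‖ ^ 2 := by
    have h2 := pow_le_pow_left₀ (norm_nonneg _) ((F.norm_a_le (w 0)).trans S.A₁_le) 2
    have h3 := pow_le_pow_left₀ (by positivity) hgen 2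
    rw [sq_abs] at h3
    rw [le_div_iff₀ (pow_pos S.norm_a_zero_pos 2)]
    calc _ ≤ α ^ 2 / K ^ 4 * (K * α) ^ 2 := mul_le_mul_of_nonneg_left h2 (by positivity)
      _ = (α ^ 2 / K) ^ 2 := by field_simp
      _ ≤ _ := h3
  -- The loss accumulated over the horizon is at most half of the initial amount `α² / K⁴`.
  have hT : F.ratioC M K * κ * T * α ^ 2 ≤ α ^ 2 / (2 * K ^ 4) := by
    have h2 := S.mul_κ_mul_le hC₁ le_rfl S.T_nonneg
    rw [le_div_iff₀ (by positivity)]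
    calc _ = 2 * K ^ 4 * F.ratioC M K * κ * T * α ^ 2 := by ring
      _ ≤ 1 * α ^ 2 := mul_le_mul_of_nonneg_right h2 (sq_nonneg _)
      _ = _ := one_mul _
  have hB0 : 0 < B := Real.exp_pos _
  have hq0 : 0 < q := by linarith
  have h2 : α ^ 2 / (2 * K ^ 4) ≤ φ ^ 2 / q * B := by
    have : α ^ 2 / (2 * K ^ 4) = α ^ 2 / K ^ 4 - α ^ 2 / (2 * K ^ 4) := by
      field_simp
      norm_num
    linarith
  have h3 : φ ^ 2 / q ≤ 40 * M ^ 4 * Δ / (4 * F.thr) := div_le_div₀ (by positivity) hφ (by positivity) hq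
  have h4 : α ^ 2 / (2 * K ^ 4) ≤ 40 * M ^ 4 * Δ / (4 * F.thr) * B :=
    h2.trans (mul_le_mul_of_nonneg_right h3 hB0.le)
  rw [div_le_iff₀ (by positivity)] at h4
  refine h4.trans_eq ?_
  field_simp
  ring

end Setting

end AlignedModel

end TransverseLowerBound

/-! ### The case of a single column, n = 1 -/

section SingleColumn

open scoped Matrix.Norms.Frobenius

namespace AlignedModel

variable {m n h r : ℕ} {F : AlignedModel m n h} {x : LoRAWeights m n h r} {M ζ : ℝ}

section Static

variable (hv : F.v * F.vᵀ = 1)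

include hv

theorem Ao₁_eq_zero : F.Ao₁ x = 0 := by
  rw [Ao₁, a, Matrix.mul_assoc, hv, Matrix.mul_one, sub_self]

theorem R₁_eq_zero : F.R₁ = 0 := by
  rw [← Matrix.mul_one F.R₁, ← hv, ← Matrix.mul_assoc, F.R₁_v, Matrix.zero_mul]

theorem Ev_eq_zero : F.Ev x = 0 := by
  rw [Ev, Ao₁_eq_zero hv, R₁_eq_zero hv]
  simp

theorem Eo_eq_neg_Eu : F.Eo x = -F.Eu x := by
  rw [Eo_eq, Ev_eq_zero hv]
  simp

theorem E_eq_sub_Eu : F.E x = F.e x • (F.u * F.vᵀ) - F.Eu x := by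
  have h : F.Eo x = -F.Eu x := Eo_eq_neg_Eu hv
  rw [Eo, sub_eq_iff_eq_add] at h
  rw [h]
  abel

/-- If there is only one column, then balance forces the first pair of weights to have rank one. -/
theorem balance_of_single_column {S : Matrix (Fin r) (Fin n) ℝ}
    (hS : x.A₁ * x.A₁ᵀ = x.B₁ᵀ * x.B₁ + S * Sᵀ) {z : Matrix (Fin r) Unit ℝ}
    (hz : frobInner (F.a x) z = 0) : x.B₁ * z = 0 ∧ Sᵀ * z = 0 := by
  have h1 := norm_A₁t_mul_sq_of_balance hS z
  rw [norm_A₁t_mul_sq (F := F), hz, Ao₁_eq_zero hv, transpose_zero, Matrix.zero_mul, norm_zero] at h1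
  constructor
  · rw [← norm_eq_zero]
    nlinarith [sq_nonneg ‖x.B₁ * z‖, sq_nonneg ‖Sᵀ * z‖]
  · rw [← norm_eq_zero]
    nlinarith [sq_nonneg ‖x.B₁ * z‖, sq_nonneg ‖Sᵀ * z‖]

/-- `a` and `b` are parallel. -/
theorem b_eq_smul_a {S : Matrix (Fin r) (Fin n) ℝ}
    (hS : x.A₁ * x.A₁ᵀ = x.B₁ᵀ * x.B₁ + S * Sᵀ) : ‖F.a x‖ ^ 2 • F.b x = F.p x • F.a x := by
  set z := ‖F.a x‖ ^ 2 • F.b x - F.p x • F.a x with hz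
  have h0 : frobInner (F.a x) z = 0 := by
    rw [hz, frobInner_sub_right, frobInner_smul_right, frobInner_smul_right, frobInner_self, p]
    ring
  have h1 := (balance_of_single_column hv hS h0).1
  have h2 : frobInner (F.b x) z = 0 := by
    rw [b, frobInner_mul_left, transpose_transpose, h1, frobInner_zero_right]
  have h3 : frobInner z z = 0 := by
    conv_lhs =>
      arg 1
      rw [hz]
    rw [frobInner_sub_left, frobInner_smul_left, frobInner_smul_left, h2, h0]
    ring
  rw [frobInner_self] at h3
  exact sub_eq_zero.1 (norm_eq_zero.1 (pow_eq_zero_iff two_ne_zero |>.1 h3))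

/-- Parallel vectors turn the inequality for `a - b` into an identity. Since `‖a‖² - p` is quadratic
in the tail and in `α`, this gains one order over the general bound. -/
theorem norm_a_mul_norm_a_sub_b {S : Matrix (Fin r) (Fin n) ℝ}
    (hS : x.A₁ * x.A₁ᵀ = x.B₁ᵀ * x.B₁ + S * Sᵀ) (ha : 0 < ‖F.a x‖) :
    ‖F.a x‖ * ‖F.a x - F.b x‖ = |‖F.a x‖ ^ 2 - F.p x| := by
  have h1 : ‖F.a x‖ ^ 2 • (F.a x - F.b x) = (‖F.a x‖ ^ 2 - F.p x) • F.a x := by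
    rw [smul_sub, b_eq_smul_a hv hS, sub_smul]
  have h2 := congrArg norm h1
  rw [norm_smul, norm_smul, Real.norm_of_nonneg (sq_nonneg _), Real.norm_eq_abs] at h2
  have : ‖F.a x‖ * (‖F.a x‖ * ‖F.a x - F.b x‖) = ‖F.a x‖ * |‖F.a x‖ ^ 2 - F.p x| := by
    linarith
  exact mul_left_cancel₀ ha.ne' this

/-- The balance along `a`. -/
theorem norm_a_pow_four {S : Matrix (Fin r) (Fin n) ℝ}
    (hS : x.A₁ * x.A₁ᵀ = x.B₁ᵀ * x.B₁ + S * Sᵀ) :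
    (‖F.a x‖ ^ 2 - F.p x) * (‖F.a x‖ ^ 2 + F.p x) = ‖F.Bo₁ x * F.a x‖ ^ 2 + ‖Sᵀ * F.a x‖ ^ 2 := by
  have h1 := norm_A₁t_mul_sq_of_balance hS (F.a x)
  rw [norm_A₁t_mul_sq (F := F), norm_B₁_mul_sq (F := F), Ao₁_eq_zero hv, transpose_zero,
    Matrix.zero_mul, norm_zero, frobInner_self, frobInner_comm, ← p] at h1
  linarith

theorem p_le_norm_a_sq {S : Matrix (Fin r) (Fin n) ℝ}
    (hS : x.A₁ * x.A₁ᵀ = x.B₁ᵀ * x.B₁ + S * Sᵀ) : F.p x ≤ ‖F.a x‖ ^ 2 := by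
  have h1 := norm_a_pow_four hv hS
  by_contra! hcon
  nlinarith [sq_nonneg ‖F.Bo₁ x * F.a x‖, sq_nonneg ‖Sᵀ * F.a x‖, sq_nonneg ‖F.a x‖]

/-- The term of first order in the orthogonal components contains `Ao₁`, which vanishes here; the
remaining one is quadratic. -/
theorem Bounded.norm_err_c_le (hx : F.Bounded x M ζ) (hσ : |F.σ₁ + F.p x| ≤ 2 * M ^ 2) :
    ‖F.err_c x‖ ≤ 4 * M ^ 4 * F.off x := by
  have hM := hx.M_nonneg
  rw [err_c_eq, Ao₁_eq_zero hv, transpose_zero, Matrix.zero_mul, Matrix.mul_zero, Matrix.mul_zero,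
    add_zero, norm_neg, norm_smul, Real.norm_eq_abs]
  have ho := F.off_nonneg x
  have hsq : √(F.off x) * √(F.off x) = F.off x := Real.mul_self_sqrt ho
  have h1 : ‖F.Eu x‖ ≤ 2 * M ^ 2 * √(F.off x) := by
    refine hx.norm_Eu_le.trans ?_
    have := add_le_add (F.norm_Bo₁_le_off x) (F.norm_Bo₂_le_off x)
    have := mul_le_mul_of_nonneg_left this (sq_nonneg M)
    linarith
  have h2 : ‖(F.Bo₂ x)ᵀ * (F.Eu x * F.v)‖ ≤ √(F.off x) * (2 * M ^ 2 * √(F.off x) * 1) :=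
    fro_mul_le ((frobenius_norm_transpose _).le.trans (F.norm_Bo₂_le_off x))
      (fro_mul_le h1 F.norm_v.le)
  refine (mul_le_mul hσ h2 (norm_nonneg _) (by positivity)).trans_eq ?_
  linear_combination 4 * M ^ 4 * hsq

theorem Bounded.norm_err_y_le (hx : F.Bounded x M ζ) : ‖F.err_y x‖ ≤ 4 * M ^ 4 * F.off x := by
  have hM := hx.one_le
  have ho := F.off_nonneg x
  have hsq : √(F.off x) * √(F.off x) = F.off x := Real.mul_self_sqrt ho
  rw [err_y_eq, Ev_eq_zero hv, transpose_zero, Matrix.zero_mul, Matrix.mul_zero, Matrix.mul_zero,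
    sub_zero, norm_smul, Real.norm_eq_abs]
  have h2 : ‖F.Ao₂ x * (F.Bo₁ x * F.a x)‖ ≤ √(F.off x) * (√(F.off x) * M) :=
    fro_mul_le (F.norm_Ao₂_le_off x) (fro_mul_le (F.norm_Bo₁_le_off x)
      ((F.norm_a_le x).trans hx.A₁))
  refine (mul_le_mul hx.abs_e_le h2 (norm_nonneg _) (by positivity)).trans ?_
  have h3 : M * (√(F.off x) * (√(F.off x) * M)) = M ^ 2 * F.off x := by
    linear_combination M ^ 2 * hsq
  rw [h3]
  refine mul_le_mul_of_nonneg_right ?_ ho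
  have : M ^ 2 ≤ M ^ 4 := pow_le_pow_right₀ hM (by norm_num)
  nlinarith [sq_nonneg M]

/-- The growth of the components orthogonal to `g` and `u`. -/
theorem Bounded.tail_velocity_le (hx : F.Bounded x M ζ) :
    2 * frobInner (F.Bo₁ x) (F.dB₁ x) + 2 * frobInner (F.Bo₂ x) (F.dB₂ x) ≤
      (4 * M ^ 3 * ζ ^ 2 + |F.e x| * ‖F.a x‖) * (‖F.Bo₁ x‖ ^ 2 + ‖F.Bo₂ x‖ ^ 2) +
        |F.e x| * ‖F.a x‖ * (‖F.y x‖ ^ 2 * ‖F.Ao₂ x‖ ^ 2) := by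
  have hM := hx.M_nonneg
  have hζ := hx.ζ_nonneg
  -- With `n = 1` the residual is `e u vᵀ - Eu`. The tail is therefore driven only through `y` and
  -- `Ao₂`, and the rest is proportional to the tail itself.
  have hE : frobInner (x.B₂ * (F.Ao₂ x * (F.Bo₁ x * x.A₁))) (F.E x) =
      F.e x * frobInner (F.y x) (F.Ao₂ x * (F.Bo₁ x * F.a x)) -
        frobInner (x.B₂ * (F.Ao₂ x * (F.Bo₁ x * x.A₁))) (F.Eu x) := by
    rw [E_eq_sub_Eu hv, frobInner_sub_right, frobInner_smul_right, frobInner_comm _ (F.u * F.vᵀ),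
      frobInner_col_mul, y, frobInner_mul_left x.B₂ᵀ, transpose_transpose, a]
    simp only [Matrix.mul_assoc]
  rw [frobInner_Bo₁_dB₁, frobInner_Bo₂_dB₂, hE]
  have h1 : |frobInner (F.y x) (F.Ao₂ x * (F.Bo₁ x * F.a x))| ≤
      ‖F.y x‖ * (‖F.Ao₂ x‖ * (‖F.Bo₁ x‖ * ‖F.a x‖)) := (abs_frobInner_le _ _).trans
    (mul_le_mul_of_nonneg_left (fro_mul_le le_rfl (fro_mul_le le_rfl le_rfl)) (norm_nonneg _))
  have h2 : |F.e x * frobInner (F.y x) (F.Ao₂ x * (F.Bo₁ x * F.a x))| ≤ |F.e x| * ‖F.a x‖ *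
      (‖F.Bo₁ x‖ ^ 2 / 2 + ‖F.y x‖ ^ 2 * ‖F.Ao₂ x‖ ^ 2 / 2) := by
    rw [abs_mul, mul_assoc]
    refine mul_le_mul_of_nonneg_left (h1.trans ?_) (abs_nonneg _)
    have : ‖F.y x‖ * ‖F.Ao₂ x‖ * ‖F.Bo₁ x‖ ≤ ‖F.Bo₁ x‖ ^ 2 / 2 + ‖F.y x‖ ^ 2 * ‖F.Ao₂ x‖ ^ 2 / 2 := by
      nlinarith [sq_nonneg (‖F.y x‖ * ‖F.Ao₂ x‖ - ‖F.Bo₁ x‖)]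
    have := mul_le_mul_of_nonneg_left this (norm_nonneg (F.a x))
    linarith
  have h3 : |frobInner (x.B₂ * (F.Ao₂ x * (F.Bo₁ x * x.A₁))) (F.Eu x)| ≤
      2 * M ^ 3 * ζ ^ 2 * (‖F.Bo₁ x‖ ^ 2 + ‖F.Bo₂ x‖ ^ 2) := by
    refine (abs_frobInner_le _ _).trans ((mul_le_mul (fro_mul_le hx.B₂ (fro_mul_le
      ((F.norm_Ao₂_le x).trans hx.A₂) (fro_mul_le le_rfl hx.A₁))) hx.norm_Eu_le (norm_nonneg _)
      (by positivity)).trans ?_)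
    have : ‖F.Bo₁ x‖ * (‖F.Bo₁ x‖ + ‖F.Bo₂ x‖) ≤ 2 * (‖F.Bo₁ x‖ ^ 2 + ‖F.Bo₂ x‖ ^ 2) := by
      nlinarith [sq_nonneg (‖F.Bo₁ x‖ - ‖F.Bo₂ x‖), sq_nonneg ‖F.Bo₂ x‖]
    have := mul_le_mul_of_nonneg_left this (show 0 ≤ M ^ 3 * ζ ^ 2 by positivity)
    linarith
  set P := F.R₂ * (F.Bo₁ x * x.A₁)
  set Q := F.Bo₂ x * (x.A₂ * F.X₁ x)
  have h4 := norm_add_sq_frob P Q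
  have h5 := sq_nonneg ‖P + Q‖
  rw [frobInner_comm Q P]
  have h6 : 0 ≤ |F.e x| * ‖F.a x‖ * ‖F.Bo₂ x‖ ^ 2 := by positivity
  have h7 := (le_abs_self _).trans h2
  have h8 := (neg_le_abs _).trans h3
  generalize frobInner (F.y x) (F.Ao₂ x * (F.Bo₁ x * F.a x)) = i₁ at *
  generalize frobInner (x.B₂ * (F.Ao₂ x * (F.Bo₁ x * x.A₁))) (F.Eu x) = i₂ at *
  linarith

end Static

namespace Setting

variable {w : ℝ → LoRAWeights m n h r} {K α κ T C T₁ : ℝ}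
  (S : F.Setting w K M α κ T C) (A : F.AlignedAt w κ T T₁)

/-- The bound for the growth of the components orthogonal to `g` and `u`. -/
noncomputable def tailC (F : AlignedModel m n h) (M : ℝ) : ℝ :=
  Real.exp (8 * M / F.σ₂ + 1) * Real.exp (2 * F.σ * M / F.rate + 1)

include S A

/-- An upper bound for the components orthogonal to `g` and `u`, in terms of bounds `Z` for `y` and
`O` for `A₂` on the complement of `g`. -/
theorem tail_le (hv : F.v * F.vᵀ = 1) (hC₁ : 4 * M ^ 3 ≤ C)
    (hC₂ : 4 * M ^ 3 + 32 * M ^ 7 * K / F.rate ≤ C) {Z O : ℝ}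
    (hZ : ∀ t ∈ Icc 0 T, ‖F.y (w t)‖ ^ 2 ≤ Z) (hO : ∀ t ∈ Icc 0 T, ‖F.Ao₂ (w t)‖ ^ 2 ≤ O) {t : ℝ}
    (ht : t ∈ Icc 0 T) :
    ‖F.Bo₁ (w t)‖ ^ 2 + ‖F.Bo₂ (w t)‖ ^ 2 ≤ tailC F M * (Z * O) := by
  have hM := S.one_le_M
  have hK := S.one_le_K
  have hσ := S.σ_pos
  have hσ₂ := S.σ₂_pos
  have hr := S.rate_pos
  have hα := S.α_pos
  have hκ := S.κ_pos
  have hκ2 : κ ^ 2 ≤ κ := by nlinarith [S.κ_le_one]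
  have hT0 := S.T_nonneg
  have hZO : ∀ s ∈ Icc 0 T, ‖F.y (w s)‖ ^ 2 * ‖F.Ao₂ (w s)‖ ^ 2 ≤ Z * O := fun s hs =>
    mul_le_mul (hZ s hs) (hO s hs) (by positivity) ((sq_nonneg _).trans (hZ s hs))
  have hZO0 : 0 ≤ Z * O := (by positivity : (0 : ℝ) ≤ _).trans (hZO t ht)
  -- Adding the constant `Z * O` makes the driven inequality homogeneous, so that Grönwall applies
  -- and the initial value is `Z * O`.
  set G : ℝ → ℝ := fun s => ‖F.Bo₁ (w s)‖ ^ 2 + ‖F.Bo₂ (w s)‖ ^ 2 + Z * O with hG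
  have hG' : ∀ s, 0 ≤ s → HasDerivWithinAt G (2 * frobInner (F.Bo₁ (w s)) (F.dB₁ (w s)) +
      2 * frobInner (F.Bo₂ (w s)) (F.dB₂ (w s))) (Ici 0) s := fun s hs =>
    ((S.flow.norm_Bo₁_sq hs).add (S.flow.norm_Bo₂_sq hs)).add_const _
  have hG0 : ∀ s, 0 ≤ G s := fun s => by positivity
  have hvel : ∀ s ∈ Icc 0 T, ∀ μ, |F.e (w s)| * ‖F.a (w s)‖ ≤ μ →
      2 * frobInner (F.Bo₁ (w s)) (F.dB₁ (w s)) + 2 * frobInner (F.Bo₂ (w s)) (F.dB₂ (w s)) ≤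
        (4 * M ^ 3 * κ + μ) * G s := fun s hs μ hμ => by
    have hb := S.bounded hs.1 (S.good A s hs)
    refine (hb.tail_velocity_le hv).trans ?_
    have hμ0 : 0 ≤ |F.e (w s)| * ‖F.a (w s)‖ := by positivity
    have h1 := mul_le_mul hμ (hZO s hs) (by positivity) (hμ0.trans hμ)
    have h2 : 4 * M ^ 3 * κ ^ 2 ≤ 4 * M ^ 3 * κ := mul_le_mul_of_nonneg_left hκ2 (by positivity)
    have h3 := mul_le_mul_of_nonneg_right (add_le_add h2 hμ)
      (show 0 ≤ ‖F.Bo₁ (w s)‖ ^ 2 + ‖F.Bo₂ (w s)‖ ^ 2 by positivity)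
    have h4 : 0 ≤ 4 * M ^ 3 * κ * (Z * O) := by positivity
    simp only [hG]
    linarith
  have hearly : ∀ s ∈ Icc 0 T₁, G s ≤ Z * O * Real.exp (8 * M / F.σ₂ + 1) := by
    intro s hs
    have hsT := hs.2.trans A.le_T
    have hE : ∀ τ ∈ Icc 0 s, F.Early κ (‖F.a (w 0)‖ ^ 2) (w τ) := fun τ hτ =>
      A.early τ ⟨hτ.1, hτ.2.trans hs.2⟩
    choose! η hη using fun τ (hτ : τ ∈ Icc 0 s) => S.q_velocity hsT hE hτ
    have hqpos : ∀ τ ∈ Icc 0 s, 0 < ‖F.a (w τ) + F.b (w τ)‖ ^ 2 := fun τ hτ =>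
      S.q_pos hτ.1 (hτ.2.trans hsT) fun τ' hτ' => hE τ' ⟨hτ'.1, hτ'.2.trans hτ.2⟩
    -- The rate is at most `σ ‖a + b‖`. As `‖a + b‖` grows exponentially, its time integral is
    -- bounded by a multiple of its current value, hence by a constant independent of `α`.
    have hμ : ∀ τ ∈ Icc 0 s, HasDerivWithinAt
        (fun τ => 4 / F.σ₂ * √(‖F.a (w τ) + F.b (w τ)‖ ^ 2) + 4 * M ^ 3 * κ * τ)
        (4 / F.σ₂ * ((2 * (F.σ₂ * F.e (w τ)) * ‖F.a (w τ) + F.b (w τ)‖ ^ 2 + η τ) /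
          (2 * √(‖F.a (w τ) + F.b (w τ)‖ ^ 2))) + 4 * M ^ 3 * κ) (Ici 0) τ := fun τ hτ =>
      (((hη τ hτ).1.sqrt (hqpos τ hτ).ne').const_mul _).add
        (by simpa using (hasDerivWithinAt_id τ (Ici 0)).const_mul (4 * M ^ 3 * κ))
    have h1 := le_mul_exp_of_hasDerivWithinAt_le le_rfl hs.1 (fun τ hτ => hG' τ hτ.1) hμ
      fun τ hτ => by
        have hτ' : τ ∈ Icc 0 s := ⟨hτ.1.le, hτ.2.le⟩
        obtain ⟨hb, ho, he, heσ, -, -⟩ := S.early_facts hsT hE hτ'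
        have hp := S.p_nonneg hτ'.1 (hτ'.2.trans hsT) fun τ' hτ'' =>
          hE τ' ⟨hτ''.1, hτ''.2.trans hτ'.2⟩
        rw [add_comm (4 / F.σ₂ * _)]
        refine hvel τ ⟨hτ'.1, hτ'.2.trans hsT⟩ _ ?_
        have hq := hqpos τ hτ'
        have hz : 0 < ‖F.a (w τ) + F.b (w τ)‖ := by
          by_contra hcon
          have : ‖F.a (w τ) + F.b (w τ)‖ = 0 := le_antisymm (not_lt.1 hcon) (norm_nonneg _)
          rw [this] at hq
          norm_num at hq
        have h2 := S.le_q_velocity he hq.le (hη τ hτ').2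
        rw [Real.sqrt_sq hz.le, abs_of_nonneg (by linarith)]
        have ha : ‖F.a (w τ)‖ ≤ ‖F.a (w τ) + F.b (w τ)‖ := by
          refine le_of_sq_le_sq ?_ hz.le
          rw [norm_add_sq_frob, ← AlignedModel.p]
          nlinarith [sq_nonneg ‖F.b (w τ)‖]
        have h3 : F.σ * ‖F.a (w τ) + F.b (w τ)‖ = 4 / F.σ₂ *
            (F.σ * F.σ₂ / 2 * ‖F.a (w τ) + F.b (w τ)‖ ^ 2 /
              (2 * ‖F.a (w τ) + F.b (w τ)‖)) := by
          field_simp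
          norm_num
        refine (mul_le_mul heσ ha (norm_nonneg _) hσ.le).trans (h3.le.trans ?_)
        gcongr
    have hq4 := S.q_le hs.1 (hE s ⟨hs.1, le_rfl⟩).toGood
    have h2 : √(‖F.a (w s) + F.b (w s)‖ ^ 2) ≤ 2 * M :=
      Real.sqrt_le_iff.2 ⟨by linarith, hq4.trans (by nlinarith)⟩
    have h3 := S.mul_κ_mul_le hC₁ hsT hs.1
    have hz : G 0 = Z * O := by simp [hG, Bo₁, Bo₂, b, y, S.B₁_zero, S.B₂_zero]
    rw [hz] at h1
    refine h1.trans (mul_le_mul_of_nonneg_left (Real.exp_le_exp.2 ?_) hZO0)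
    have h4 := mul_le_mul_of_nonneg_left h2 (show 0 ≤ 4 / F.σ₂ by positivity)
    have h5 : 0 ≤ 4 / F.σ₂ * √(‖F.a (w 0) + F.b (w 0)‖ ^ 2) := by positivity
    have h6 : 4 / F.σ₂ * (2 * M) = 8 * M / F.σ₂ := by ring
    linarith
  have hfin : G t ≤ tailC F M * (Z * O) := by
    rcases le_total t T₁ with h | h
    · refine (hearly t ⟨ht.1, h⟩).trans ?_
      rw [tailC, mul_comm (Z * O)]
      refine mul_le_mul_of_nonneg_right (le_mul_of_one_le_right (Real.exp_pos _).le
        (Real.one_le_exp (by positivity))) hZO0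
    · have hL := S.late A
      set c₀ := 32 * M ^ 6 * K / F.rate with hc₀
      -- After `T₁` the rate is at most `M |e|`, whose integral is bounded by the decay of `e`.
      have hμ : ∀ s ∈ Icc T₁ t, HasDerivWithinAt (fun s => -(2 * M * F.σ / F.rate) *
          Real.exp (-(F.rate / 2) * (s - T₁)) + (4 * M ^ 3 * κ + M * (c₀ * α)) * s)
          (4 * M ^ 3 * κ + M * (F.σ * Real.exp (-(F.rate / 2) * (s - T₁)) + c₀ * α)) (Ici 0) s :=
        fun s _ => by
          have h1 : HasDerivWithinAt (fun s => -(F.rate / 2) * (s - T₁)) (-(F.rate / 2))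
              (Ici 0) s := by
            simpa using ((hasDerivWithinAt_id s (Ici 0)).sub_const T₁).const_mul (-(F.rate / 2))
          have h2 : HasDerivWithinAt (fun s => (4 * M ^ 3 * κ + M * (c₀ * α)) * s)
              (4 * M ^ 3 * κ + M * (c₀ * α)) (Ici 0) s := by
            simpa using (hasDerivWithinAt_id s (Ici 0)).const_mul (4 * M ^ 3 * κ + M * (c₀ * α))
          refine ((h1.exp.const_mul _).add h2).congr_deriv ?_
          field_simp
          ring
      have h1 := le_mul_exp_of_hasDerivWithinAt_le A.nonneg h
        (fun s hs => hG' s (A.nonneg.trans hs.1)) hμ fun s hs => by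
          have hs' : s ∈ Icc T₁ T := ⟨hs.1.le, hs.2.le.trans ht.2⟩
          have hb := S.late_bounded A hL hs'
          refine hvel s ⟨A.nonneg.trans hs'.1, hs'.2⟩ _ ?_
          have he := S.abs_e_le A le_rfl hL hs'
          have heT : F.e (w T₁) ≤ F.σ := (le_abs_self _).trans (S.abs_e_le_σ A.nonneg)
          have := mul_le_mul_of_nonneg_left heT (Real.exp_pos (-(F.rate / 2) * (s - T₁))).le
          rw [mul_comm]
          exact mul_le_mul ((F.norm_a_le _).trans hb.A₁) (by linarith) (abs_nonneg _) (by linarith)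
      have h2 := S.mul_κ_mul_le hC₂ ht.2 ht.1
      have hc₀0 : 0 ≤ c₀ := by positivity
      have h3 : (4 * M ^ 3 * κ + M * (c₀ * α)) * (t - T₁) ≤ 1 := by
        refine le_trans ?_ h2
        have h4 : M * (c₀ * α) ≤ 32 * M ^ 7 * K / F.rate * κ := by
          have := mul_le_mul_of_nonneg_left S.α_le_κ (mul_nonneg (by linarith : 0 ≤ M) hc₀0)
          have h5 : M * c₀ = 32 * M ^ 7 * K / F.rate := by
            rw [hc₀]
            ring
          rw [← h5]
          linarith
        refine mul_le_mul ?_ (by linarith [A.nonneg]) (by linarith) (by positivity)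
        linarith
      have h4 : 0 ≤ 2 * M * F.σ / F.rate * Real.exp (-(F.rate / 2) * (t - T₁)) := by positivity
      refine h1.trans ((mul_le_mul (hearly T₁ ⟨A.nonneg, le_rfl⟩) (Real.exp_le_exp.2 ?_)
        (Real.exp_pos _).le (by positivity)).trans_eq
          (b := Z * O * Real.exp (8 * M / F.σ₂ + 1) * Real.exp (2 * F.σ * M / F.rate + 1)) ?_)
      · rw [sub_self, mul_zero, Real.exp_zero]
        have h5 : 2 * M * F.σ / F.rate = 2 * F.σ * M / F.rate := by ring
        linarith
      · rw [tailC]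
        ring
  simp only [hG] at hfin
  linarith

end Setting

end AlignedModel

end SingleColumn

/-! ### The second pair of weights along g and u -/

section SecondPair

open scoped Matrix.Norms.Frobenius

namespace AlignedModel

variable {m n h r : ℕ} {F : AlignedModel m n h} {M : ℝ}

/-- The rate at which `c` and `y` grow. -/
def coupling (F : AlignedModel m n h) (x : LoRAWeights m n h r) : ℝ := F.e x * (F.σ₁ + F.p x)

/-- The constant in the bound for the error terms of `c` and `y`. -/
def pairC (M K : ℝ) : ℝ := 16 * M ^ 4 * K ^ 2

/-- The constant in the bound for the error terms of the transverse components of `A₂`. -/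
def crossC (M K : ℝ) : ℝ := 40 * K ^ 4 * pairC M K + 8 * K ^ 3 * M ^ 2

/-- The combinations `c + y` and `c - y` diagonalize the system: the first grows and the second
decays, with the same rate `coupling`. -/
theorem IsFlow.c_add_y {w : ℝ → LoRAWeights m n h r} (hw : F.IsFlow w) {t : ℝ} (ht : 0 ≤ t) :
    HasMatDeriv (fun s => F.c (w s) + F.y (w s)) (F.coupling (w t) • (F.c (w t) + F.y (w t)) +
      (F.err_c (w t) + F.err_y (w t))) t :=
  ((hw.c' ht).add (hw.y' ht)).congr_deriv (by rw [smul_add, coupling]; abel)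

theorem IsFlow.c_sub_y {w : ℝ → LoRAWeights m n h r} (hw : F.IsFlow w) {t : ℝ} (ht : 0 ≤ t) :
    HasMatDeriv (fun s => F.c (w s) - F.y (w s)) (-(F.coupling (w t) • (F.c (w t) - F.y (w t))) +
      (F.err_c (w t) - F.err_y (w t))) t :=
  ((hw.c' ht).sub (hw.y' ht)).congr_deriv (by rw [smul_sub, coupling]; abel)

namespace Setting

variable {w : ℝ → LoRAWeights m n h r} {K α κ T C T₁ : ℝ}
  (S : F.Setting w K M α κ T C) (A : F.AlignedAt w κ T T₁)

include S

theorem pairC_pos : 0 < pairC M K := by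
  have := S.one_le_M
  have := S.one_le_K
  unfold pairC
  positivity

theorem one_le_pairC : 1 ≤ pairC M K := by
  have h1 : 1 ≤ M ^ 4 := one_le_pow₀ S.one_le_M
  have h2 : 1 ≤ K ^ 2 := one_le_pow₀ S.one_le_K
  unfold pairC
  nlinarith

theorem abs_σ₁_add_p_le {t : ℝ} (ht : 0 ≤ t) (hg : F.Good κ (w t)) :
    |F.σ₁ + F.p (w t)| ≤ 2 * M ^ 2 := by
  have hM := S.one_le_M
  have hb := S.bounded ht hg
  have h3 : |F.p (w t)| ≤ M * M := (abs_frobInner_le _ _).trans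
    (mul_le_mul ((F.norm_a_le _).trans hb.A₁) ((F.norm_b_le _).trans hb.B₁) (norm_nonneg _)
      (by linarith))
  refine (abs_add_le _ _).trans ?_
  rw [abs_of_nonneg S.σ₁_nonneg]
  nlinarith [S.σ₁_lt, hb.σ₂]

variable (hv : F.v * F.vᵀ = 1)

include A hv

theorem norm_err_c_le_of_mem {t : ℝ} (ht : t ∈ Icc 0 T₁) :
    ‖F.err_c (w t)‖ ≤ pairC M K * α ^ 2 := by
  have hg := (A.early t ht).toGood
  have hb := S.bounded ht.1 hg
  have ho := S.off_le ht.1 (ht.2.trans A.le_T) fun s hs => (A.early s ⟨hs.1, hs.2.le.trans ht.2⟩).toGood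
  have h1 := hb.norm_err_c_le hv (S.abs_σ₁_add_p_le ht.1 hg)
  have h2 := mul_le_mul_of_nonneg_left ho (show 0 ≤ 4 * M ^ 4 by positivity)
  unfold pairC
  linarith

theorem norm_err_y_le_of_mem {t : ℝ} (ht : t ∈ Icc 0 T₁) :
    ‖F.err_y (w t)‖ ≤ pairC M K * α ^ 2 := by
  have hg := (A.early t ht).toGood
  have hb := S.bounded ht.1 hg
  have ho := S.off_le ht.1 (ht.2.trans A.le_T) fun s hs => (A.early s ⟨hs.1, hs.2.le.trans ht.2⟩).toGood
  have h1 := hb.norm_err_y_le hv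
  have h2 := mul_le_mul_of_nonneg_left ho (show 0 ≤ 4 * M ^ 4 by positivity)
  unfold pairC
  linarith

omit hv in
theorem coupling_nonneg {t : ℝ} (ht : t ∈ Icc 0 T₁) : 0 ≤ F.coupling (w t) := by
  have hE : ∀ s ∈ Icc 0 t, F.Early κ (‖F.a (w 0)‖ ^ 2) (w s) := fun s hs =>
    A.early s ⟨hs.1, hs.2.trans ht.2⟩
  have hp := S.p_nonneg ht.1 (ht.2.trans A.le_T) hE
  have he := S.half_le_e ht.1 (A.early t ht).toGood (A.early t ht).p_le
  exact mul_nonneg (by linarith [S.σ_pos]) (add_nonneg S.σ₁_nonneg hp)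

/-- The sum `c + y` stays at least of order `α`. -/
theorem sq_le_norm_c_add_y (hC : 16 * pairC M K ^ 2 * K ^ 2 ≤ C) {t : ℝ} (ht : t ∈ Icc 0 T₁) :
    α ≤ 2 * K * ‖F.c (w t) + F.y (w t)‖ := by
  have hM := S.one_le_M
  have hK := S.one_le_K
  have hα := S.α_pos
  have hκ := S.κ_pos
  have hP := S.one_le_pairC
  set P := pairC M K with hPdef
  -- The errors contribute at worst `-4 P α² Θ` to the velocity of `Θ²`. Shifting `Θ²` by `4 P² α²`
  -- and allowing decay at rate `κ` absorbs this, since `α ≤ κ`.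
  have h1 := mul_exp_le_of_le_hasDerivWithinAt_const (c := -κ) le_rfl ht.1
    (fun s hs => (S.flow.c_add_y hs.1).norm_sq.add_const (4 * P ^ 2 * α ^ 2)) fun s hs => by
      have hs' : s ∈ Icc 0 T₁ := ⟨hs.1.le, hs.2.le.trans ht.2⟩
      have e1 := S.norm_err_c_le_of_mem A hv hs'
      have e2 := S.norm_err_y_le_of_mem A hv hs'
      have e3 := (norm_add_le _ _).trans (add_le_add e1 e2)
      have e4 := neg_le_frobInner (F.c (w s) + F.y (w s)) (F.err_c (w s) + F.err_y (w s))
      have e5 := mul_le_mul_of_nonneg_left e3 (norm_nonneg (F.c (w s) + F.y (w s)))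
      have hf := S.coupling_nonneg A hs'
      rw [frobInner_add_right, frobInner_smul_right, frobInner_self]
      set Θ := ‖F.c (w s) + F.y (w s)‖
      have e6 : 0 ≤ F.coupling (w s) * Θ ^ 2 := by positivity
      have e7 : 4 * P * (α ^ 2 * Θ) ≤ κ * Θ ^ 2 + κ * (4 * P ^ 2 * α ^ 2) := by
        have e8 : α ^ 2 * Θ ≤ κ * (α * Θ) := by
          have := mul_le_mul_of_nonneg_right S.α_le_κ (show 0 ≤ α * Θ by positivity)
          linarith
        have e9 : 4 * P * (α * Θ) ≤ Θ ^ 2 + 4 * P ^ 2 * α ^ 2 := by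
          linarith [sq_nonneg (Θ - 2 * P * α), sub_sq Θ (2 * P * α)]
        have e10 := mul_le_mul_of_nonneg_left e9 hκ.le
        have e11 := mul_le_mul_of_nonneg_left e8 (show 0 ≤ 4 * P by positivity)
        linarith
      linarith
  have hy0 : F.y (w 0) = 0 := by simp [y, S.B₂_zero]
  rw [hy0, add_zero] at h1
  have h2 := S.mul_κ_mul_le hC (ht.2.trans A.le_T) ht.1
  have hPK : 1 ≤ P ^ 2 * K ^ 2 := one_le_mul_of_one_le_of_one_le (one_le_pow₀ hP) (one_le_pow₀ hK)
  have hκt : 0 ≤ κ * t := mul_nonneg hκ.le ht.1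
  have hκt2 : κ * t ≤ 1 / 16 := by nlinarith
  have h3 := Real.add_one_le_exp (-κ * (t - 0))
  have h4 := pow_le_pow_left₀ (by positivity) S.le_c 2
  rw [div_pow] at h4
  have h5 := mul_le_mul_of_nonneg_left h3
    (show 0 ≤ ‖F.c (w 0)‖ ^ 2 + 4 * P ^ 2 * α ^ 2 by positivity)
  set X := α ^ 2 / K ^ 2 with hX
  have hX0 : 0 < X := by positivity
  have hαX : α ^ 2 = K ^ 2 * X := by
    rw [hX]
    field_simp
  have h6 : 4 * P ^ 2 * α ^ 2 * (κ * t) ≤ X / 4 := by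
    rw [hαX]
    have := mul_le_mul_of_nonneg_right h2 hX0.le
    linarith
  have h7 : X / 4 ≤ ‖F.c (w t) + F.y (w t)‖ ^ 2 := by
    have h8 : X * (1 / 2) ≤ ‖F.c (w 0)‖ ^ 2 * (1 - κ * t) :=
      mul_le_mul h4 (by linarith) (by norm_num) (sq_nonneg _)
    linarith
  refine le_of_sq_le_sq ?_ (by positivity)
  rw [hαX]
  have := mul_le_mul_of_nonneg_left h7 (show 0 ≤ 4 * K ^ 2 by positivity)
  linarith

theorem norm_c_add_y_pos (hC : 16 * pairC M K ^ 2 * K ^ 2 ≤ C) {t : ℝ} (ht : t ∈ Icc 0 T₁) :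
    0 < ‖F.c (w t) + F.y (w t)‖ := by
  have h1 := S.sq_le_norm_c_add_y A hv hC ht
  have hK := S.one_le_K
  have hα := S.α_pos
  by_contra hcon
  have : ‖F.c (w t) + F.y (w t)‖ = 0 := le_antisymm (not_lt.1 hcon) (norm_nonneg _)
  rw [this] at h1
  linarith

/-- The growth of `‖c + y‖`. -/
theorem norm_c_add_y_velocity (hC : 16 * pairC M K ^ 2 * K ^ 2 ≤ C) {t : ℝ} (ht : t ∈ Icc 0 T₁) :
    ∃ θ, HasDerivWithinAt (fun s => ‖F.c (w s) + F.y (w s)‖)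
      (F.coupling (w t) * ‖F.c (w t) + F.y (w t)‖ + θ) (Ici 0) t ∧
      |θ| ≤ 4 * K * pairC M K * α * ‖F.c (w t) + F.y (w t)‖ := by
  have hpos := S.norm_c_add_y_pos A hv hC ht
  have h1 := ((S.flow.c_add_y ht.1).norm_sq.sqrt (pow_pos hpos 2).ne')
  simp only [Real.sqrt_sq (norm_nonneg _)] at h1
  have e1 := S.norm_err_c_le_of_mem A hv ht
  have e2 := S.norm_err_y_le_of_mem A hv ht
  have e3 := (norm_add_le _ _).trans (add_le_add e1 e2)
  have e4 := abs_frobInner_le (F.c (w t) + F.y (w t)) (F.err_c (w t) + F.err_y (w t))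
  have e5 := S.sq_le_norm_c_add_y A hv hC ht
  refine ⟨frobInner (F.c (w t) + F.y (w t)) (F.err_c (w t) + F.err_y (w t)) /
    ‖F.c (w t) + F.y (w t)‖, h1.congr_deriv ?_, ?_⟩
  · rw [frobInner_add_right, frobInner_smul_right, frobInner_self]
    field_simp
  · rw [abs_div, abs_norm, div_le_iff₀ hpos]
    refine e4.trans ?_
    have hP := S.pairC_pos
    have h2 := mul_le_mul_of_nonneg_left e3 hpos.le
    have hα := S.α_pos
    have h3 := mul_le_mul_of_nonneg_left e5
      (show 0 ≤ 2 * pairC M K * α * ‖F.c (w t) + F.y (w t)‖ by positivity)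
    linarith

/-- The size of `c + y` essentially does not decrease during the alignment phase. -/
theorem norm_c_add_y_le (hC : 16 * pairC M K ^ 2 * K ^ 2 ≤ C) (hC' : 8 * K * pairC M K ≤ C)
    {s t : ℝ} (hs : 0 ≤ s) (hst : s ≤ t) (ht : t ≤ T₁) :
    ‖F.c (w s) + F.y (w s)‖ ≤ 2 * ‖F.c (w t) + F.y (w t)‖ := by
  have hK := S.one_le_K
  have hP := S.pairC_pos
  have hα := S.α_pos
  choose! θ hθ using fun τ (hτ : τ ∈ Icc 0 T₁) => S.norm_c_add_y_velocity A hv hC hτ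
  have hmem : ∀ τ ∈ Icc s t, τ ∈ Icc 0 T₁ := fun τ hτ => ⟨hs.trans hτ.1, hτ.2.trans ht⟩
  have h1 := mul_exp_le_of_le_hasDerivWithinAt_const (c := -(4 * K * pairC M K * α)) hs hst
    (fun τ hτ => (hθ τ (hmem τ hτ)).1) fun τ hτ => by
      have hτ' := hmem τ ⟨hτ.1.le, hτ.2.le⟩
      have := mul_nonneg (S.coupling_nonneg A hτ') (norm_nonneg (F.c (w τ) + F.y (w τ)))
      linarith [(abs_le.1 (hθ τ hτ').2).1]
  have h2 := S.mul_κ_mul_le hC' (ht.trans A.le_T) (hs.trans hst)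
  have h3 : 4 * K * pairC M K * α * (t - s) ≤ 1 / 2 := by
    have : 4 * K * pairC M K * α * (t - s) ≤ 4 * K * pairC M K * κ * t :=
      mul_le_mul (mul_le_mul_of_nonneg_left S.α_le_κ (by positivity)) (by linarith) (by linarith)
        (by have := S.κ_pos; positivity)
    linarith
  have h4 := Real.add_one_le_exp (-(4 * K * pairC M K * α) * (t - s))
  have h5 : 1 / 2 ≤ Real.exp (-(4 * K * pairC M K * α) * (t - s)) := by linarith
  have h6 := mul_le_mul_of_nonneg_left h5 (norm_nonneg (F.c (w s) + F.y (w s)))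
  linarith

/-- During the alignment phase, the second pair of weights is controlled by `c + y`. -/
theorem size_le_norm_c_add_y (hC : 16 * pairC M K ^ 2 * K ^ 2 ≤ C)
    (hC' : 40 * M ^ 3 * K + 16 * K * pairC M K ≤ C) {t : ℝ} (ht : t ∈ Icc 0 T₁) :
    size₂ (w t) ≤ (2 * K ^ 2 * ‖F.c (w t) + F.y (w t)‖) ^ 2 := by
  have hM := S.one_le_M
  have hK := S.one_le_K
  have hP := S.pairC_pos
  have hα := S.α_pos
  choose! θ hθ using fun τ (hτ : τ ∈ Icc 0 T₁) => S.norm_c_add_y_velocity A hv hC hτ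
  have hmem : ∀ τ ∈ Icc 0 t, τ ∈ Icc 0 T₁ := fun τ hτ => ⟨hτ.1, hτ.2.trans ht.2⟩
  have hpos : ∀ τ ∈ Icc 0 t, 0 < ‖F.c (w τ) + F.y (w τ)‖ := fun τ hτ =>
    S.norm_c_add_y_pos A hv hC (hmem τ hτ)
  set c' := 20 * M ^ 3 * K + 8 * K * pairC M K with hc'
  -- The total size grows at rate `2 coupling` up to errors, which is the growth rate of `‖c + y‖²`;
  -- hence the antiderivative `2 log ‖c + y‖`.
  have h1 := le_mul_exp_of_hasDerivWithinAt_le le_rfl ht.1 (fun s hs => S.flow.size₂ hs.1)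
    (fun s hs => (((hθ s (hmem s hs)).1.log (hpos s hs).ne').const_mul 2).add
      (by simpa using (hasDerivWithinAt_id s (Ici 0)).const_mul (c' * α) :
        HasDerivWithinAt (fun s => c' * α * s) (c' * α) (Ici 0) s)) fun s hs => by
      have hs' := hmem s ⟨hs.1.le, hs.2.le⟩
      have hg := (A.early s hs').toGood
      have hb := S.bounded hs'.1 hg
      have ho := S.sqrt_off_le hs'.1 (hs'.2.trans A.le_T) fun τ hτ =>
        (A.early τ ⟨hτ.1, hτ.2.le.trans hs'.2⟩).toGood
      refine (hb.size_velocity_le rfl).trans (mul_le_mul_of_nonneg_right ?_ (by positivity))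
      have hf := S.coupling_nonneg A hs'
      rw [← coupling, abs_of_nonneg hf]
      have e1 := mul_le_mul_of_nonneg_left ho (show 0 ≤ 10 * M ^ 3 by positivity)
      have hp := hpos s ⟨hs.1.le, hs.2.le⟩
      have e2 : (F.coupling (w s) * ‖F.c (w s) + F.y (w s)‖ + θ s) / ‖F.c (w s) + F.y (w s)‖ =
          F.coupling (w s) + θ s / ‖F.c (w s) + F.y (w s)‖ := by field_simp
      have e3 : -(4 * K * pairC M K * α) ≤ θ s / ‖F.c (w s) + F.y (w s)‖ := by
        rw [le_div_iff₀ hp]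
        linarith [(abs_le.1 (hθ s hs').2).1]
      rw [e2, hc']
      linarith
  have h2 := S.mul_κ_mul_le hC' (ht.2.trans A.le_T) ht.1
  have h3 : c' * α * t ≤ 1 / 2 := by
    have : c' * α * t ≤ c' * κ * t := mul_le_mul_of_nonneg_right
      (mul_le_mul_of_nonneg_left S.α_le_κ (by positivity)) ht.1
    linarith
  have hpt := hpos t ⟨ht.1, le_rfl⟩
  have hp0 := hpos 0 ⟨le_rfl, ht.1⟩
  have h4 : Real.exp (2 * Real.log ‖F.c (w t) + F.y (w t)‖ + c' * α * t -
      (2 * Real.log ‖F.c (w 0) + F.y (w 0)‖ + c' * α * 0)) ≤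
      ‖F.c (w t) + F.y (w t)‖ ^ 2 / ‖F.c (w 0) + F.y (w 0)‖ ^ 2 * 2 := by
    have e1 : 2 * Real.log ‖F.c (w t) + F.y (w t)‖ + c' * α * t -
      (2 * Real.log ‖F.c (w 0) + F.y (w 0)‖ + c' * α * 0) =
      Real.log (‖F.c (w t) + F.y (w t)‖ ^ 2 / ‖F.c (w 0) + F.y (w 0)‖ ^ 2) + c' * α * t := by
      rw [Real.log_div (by positivity) (by positivity), Real.log_pow, Real.log_pow]
      push_cast
      ring
    rw [e1, Real.exp_add, Real.exp_log (by positivity)]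
    exact mul_le_mul_of_nonneg_left (exp_le_two_of_le_half h3) (by positivity)
  have hs0 : AlignedModel.size₂ (w 0) ≤ (K * α) ^ 2 := by
    have := pow_le_pow_left₀ (norm_nonneg _) S.A₂_le 2
    rw [AlignedModel.size₂, S.B₂_zero]
    simpa using this
  have hy0 : F.y (w 0) = 0 := by simp [y, S.B₂_zero]
  have h5 : (α / K) ^ 2 ≤ ‖F.c (w 0) + F.y (w 0)‖ ^ 2 := by
    rw [hy0, add_zero]
    exact pow_le_pow_left₀ (by positivity) S.le_c 2
  have h6 : ‖F.c (w t) + F.y (w t)‖ ^ 2 / ‖F.c (w 0) + F.y (w 0)‖ ^ 2 ≤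
      ‖F.c (w t) + F.y (w t)‖ ^ 2 / (α / K) ^ 2 := by gcongr
  calc AlignedModel.size₂ (w t) ≤ _ := h1
    _ ≤ (K * α) ^ 2 * (‖F.c (w t) + F.y (w t)‖ ^ 2 / (α / K) ^ 2 * 2) :=
      mul_le_mul hs0 (h4.trans (by linarith)) (Real.exp_pos _).le (by positivity)
    _ = 2 * K ^ 4 * ‖F.c (w t) + F.y (w t)‖ ^ 2 := by field_simp
    _ ≤ 4 * K ^ 4 * ‖F.c (w t) + F.y (w t)‖ ^ 2 := by gcongr; norm_num
    _ = _ := by ring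

end Setting

end AlignedModel

end SecondPair

/-! ### Correlation of the second pair's components -/

section CrossTerms

open scoped Matrix.Norms.Frobenius

/-- A function that is continuous on `[0, ∞)` has an antiderivative there. -/
theorem exists_antiderivative {k : ℝ → ℝ} (hk : ∀ t, 0 ≤ t → ContinuousWithinAt k (Ici 0) t) :
    ∃ J : ℝ → ℝ, J 0 = 0 ∧ ∀ t, 0 ≤ t → HasDerivWithinAt J (k t) (Ici 0) t := by
  have hc : Continuous fun s => k (max s 0) :=
    ContinuousOn.comp_continuous (s := Ici 0) (fun t ht => hk t ht) (by fun_prop)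
      fun s => le_max_right s 0
  refine ⟨fun t => ∫ s in (0 : ℝ)..t, k (max s 0), by simp, fun t ht => ?_⟩
  have := (hc.integral_hasStrictDerivAt 0 t).hasDerivAt.hasDerivWithinAt (s := Ici 0)
  rwa [max_eq_left ht] at this

namespace AlignedModel

variable {m n h r : ℕ} {F : AlignedModel m n h} {x : LoRAWeights m n h r} {M ζ : ℝ}
  {d : Matrix (Fin h) Unit ℝ}

theorem A₂_mul_of_orthogonal (hd : F.gᵀ * d = 0) : x.A₂ * d = F.Ao₂ x * d := by
  conv_lhs => rw [F.A₂_eq x]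
  rw [Matrix.add_mul, Matrix.mul_assoc, hd, Matrix.mul_zero, zero_add]

theorem B₁t_mul_of_orthogonal (hd : F.gᵀ * d = 0) : x.B₁ᵀ * d = (F.Bo₁ x)ᵀ * d := by
  conv_lhs => rw [F.B₁_eq x]
  rw [transpose_add, Matrix.add_mul, transpose_mul, transpose_transpose, Matrix.mul_assoc, hd,
    Matrix.mul_zero, zero_add]

theorem X₂_mul_of_orthogonal (hd : F.gᵀ * d = 0) :
    F.X₂ x * d = F.R₂ * d + x.B₂ * (x.A₂ * d) := by
  simp [X₂, W₂, Matrix.add_mul, Matrix.mul_assoc, hd]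

/-- `X₁ᵀ d` loses its σ₁-part because `d` is orthogonal to `g`, and `R₁ = 0` when `n = 1`. Only the
tail of `B₁` moves `A₂ d`, which is therefore almost frozen. -/
theorem dA₂_mul_of_orthogonal (hv : F.v * F.vᵀ = 1) (hd : F.gᵀ * d = 0) :
    F.dA₂ x * d = x.B₂ᵀ * (F.E x * (x.A₁ᵀ * ((F.Bo₁ x)ᵀ * d))) := by
  have h1 : (F.X₁ x)ᵀ * d = x.A₁ᵀ * ((F.Bo₁ x)ᵀ * d) := by
    rw [← B₁t_mul_of_orthogonal hd, X₁, W₁, R₁_eq_zero hv, add_zero, transpose_add,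
      transpose_smul, transpose_mul, transpose_transpose, Matrix.add_mul, Matrix.smul_mul,
      Matrix.mul_assoc, hd, transpose_mul, Matrix.mul_assoc]
    simp
  rw [dA₂, Matrix.mul_assoc, Matrix.mul_assoc, h1]

theorem Bounded.norm_dA₂_mul_le (hx : F.Bounded x M ζ) (hv : F.v * F.vᵀ = 1) (hd : F.gᵀ * d = 0)
    (hd1 : ‖d‖ ≤ 1) : ‖F.dA₂ x * d‖ ≤ ‖x.B₂‖ * (M ^ 2 * √(F.off x)) := by
  rw [dA₂_mul_of_orthogonal hv hd]
  have := fro_mul_le (frobenius_norm_transpose x.B₂).le (fro_mul_le hx.E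
    (fro_mul_le ((frobenius_norm_transpose x.A₁).le.trans hx.A₁)
      (fro_mul_le ((frobenius_norm_transpose (F.Bo₁ x)).le.trans (F.norm_Bo₁_le_off x)) hd1)))
  refine this.trans_eq ?_
  ring

/-- The velocity of the component of `B₁` along `d`. -/
theorem frobInner_dB₁t_mul (hv : F.v * F.vᵀ = 1) (hd : F.gᵀ * d = 0) {τ : ℝ}
    (hτ : F.R₂ᵀ * (F.R₂ * d) = τ • d) {ν : Matrix (Fin r) Unit ℝ} (hν : ‖ν‖ = 1) {s : ℝ}
    (ha : F.a x = s • ν) :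
    frobInner ((F.dB₁ x)ᵀ * d) ν = s * (F.e x * frobInner (x.A₂ * d) (F.y x) +
      (-frobInner (F.R₂ * d) (F.Bo₂ x * (x.A₂ * (F.X₁ x * F.v))) -
        frobInner (x.B₂ * (x.A₂ * d)) (F.Eu x * F.v))) -
      τ * s ^ 2 * frobInner (x.B₁ᵀ * d) ν := by
  have hA : x.A₁ᵀ * ν = s • F.v := by
    conv_lhs => rw [F.A₁_eq x]
    rw [Ao₁_eq_zero hv, add_zero, transpose_mul, transpose_transpose, Matrix.mul_assoc,
      transpose_mul_col, ha, frobInner_smul_left, frobInner_self, hν]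
    simp
  have h1 : frobInner ((F.dB₁ x)ᵀ * d) ν = s * frobInner (F.X₂ x * d) (F.E x * F.v) := by
    rw [frobInner_mul_left, transpose_transpose, dB₁, frobInner_comm, frobInner_comm (F.X₂ x * d),
      Matrix.mul_assoc, Matrix.mul_assoc, hA, Matrix.mul_smul, Matrix.mul_smul,
      frobInner_smul_left, frobInner_mul_left, transpose_transpose]
  have h2 : frobInner (F.R₂ * d) F.u = 0 := by
    rw [frobInner_mul_left, F.R₂_u, frobInner_zero_right]
  have h3 : frobInner (x.B₂ * (x.A₂ * d)) F.u = frobInner (x.A₂ * d) (F.y x) := by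
    rw [frobInner_mul_left, y]
  have h4 : frobInner (F.R₂ * d) (F.Eu x * F.v) = τ * s * frobInner (x.B₁ᵀ * d) ν +
      frobInner (F.R₂ * d) (F.Bo₂ x * (x.A₂ * (F.X₁ x * F.v))) := by
    have : F.Eu x * F.v = F.R₂ * (F.Bo₁ x * F.a x) + F.Bo₂ x * (x.A₂ * (F.X₁ x * F.v)) := by
      rw [Eu, a, Matrix.add_mul]
      simp only [Matrix.mul_assoc]
    rw [this, frobInner_add_right, frobInner_comm _ (F.R₂ * (_ * _)), frobInner_mul_left F.R₂, hτ,
      frobInner_smul_right, frobInner_mul_left, ← B₁t_mul_of_orthogonal hd, ha,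
      frobInner_smul_left, frobInner_comm ν]
    ring
  rw [h1, X₂_mul_of_orthogonal hd, E_v_eq, frobInner_sub_right, frobInner_smul_right,
    frobInner_add_left, frobInner_add_left, h2, h3, h4]
  ring

/-- Each of the two products contains one factor from the tail and one from the second pair. -/
theorem Bounded.abs_tail_error_le (hx : F.Bounded x M ζ) (hd1 : ‖d‖ ≤ 1) (hA : ‖x.A₂ * d‖ ≤ 1)
    {G : ℝ} (hB₁ : ‖F.Bo₁ x‖ ≤ G) (hB₂ : ‖F.Bo₂ x‖ ≤ G) :
    |-frobInner (F.R₂ * d) (F.Bo₂ x * (x.A₂ * (F.X₁ x * F.v))) -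
        frobInner (x.B₂ * (x.A₂ * d)) (F.Eu x * F.v)| ≤ 3 * M ^ 2 * ζ * G := by
  have hM := hx.M_nonneg
  have hζ := hx.ζ_nonneg
  have hG := (norm_nonneg _).trans hB₁
  have h1 : |frobInner (F.R₂ * d) (F.Bo₂ x * (x.A₂ * (F.X₁ x * F.v)))| ≤
      M * 1 * (G * (ζ * (M * 1))) := (abs_frobInner_le _ _).trans
    (mul_le_mul (fro_mul_le hx.R₂ hd1) (fro_mul_le hB₂ (fro_mul_le hx.A₂
      (fro_mul_le hx.X₁ F.norm_v.le))) (norm_nonneg _) (by positivity))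
  have hEu : ‖F.Eu x‖ ≤ M ^ 2 * (G + G) :=
    hx.norm_Eu_le.trans (mul_le_mul_of_nonneg_left (add_le_add hB₁ hB₂) (sq_nonneg M))
  have h2 : |frobInner (x.B₂ * (x.A₂ * d)) (F.Eu x * F.v)| ≤ ζ * 1 * (M ^ 2 * (G + G) * 1) :=
    (abs_frobInner_le _ _).trans (mul_le_mul (fro_mul_le hx.B₂ hA)
      (fro_mul_le hEu F.norm_v.le) (norm_nonneg _) (by positivity))
  have h1' := abs_le.1 h1
  have h2' := abs_le.1 h2
  rw [abs_le]
  constructor <;> linarith [h1'.1, h1'.2, h2'.1, h2'.2]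

namespace Setting

variable {w : ℝ → LoRAWeights m n h r} {K α κ T C T₁ : ℝ}
  (S : F.Setting w K M α κ T C) (A : F.AlignedAt w κ T T₁)

include S A

/-- The component of `A₂ d` along `c` stays comparable to its initial size, relative to the growth
of `c + y`. -/
theorem le_frobInner_c (hv : F.v * F.vᵀ = 1) (hC : 16 * pairC M K ^ 2 * K ^ 2 ≤ C)
    (hC' : 40 * M ^ 3 * K + 16 * K * pairC M K ≤ C) (hC₃ : 10 * K ^ 2 * crossC M K ≤ C)
    (hd : F.gᵀ * d = 0) (hd1 : ‖d‖ ≤ 1)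
    (hgen : α ^ 2 / K ≤ frobInner ((w 0).A₂ * d) (F.c (w 0))) {t : ℝ} (ht : t ∈ Icc 0 T₁) :
    (∃ η, HasDerivWithinAt (fun s => frobInner ((w s).A₂ * d) (F.y (w s)))
        (F.coupling (w t) * frobInner ((w t).A₂ * d) (F.c (w t)) + η) (Ici 0) t ∧
        |η| ≤ crossC M K * κ * α * ‖F.c (w t) + F.y (w t)‖) ∧
      α / (4 * K ^ 2) * ‖F.c (w t) + F.y (w t)‖ ≤ frobInner ((w t).A₂ * d) (F.c (w t)) := by
  have hM := S.one_le_M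
  have hK := S.one_le_K
  have hP := S.pairC_pos
  have hα := S.α_pos
  have hκ := S.κ_pos
  have hPC : 0 < crossC M K := by
    unfold crossC
    positivity
  choose! θ hθ using fun τ (hτ : τ ∈ Icc 0 T₁) => S.norm_c_add_y_velocity A hv hC hτ
  -- bounds that hold at all times before the alignment time
  have key : ∀ s ∈ Icc 0 T₁, ‖(w s).A₂ * d‖ ≤ 2 * K * α ∧
      ‖F.dA₂ (w s) * d‖ ≤ 2 * K * M ^ 2 * κ * α ∧
      ‖F.c (w s)‖ ≤ 2 * K ^ 2 * ‖F.c (w s) + F.y (w s)‖ ∧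
      ‖F.y (w s)‖ ≤ 2 * K ^ 2 * ‖F.c (w s) + F.y (w s)‖ ∧
      ‖F.err_c (w s)‖ ≤ 2 * K * pairC M K * κ * ‖F.c (w s) + F.y (w s)‖ ∧
      ‖F.err_y (w s)‖ ≤ 2 * K * pairC M K * κ * ‖F.c (w s) + F.y (w s)‖ := by
    intro s hs
    have hg := (A.early s hs).toGood
    have hb := S.bounded hs.1 hg
    have ho := S.sqrt_off_le hs.1 (hs.2.trans A.le_T) fun τ hτ =>
      (A.early τ ⟨hτ.1, hτ.2.le.trans hs.2⟩).toGood
    have hsz := S.size_le_norm_c_add_y A hv hC hC' hs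
    have e5 := S.sq_le_norm_c_add_y A hv hC hs
    unfold AlignedModel.size₂ at hsz
    have hαΘ : pairC M K * α ^ 2 ≤ 2 * K * pairC M K * κ * ‖F.c (w s) + F.y (w s)‖ := by
      have h1 := mul_le_mul S.α_le_κ e5 hα.le hκ.le
      have h2 := mul_le_mul_of_nonneg_left h1 hP.le
      linarith
    refine ⟨?_, ?_, ?_, ?_, (S.norm_err_c_le_of_mem A hv hs).trans hαΘ,
      (S.norm_err_y_le_of_mem A hv hs).trans hαΘ⟩
    · rw [A₂_mul_of_orthogonal hd]
      simpa using fro_mul_le ((F.norm_Ao₂_le_off _).trans ho) hd1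
    · refine (hb.norm_dA₂_mul_le hv hd hd1).trans ((mul_le_mul hb.B₂
        (mul_le_mul_of_nonneg_left ho (sq_nonneg M)) (by positivity) hκ.le).trans_eq ?_)
      ring
    · refine (F.norm_c_le _).trans (le_of_sq_le_sq ?_ (by positivity))
      linarith [sq_nonneg ‖(w s).B₂‖]
    · refine (F.norm_y_le _).trans (le_of_sq_le_sq ?_ (by positivity))
      linarith [sq_nonneg ‖(w s).A₂‖]
  have hpos : ∀ s ∈ Icc 0 T₁, 0 < ‖F.c (w s) + F.y (w s)‖ := fun s hs =>
    S.norm_c_add_y_pos A hv hC hs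
  have hmem : ∀ τ ∈ Icc 0 t, τ ∈ Icc 0 T₁ := fun τ hτ => ⟨hτ.1, hτ.2.trans ht.2⟩
  have hω : ∀ s, 0 ≤ s → HasMatDeriv (fun s => (w s).A₂ * d) (F.dA₂ (w s) * d) s := fun s hs =>
    (S.flow.A₂ s hs).mul_const d
  have hκα : 0 < κ * α := mul_pos hκ hα
  have hακ := S.α_le_κ
  have hK4 : ∀ {i : ℕ}, i ≤ 4 → K ^ i ≤ K ^ 4 := fun hi => pow_le_pow_right₀ hK hi
  -- the growing combination
  have hplus := add_mul_le_of_le_hasDerivWithinAt (c := -(crossC M K * κ * α)) le_rfl ht.1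
    (fun s hs => ((hω s hs.1).frobInner (S.flow.c_add_y hs.1)).fun_div (hθ s (hmem s hs)).1
      (hpos s (hmem s hs)).ne') fun s hs => by
      have hs' := hmem s ⟨hs.1.le, hs.2.le⟩
      obtain ⟨k1, k2, -, -, k5, k6⟩ := key s hs'
      have k7 := (hθ s hs').2
      have hΘ := hpos s hs'
      rw [frobInner_add_right ((w s).A₂ * d) (F.coupling (w s) • _), frobInner_smul_right]
      have l1 : |frobInner (F.dA₂ (w s) * d) (F.c (w s) + F.y (w s))| ≤
          2 * K * M ^ 2 * κ * α * ‖F.c (w s) + F.y (w s)‖ := (abs_frobInner_le _ _).trans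
        (mul_le_mul_of_nonneg_right k2 hΘ.le)
      have l2 : |frobInner ((w s).A₂ * d) (F.err_c (w s) + F.err_y (w s))| ≤
          2 * K * α * (2 * K * pairC M K * κ * ‖F.c (w s) + F.y (w s)‖ +
            2 * K * pairC M K * κ * ‖F.c (w s) + F.y (w s)‖) := (abs_frobInner_le _ _).trans
        (mul_le_mul k1 ((norm_add_le _ _).trans (add_le_add k5 k6)) (norm_nonneg _)
          (by positivity))
      have l3 : |frobInner ((w s).A₂ * d) (F.c (w s) + F.y (w s))| ≤
          2 * K * α * ‖F.c (w s) + F.y (w s)‖ := (abs_frobInner_le _ _).trans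
        (mul_le_mul_of_nonneg_right k1 hΘ.le)
      have l4 : |frobInner ((w s).A₂ * d) (F.c (w s) + F.y (w s)) * θ s| ≤
          2 * K * α * ‖F.c (w s) + F.y (w s)‖ * (4 * K * pairC M K * κ *
            ‖F.c (w s) + F.y (w s)‖) := by
        rw [abs_mul]
        refine mul_le_mul l3 (k7.trans ?_) (abs_nonneg _) (by positivity)
        gcongr
      generalize frobInner (F.dA₂ (w s) * d) (F.c (w s) + F.y (w s)) = i₁ at *
      generalize frobInner ((w s).A₂ * d) (F.err_c (w s) + F.err_y (w s)) = i₂ at *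
      generalize frobInner ((w s).A₂ * d) (F.c (w s) + F.y (w s)) = i₃ at *
      set Θ := ‖F.c (w s) + F.y (w s)‖
      have l5 : (i₁ + (F.coupling (w s) * i₃ + i₂)) * Θ - i₃ * (F.coupling (w s) * Θ + θ s) =
          (i₁ + i₂) * Θ - i₃ * θ s := by ring
      rw [l5, le_div_iff₀ (by positivity)]
      have l6 := mul_le_mul_of_nonneg_right (abs_le.1 l1).1 hΘ.le
      have l7 := mul_le_mul_of_nonneg_right (abs_le.1 l2).1 hΘ.le
      have l8 := (abs_le.1 l4).2
      have l9 : 2 * K * M ^ 2 + 16 * K ^ 2 * pairC M K ≤ crossC M K := by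
        have m1 := mul_le_mul_of_nonneg_right (hK4 (show 2 ≤ 4 by norm_num)) hP.le
        have m2 := mul_le_mul_of_nonneg_right (pow_le_pow_right₀ hK (show 1 ≤ 3 by norm_num))
          (sq_nonneg M)
        have m3 : 0 ≤ K ^ 3 * M ^ 2 := by positivity
        have m4 : 0 ≤ K ^ 4 * pairC M K := by positivity
        unfold crossC
        linarith
      have l10 := mul_le_mul_of_nonneg_right l9 (show 0 ≤ κ * α * Θ ^ 2 by positivity)
      linarith
  -- the shrinking combination
  have hΘmono : ∀ s ∈ Icc 0 t, ‖F.c (w s) + F.y (w s)‖ ≤ 2 * ‖F.c (w t) + F.y (w t)‖ :=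
    fun s hs => S.norm_c_add_y_le A hv hC (le_trans (by
      have : 0 ≤ M ^ 3 * K := by positivity
      have : 0 ≤ K * pairC M K := by positivity
      linarith) hC') hs.1 hs.2 ht.2
  have hminus := add_mul_le_of_le_hasDerivWithinAt
    (c := -(crossC M K * κ * α * (4 * ‖F.c (w t) + F.y (w t)‖ ^ 2))) le_rfl ht.1
    (fun s hs => ((hω s hs.1).frobInner (S.flow.c_sub_y hs.1)).fun_mul (hθ s (hmem s hs)).1)
    fun s hs => by
      have hs' := hmem s ⟨hs.1.le, hs.2.le⟩
      obtain ⟨k1, k2, k3, k4, k5, k6⟩ := key s hs'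
      have k7 := (hθ s hs').2
      have hΘ := hpos s hs'
      have k8 : ‖F.c (w s) - F.y (w s)‖ ≤ 4 * K ^ 2 * ‖F.c (w s) + F.y (w s)‖ := by
        linarith [norm_sub_le (F.c (w s)) (F.y (w s))]
      rw [frobInner_add_right ((w s).A₂ * d) (-(F.coupling (w s) • _)), frobInner_neg_right,
        frobInner_smul_right]
      have l1 : |frobInner (F.dA₂ (w s) * d) (F.c (w s) - F.y (w s))| ≤
          2 * K * M ^ 2 * κ * α * (4 * K ^ 2 * ‖F.c (w s) + F.y (w s)‖) :=
        (abs_frobInner_le _ _).trans (mul_le_mul k2 k8 (norm_nonneg _) (by positivity))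
      have l2 : |frobInner ((w s).A₂ * d) (F.err_c (w s) - F.err_y (w s))| ≤
          2 * K * α * (2 * K * pairC M K * κ * ‖F.c (w s) + F.y (w s)‖ +
            2 * K * pairC M K * κ * ‖F.c (w s) + F.y (w s)‖) := (abs_frobInner_le _ _).trans
        (mul_le_mul k1 ((norm_sub_le _ _).trans (add_le_add k5 k6)) (norm_nonneg _)
          (by positivity))
      have l3 : |frobInner ((w s).A₂ * d) (F.c (w s) - F.y (w s))| ≤
          2 * K * α * (4 * K ^ 2 * ‖F.c (w s) + F.y (w s)‖) := (abs_frobInner_le _ _).trans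
        (mul_le_mul k1 k8 (norm_nonneg _) (by positivity))
      have l4 : |frobInner ((w s).A₂ * d) (F.c (w s) - F.y (w s)) * θ s| ≤
          2 * K * α * (4 * K ^ 2 * ‖F.c (w s) + F.y (w s)‖) * (4 * K * pairC M K * κ *
            ‖F.c (w s) + F.y (w s)‖) := by
        rw [abs_mul]
        refine mul_le_mul l3 (k7.trans ?_) (abs_nonneg _) (by positivity)
        gcongr
      have l11 := pow_le_pow_left₀ hΘ.le (hΘmono s ⟨hs.1.le, hs.2.le⟩) 2
      generalize frobInner (F.dA₂ (w s) * d) (F.c (w s) - F.y (w s)) = i₁ at *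
      generalize frobInner ((w s).A₂ * d) (F.err_c (w s) - F.err_y (w s)) = i₂ at *
      generalize frobInner ((w s).A₂ * d) (F.c (w s) - F.y (w s)) = i₃ at *
      set Θ := ‖F.c (w s) + F.y (w s)‖
      have l5 : (i₁ + (-(F.coupling (w s) * i₃) + i₂)) * Θ + i₃ * (F.coupling (w s) * Θ + θ s) =
          (i₁ + i₂) * Θ + i₃ * θ s := by ring
      rw [l5]
      have l6 := mul_le_mul_of_nonneg_right (abs_le.1 l1).1 hΘ.le
      have l7 := mul_le_mul_of_nonneg_right (abs_le.1 l2).1 hΘ.le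
      have l8 := (abs_le.1 l4).1
      have l9 : 8 * K ^ 3 * M ^ 2 + 8 * K ^ 2 * pairC M K + 32 * K ^ 4 * pairC M K ≤
          crossC M K := by
        have m1 := mul_le_mul_of_nonneg_right (hK4 (show 2 ≤ 4 by norm_num)) hP.le
        unfold crossC
        linarith
      have l10 := mul_le_mul_of_nonneg_right l9 (show 0 ≤ κ * α * Θ ^ 2 by positivity)
      have l12 := mul_le_mul_of_nonneg_left l11 (show 0 ≤ crossC M K * κ * α by positivity)
      linarith
  obtain ⟨k1, k2, k3, k4, k5, k6⟩ := key t ht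
  have hΘ := hpos t ht
  constructor
  · refine ⟨frobInner ((w t).A₂ * d) (F.err_y (w t)) + frobInner (F.dA₂ (w t) * d) (F.y (w t)),
      ((hω t ht.1).frobInner (S.flow.y' ht.1)).congr_deriv ?_, ?_⟩
    · rw [frobInner_add_right, frobInner_smul_right, coupling]
      ring
    · have l1 : |frobInner ((w t).A₂ * d) (F.err_y (w t))| ≤
          2 * K * α * (2 * K * pairC M K * κ * ‖F.c (w t) + F.y (w t)‖) :=
        (abs_frobInner_le _ _).trans (mul_le_mul k1 k6 (norm_nonneg _) (by positivity))
      have l2 : |frobInner (F.dA₂ (w t) * d) (F.y (w t))| ≤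
          2 * K * M ^ 2 * κ * α * (2 * K ^ 2 * ‖F.c (w t) + F.y (w t)‖) :=
        (abs_frobInner_le _ _).trans (mul_le_mul k2 k4 (norm_nonneg _) (by positivity))
      refine (abs_add_le _ _).trans ((add_le_add l1 l2).trans ?_)
      have l9 : 4 * K ^ 3 * M ^ 2 + 4 * K ^ 2 * pairC M K ≤ crossC M K := by
        have m1 := mul_le_mul_of_nonneg_right (hK4 (show 2 ≤ 4 by norm_num)) hP.le
        have m3 : 0 ≤ K ^ 3 * M ^ 2 := by positivity
        have m4 : 0 ≤ K ^ 4 * pairC M K := by positivity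
        unfold crossC
        linarith
      have l10 := mul_le_mul_of_nonneg_right l9
        (show 0 ≤ κ * α * ‖F.c (w t) + F.y (w t)‖ by positivity)
      linarith
  · have hy0 : F.y (w 0) = 0 := by simp [y, S.B₂_zero]
    rw [hy0, add_zero] at hplus
    rw [hy0, sub_zero, add_zero] at hminus
    have hgen0 : 0 ≤ frobInner ((w 0).A₂ * d) (F.c (w 0)) := le_trans (by positivity) hgen
    have hc0 : 0 < ‖F.c (w 0)‖ := (div_pos hα (by linarith)).trans_le S.le_c
    have hc1 : ‖F.c (w 0)‖ ≤ K * α := (F.norm_c_le _).trans S.A₂_le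
    have n1 : α / K ^ 2 ≤ frobInner ((w 0).A₂ * d) (F.c (w 0)) / ‖F.c (w 0)‖ := by
      rw [le_div_iff₀ hc0]
      refine le_trans ?_ hgen
      calc α / K ^ 2 * ‖F.c (w 0)‖ ≤ α / K ^ 2 * (K * α) :=
            mul_le_mul_of_nonneg_left hc1 (by positivity)
        _ = α ^ 2 / K := by field_simp
    have n2 := S.mul_κ_mul_le hC₃ (ht.2.trans A.le_T) ht.1
    have n3 : crossC M K * κ * α * (t - 0) ≤ α / K ^ 2 / 10 := by
      rw [div_div, le_div_iff₀ (by positivity)]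
      have := mul_le_mul_of_nonneg_right n2 hα.le
      linarith
    set Θ := ‖F.c (w t) + F.y (w t)‖
    set X := α / K ^ 2 with hX
    -- The quotient of `⟨A₂d, c + y⟩` by `Θ` and the product of `⟨A₂d, c - y⟩` with `Θ` are both
    -- almost conserved from below and start positive. Their errors leave 9/10 in one bound and
    -- -4/10 in the other; half the sum is the factor 1/4 in the claim.
    have n4 : X * (9 / 10) * Θ ≤ frobInner ((w t).A₂ * d) (F.c (w t) + F.y (w t)) := by
      rw [← le_div_iff₀ hΘ]
      linarith
    have n5 : -(4 / 10 * X * Θ) ≤ frobInner ((w t).A₂ * d) (F.c (w t) - F.y (w t)) := by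
      have n6 : -(4 / 10 * X * Θ) * Θ ≤ frobInner ((w t).A₂ * d) (F.c (w t) - F.y (w t)) * Θ := by
        have n7 := mul_le_mul_of_nonneg_right n3 (show 0 ≤ 4 * Θ ^ 2 by positivity)
        have n8 := mul_nonneg hgen0 hc0.le
        linarith
      exact le_of_mul_le_mul_right n6 hΘ
    rw [frobInner_add_right] at n4
    rw [frobInner_sub_right] at n5
    have n6 : α / (4 * K ^ 2) = X / 4 := by rw [hX]; field_simp
    rw [n6]
    linarith

end Setting

end AlignedModel

end CrossTerms

/-! ### Production of a tail component of B₁ -/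

section TailComponent

open scoped Matrix.Norms.Frobenius

/-- A lower bound for a quantity that is driven, with damping, by an integral that grows at least
linearly in a final time window. -/
theorem le_of_driven {χ χ' ω J k l e ρ : ℝ → ℝ} {T₁ τ₀ β c l₀ l₁ σ ϱ J₁ : ℝ} (hτ₀ : 0 ≤ τ₀)
    (hτT : τ₀ ≤ T₁)
    (hχ0 : χ 0 = 0) (hχ : ∀ t ∈ Icc 0 T₁, HasDerivWithinAt χ (χ' t) (Ici 0) t)
    (hχβ : ∀ t ∈ Icc 0 T₁, -β ≤ χ' t) (hχc : ∀ t ∈ Icc (T₁ - τ₀) T₁, c ≤ χ' t)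
    (hω0 : ω 0 = 0) (hω : ∀ t ∈ Icc 0 T₁, HasDerivWithinAt ω
      (l t * (e t * χ t + ρ t) - k t * ω t) (Ici 0) t)
    (hJ0 : J 0 = 0) (hJ : ∀ t ∈ Icc 0 T₁, HasDerivWithinAt J (k t) (Ici 0) t)
    (hk : ∀ t ∈ Icc 0 T₁, 0 ≤ k t) (hJ₁ : J T₁ ≤ J₁)
    (hβ : 0 ≤ β) (hc : 0 ≤ c)
    (hl : ∀ t ∈ Icc 0 T₁, 0 ≤ l t ∧ l t ≤ l₁) (hl₀' : ∀ t ∈ Icc (T₁ - τ₀) T₁, l₀ ≤ l t)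
    (hσ : 0 ≤ σ)
    (he : ∀ t ∈ Icc 0 T₁, σ / 2 ≤ e t ∧ e t ≤ σ) (hρ : ∀ t ∈ Icc 0 T₁, |ρ t| ≤ ϱ) :
    l₀ * σ * c * τ₀ ^ 2 / 4 - Real.exp J₁ * (l₁ * (σ * (β * T₁) + ϱ)) * T₁ ≤
      ω T₁ * Real.exp (J T₁) := by
  have hT₁ : 0 ≤ T₁ := hτ₀.trans hτT
  have hϱ : 0 ≤ ϱ := (abs_nonneg _).trans (hρ 0 ⟨le_rfl, hT₁⟩)
  have hl₁ : 0 ≤ l₁ := (hl 0 ⟨le_rfl, hT₁⟩).1.trans (hl 0 ⟨le_rfl, hT₁⟩).2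
  have hJmono : ∀ t ∈ Icc 0 T₁, 0 ≤ J t ∧ J t ≤ J₁ := by
    intro t ht
    constructor
    · rw [← hJ0]
      exact le_of_hasDerivWithinAt_nonneg le_rfl ht.1 (fun s hs => hJ s ⟨hs.1, hs.2.trans ht.2⟩)
        fun s hs => hk s ⟨hs.1.le, hs.2.le.trans ht.2⟩
    · refine le_trans ?_ hJ₁
      exact le_of_hasDerivWithinAt_nonneg ht.1 ht.2 (fun s hs => hJ s ⟨ht.1.trans hs.1, hs.2⟩)
        fun s hs => hk s ⟨ht.1.trans hs.1.le, hs.2.le⟩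
  have hχ1 : ∀ t ∈ Icc 0 T₁, -(β * T₁) ≤ χ t := by
    intro t ht
    have := add_mul_le_of_le_hasDerivWithinAt (c := -β) le_rfl ht.1
      (fun s hs => hχ s ⟨hs.1, hs.2.trans ht.2⟩) fun s hs => hχβ s ⟨hs.1.le, hs.2.le.trans ht.2⟩
    have h2 := mul_le_mul_of_nonneg_left ht.2 hβ
    rw [hχ0] at this
    linarith
  have hw0 : 0 ≤ T₁ - τ₀ := sub_nonneg.2 hτT
  have hχ2 : ∀ t ∈ Icc (T₁ - τ₀) T₁, c * (t - (T₁ - τ₀)) - β * T₁ ≤ χ t := by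
    intro t ht
    have := add_mul_le_of_le_hasDerivWithinAt (c := c) hw0 ht.1
      (fun s hs => hχ s ⟨hw0.trans hs.1, hs.2.trans ht.2⟩)
      fun s hs => hχc s ⟨hs.1.le, hs.2.le.trans ht.2⟩
    linarith [hχ1 (T₁ - τ₀) ⟨hw0, by linarith⟩]
  set D := Real.exp J₁ * (l₁ * (σ * (β * T₁) + ϱ)) with hD
  -- The integrating factor `exp J` removes the damping. It lies between 1 and `exp J₁`, so it can
  -- only help the gain and costs a constant in the loss.
  have hder : ∀ t ∈ Icc 0 T₁, HasDerivWithinAt (fun s => ω s * Real.exp (J s))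
      (l t * Real.exp (J t) * (e t * χ t + ρ t)) (Ici 0) t := fun t ht =>
    ((hω t ht).fun_mul (hJ t ht).exp).congr_deriv (by ring)
  -- the common lower bound
  have hlow : ∀ t ∈ Icc 0 T₁, ∀ y : ℝ, 0 ≤ y → y - β * T₁ ≤ χ t →
      l t * (σ / 2) * y - D ≤ l t * Real.exp (J t) * (e t * χ t + ρ t) := by
    intro t ht y hy hyχ
    obtain ⟨l1, l2⟩ := hl t ht
    obtain ⟨e1, e2⟩ := he t ht
    obtain ⟨j1, j2⟩ := hJmono t ht
    have r1 := (abs_le.1 (hρ t ht)).1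
    have e0 : 0 ≤ e t := by linarith
    have x1 : 1 ≤ Real.exp (J t) := Real.one_le_exp j1
    have x2 : Real.exp (J t) ≤ Real.exp J₁ := Real.exp_le_exp.2 j2
    have b0 : 0 ≤ β * T₁ := mul_nonneg hβ hT₁
    have y1 := mul_le_mul_of_nonneg_left hyχ e0
    have y2 : σ / 2 * y - (σ * (β * T₁) + ϱ) ≤ e t * χ t + ρ t := by
      have := mul_le_mul_of_nonneg_right e1 hy
      have := mul_le_mul_of_nonneg_right e2 b0
      linarith
    have y3 := mul_le_mul_of_nonneg_left y2 (mul_nonneg l1 (Real.exp_pos (J t)).le)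
    have y4 : l t * Real.exp (J t) * (σ * (β * T₁) + ϱ) ≤ D := by
      have h1 : l t * Real.exp (J t) ≤ l₁ * Real.exp J₁ :=
        mul_le_mul l2 x2 (Real.exp_pos _).le hl₁
      have := mul_le_mul_of_nonneg_right h1 (show 0 ≤ σ * (β * T₁) + ϱ by positivity)
      rw [hD]
      linarith
    have y5 := mul_le_mul_of_nonneg_right x1 (show 0 ≤ l t * (σ / 2 * y) by positivity)
    linarith
  have s1 := add_mul_le_of_le_hasDerivWithinAt (c := -D) le_rfl hw0
    (fun s hs => hder s ⟨hs.1, by linarith [hs.2]⟩) fun s hs => by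
      have hs' : s ∈ Icc 0 T₁ := ⟨hs.1.le, by linarith [hs.2]⟩
      have := hlow s hs' 0 le_rfl (by linarith [hχ1 s hs'])
      linarith
  -- In the window the driver `χ` grows linearly, so `ω exp J` gains a quadratic; its value at the
  -- end of the window is the term with `τ₀ ^ 2`.
  have s2 := le_of_hasDerivWithinAt_nonneg hw0 (show T₁ - τ₀ ≤ T₁ by linarith)
    (f := fun s => ω s * Real.exp (J s) - (l₀ * σ * c / 4 * (s - (T₁ - τ₀)) ^ 2 - D * s))
    (fun s hs => (hder s ⟨hw0.trans hs.1, hs.2⟩).fun_sub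
      ((((((hasDerivWithinAt_id s _).sub_const (T₁ - τ₀)).fun_pow 2).const_mul
        (l₀ * σ * c / 4))).fun_sub ((hasDerivWithinAt_id s _).const_mul D)))
    fun s hs => by
      have hs' : s ∈ Icc (T₁ - τ₀) T₁ := ⟨hs.1.le, hs.2.le⟩
      have hy : 0 ≤ c * (s - (T₁ - τ₀)) := mul_nonneg hc (by linarith [hs.1])
      have h1 := hlow s ⟨hw0.trans hs'.1, hs'.2⟩ _ hy (hχ2 s hs')
      have h2 := mul_le_mul_of_nonneg_right (hl₀' s hs') (show 0 ≤ σ / 2 * (c * (s - (T₁ - τ₀))) by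
        positivity)
      simp only [id]
      push_cast
      rw [pow_one]
      linarith
  simp only [sub_self, hω0] at s1 s2
  linarith

namespace AlignedModel

variable {m n h r : ℕ} {F : AlignedModel m n h} {x : LoRAWeights m n h r} {M ζ : ℝ}
  {d : Matrix (Fin h) Unit ℝ}

/-- When there is a single column, the rows of `B₁ᵀ` are parallel to `a`. -/
theorem norm_a_sq_mul_frobInner (hv : F.v * F.vᵀ = 1) {S : Matrix (Fin r) (Fin n) ℝ}
    (hS : x.A₁ * x.A₁ᵀ = x.B₁ᵀ * x.B₁ + S * Sᵀ) (d : Matrix (Fin h) Unit ℝ)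
    (z : Matrix (Fin r) Unit ℝ) : ‖F.a x‖ ^ 2 * frobInner (x.B₁ᵀ * d) z =
      frobInner (x.B₁ᵀ * d) (F.a x) * frobInner (F.a x) z := by
  have h1 : frobInner (F.a x) (‖F.a x‖ ^ 2 • z - frobInner (F.a x) z • F.a x) = 0 := by
    rw [frobInner_sub_right, frobInner_smul_right, frobInner_smul_right, frobInner_self]
    ring
  have h2 := (balance_of_single_column hv hS h1).1
  have h3 : frobInner (x.B₁ᵀ * d) (‖F.a x‖ ^ 2 • z - frobInner (F.a x) z • F.a x) = 0 := by
    rw [frobInner_mul_left, transpose_transpose, h2, frobInner_zero_right]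
  rw [frobInner_sub_right, frobInner_smul_right, frobInner_smul_right] at h3
  linarith

/-- When there is a single column, the image of a pair of vectors is parallel to `a`. -/
theorem norm_a_sq_mul_frobInner_image (hv : F.v * F.vᵀ = 1) {S : Matrix (Fin r) (Fin n) ℝ}
    (hS : x.A₁ * x.A₁ᵀ = x.B₁ᵀ * x.B₁ + S * Sᵀ) (qB : Matrix (Fin h) Unit ℝ)
    (qA : Matrix (Fin n) Unit ℝ) (z : Matrix (Fin r) Unit ℝ) :
    ‖F.a x‖ ^ 2 * frobInner (x.B₁ᵀ * qB + x.A₁ * qA) z =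
      frobInner (x.B₁ᵀ * qB + x.A₁ * qA) (F.a x) * frobInner (F.a x) z := by
  have h1 : x.A₁ * qA = frobInner F.v qA • F.a x := by
    conv_lhs => rw [F.A₁_eq x]
    rw [Ao₁_eq_zero hv, add_zero, Matrix.mul_assoc, transpose_mul_col]
    simp
  have h2 := norm_a_sq_mul_frobInner hv hS qB z
  rw [h1, frobInner_add_left, frobInner_add_left, frobInner_smul_left, frobInner_smul_left,
    frobInner_self]
  linarith

/-- A component of `B₁` along a direction orthogonal to `g` bounds the defect from below. -/
theorem IsTop.sq_le_mul_defect {s : ℝ} {qB : Matrix (Fin h) Unit ℝ} {qA : Matrix (Fin n) Unit ℝ}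
    (hx : F.IsTop x s qB qA) (hs : 0 < s) (hv : F.v * F.vᵀ = 1) {S : Matrix (Fin r) (Fin n) ℝ}
    (hS : x.A₁ * x.A₁ᵀ = x.B₁ᵀ * x.B₁ + S * Sᵀ) (ha : 0 < ‖F.a x‖)
    {dB : Matrix (Fin h) Unit ℝ} {dA : Matrix (Fin n) Unit ℝ}
    (hd : ‖dB‖ ^ 2 + ‖dA‖ ^ 2 ≤ 1) (h0 : frobInner F.g dB + frobInner F.v dA = 0) :
    (frobInner (x.B₁ᵀ * dB + x.A₁ * dA) (F.a x) / ‖F.a x‖) ^ 2 ≤ s ^ 2 * F.defect qB qA := by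
  have h1 := hx.inner_eq dB dA
  have h2 := norm_a_sq_mul_frobInner_image hv hS dB dA (x.B₁ᵀ * qB + x.A₁ * qA)
  have h3 := norm_a_sq_mul_frobInner_image hv hS qB qA (x.B₁ᵀ * qB + x.A₁ * qA)
  rw [frobInner_self, hx.norm_image, frobInner_comm _ (F.a x)] at h3
  have h4 := sq_le_defect (F := F) hx.unit hd h0
  refine le_trans (le_of_eq ?_) (mul_le_mul_of_nonneg_left h4 (sq_nonneg s))
  rw [← h1] at h2
  generalize frobInner dB qB + frobInner dA qA = I at *
  generalize frobInner (x.B₁ᵀ * dB + x.A₁ * dA) (F.a x) = P at *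
  generalize frobInner (F.a x) (x.B₁ᵀ * qB + x.A₁ * qA) = Q at *
  generalize ‖F.a x‖ = N at *
  rw [div_pow, div_eq_iff (by positivity)]
  have h5 : (N ^ 2 * s ^ 2) * (s ^ 2 * I ^ 2 * N ^ 2) = (N ^ 2 * s ^ 2) * P ^ 2 := by
    calc _ = (N ^ 2 * (s ^ 2 * I)) ^ 2 := by ring
      _ = P ^ 2 * (Q * Q) := by rw [h2]; ring
      _ = _ := by rw [← h3]; ring
  exact (mul_left_cancel₀ (by positivity) h5).symm

/-- When `n = 1`, the vector `B₁ᵀ d` is parallel to `a`. The rotation of the unit vector `a / ‖a‖`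
then contributes nothing, and the component obeys a scalar equation with damping `τ ‖a‖²`. -/
theorem IsFlow.tail_component {w : ℝ → LoRAWeights m n h r} (hw : F.IsFlow w)
    (hB : (w 0).B₁ = 0) (hv : F.v * F.vᵀ = 1) (hd : F.gᵀ * d = 0) {τ : ℝ}
    (hτ : F.R₂ᵀ * (F.R₂ * d) = τ • d) {t : ℝ} (ht : 0 ≤ t) (ha : 0 < ‖F.a (w t)‖) :
    HasDerivWithinAt
      (fun s => frobInner ((w s).B₁ᵀ * d) (F.a (w s)) / ‖F.a (w s)‖)
      (‖F.a (w t)‖ * (F.e (w t) * frobInner ((w t).A₂ * d) (F.y (w t)) +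
        (-frobInner (F.R₂ * d) (F.Bo₂ (w t) * ((w t).A₂ * (F.X₁ (w t) * F.v))) -
          frobInner ((w t).B₂ * ((w t).A₂ * d)) (F.Eu (w t) * F.v))) -
        τ * ‖F.a (w t)‖ ^ 2 *
          (frobInner ((w t).B₁ᵀ * d) (F.a (w t)) / ‖F.a (w t)‖)) (Ici 0) t := by
  have h1 := hw.a ht
  have h2 := h1.norm_sq.sqrt (by positivity)
  have h3 : ∀ s, √(‖F.a (w s)‖ ^ 2) = ‖F.a (w s)‖ := fun s => Real.sqrt_sq (norm_nonneg _)
  simp only [h3] at h2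
  have h4 := (((hw.B₁ t ht).transpose.mul_const d).frobInner h1).fun_div h2 ha.ne'
  refine h4.congr_deriv ?_
  set N := ‖F.a (w t)‖ with hN
  have hν : ‖(N⁻¹ • F.a (w t))‖ = 1 := by
    rw [norm_smul, norm_inv, norm_norm, inv_mul_cancel₀ ha.ne']
  have h5 := frobInner_dB₁t_mul (x := w t) hv hd hτ hν (s := N)
    (by rw [smul_smul, mul_inv_cancel₀ ha.ne', one_smul])
  have h6 := norm_a_sq_mul_frobInner hv (hw.balance₁ hB ht) d (F.dA₁ (w t) * F.v)
  rw [← hN] at h6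
  rw [frobInner_smul_right, frobInner_smul_right] at h5
  generalize F.e (w t) * frobInner ((w t).A₂ * d) (F.y (w t)) +
    (-frobInner (F.R₂ * d) (F.Bo₂ (w t) * ((w t).A₂ * (F.X₁ (w t) * F.v))) -
      frobInner ((w t).B₂ * ((w t).A₂ * d)) (F.Eu (w t) * F.v)) = Q at *
  have h7 : frobInner ((F.dB₁ (w t))ᵀ * d) (F.a (w t)) =
      N * (N * Q) - τ * N ^ 2 * frobInner ((w t).B₁ᵀ * d) (F.a (w t)) := by
    field_simp at h5
    linarith
  rw [h7]
  generalize frobInner ((w t).B₁ᵀ * d) (F.a (w t)) = P at *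
  generalize frobInner ((w t).B₁ᵀ * d) (F.dA₁ (w t) * F.v) = R at *
  generalize frobInner (F.a (w t)) (F.dA₁ (w t) * F.v) = R' at *
  have hN0 : N ≠ 0 := ha.ne'
  field_simp
  linear_combination h6

end AlignedModel

end TailComponent

/-! ### Lower bound for the tail at the alignment time -/

section TailLowerBound

open scoped Matrix.Norms.Frobenius

namespace AlignedModel

variable {m n h r : ℕ} {F : AlignedModel m n h}

/-- The length of a time window before the alignment time with `p ≥ thr / 2`. -/
noncomputable def window (F : AlignedModel m n h) (M : ℝ) : ℝ :=
  F.thr / (10 * M * (F.σ * F.σ₂))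

/-- The constant in the bound of the components orthogonal to `g` and `u` when `n = 1`. -/
noncomputable def tailBoundC (F : AlignedModel m n h) (M K : ℝ) : ℝ :=
  √(Setting.tailC F M * (64 * K ^ 6 * F.growC M))

/-- The gain of a component of `B₁` orthogonal to `g`. -/
noncomputable def driveC (F : AlignedModel m n h) (M K : ℝ) : ℝ :=
  √(F.thr / 2) * F.σ * (F.σ * F.thr / (32 * K ^ 2 * Real.exp ((2 * M ^ 3 + 1) * F.window M))) *
    F.window M ^ 2 / 4

/-- The loss of a component of `B₁` orthogonal to `g`. -/
noncomputable def dragC (F : AlignedModel m n h) (M K : ℝ) : ℝ :=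
  Real.exp (8 * M ^ 3 / (F.σ * F.σ₂)) * (M * (F.σ * (2 * crossC M K) +
    3 * M ^ 2 * F.tailBoundC M K))

theorem AlignedAt.early_of_mem {w : ℝ → LoRAWeights m n h r} {κ T T₁ : ℝ}
    (A : F.AlignedAt w κ T T₁) {t : ℝ} (ht : t ∈ Icc 0 T₁) :
    ∀ s ∈ Icc 0 t, F.Early κ (‖F.a (w 0)‖ ^ 2) (w s) :=
  fun s hs => A.early s ⟨hs.1, hs.2.trans ht.2⟩

namespace Setting

variable {w : ℝ → LoRAWeights m n h r} {K M α κ T C T₁ : ℝ}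
  (S : F.Setting w K M α κ T C) (A : F.AlignedAt w κ T T₁)

include S

theorem window_pos : 0 < F.window M := by
  have := S.thr_pos
  have := S.σ_pos
  have := S.σ₂_pos
  have := S.one_le_M
  unfold window
  positivity

theorem driveC_pos : 0 < F.driveC M K := by
  have := S.thr_pos
  have := S.σ_pos
  have := S.window_pos
  have := S.one_le_K
  unfold driveC
  positivity

include A

theorem p_velocity {t : ℝ} (ht : t ∈ Icc 0 T₁) :
    ∃ p', HasDerivWithinAt (fun s => F.p (w s)) p' (Ici 0) t ∧ p' ≤ 5 * M * (F.σ * F.σ₂) := by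
  refine ⟨_, S.flow.p ht.1, ?_⟩
  have hT := ht.2.trans A.le_T
  have hE := A.early_of_mem ht
  obtain ⟨-, -, he1, he2, h1, h2⟩ := S.early_facts hT hE ⟨ht.1, le_rfl⟩
  have hp := S.p_nonneg ht.1 hT hE
  have hq := S.q_le ht.1 (A.early t ht).toGood
  rw [norm_add_sq_frob] at hq
  change 0 ≤ frobInner (F.a (w t)) (F.b (w t)) at hp
  have hσ := S.σ_pos
  have hσ₂ := S.σ₂_pos
  set R := √(‖F.a (w t)‖ ^ 2 + ‖F.b (w t)‖ ^ 2) with hR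
  have hR2 : R ^ 2 = ‖F.a (w t)‖ ^ 2 + ‖F.b (w t)‖ ^ 2 := Real.sq_sqrt (by positivity)
  have hR0 : 0 ≤ R := Real.sqrt_nonneg _
  have hRM : R ^ 2 ≤ 4 * M := by linarith
  have ha : ‖F.a (w t)‖ ≤ R := Real.le_sqrt_of_sq_le (by linarith [sq_nonneg ‖F.b (w t)‖])
  have hb : ‖F.b (w t)‖ ≤ R := Real.le_sqrt_of_sq_le (by linarith [sq_nonneg ‖F.a (w t)‖])
  have h3 := (frobInner_le (F.err_a (w t)) (F.b (w t))).trans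
    (mul_le_mul h1 hb (norm_nonneg _) ((norm_nonneg _).trans h1))
  have h4 := (frobInner_le (F.a (w t)) (F.err_b (w t))).trans
    (mul_le_mul ha h2 (norm_nonneg _) hR0)
  have h5 := mul_le_mul S.errC_κ_sq_le hRM (sq_nonneg R) (by positivity)
  have h6 := mul_le_mul (mul_le_mul_of_nonneg_left he2 hσ₂.le) hRM (sq_nonneg R) (by positivity)
  rw [← hR2]
  linarith

/-- The speed of `p` is bounded by `p_velocity`, and `window` is the time in which it can rise by
half the threshold. Throughout this final window the coupling is bounded below, even if `σ₁ = 0`. -/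
theorem half_thr_le_p {t : ℝ} (ht : t ∈ Icc (T₁ - F.window M) T₁) (h0 : 0 ≤ t) :
    F.thr / 2 ≤ F.p (w t) := by
  choose! p' hp' using fun t (ht : t ∈ Icc 0 T₁) => S.p_velocity A ht
  have h1 := le_add_mul_of_hasDerivWithinAt_le h0 ht.2
    (fun s hs => (hp' s ⟨h0.trans hs.1, hs.2⟩).1) fun s hs => (hp' s ⟨h0.trans hs.1.le, hs.2.le⟩).2
  have hσ := S.σ_pos
  have hσ₂ := S.σ₂_pos
  have hM := S.one_le_M
  have h2 : 5 * M * (F.σ * F.σ₂) * F.window M = F.thr / 2 := by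
    unfold window
    field_simp
    ring
  have h3 : 5 * M * (F.σ * F.σ₂) * (T₁ - t) ≤ 5 * M * (F.σ * F.σ₂) * F.window M :=
    mul_le_mul_of_nonneg_left (by linarith [ht.1]) (by positivity)
  linarith [A.thr_le]

theorem window_le : F.window M ≤ T₁ := by
  by_contra! hlt
  have h1 := S.half_thr_le_p A (t := 0) ⟨by linarith, A.nonneg⟩ le_rfl
  have h2 : F.p (w 0) = 0 := by simp [p, b, S.B₁_zero, frobInner_zero_right]
  linarith [S.thr_pos]

variable (hv : F.v * F.vᵀ = 1)

include hv

omit A in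
-- If `a` vanished, every vector would be orthogonal to it, and balance would force `A₁(0)ᵀ a(0) =
-- 0`, hence `a(0) = 0`.
theorem norm_a_pos {t : ℝ} (ht : 0 ≤ t) : 0 < ‖F.a (w t)‖ := by
  rw [norm_pos_iff]
  intro h0
  have h1 := (balance_of_single_column hv (S.flow.balance₁ S.B₁_zero ht) (z := F.a (w 0))
    (by rw [h0, frobInner_zero_left])).2
  have h2 : frobInner (F.a (w 0)) (F.a (w 0)) = 0 := by
    conv_lhs => rw [a, frobInner_mul_left]
    rw [a] at h1
    rw [h1, frobInner_zero_right]
  rw [frobInner_self] at h2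
  exact (pow_pos S.norm_a_zero_pos 2).ne' h2

/-- Feeds `tail_le` with its two sources: `y` is bounded by `‖c + y‖` at `T₁` at all times, and
`Ao₂` is of order `α`. -/
theorem tail_le_norm_c_add_y (hC : 16 * pairC M K ^ 2 * K ^ 2 ≤ C)
    (hC' : 40 * M ^ 3 * K + 16 * K * pairC M K ≤ C) (hC₁ : 4 * M ^ 3 ≤ C)
    (hC₂ : 4 * M ^ 3 + 32 * M ^ 7 * K / F.rate ≤ C) {t : ℝ} (ht : t ∈ Icc 0 T) :
    ‖F.Bo₁ (w t)‖ ^ 2 + ‖F.Bo₂ (w t)‖ ^ 2 ≤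
      tailC F M * (64 * K ^ 6 * F.growC M) * (α * ‖F.c (w T₁) + F.y (w T₁)‖) ^ 2 := by
  have hK := S.one_le_K
  have hM := S.one_le_M
  have hg : 1 ≤ F.growC M := by
    have := S.σ_pos
    have := S.rate_pos
    exact Real.one_le_exp (by positivity)
  have hT₁ : T₁ ∈ Icc 0 T₁ := ⟨A.nonneg, le_rfl⟩
  have hP := S.pairC_pos
  have hC8 : 8 * K * pairC M K ≤ C := by
    have : 0 ≤ M ^ 3 * K := by positivity
    have : 0 ≤ K * pairC M K := by positivity
    linarith
  have hsz := S.size_le_norm_c_add_y A hv hC hC' hT₁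
  set Θ := ‖F.c (w T₁) + F.y (w T₁)‖
  have hZ : ∀ t ∈ Icc 0 T, ‖F.y (w t)‖ ^ 2 ≤ F.growC M * (16 * K ^ 4 * Θ ^ 2) := by
    intro t ht
    have h1 : ‖F.y (w t)‖ ^ 2 ≤ size₂ (w t) := by
      have := pow_le_pow_left₀ (norm_nonneg _) (F.norm_y_le (w t)) 2
      unfold size₂
      linarith [sq_nonneg ‖(w t).A₂‖]
    refine h1.trans ?_
    have hnn : 0 ≤ 16 * K ^ 4 * Θ ^ 2 := by positivity
    rcases le_total t T₁ with h | h
    · have h2 := S.size_le_norm_c_add_y A hv hC hC' ⟨ht.1, h⟩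
      have h3 := pow_le_pow_left₀ (norm_nonneg _)
        (S.norm_c_add_y_le A hv hC hC8 ht.1 h le_rfl) 2
      have h4 := mul_le_mul_of_nonneg_left h3 (show 0 ≤ 4 * K ^ 4 by positivity)
      have h5 := mul_le_mul_of_nonneg_right hg hnn
      linarith
    · have h2 := S.size_le_of_late A h ht.2 fun s hs => S.late A s ⟨hs.1, hs.2.trans ht.2⟩
      refine h2.trans (mul_le_mul_of_nonneg_left (hsz.trans ?_) (by linarith))
      have : 0 ≤ K ^ 4 * Θ ^ 2 := by positivity
      linarith
  have hO : ∀ t ∈ Icc 0 T, ‖F.Ao₂ (w t)‖ ^ 2 ≤ (2 * K * α) ^ 2 := fun t ht => by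
    have := S.off_le ht.1 ht.2 fun s hs => S.good A s ⟨hs.1, hs.2.le.trans ht.2⟩
    unfold off at this
    linarith [sq_nonneg ‖F.Ao₁ (w t)‖, sq_nonneg ‖F.Bo₁ (w t)‖, sq_nonneg ‖F.Bo₂ (w t)‖]
  refine (S.tail_le A hv hC₁ hC₂ hZ hO ht).trans_eq ?_
  ring

theorem norm_tail_le (hC : 16 * pairC M K ^ 2 * K ^ 2 ≤ C)
    (hC' : 40 * M ^ 3 * K + 16 * K * pairC M K ≤ C) (hC₁ : 4 * M ^ 3 ≤ C)
    (hC₂ : 4 * M ^ 3 + 32 * M ^ 7 * K / F.rate ≤ C) {t : ℝ} (ht : t ∈ Icc 0 T) :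
    ‖F.Bo₁ (w t)‖ ≤ F.tailBoundC M K * (α * ‖F.c (w T₁) + F.y (w T₁)‖) ∧
      ‖F.Bo₂ (w t)‖ ≤ F.tailBoundC M K * (α * ‖F.c (w T₁) + F.y (w T₁)‖) := by
  have h1 := S.tail_le_norm_c_add_y A hv hC hC' hC₁ hC₂ ht
  have h2 : 0 ≤ α * ‖F.c (w T₁) + F.y (w T₁)‖ := mul_nonneg S.α_pos.le (norm_nonneg _)
  unfold tailBoundC
  rw [← Real.sqrt_sq h2, ← Real.sqrt_mul' _ (sq_nonneg _)]
  exact ⟨Real.le_sqrt_of_sq_le (by linarith [sq_nonneg ‖F.Bo₂ (w t)‖]),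
    Real.le_sqrt_of_sq_le (by linarith [sq_nonneg ‖F.Bo₁ (w t)‖])⟩

set_option maxHeartbeats 1000000 in
/-- At the alignment time, `B₁` has a component orthogonal to `g` whose size is comparable to the
bound of the tail. -/
theorem le_tail_component (hC : 16 * pairC M K ^ 2 * K ^ 2 ≤ C)
    (hC' : 40 * M ^ 3 * K + 16 * K * pairC M K ≤ C) (hC₁ : 4 * M ^ 3 ≤ C)
    (hC₂ : 4 * M ^ 3 + 32 * M ^ 7 * K / F.rate ≤ C) (hC₃ : 10 * K ^ 2 * crossC M K ≤ C)
    (hC₄ : 8 * K ^ 2 * crossC M K / (F.σ * F.thr) * 4 ≤ C)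
    (hC₅ : 2 * F.dragC M K / F.driveC M K * κ * (1 + T) ^ 2 ≤ 1)
    {d : Matrix (Fin h) Unit ℝ} (hd : F.gᵀ * d = 0) (hd1 : ‖d‖ = 1) {τ : ℝ}
    (hτ : F.R₂ᵀ * (F.R₂ * d) = τ • d)
    (hgen : α ^ 2 / K ≤ frobInner ((w 0).A₂ * d) (F.c (w 0))) :
    F.driveC M K / (2 * Real.exp (8 * M ^ 3 / (F.σ * F.σ₂))) *
        (α * ‖F.c (w T₁) + F.y (w T₁)‖) ≤
      frobInner ((w T₁).B₁ᵀ * d) (F.a (w T₁)) / ‖F.a (w T₁)‖ := by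
  have hM := S.one_le_M
  have hK := S.one_le_K
  have hα := S.α_pos
  have hκ := S.κ_pos
  have hσ := S.σ_pos
  have hσ₂ := S.σ₂_pos
  have hthr := S.thr_pos
  have hP := S.pairC_pos
  have hwin := S.window_pos
  have hPC : 0 < crossC M K := by
    unfold crossC
    positivity
  have hC8 : 8 * K * pairC M K ≤ C := by
    have : 0 ≤ M ^ 3 * K := by positivity
    have : 0 ≤ K * pairC M K := by positivity
    linarith
  have hTm : T₁ ∈ Icc 0 T₁ := ⟨A.nonneg, le_rfl⟩
  have hΘ₁ := S.norm_c_add_y_pos A hv hC hTm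
  set Θ₁ := ‖F.c (w T₁) + F.y (w T₁)‖ with hΘ₁def
  have hτ' : τ = ‖F.R₂ * d‖ ^ 2 := by
    rw [← frobInner_self, frobInner_mul_left, hτ, frobInner_smul_right, frobInner_self, hd1]
    ring
  have hτ0 : 0 ≤ τ := hτ' ▸ sq_nonneg _
  have hτM : τ ≤ M ^ 2 := by
    rw [hτ']
    refine pow_le_pow_left₀ (norm_nonneg _) ?_ 2
    simpa using fro_mul_le S.bounds.2.2.2.1 hd1.le
  obtain ⟨J, hJ0, hJ⟩ := exists_antiderivative (k := fun s => τ * ‖F.a (w s)‖ ^ 2) fun t ht =>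
    ((S.flow.a ht).norm_sq.const_mul τ).continuousWithinAt
  have hp := fun t (ht : t ∈ Icc 0 T₁) =>
    S.p_nonneg ht.1 (ht.2.trans A.le_T) (A.early_of_mem ht)
  -- the damping
  have hJ₁ : J T₁ ≤ 8 * M ^ 3 / (F.σ * F.σ₂) := by
    choose! η hη using fun t (ht : t ∈ Icc 0 T₁) =>
      S.q_velocity (ht.2.trans A.le_T) (A.early_of_mem ht) ⟨ht.1, le_rfl⟩
    -- The accumulated damping is charged to the growth of `q = ‖a + b‖²`: the velocity of `q` is at
    -- least `σ σ₂ q / 2`, `‖a‖² ≤ q`, and `q` stays below `4 M`.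
    have h1 := le_of_hasDerivWithinAt_nonpos le_rfl A.nonneg
      (fun s hs => (hJ s hs.1).fun_sub ((hη s hs).1.const_mul (2 * τ / (F.σ * F.σ₂))))
      fun s hs => by
        have hs' : s ∈ Icc 0 T₁ := ⟨hs.1.le, hs.2.le⟩
        have h2 := S.le_q_velocity (S.early_facts (hs'.2.trans A.le_T) (A.early_of_mem hs')
          ⟨hs'.1, le_rfl⟩).2.2.1 (sq_nonneg _) (hη s hs').2
        have h3 := mul_le_mul_of_nonneg_left h2 (show 0 ≤ 2 * τ / (F.σ * F.σ₂) by positivity)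
        have h4 : ‖F.a (w s)‖ ^ 2 ≤ ‖F.a (w s) + F.b (w s)‖ ^ 2 := by
          have := hp s hs'
          unfold p at this
          rw [norm_add_sq_frob]
          linarith [sq_nonneg ‖F.b (w s)‖]
        have h5 := mul_le_mul_of_nonneg_left h4 hτ0
        have h6 : 2 * τ / (F.σ * F.σ₂) * (F.σ * F.σ₂ / 2 * ‖F.a (w s) + F.b (w s)‖ ^ 2) =
            τ * ‖F.a (w s) + F.b (w s)‖ ^ 2 := by
          field_simp
        linarith
    rw [hJ0] at h1
    have h2 := S.q_le A.nonneg (A.early T₁ hTm).toGood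
    have h3 : 2 * τ / (F.σ * F.σ₂) * ‖F.a (w T₁) + F.b (w T₁)‖ ^ 2 ≤
        8 * M ^ 3 / (F.σ * F.σ₂) := by
      rw [div_mul_eq_mul_div]
      refine div_le_div_of_nonneg_right ?_ (by positivity)
      have := mul_le_mul hτM h2 (sq_nonneg _) (by positivity)
      linarith
    have h4 : 0 ≤ 2 * τ / (F.σ * F.σ₂) * ‖F.a (w 0) + F.b (w 0)‖ ^ 2 := by positivity
    linarith
  -- the driving term
  choose! θ hθ using fun t (ht : t ∈ Icc 0 T₁) => S.norm_c_add_y_velocity A hv hC ht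
  have hcross := fun t (ht : t ∈ Icc 0 T₁) =>
    S.le_frobInner_c A hv hC hC' hC₃ hd hd1.le hgen ht
  choose! η hη using fun t (ht : t ∈ Icc 0 T₁) => (hcross t ht).1
  set L := Real.exp ((2 * M ^ 3 + 1) * F.window M) with hL
  have hΘwin : ∀ t ∈ Icc (T₁ - F.window M) T₁, 0 ≤ t →
      Θ₁ / L ≤ ‖F.c (w t) + F.y (w t)‖ := by
    intro t ht h0
    have h1 := le_mul_exp_of_hasDerivWithinAt_le_const (c := 2 * M ^ 3 + 1) h0 ht.2
      (fun s hs => (hθ s ⟨h0.trans hs.1, hs.2⟩).1) fun s hs => by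
        have hs' : s ∈ Icc 0 T₁ := ⟨h0.trans hs.1.le, hs.2.le⟩
        have hΘ := norm_nonneg (F.c (w s) + F.y (w s))
        have h1 : F.coupling (w s) ≤ 2 * M ^ 3 := by
          have h2 := S.abs_σ₁_add_p_le hs'.1 (A.early s hs').toGood
          have h3 := S.abs_e_le_σ hs'.1
          have h4 := S.bounds.2.2.2.2.1
          calc F.coupling (w s) ≤ |F.e (w s)| * |F.σ₁ + F.p (w s)| := by
                rw [← abs_mul]
                exact le_abs_self _
            _ ≤ M * (2 * M ^ 2) := mul_le_mul (h3.trans h4) h2 (abs_nonneg _) (by linarith)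
            _ = 2 * M ^ 3 := by ring
        have h2 := (le_abs_self _).trans (hθ s hs').2
        have h3 : 4 * K * pairC M K * α ≤ 1 := by
          have h4 := S.mul_κ_le hC8
          have h5 := mul_le_mul_of_nonneg_left S.α_le_κ (show 0 ≤ 4 * K * pairC M K by positivity)
          have : 0 ≤ 4 * K * pairC M K * κ := by positivity
          linarith
        have h4 := mul_le_mul_of_nonneg_right h1 hΘ
        have h5 := mul_le_mul_of_nonneg_right h3 hΘ
        linarith
    have h2 : Real.exp ((2 * M ^ 3 + 1) * (T₁ - t)) ≤ L := by
      rw [hL]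
      gcongr
      linarith [ht.1]
    rw [div_le_iff₀ (Real.exp_pos _)]
    exact h1.trans (mul_le_mul_of_nonneg_left h2 (norm_nonneg _))
  have hηle : ∀ t ∈ Icc 0 T₁, |η t| ≤ crossC M K * κ * α * ‖F.c (w t) + F.y (w t)‖ :=
    fun t ht => (hη t ht).2
  have hNnn : ∀ t ∈ Icc 0 T₁, 0 ≤ frobInner ((w t).A₂ * d) (F.c (w t)) := fun t ht =>
    le_trans (by positivity) (hcross t ht).2
  have hL0 : 0 < L := Real.exp_pos _
  -- The driver is `⟨A₂d, y⟩`. Its velocity is `coupling * ⟨A₂d, c⟩` up to an error with a factor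
  -- `κ`, so it never falls fast, and it rises at a rate of order `α Θ₁` in the window.
  have key := le_of_driven (T₁ := T₁) (τ₀ := F.window M)
    (χ := fun s => frobInner ((w s).A₂ * d) (F.y (w s)))
    (ω := fun s => frobInner ((w s).B₁ᵀ * d) (F.a (w s)) / ‖F.a (w s)‖)
    (l := fun s => ‖F.a (w s)‖) (e := fun s => F.e (w s)) (k := fun s => τ * ‖F.a (w s)‖ ^ 2)
    (ρ := fun s => -frobInner (F.R₂ * d) (F.Bo₂ (w s) * ((w s).A₂ * (F.X₁ (w s) * F.v))) -
          frobInner ((w s).B₂ * ((w s).A₂ * d)) (F.Eu (w s) * F.v))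
    (β := 2 * crossC M K * κ * (α * Θ₁)) (c := F.σ * F.thr / (32 * K ^ 2 * L) * (α * Θ₁))
    (l₀ := √(F.thr / 2)) (l₁ := M) (σ := F.σ)
    (ϱ := 3 * M ^ 2 * κ * (F.tailBoundC M K * (α * Θ₁)))
    hwin.le (S.window_le A) (by simp [y, S.B₂_zero, frobInner_zero_right])
    (fun t ht => (hη t ht).1) (fun t ht => by
      have h1 := (abs_le.1 (hηle t ht)).1
      have h2 := mul_nonneg (S.coupling_nonneg A ht) (hNnn t ht)
      have h3 := mul_le_mul_of_nonneg_left (S.norm_c_add_y_le A hv hC hC8 ht.1 ht.2 le_rfl)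
        (show 0 ≤ crossC M K * κ * α by positivity)
      linarith)
    (fun t ht => by
      have h0 : 0 ≤ t := (sub_nonneg.2 (S.window_le A)).trans ht.1
      have ht' : t ∈ Icc 0 T₁ := ⟨h0, ht.2⟩
      have h1 := (abs_le.1 (hηle t ht')).1
      have h2 := (S.early_facts (ht'.2.trans A.le_T) (A.early_of_mem ht')
          ⟨ht'.1, le_rfl⟩).2.2.1
      have h3 : F.σ / 2 * (F.thr / 2) ≤ F.coupling (w t) :=
        mul_le_mul h2 (by linarith [S.half_thr_le_p A ht h0, S.σ₁_nonneg]) (by positivity)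
          (by linarith)
      have h4 := mul_le_mul h3 (hcross t ht').2 (by positivity) (S.coupling_nonneg A ht')
      have h5 := S.mul_κ_le hC₄
      have h6 : crossC M K * κ ≤ F.σ * F.thr / (32 * K ^ 2) := by
        rw [le_div_iff₀ (by positivity)]
        have : 8 * K ^ 2 * crossC M K / (F.σ * F.thr) * 4 * κ =
          crossC M K * κ * (32 * K ^ 2) / (F.σ * F.thr) := by ring
        rw [this, div_le_one (by positivity)] at h5
        exact h5
      have h7 := mul_le_mul_of_nonneg_right h6
        (show 0 ≤ α * ‖F.c (w t) + F.y (w t)‖ by positivity)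
      have h8 := mul_le_mul_of_nonneg_left (hΘwin t ht h0)
        (show 0 ≤ F.σ * F.thr / (32 * K ^ 2) * α by positivity)
      have h9 : F.σ / 2 * (F.thr / 2) * (α / (4 * K ^ 2) * ‖F.c (w t) + F.y (w t)‖) =
          2 * (F.σ * F.thr / (32 * K ^ 2) * α * ‖F.c (w t) + F.y (w t)‖) := by
        field_simp
        ring
      have h10 : F.σ * F.thr / (32 * K ^ 2 * L) * (α * Θ₁) =
          F.σ * F.thr / (32 * K ^ 2) * α * (Θ₁ / L) := by
        field_simp
      rw [h10]
      linarith)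
    (by simp [S.B₁_zero, frobInner_zero_left])
    (fun t ht => S.flow.tail_component S.B₁_zero hv hd hτ ht.1 (S.norm_a_pos hv ht.1))
    hJ0 (fun t ht => hJ t ht.1) (fun t _ => by positivity) hJ₁ (by positivity) (by positivity)
    (fun t ht => ⟨norm_nonneg _, (F.norm_a_le _).trans
      (S.bounded ht.1 (A.early t ht).toGood).A₁⟩)
    (fun t ht => by
      have h0 : 0 ≤ t := (sub_nonneg.2 (S.window_le A)).trans ht.1
      refine Real.sqrt_le_iff.2 ⟨norm_nonneg _, (S.half_thr_le_p A ht h0).trans ?_⟩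
      exact p_le_norm_a_sq hv (S.flow.balance₁ S.B₁_zero h0))
    hσ.le (fun t ht => by
      have := S.early_facts (ht.2.trans A.le_T) (A.early_of_mem ht) ⟨ht.1, le_rfl⟩
      exact ⟨this.2.2.1, this.2.2.2.1⟩)
    fun t ht => by
      have hb := S.bounded ht.1 (A.early t ht).toGood
      obtain ⟨t1, t2⟩ := S.norm_tail_le A hv hC hC' hC₁ hC₂ ⟨ht.1, ht.2.trans A.le_T⟩
      refine hb.abs_tail_error_le hd1.le ?_ t1 t2
      have := fro_mul_le hb.A₂ hd1.le
      linarith [S.κ_le_one]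
  have hX : 0 < α * Θ₁ := by positivity
  set X := α * Θ₁ with hXdef
  have hT₁ := A.nonneg
  have hTT := A.le_T
  have hE1 : 1 ≤ Real.exp (8 * M ^ 3 / (F.σ * F.σ₂)) := Real.one_le_exp (by positivity)
  have htb : 0 ≤ F.tailBoundC M K := Real.sqrt_nonneg _
  have hdr := S.driveC_pos
  have k1 : √(F.thr / 2) * F.σ * (F.σ * F.thr / (32 * K ^ 2 * L) * X) * F.window M ^ 2 / 4 =
      F.driveC M K * X := by
    unfold driveC
    ring
  have k2 : Real.exp (8 * M ^ 3 / (F.σ * F.σ₂)) * (M * (F.σ * (2 * crossC M K * κ * X * T₁) +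
      3 * M ^ 2 * κ * (F.tailBoundC M K * X))) * T₁ ≤ F.dragC M K * κ * (1 + T) ^ 2 * X := by
    unfold dragC
    have m1 : T₁ * T₁ ≤ (1 + T) ^ 2 := by nlinarith
    have m2 : T₁ ≤ (1 + T) ^ 2 := by nlinarith
    have m3 := mul_le_mul_of_nonneg_left m1 (show 0 ≤ Real.exp (8 * M ^ 3 / (F.σ * F.σ₂)) * M *
      (F.σ * (2 * crossC M K)) * κ * X by positivity)
    have m4 := mul_le_mul_of_nonneg_left m2 (show 0 ≤ Real.exp (8 * M ^ 3 / (F.σ * F.σ₂)) * M *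
      (3 * M ^ 2 * F.tailBoundC M K) * κ * X by positivity)
    linarith
  -- The total loss carries a factor `κ` and at most two powers of the horizon, while the gain has a
  -- fixed window. This explains the square in `hC₅`; half of the gain survives.
  have k3 : F.dragC M K * κ * (1 + T) ^ 2 ≤ F.driveC M K / 2 := by
    have : 2 * F.dragC M K / F.driveC M K * κ * (1 + T) ^ 2 =
      2 * (F.dragC M K * κ * (1 + T) ^ 2) / F.driveC M K := by ring
    rw [this, div_le_one hdr] at hC₅
    linarith
  have k4 := mul_le_mul_of_nonneg_right k3 hX.le
  rw [k1] at key
  have k5 : F.driveC M K / 2 * X ≤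
      frobInner ((w T₁).B₁ᵀ * d) (F.a (w T₁)) / ‖F.a (w T₁)‖ * Real.exp (J T₁) := by linarith
  have k6 : 0 ≤ frobInner ((w T₁).B₁ᵀ * d) (F.a (w T₁)) / ‖F.a (w T₁)‖ :=
    nonneg_of_mul_nonneg_left (le_trans (by positivity) k5) (Real.exp_pos _)
  have k7 := k5.trans (mul_le_mul_of_nonneg_left (Real.exp_le_exp.2 hJ₁) k6)
  rw [div_mul_eq_mul_div, div_le_iff₀ (by positivity)]
  linarith

end Setting

end AlignedModel

end TailLowerBound

/-! ### The misalignment scale in the three cases -/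

section Endgame

open scoped Matrix.Norms.Frobenius

namespace AlignedModel

variable {m n h r : ℕ} {F : AlignedModel m n h} {x : LoRAWeights m n h r}

/-- From the alignment time on, the residual stays within `C₀ D` of its component along `u vᵀ`, the
squared sine of the angle between the top singular vector and `(g; v)` stays within `C₀ D²`, and at
the alignment time it is comparable to `D²`. -/
structure Endgame (F : AlignedModel m n h) (w : ℝ → LoRAWeights m n h r) (α T T₁ C₀ D : ℝ) :
    Prop where
  nonneg : 0 ≤ D
  le : D ≤ C₀ * α
  norm_Eo_le : ∀ t ∈ Icc T₁ T, ‖F.Eo (w t)‖ ≤ C₀ * D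
  defect_le : ∀ t ∈ Icc T₁ T, ∀ s qB qA, F.IsTop (w t) s qB qA → F.defect qB qA ≤ C₀ * D ^ 2
  le_defect : ∀ s qB qA, F.IsTop (w T₁) s qB qA → D ^ 2 ≤ C₀ * F.defect qB qA

/-- When `n = 1`, balance forces `a(t)` to be parallel to `a(0)`; this is equality in
Cauchy–Schwarz. -/
theorem norm_a_sq_mul_norm_a_zero_sq {x₀ : LoRAWeights m n h r} (hv : F.v * F.vᵀ = 1)
    (hS : x.A₁ * x.A₁ᵀ = x.B₁ᵀ * x.B₁ + x₀.A₁ * x₀.A₁ᵀ) :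
    ‖F.a x‖ ^ 2 * ‖F.a x₀‖ ^ 2 = frobInner (F.a x) (F.a x₀) ^ 2 := by
  have h1 : frobInner (F.a x) (‖F.a x‖ ^ 2 • F.a x₀ - frobInner (F.a x) (F.a x₀) • F.a x) = 0 := by
    rw [frobInner_sub_right, frobInner_smul_right, frobInner_smul_right, frobInner_self]
    ring
  have h2 := (balance_of_single_column hv hS h1).2
  have h3 : frobInner (F.a x₀)
      (‖F.a x‖ ^ 2 • F.a x₀ - frobInner (F.a x) (F.a x₀) • F.a x) = 0 := by
    rw [show F.a x₀ = x₀.A₁ * F.v from rfl] at h2 ⊢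
    rw [frobInner_mul_left, h2, frobInner_zero_right]
  rw [frobInner_sub_right, frobInner_smul_right, frobInner_smul_right, frobInner_self,
    frobInner_comm (F.a x₀)] at h3
  linarith

theorem norm_transpose_mul_a_sq {x₀ : LoRAWeights m n h r} (hv : F.v * F.vᵀ = 1)
    (hS : x.A₁ * x.A₁ᵀ = x.B₁ᵀ * x.B₁ + x₀.A₁ * x₀.A₁ᵀ) :
    ‖x₀.A₁ᵀ * F.a x‖ ^ 2 = ‖F.a x₀‖ ^ 2 * ‖F.a x‖ ^ 2 := by
  have h1 : x₀.A₁ᵀ * F.a x = frobInner (F.a x₀) (F.a x) • F.v := by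
    conv_lhs => rw [F.A₁_eq x₀]
    rw [Ao₁_eq_zero hv, add_zero, transpose_mul, transpose_transpose, Matrix.mul_assoc,
      transpose_mul_col]
    simp
  rw [h1, norm_smul, F.norm_v, mul_one, Real.norm_eq_abs, sq_abs, frobInner_comm,
    ← norm_a_sq_mul_norm_a_zero_sq hv hS]
  ring

namespace Setting

variable {w : ℝ → LoRAWeights m n h r} {K M α κ T C T₁ : ℝ}
  (S : F.Setting w K M α κ T C) (A : F.AlignedAt w κ T T₁)

include S A

/-- If `n ≥ 2`, the general upper bounds are already sharp in order, and the transverse component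
supplies the matching lower bound of order `α²` for the defect. -/
theorem endgame_of_transverse {d : Matrix (Fin n) Unit ℝ} (hd : F.vᵀ * d = 0) (hd1 : ‖d‖ ≤ 1)
    (hgen : α ^ 2 / K ≤ |frobInner (F.a (w 0)) ((w 0).A₁ * d)|)
    (hC₁ : 2 * K ^ 4 * F.ratioC M K ≤ C) (hC₂ : 98 * K ^ 2 / F.thr ≤ C) {C₀ : ℝ}
    (h1 : 1 ≤ C₀) (h2 : 8 * M ^ 2 * K ≤ C₀) (h3 : 49 * K ^ 2 / F.thr ≤ C₀)
    (h4 : 20 * M ^ 4 * K ^ 4 * Real.exp (2 * F.σ₂ / F.σ * (4 * M)) / F.thr ≤ C₀) :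
    F.Endgame w α T T₁ C₀ α where
  nonneg := S.α_pos.le
  le := by nlinarith [S.α_pos]
  norm_Eo_le t ht := (S.norm_Eo_le_of_late A ht.2 (fun s hs => S.late A s ⟨hs.1, hs.2.trans ht.2⟩)
    ⟨ht.1, le_rfl⟩).trans (mul_le_mul_of_nonneg_right h2 S.α_pos.le)
  defect_le t ht s qB qA hx := by
    have hm := S.misalignment_le (A.nonneg.trans ht.1) (S.off_le_of_mem A ht)
      ((half_pos S.thr_pos).le.trans (S.late A t ht).p)
    refine (S.defect_le_of_misalignment_le A ht hx hm).trans ?_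
    have : (7 * K * α) ^ 2 / F.thr = 49 * K ^ 2 / F.thr * α ^ 2 := by ring
    rw [this]
    exact mul_le_mul_of_nonneg_right h3 (sq_nonneg _)
  le_defect s qB qA hx := (S.sq_le_defect_of_transverse A hd hd1 hgen hC₁ hC₂ hx).trans
    (mul_le_mul_of_nonneg_right h4 (defect_nonneg hx.unit))

variable (hv : F.v * F.vᵀ = 1)

include hv

/-- When there is a single column, the misalignment is controlled by the tail of `B₁`. -/
theorem misalignment_le_of_tail {t : ℝ} (ht : t ∈ Icc T₁ T) :
    F.misalignment (w t) ≤
      (‖F.Bo₁ (w t)‖ ^ 2 + (K * α) ^ 2) / √(F.thr / 2) + ‖F.Bo₁ (w t)‖ := by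
  have h0 : 0 ≤ t := A.nonneg.trans ht.1
  have ha := S.norm_a_pos hv h0
  have hB := S.flow.balance₁ S.B₁_zero h0
  have hthr := S.thr_pos
  have h1 := norm_a_mul_norm_a_sub_b hv hB ha
  have h2 := norm_a_pow_four hv hB
  have h3 := p_le_norm_a_sq hv hB
  have h4 := (S.late A t ht).p
  have h5 : √(F.thr / 2) ≤ ‖F.a (w t)‖ := Real.sqrt_le_iff.2 ⟨norm_nonneg _, h4.trans h3⟩
  have h6 : ‖F.Bo₁ (w t) * F.a (w t)‖ ^ 2 ≤ (‖F.Bo₁ (w t)‖ * ‖F.a (w t)‖) ^ 2 :=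
    pow_le_pow_left₀ (norm_nonneg _) (fro_mul_le le_rfl le_rfl) 2
  have h7 : ‖((w 0).A₁)ᵀ * F.a (w t)‖ ^ 2 ≤ (K * α * ‖F.a (w t)‖) ^ 2 :=
    pow_le_pow_left₀ (norm_nonneg _)
      (fro_mul_le ((frobenius_norm_transpose _).le.trans S.A₁_le) le_rfl) 2
  unfold misalignment
  rw [Ao₁_eq_zero hv, norm_zero, add_zero]
  refine add_le_add ?_ le_rfl
  rw [le_div_iff₀ (by positivity)]
  rw [abs_of_nonneg (sub_nonneg.2 h3)] at h1
  have h8 : ‖F.a (w t)‖ ^ 2 - F.p (w t) ≤ ‖F.Bo₁ (w t)‖ ^ 2 + (K * α) ^ 2 := by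
    have h9 : (‖F.a (w t)‖ ^ 2 - F.p (w t)) * ‖F.a (w t)‖ ^ 2 ≤
        (‖F.Bo₁ (w t)‖ ^ 2 + (K * α) ^ 2) * ‖F.a (w t)‖ ^ 2 := by
      have := mul_nonneg (sub_nonneg.2 h3) (show 0 ≤ F.p (w t) by linarith)
      linarith
    exact le_of_mul_le_mul_right h9 (by positivity)
  have h10 := mul_le_mul_of_nonneg_left h5 (norm_nonneg (F.a (w t) - F.b (w t)))
  linarith

/-- The tail is bounded by a multiple of `D`, and so is `α²`, because `‖c + y‖` is at least of order
`α`. This controls the residual and the misalignment; `le_tail_component` gives the lower bound. -/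
theorem endgame_of_single_column (hC : 16 * pairC M K ^ 2 * K ^ 2 ≤ C)
    (hC' : 40 * M ^ 3 * K + 16 * K * pairC M K ≤ C) (hC₁ : 4 * M ^ 3 ≤ C)
    (hC₂ : 4 * M ^ 3 + 32 * M ^ 7 * K / F.rate ≤ C) (hC₃ : 10 * K ^ 2 * crossC M K ≤ C)
    (hC₄ : 8 * K ^ 2 * crossC M K / (F.σ * F.thr) * 4 ≤ C)
    (hC₅ : 2 * F.dragC M K / F.driveC M K * κ * (1 + T) ^ 2 ≤ 1)
    {d : Matrix (Fin h) Unit ℝ} (hd : F.gᵀ * d = 0) (hd1 : ‖d‖ = 1) {τ : ℝ}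
    (hτ : F.R₂ᵀ * (F.R₂ * d) = τ • d)
    (hgen : α ^ 2 / K ≤ |frobInner ((w 0).A₂ * d) (F.c (w 0))|) {C₀ : ℝ}
    (h1 : 2 ≤ C₀) (h2 : 2 * M ^ 2 * F.tailBoundC M K ≤ C₀)
    (h3 : ((F.tailBoundC M K + 2 * K ^ 3) / √(F.thr / 2) + F.tailBoundC M K) ^ 2 / F.thr ≤ C₀)
    (h4 : 2 * M ^ 2 / (F.driveC M K / (2 * Real.exp (8 * M ^ 3 / (F.σ * F.σ₂)))) ^ 2 ≤ C₀) :
    F.Endgame w α T T₁ C₀ (α * ‖F.c (w T₁) + F.y (w T₁)‖) := by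
  have hM := S.one_le_M
  have hK := S.one_le_K
  have hα := S.α_pos
  have hTm : T₁ ∈ Icc 0 T₁ := ⟨A.nonneg, le_rfl⟩
  have hTT : T₁ ∈ Icc T₁ T := ⟨le_rfl, A.le_T⟩
  have hΘ := S.norm_c_add_y_pos A hv hC hTm
  have hαΘ := S.sq_le_norm_c_add_y A hv hC hTm
  have hb := S.bounded A.nonneg (A.early T₁ hTm).toGood
  have htail := fun t (ht : t ∈ Icc T₁ T) =>
    S.norm_tail_le A hv hC hC' hC₁ hC₂ ⟨A.nonneg.trans ht.1, ht.2⟩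
  have hthr := S.thr_pos
  have htb : 0 ≤ F.tailBoundC M K := Real.sqrt_nonneg _
  have hdr := S.driveC_pos
  set D := α * ‖F.c (w T₁) + F.y (w T₁)‖ with hD
  have hD0 : 0 < D := by positivity
  have hbd := fun t (ht : t ∈ Icc T₁ T) =>
    S.bounded (A.nonneg.trans ht.1) (S.late A t ht).toGood
  constructor
  · exact hD0.le
  · have h5 : ‖F.c (w T₁) + F.y (w T₁)‖ ≤ 2 := by
      have := norm_add_le (F.c (w T₁)) (F.y (w T₁))
      have := (F.norm_c_le (w T₁)).trans hb.A₂
      have := (F.norm_y_le (w T₁)).trans hb.B₂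
      linarith [S.κ_le_one]
    rw [hD, mul_comm C₀]
    exact mul_le_mul_of_nonneg_left (h5.trans h1) hα.le
  · intro t ht
    rw [Eo_eq_neg_Eu hv, norm_neg]
    have h5 := (hbd t ht).norm_Eu_le
    obtain ⟨t1, t2⟩ := htail t ht
    have h6 := mul_le_mul_of_nonneg_left (add_le_add t1 t2) (sq_nonneg M)
    have h7 := mul_le_mul_of_nonneg_right h2 hD0.le
    linarith
  · intro t ht s qB qA hx
    have h5 := S.misalignment_le_of_tail A hv ht
    have h6 : F.misalignment (w t) ≤
        ((F.tailBoundC M K + 2 * K ^ 3) / √(F.thr / 2) + F.tailBoundC M K) * D := by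
      refine h5.trans ?_
      obtain ⟨t1, -⟩ := htail t ht
      have h7 : ‖F.Bo₁ (w t)‖ ≤ 1 := by
        have h8 := (F.norm_Bo₁_le_off (w t)).trans
          (S.late_off_le A ht.2 (fun s hs => S.late A s ⟨hs.1, hs.2.trans ht.2⟩) ⟨ht.1, le_rfl⟩)
        have := S.Kα_le
        have := S.κ_le_one
        linarith
      have h8 : ‖F.Bo₁ (w t)‖ ^ 2 ≤ F.tailBoundC M K * D := by
        have := mul_le_mul_of_nonneg_left h7 (norm_nonneg (F.Bo₁ (w t)))
        linarith
      have h9 : (K * α) ^ 2 ≤ 2 * K ^ 3 * D := by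
        have := mul_le_mul_of_nonneg_left hαΘ (show 0 ≤ K ^ 2 * α by positivity)
        rw [hD]
        linarith
      rw [add_mul, div_mul_eq_mul_div]
      refine add_le_add (div_le_div_of_nonneg_right ?_ (Real.sqrt_nonneg _)) t1
      linarith
    refine (S.defect_le_of_misalignment_le A ht hx h6).trans ?_
    rw [mul_pow, mul_div_right_comm]
    exact mul_le_mul_of_nonneg_right h3 (sq_nonneg _)
  · intro s qB qA hx
    -- The generic condition fixes only the absolute value of the initial correlation; replacing `d`
    -- by `-d` makes it positive.
    obtain ⟨d', hd', hd1', hτ', hgen'⟩ : ∃ d' : Matrix (Fin h) Unit ℝ, F.gᵀ * d' = 0 ∧ ‖d'‖ = 1 ∧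
        F.R₂ᵀ * (F.R₂ * d') = τ • d' ∧ α ^ 2 / K ≤ frobInner ((w 0).A₂ * d') (F.c (w 0)) := by
      rcases abs_cases (frobInner ((w 0).A₂ * d) (F.c (w 0))) with ⟨h5, -⟩ | ⟨h5, -⟩
      · exact ⟨d, hd, hd1, hτ, by rwa [← h5]⟩
      · refine ⟨-d, by simp [hd], by rwa [norm_neg], by simp [hτ], ?_⟩
        rw [Matrix.mul_neg, frobInner_neg_left, ← h5]
        exact hgen
    have h5 := S.le_tail_component A hv hC hC' hC₁ hC₂ hC₃ hC₄ hC₅ hd' hd1' hτ' hgen'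
    set c := F.driveC M K / (2 * Real.exp (8 * M ^ 3 / (F.σ * F.σ₂))) with hc
    have hc0 : 0 < c := by positivity
    have hs : 0 < s := by
      have := S.thr_le_sq A hTT hx
      rcases hx.nonneg.eq_or_lt with h | h
      · rw [← h] at this
        norm_num at this
        linarith
      · exact h
    have h6 := hx.sq_le_mul_defect hs hv (S.flow.balance₁ S.B₁_zero A.nonneg)
      (S.norm_a_pos hv A.nonneg) (dB := d') (dA := 0) (by rw [hd1', norm_zero]; norm_num) (by
        have h7 := transpose_mul_col F.g d'
        rw [hd'] at h7
        have := congrFun (congrFun h7 ()) ()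
        simp at this
        rw [← this, frobInner_zero_right, add_zero])
    rw [Matrix.mul_zero, add_zero] at h6
    have h7 := pow_le_pow_left₀ (by positivity) h5 2
    have h8 := S.sq_le_of_isTop A hTT hx
    have h9 := mul_le_mul_of_nonneg_right h8 (defect_nonneg (F := F) hx.unit)
    have h10 := mul_le_mul_of_nonneg_right h4 (defect_nonneg (F := F) hx.unit)
    refine le_trans ?_ h10
    rw [div_mul_eq_mul_div, le_div_iff₀ (by positivity)]
    change (c * D) ^ 2 ≤ _ at h7
    linarith [mul_pow c D 2]

/-- If also `h = 1`, then `Ao₂ = 0`, the tail has no source and vanishes. Only the difference of `a`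
and `b` is left, and conservation determines its order `α²` from both sides. -/
theorem endgame_of_single_column_of_single_row (hg : F.g * F.gᵀ = 1) (hC₁ : 4 * M ^ 3 ≤ C)
    (hC₂ : 4 * M ^ 3 + 32 * M ^ 7 * K / F.rate ≤ C) {C₀ : ℝ} (h1 : 1 ≤ C₀)
    (h3 : (K ^ 2 / √(F.thr / 2)) ^ 2 / F.thr ≤ C₀) (h4 : 16 * K ^ 4 * M ^ 4 ≤ C₀) :
    F.Endgame w α T T₁ C₀ (α ^ 2) := by
  have hM := S.one_le_M
  have hK := S.one_le_K
  have hα := S.α_pos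
  have hthr := S.thr_pos
  have hTT : T₁ ∈ Icc T₁ T := ⟨le_rfl, A.le_T⟩
  have hAo : ∀ x : LoRAWeights m n h r, F.Ao₂ x = 0 := fun x => by
    rw [Ao₂, c, Matrix.mul_assoc, hg, Matrix.mul_one, sub_self]
  have htail : ∀ t ∈ Icc T₁ T, F.Bo₁ (w t) = 0 ∧ F.Bo₂ (w t) = 0 := by
    intro t ht
    have h5 := S.tail_le A hv hC₁ hC₂ (Z := 1) (O := 0) (fun t ht => by
      have h6 := (S.good A t ht).size
      unfold AlignedModel.size₂ at h6
      have h7 := pow_le_pow_left₀ (norm_nonneg _) (F.norm_y_le (w t)) 2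
      nlinarith [sq_nonneg ‖(w t).A₂‖, S.κ_le_one, S.κ_pos]) (fun t _ => by rw [hAo]; simp)
      ⟨A.nonneg.trans ht.1, ht.2⟩
    rw [mul_zero, mul_zero] at h5
    constructor <;> rw [← norm_eq_zero] <;>
      nlinarith [sq_nonneg ‖F.Bo₁ (w t)‖, sq_nonneg ‖F.Bo₂ (w t)‖, norm_nonneg (F.Bo₁ (w t)),
        norm_nonneg (F.Bo₂ (w t))]
  constructor
  · positivity
  · have := mul_le_mul h1 S.α_le_one hα.le (by linarith)
    nlinarith [S.α_le_one]
  · intro t ht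
    obtain ⟨t1, t2⟩ := htail t ht
    rw [Eo_eq_neg_Eu hv, Eu, t1, t2]
    simp only [Matrix.zero_mul, Matrix.mul_zero, add_zero, neg_zero, norm_zero]
    positivity
  · intro t ht s qB qA hx
    have h5 := S.misalignment_le_of_tail A hv ht
    rw [(htail t ht).1, norm_zero] at h5
    have h6 : F.misalignment (w t) ≤ K ^ 2 / √(F.thr / 2) * α ^ 2 := h5.trans_eq (by ring)
    refine (S.defect_le_of_misalignment_le A ht hx h6).trans ?_
    rw [mul_pow, mul_div_right_comm]
    exact mul_le_mul_of_nonneg_right h3 (sq_nonneg _)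
  · intro s qB qA hx
    have ha := S.norm_a_pos hv A.nonneg
    have hB := S.flow.balance₁ S.B₁_zero A.nonneg
    have hs : 0 < s := by
      have := S.thr_le_sq A hTT hx
      rcases hx.nonneg.eq_or_lt with h | h
      · rw [← h] at this
        norm_num at this
        linarith
      · exact h
    have h2 : (√2)⁻¹ ^ 2 = (1 / 2 : ℝ) := by
      rw [inv_pow, Real.sq_sqrt (by norm_num)]
      norm_num
    -- The unit test pair proportional to `(g; -v)`, orthogonal to `(g; v)`, measures `a - b`.
    have h6 := hx.sq_le_mul_defect hs hv hB ha (dB := (√2)⁻¹ • F.g) (dA := -((√2)⁻¹ • F.v))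
      (by
        rw [norm_neg, norm_smul, norm_smul, F.norm_g, F.norm_v, mul_one, Real.norm_eq_abs, sq_abs,
          h2]
        norm_num)
      (by
        rw [frobInner_neg_right, frobInner_smul_right, frobInner_smul_right, frobInner_self,
          frobInner_self, F.norm_g, F.norm_v]
        ring)
    have h7 : frobInner ((w T₁).B₁ᵀ * ((√2)⁻¹ • F.g) + (w T₁).A₁ * -((√2)⁻¹ • F.v)) (F.a (w T₁)) =
        -((√2)⁻¹ * (‖F.a (w T₁)‖ ^ 2 - F.p (w T₁))) := by
      have e1 : (w T₁).B₁ᵀ * F.g = F.b (w T₁) := rfl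
      have e2 : (w T₁).A₁ * F.v = F.a (w T₁) := rfl
      rw [Matrix.mul_neg, Matrix.mul_smul, Matrix.mul_smul, e1, e2, frobInner_add_left,
        frobInner_neg_left, frobInner_smul_left, frobInner_smul_left, frobInner_self,
        frobInner_comm, p]
      ring
    have h8 := norm_a_pow_four hv hB
    rw [norm_transpose_mul_a_sq hv hB] at h8
    have h9 := p_le_norm_a_sq hv hB
    have h10 := S.le_a
    have h11 : ‖F.a (w T₁)‖ ≤ M := (F.norm_a_le _).trans
      (S.bounded A.nonneg (A.early T₁ ⟨A.nonneg, le_rfl⟩).toGood).A₁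
    -- Balance along `a` gives `(‖a‖² - p)(‖a‖² + p) ≥ ‖a(0)‖² ‖a‖²`, and the second factor is at
    -- most `2 ‖a‖²`.
    have h12 : (α / K) ^ 2 / 2 ≤ ‖F.a (w T₁)‖ ^ 2 - F.p (w T₁) := by
      have k1 := pow_le_pow_left₀ (by positivity) h10 2
      have k2 : (α / K) ^ 2 / 2 * ‖F.a (w T₁)‖ ^ 2 ≤
          (‖F.a (w T₁)‖ ^ 2 - F.p (w T₁)) * ‖F.a (w T₁)‖ ^ 2 := by
        have k3 := mul_le_mul_of_nonneg_right k1 (sq_nonneg ‖F.a (w T₁)‖)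
        have k4 := mul_nonneg (sub_nonneg.2 h9) (sub_nonneg.2 h9)
        have k5 := sq_nonneg ‖F.Bo₁ (w T₁) * F.a (w T₁)‖
        linarith
      exact le_of_mul_le_mul_right k2 (by positivity)
    rw [h7, div_pow, neg_sq, mul_pow, h2, div_le_iff₀ (by positivity)] at h6
    have h13 := pow_le_pow_left₀ (by positivity) h12 2
    have hdef := defect_nonneg (F := F) hx.unit
    have h14 : s ^ 2 * F.defect qB qA * ‖F.a (w T₁)‖ ^ 2 ≤
        2 * M ^ 2 * F.defect qB qA * M ^ 2 :=
      mul_le_mul (mul_le_mul_of_nonneg_right (S.sq_le_of_isTop A hTT hx) hdef)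
        (pow_le_pow_left₀ (norm_nonneg _) h11 2) (by positivity) (by positivity)
    refine le_trans ?_ (mul_le_mul_of_nonneg_right h4 hdef)
    have h15 : ((α / K) ^ 2 / 2) ^ 2 ≤ 4 * M ^ 4 * F.defect qB qA := by linarith
    have h16 : (α ^ 2) ^ 2 = 4 * K ^ 4 * ((α / K) ^ 2 / 2) ^ 2 := by
      field_simp
      ring
    rw [h16]
    have := mul_le_mul_of_nonneg_left h15 (show 0 ≤ 4 * K ^ 4 by positivity)
    linarith

end Setting

end AlignedModel

end Endgame

/-! ### From the misalignment scale to the stated estimates -/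

section Conclusions

open scoped Matrix.Norms.Frobenius

/-- Combines `1 - x₁ ≤ exp (-x₁)` with `exp (-2x) ≤ 1 - x` for `0 ≤ x ≤ 1/2`; the latter costs the
factor 2 in the exponent. -/
theorem one_sub_rpow_le {x₁ x B : ℝ} (hx₁ : x₁ ≤ 1) (hB : 0 ≤ B) (hx : x ≤ B * x₁)
    (hx0 : 0 ≤ x) (hx2 : x ≤ 1 / 2) : (1 - x₁) ^ (2 * B) ≤ 1 - x := by
  have h1 : (1 - x₁) ^ (2 * B) ≤ Real.exp (-x₁) ^ (2 * B) :=
    Real.rpow_le_rpow (by linarith) (by linarith [Real.add_one_le_exp (-x₁)]) (by positivity)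
  rw [← Real.exp_mul] at h1
  have h2 : Real.exp (-x₁ * (2 * B)) ≤ Real.exp (-(2 * x)) := Real.exp_le_exp.2 (by linarith)
  have h3 : Real.exp (-(2 * x)) ≤ 1 - x := by
    rw [Real.exp_neg, inv_le_comm₀ (Real.exp_pos _) (by linarith), ← one_div]
    refine le_trans ?_ (Real.add_one_le_exp _)
    rw [div_le_iff₀ (by linarith)]
    nlinarith
  exact h1.trans (h2.trans h3)

namespace AlignedModel

variable {m n h r : ℕ} {F : AlignedModel m n h} {x : LoRAWeights m n h r}

theorem norm_E_sq (F : AlignedModel m n h) (x : LoRAWeights m n h r) :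
    ‖F.E x‖ ^ 2 = F.e x ^ 2 + ‖F.Eo x‖ ^ 2 := by
  have h1 : frobInner (F.u * F.vᵀ) (F.E x) = F.e x := by rw [frobInner_col_mul, e]
  have h2 : ‖F.u * F.vᵀ‖ = 1 := by rw [norm_col_mul_row, F.norm_u, F.norm_v, mul_one]
  rw [Eo, norm_sub_sq_frob, frobInner_smul_right, frobInner_comm, h1, norm_smul, h2,
    Real.norm_eq_abs, mul_one, sq_abs]
  ring

/-- The floor of the loss relative to the squared misalignment. -/
noncomputable def floorC (F : AlignedModel m n h) (M C₀ : ℝ) : ℝ :=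
  ((4 * M ^ 4 * C₀ / F.rate) ^ 2 + C₀ ^ 2) / 2

namespace Setting

variable {w : ℝ → LoRAWeights m n h r} {K M α κ T C T₁ C₀ D : ℝ}
  (S : F.Setting w K M α κ T C) (A : F.AlignedAt w κ T T₁)

include S A

theorem thr_le_half_norm_sq {t : ℝ} (ht : t ∈ Icc T₁ T) :
    2 * F.thr ≤ ‖F.a (w t) + F.b (w t)‖ ^ 2 := by
  have h1 := norm_sub_sq_frob (F.a (w t)) (F.b (w t))
  have h2 := (S.late A t ht).p
  unfold p at h2
  rw [norm_add_sq_frob]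
  linarith [sq_nonneg ‖F.a (w t) - F.b (w t)‖]

omit A in
-- Conservation for the second pair gives `‖A₂ᵀ z‖² = ‖B₂ z‖² + ‖A₂(0)ᵀ z‖²`, so `A₂` cannot shrink
-- on the fixed vector `c(0)`. This bounds the norm of `Z₂` below by order `α`.
theorem le_norm_A₂t_mul {t : ℝ} (ht : 0 ≤ t) :
    α / K * ‖F.c (w 0)‖ ≤ ‖(w t).A₂ᵀ * F.c (w 0)‖ := by
  have h1 := S.flow.balance₂ S.B₂_zero ht
  have h2 : ‖(w t).A₂ᵀ * F.c (w 0)‖ ^ 2 =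
      ‖(w t).B₂ * F.c (w 0)‖ ^ 2 + ‖(w 0).A₂ᵀ * F.c (w 0)‖ ^ 2 := by
    rw [← frobInner_self, frobInner_mul_left, transpose_transpose, ← Matrix.mul_assoc, h1,
      Matrix.add_mul, frobInner_add_right, ← frobInner_self, ← frobInner_self, frobInner_mul_left,
      frobInner_mul_left, transpose_transpose, Matrix.mul_assoc, Matrix.mul_assoc]
  have h3 : ‖F.c (w 0)‖ ^ 2 ≤ ‖(w 0).A₂ᵀ * F.c (w 0)‖ := by
    have h4 : frobInner F.g ((w 0).A₂ᵀ * F.c (w 0)) = ‖F.c (w 0)‖ ^ 2 := by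
      rw [← frobInner_self, ← frobInner_mul_left]
      rfl
    have h5 := frobInner_le F.g ((w 0).A₂ᵀ * F.c (w 0))
    rw [h4, F.norm_g, one_mul] at h5
    exact h5
  have h6 : ‖(w 0).A₂ᵀ * F.c (w 0)‖ ≤ ‖(w t).A₂ᵀ * F.c (w 0)‖ :=
    le_of_sq_le_sq (by rw [h2]; linarith [sq_nonneg ‖(w t).B₂ * F.c (w 0)‖]) (norm_nonneg _)
  have h7 := mul_le_mul_of_nonneg_right S.le_c (norm_nonneg (F.c (w 0)))
  linarith

theorem size_le_of_mem {t : ℝ} (ht : t ∈ Icc T₁ T) :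
    AlignedModel.size₂ (w t) ≤ F.growC M * F.sizeC M K * κ ^ 4 := by
  have h1 := S.size_le_of_late A ht.1 ht.2 fun s hs => S.late A s ⟨hs.1, hs.2.trans ht.2⟩
  have h2 := S.size_le A.nonneg A.le_T A.early
  have h3 := mul_le_mul_of_nonneg_left h2 (show 0 ≤ F.growC M from (Real.exp_pos _).le)
  linarith

variable (G : F.Endgame w α T T₁ C₀ D)

include G

theorem norm_E_sq_le {t : ℝ} (ht : t ∈ Icc T₁ T) : ‖F.E (w t)‖ ^ 2 / 2 ≤
    Real.exp (-F.rate * (t - T₁)) * (‖F.E (w T₁)‖ ^ 2 / 2) + F.floorC M C₀ * D ^ 2 := by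
  have h1 := S.e_sq_le A ht.1 (fun s hs => S.late A s ⟨hs.1, hs.2.trans ht.2⟩)
    fun s hs => G.norm_Eo_le s ⟨hs.1, hs.2.trans ht.2⟩
  have h2 := pow_le_pow_left₀ (norm_nonneg _) (G.norm_Eo_le t ht) 2
  have h3 := mul_nonneg (Real.exp_pos (-F.rate * (t - T₁))).le (sq_nonneg ‖F.Eo (w T₁)‖)
  have h4 : (4 * M ^ 4 * (C₀ * D) / F.rate) ^ 2 = (4 * M ^ 4 * C₀ / F.rate) ^ 2 * D ^ 2 := by ring
  rw [norm_E_sq, norm_E_sq, floorC]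
  rw [h4] at h1
  linarith

/-- The floor `D²` is exchanged for the defect at `T₁`. The true rate is `(1 - δ) σ σ₂ / 8`; the
factor `1 - q` with `q ≥ 0` and the 16 only weaken it, so nothing else about `q` is needed. -/
theorem norm_E_sq_le_defect {t : ℝ} (ht : t ∈ Icc T₁ T) {q : ℝ} (hq : 0 ≤ q)
    {s : ℝ} {qB : Matrix (Fin h) Unit ℝ} {qA : Matrix (Fin n) Unit ℝ}
    (hx : F.IsTop (w T₁) s qB qA) : ‖F.E (w t)‖ ^ 2 / 2 ≤
    2 * Real.exp (-((1 - q) * (1 - F.σ₁ / F.σ₂) * (F.σ * F.σ₂) * (t - T₁) / 16)) *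
      (‖F.E (w T₁)‖ ^ 2 / 2) + F.floorC M C₀ * C₀ * F.defect qB qA := by
  have h1 := S.norm_E_sq_le A G ht
  have h2 : F.rate = (1 - F.σ₁ / F.σ₂) * (F.σ * F.σ₂) / 8 := by
    have := S.σ₂_pos
    unfold rate thr
    field_simp
    ring
  have h0 : 0 ≤ (1 - F.σ₁ / F.σ₂) * (F.σ * F.σ₂) * (t - T₁) := by
    have := S.σ₂_pos
    have := S.σ_pos
    have := S.ratio_lt
    have := ht.1
    have : 0 ≤ t - T₁ := by linarith
    have : 0 ≤ 1 - F.σ₁ / F.σ₂ := by linarith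
    positivity
  have h3 : Real.exp (-F.rate * (t - T₁)) ≤
      Real.exp (-((1 - q) * (1 - F.σ₁ / F.σ₂) * (F.σ * F.σ₂) * (t - T₁) / 16)) := by
    refine Real.exp_le_exp.2 ?_
    rw [h2]
    have := mul_nonneg hq h0
    linarith
  have hfl : 0 ≤ F.floorC M C₀ := by unfold floorC; positivity
  have h4 := mul_le_mul_of_nonneg_left (G.le_defect s qB qA hx) hfl
  have h5 := mul_le_mul_of_nonneg_right h3 (show 0 ≤ ‖F.E (w T₁)‖ ^ 2 / 2 by positivity)
  have h6 := mul_nonneg (Real.exp_pos (-((1 - q) * (1 - F.σ₁ / F.σ₂) * (F.σ * F.σ₂) *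
    (t - T₁) / 16))).le (show 0 ≤ ‖F.E (w T₁)‖ ^ 2 / 2 by positivity)
  linarith

/-- Here `D² ≤ C₀² α²`, and one power of `α` absorbs the constants; hence the exponent 1. -/
theorem norm_E_sq_le_rpow (hC : F.floorC M C₀ * C₀ ^ 2 ≤ C) {t : ℝ} (ht : t ∈ Icc T₁ T) :
    ‖F.E (w t)‖ ^ 2 / 2 ≤
    2 * Real.exp (-((1 - F.σ₁ / F.σ₂) * (F.σ * F.σ₂) * (t - T₁) / 32)) *
      (‖F.E (w T₁)‖ ^ 2 / 2) + 2 * α ^ (1 : ℝ) := by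
  have h1 := S.norm_E_sq_le A G ht
  have h2 : F.rate = (1 - F.σ₁ / F.σ₂) * (F.σ * F.σ₂) / 8 := by
    have := S.σ₂_pos
    unfold rate thr
    field_simp
    ring
  have h0 : 0 ≤ (1 - F.σ₁ / F.σ₂) * (F.σ * F.σ₂) * (t - T₁) := by
    have := S.σ₂_pos
    have := S.σ_pos
    have := S.ratio_lt
    have := ht.1
    have : 0 ≤ t - T₁ := by linarith
    have : 0 ≤ 1 - F.σ₁ / F.σ₂ := by linarith
    positivity
  have h3 : Real.exp (-F.rate * (t - T₁)) ≤
      Real.exp (-((1 - F.σ₁ / F.σ₂) * (F.σ * F.σ₂) * (t - T₁) / 32)) := by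
    refine Real.exp_le_exp.2 ?_
    rw [h2]
    linarith
  have hfl : 0 ≤ F.floorC M C₀ := by unfold floorC; positivity
  have h4 : F.floorC M C₀ * D ^ 2 ≤ α := by
    have hα := S.α_pos
    have k1 := pow_le_pow_left₀ G.nonneg G.le 2
    have k2 := mul_le_mul_of_nonneg_left k1 hfl
    have k3 := S.mul_κ_le hC
    have k4 := mul_le_mul_of_nonneg_left S.α_le_κ (show 0 ≤ F.floorC M C₀ * C₀ ^ 2 by positivity)
    have k5 := mul_le_mul_of_nonneg_right (k4.trans k3) hα.le
    linarith
  have h5 := mul_le_mul_of_nonneg_right h3 (show 0 ≤ ‖F.E (w T₁)‖ ^ 2 / 2 by positivity)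
  have h6 := mul_nonneg (Real.exp_pos (-((1 - F.σ₁ / F.σ₂) * (F.σ * F.σ₂) *
    (t - T₁) / 32))).le (show 0 ≤ ‖F.E (w T₁)‖ ^ 2 / 2 by positivity)
  rw [Real.rpow_one]
  linarith [S.α_pos]

theorem defect_le_rpow (hC₀ : 0 ≤ C₀) {s : ℝ} {qB : Matrix (Fin h) Unit ℝ}
    {qA : Matrix (Fin n) Unit ℝ} (hx : F.IsTop (w T₁) s qB qA) {β : ℝ} (hβ : β ≤ 2) :
    F.defect qB qA ≤ C₀ ^ 3 * α ^ β := by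
  have h1 := G.defect_le T₁ ⟨le_rfl, A.le_T⟩ s qB qA hx
  have h2 := mul_le_mul_of_nonneg_left (pow_le_pow_left₀ G.nonneg G.le 2) hC₀
  have h3 := Real.rpow_le_rpow_of_exponent_ge S.α_pos S.α_le_one hβ
  rw [Real.rpow_two] at h3
  have h4 := mul_le_mul_of_nonneg_left h3 (show 0 ≤ C₀ ^ 3 by positivity)
  linarith

omit A in
-- Through the scale `D`, the later defect is at most `C₀²` times the one at `T₁`, and it is small.
theorem one_sub_defect_rpow_le (hC₀ : 1 ≤ C₀) (hC : 2 * C₀ ^ 3 ≤ C) {t : ℝ} (ht : t ∈ Icc T₁ T)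
    {s s₁ : ℝ} {qB q₁B : Matrix (Fin h) Unit ℝ} {qA q₁A : Matrix (Fin n) Unit ℝ}
    (hx : F.IsTop (w t) s qB qA) (hx₁ : F.IsTop (w T₁) s₁ q₁B q₁A) :
    (1 - F.defect q₁B q₁A) ^ (2 * C₀ ^ 2) ≤ 1 - F.defect qB qA := by
  have h1 := G.defect_le t ht s qB qA hx
  have h2 := mul_le_mul_of_nonneg_left (G.le_defect s₁ q₁B q₁A hx₁) (show 0 ≤ C₀ by linarith)
  have h3 : F.defect qB qA ≤ 1 / 2 := by
    have hα := S.α_pos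
    have k1 := mul_le_mul_of_nonneg_left (pow_le_pow_left₀ G.nonneg G.le 2)
      (show 0 ≤ C₀ by linarith)
    have k3 := S.mul_κ_le hC
    have k4 := mul_le_mul_of_nonneg_left S.α_le_κ (show 0 ≤ 2 * C₀ ^ 3 by positivity)
    have k5 : α ^ 2 ≤ α := by nlinarith [S.α_le_one]
    have k6 := mul_le_mul_of_nonneg_left k5 (show 0 ≤ 2 * C₀ ^ 3 by positivity)
    linarith
  refine one_sub_rpow_le ?_ (by positivity) (by linarith) (defect_nonneg hx.unit) h3
  unfold defect
  linarith [sq_nonneg (frobInner F.g q₁B + frobInner F.v q₁A)]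

end Setting

/-- The ratio of the sizes at the alignment time is at most a power of the later ratios. -/
theorem ratio_rpow_le {α θ κ B b s₁ s₂ t₁ t₂ : ℝ} (hα : 0 < α) (hθ : 0 ≤ θ)
    (hθ1 : θ ≤ 1) (hκ : 0 < κ) (hκα : κ ^ 2 = α ^ θ) (hB : 1 ≤ B)
    (hb : b * B * κ ≤ 1) (hb0 : 0 < b)
    (hs₁ : 0 ≤ s₁) (hs₂ : 0 < s₂) (hs : s₁ / s₂ ≤ B / α)
    (ht : 1 / b ≤ t₁ / t₂ * κ ^ 2) : (s₁ / s₂) ^ (θ / 2) ≤ t₁ / t₂ := by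
  have h1 : (s₁ / s₂) ^ (θ / 2) ≤ (B / α) ^ (θ / 2) :=
    Real.rpow_le_rpow (by positivity) hs (by positivity)
  have h2 : (B / α) ^ (θ / 2) ≤ B / κ := by
    rw [Real.div_rpow (by linarith) hα.le]
    have h3 : α ^ (θ / 2) = κ := by
      have : (α ^ (θ / 2)) ^ 2 = κ ^ 2 := by
        rw [← Real.rpow_natCast, ← Real.rpow_mul hα.le, hκα]
        congr 1
        push_cast
        ring
      exact (pow_left_inj₀ (by positivity) hκ.le two_ne_zero).1 this
    rw [h3]
    refine div_le_div_of_nonneg_right ?_ hκ.le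
    calc B ^ (θ / 2) ≤ B ^ (1 : ℝ) := Real.rpow_le_rpow_of_exponent_le hB (by linarith)
      _ = B := Real.rpow_one B
  refine h1.trans (h2.trans ?_)
  have h4 : B * κ ≤ 1 / b := by
    rw [le_div_iff₀ hb0]
    linarith
  have h5 : B / κ * κ ^ 2 ≤ t₁ / t₂ * κ ^ 2 := by
    refine le_trans (le_of_eq ?_) (h4.trans ht)
    field_simp
  exact le_of_mul_le_mul_right h5 (by positivity)

end AlignedModel

end Conclusions

/-! ### Generic properties of Gaussian initializations -/

section GenericInitialization

theorem pi_absolutelyContinuous {X : Type*} [MeasurableSpace X] : ∀ {k : ℕ}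
    (μ ν : Fin k → Measure X) [∀ i, SigmaFinite (μ i)] [∀ i, SigmaFinite (ν i)]
    (_ : ∀ i, μ i ≪ ν i), Measure.pi μ ≪ Measure.pi ν
  | 0, μ, ν, _, _, _ => by
    rw [Measure.pi_of_empty μ, Measure.pi_of_empty ν]
  | k + 1, μ, ν, _, _, hμν => by
    have h1 := (measurePreserving_piFinSuccAbove μ 0).symm.map_eq
    have h2 := (measurePreserving_piFinSuccAbove ν 0).symm.map_eq
    rw [← h1, ← h2]
    exact ((hμν 0).prod (pi_absolutelyContinuous _ _ fun i => hμν _)).map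
      (MeasurableEquiv.measurable _)

theorem stdGaussianMatrix_absolutelyContinuous (p q : ℕ) : stdGaussianMatrix p q ≪ volume :=
  pi_absolutelyContinuous _ _ fun _ => pi_absolutelyContinuous _ _ fun _ =>
    gaussianReal_absolutelyContinuous 0 one_ne_zero

instance (p q : ℕ) : IsProbabilityMeasure (stdGaussianMatrix p q) := by
  unfold stdGaussianMatrix
  infer_instance

theorem isAddHaarMeasure_volume (p q : ℕ) :
    (volume : Measure (Fin p → Fin q → ℝ)).IsAddHaarMeasure :=
  Measure.pi.isAddHaarMeasure (α := fun _ : Fin p => Fin q → ℝ) fun _ => volume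

/-- A quadratic function that does not vanish along some direction is almost everywhere nonzero. -/
theorem ae_ne_zero_of_quadratic {r n h : ℕ}
    {Q : (Fin r → Fin n → ℝ) × (Fin r → Fin h → ℝ) → ℝ} (hQ : Measurable Q)
    (e : (Fin r → Fin n → ℝ) × (Fin r → Fin h → ℝ)) {q : ℝ} (hq : q ≠ 0)
    (hQe : ∀ y, ∃ b, ∀ s : ℝ, Q (y + s • e) = q * s ^ 2 + b * s + Q y) :
    ∀ᵐ N ∂(stdGaussianMatrix r n).prod (stdGaussianMatrix r h), Q N ≠ 0 := by
  have := isAddHaarMeasure_volume r n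
  have := isAddHaarMeasure_volume r h
  have : ((volume : Measure (Fin r → Fin n → ℝ)).prod
      (volume : Measure (Fin r → Fin h → ℝ))).IsAddHaarMeasure :=
    Measure.prod.instIsAddHaarMeasure _ _
  refine ((stdGaussianMatrix_absolutelyContinuous r n).prod
    (stdGaussianMatrix_absolutelyContinuous r h)).ae_le ?_
  -- By disintegration along the lines in direction `e` it suffices to treat each line, where the
  -- function is a nonzero quadratic polynomial with finitely many zeros.
  refine ae_mem_of_ae_add_linearMap_mem (LinearMap.toSpanSingleton ℝ _ e) volume _
    (s := {N | Q N ≠ 0}) (measurableSet_eq_fun hQ measurable_const).compl fun y => ?_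
  obtain ⟨b, hb⟩ := hQe y
  have hfin : {s : ℝ | q * s ^ 2 + b * s + Q y = 0}.Finite := by
    open Polynomial in
    let P : ℝ[X] := C q * X ^ 2 + C b * X + C (Q y)
    have hP : P ≠ 0 := fun h0 => hq (by
      have := congrArg (fun p => Polynomial.coeff p 2) h0
      simpa [P, Polynomial.coeff_X, Polynomial.coeff_C] using this)
    refine (P.roots.toFinset.finite_toSet).subset fun s hs => ?_
    simpa [P, hP] using hs
  have h0 := hfin.measure_zero (volume : Measure ℝ)
  rw [← compl_mem_ae_iff] at h0
  filter_upwards [h0] with s hs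
  simp only [LinearMap.toSpanSingleton_apply, hb s]
  exact hs

/-- Moving only the first row in direction `e` gives the quadratic coefficient `(e ⬝ᵥ x) * (e ⬝ᵥ
y)`. This is where `r > 0` enters. -/
theorem ae_dotProduct_mul_ne_zero_left {r n h : ℕ} (hr : 0 < r) {x y : Fin n → ℝ}
    {e : Fin n → ℝ} (hx : e ⬝ᵥ x ≠ 0) (hy : e ⬝ᵥ y ≠ 0) :
    ∀ᵐ N ∂(stdGaussianMatrix r n).prod (stdGaussianMatrix r h),
      ∑ i, (N.1 i ⬝ᵥ x) * (N.1 i ⬝ᵥ y) ≠ 0 := by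
  let i₀ : Fin r := ⟨0, hr⟩
  refine ae_ne_zero_of_quadratic (by unfold dotProduct; fun_prop) (Pi.single i₀ e, 0)
    (mul_ne_zero hx hy) fun N => ⟨(e ⬝ᵥ x) * (N.1 i₀ ⬝ᵥ y) + (N.1 i₀ ⬝ᵥ x) * (e ⬝ᵥ y), fun s => ?_⟩
  have : ∀ i, ((N + s • (Pi.single i₀ e, 0)).1 i ⬝ᵥ x) * ((N + s • (Pi.single i₀ e, 0)).1 i ⬝ᵥ y) =
      (N.1 i ⬝ᵥ x) * (N.1 i ⬝ᵥ y) + if i = i₀ then (e ⬝ᵥ x) * (e ⬝ᵥ y) * s ^ 2 +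
        ((e ⬝ᵥ x) * (N.1 i₀ ⬝ᵥ y) + (N.1 i₀ ⬝ᵥ x) * (e ⬝ᵥ y)) * s else 0 := by
    intro i
    by_cases hi : i = i₀
    · subst hi
      simp [add_dotProduct, smul_dotProduct]
      ring
    · simp [hi]
  simp_rw [this]
  rw [Finset.sum_add_distrib, Finset.sum_ite_eq']
  simp
  ring

theorem ae_dotProduct_mul_ne_zero_right {r n h : ℕ} (hr : 0 < r) {x y : Fin h → ℝ}
    {e : Fin h → ℝ} (hx : e ⬝ᵥ x ≠ 0) (hy : e ⬝ᵥ y ≠ 0) :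
    ∀ᵐ N ∂(stdGaussianMatrix r n).prod (stdGaussianMatrix r h),
      ∑ i, (N.2 i ⬝ᵥ x) * (N.2 i ⬝ᵥ y) ≠ 0 := by
  have h1 := ae_dotProduct_mul_ne_zero_left (h := n) hr hx hy
  rw [← Measure.prod_swap] at h1
  exact ae_of_ae_map measurable_swap.aemeasurable h1

/-- With probability at least `1 - ε`, a random variable is at most a constant. -/
theorem exists_le_of_isProbabilityMeasure {Ω : Type*} [MeasurableSpace Ω] (μ : Measure Ω)
    [IsProbabilityMeasure μ] (ψ : Ω → ℝ) {ε : ℝ} (hε : 0 < ε) :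
    ∃ K : ℝ, 1 ≤ K ∧ 1 - ENNReal.ofReal ε ≤ μ {N | ψ N ≤ K} := by
  have hmono : Monotone fun k : ℕ => {N | ψ N ≤ k} := fun i j hij N hN =>
    (show ψ N ≤ i from hN).trans (Nat.cast_le.2 hij)
  have h1 := tendsto_measure_iUnion_atTop (μ := μ) hmono
  have h2 : ⋃ k : ℕ, {N | ψ N ≤ k} = univ := by
    rw [eq_univ_iff_forall]
    exact fun N => mem_iUnion.2 (exists_nat_ge (ψ N))
  rw [h2, measure_univ] at h1
  have h3 : 1 - ENNReal.ofReal ε < 1 :=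
    ENNReal.sub_lt_self ENNReal.one_ne_top one_ne_zero (by simpa using hε)
  obtain ⟨k, hk1, hk2⟩ := ((h1.eventually (lt_mem_nhds h3)).and
    (Filter.eventually_ge_atTop 1)).exists
  exact ⟨k, by exact_mod_cast hk2, hk1.le⟩

/-- With probability at least `1 - ε`, a random variable is at most a constant and three almost
everywhere nonzero ones are bounded away from zero. -/
theorem exists_event {Ω : Type*} [MeasurableSpace Ω] (μ : Measure Ω) [IsProbabilityMeasure μ]
    {f f₁ f₂ f₃ : Ω → ℝ} (hf : Measurable f) (hf₁ : Measurable f₁) (hf₂ : Measurable f₂)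
    (hf₃ : Measurable f₃) (h₁ : ∀ᵐ N ∂μ, f₁ N ≠ 0) (h₂ : ∀ᵐ N ∂μ, f₂ N ≠ 0)
    (h₃ : ∀ᵐ N ∂μ, f₃ N ≠ 0) {ε : ℝ} (hε : 0 < ε) :
    ∃ K : ℝ, 1 ≤ K ∧ ∃ S : Set Ω, MeasurableSet S ∧ 1 - ENNReal.ofReal ε ≤ μ S ∧
      ∀ N ∈ S, f N ≤ K ∧ 1 / K ≤ |f₁ N| ∧ 1 / K ≤ |f₂ N| ∧ 1 / K ≤ |f₃ N| := by
  obtain ⟨K, hK, hμ⟩ := exists_le_of_isProbabilityMeasure μ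
    (fun N => max (max (f N) |f₁ N|⁻¹) (max |f₂ N|⁻¹ |f₃ N|⁻¹)) hε
  -- Nonvanishing is part of the event because `0⁻¹ = 0` would otherwise let zeros satisfy the bound
  -- on the inverses.
  refine ⟨K, hK, {N | max (max (f N) |f₁ N|⁻¹) (max |f₂ N|⁻¹ |f₃ N|⁻¹) ≤ K ∧
    (f₁ N ≠ 0 ∧ f₂ N ≠ 0 ∧ f₃ N ≠ 0)}, ?_, ?_, ?_⟩
  · have hne : ∀ {f : Ω → ℝ}, Measurable f → MeasurableSet {N | f N ≠ 0} := fun hf =>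
      (measurableSet_eq_fun hf measurable_const).compl
    exact (measurableSet_le ((hf.max hf₁.norm.inv).max (hf₂.norm.inv.max hf₃.norm.inv))
      measurable_const).inter ((hne hf₁).inter ((hne hf₂).inter (hne hf₃)))
  · refine hμ.trans (measure_mono_ae ?_)
    filter_upwards [h₁, h₂, h₃] with N n1 n2 n3 hN
    exact ⟨hN, n1, n2, n3⟩
  · rintro N ⟨hN, n1, n2, n3⟩
    simp only [max_le_iff] at hN
    have : ∀ {y : ℝ}, y ≠ 0 → |y|⁻¹ ≤ K → 1 / K ≤ |y| := fun hy h => by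
      rw [one_div]
      exact inv_le_of_inv_le₀ (abs_pos.2 hy) h
    exact ⟨hN.1.1, this n1 hN.1.2, this n2 hN.2.1, this n3 hN.2.2⟩

end GenericInitialization

/-! ### Spectral norm -/

section SpectralNorm

variable {ι κ : Type*} [Fintype ι] [Fintype κ] [DecidableEq κ]

theorem specNorm_nonneg (M : Matrix ι κ ℝ) : 0 ≤ specNorm M := by
  open scoped Matrix.Norms.L2Operator in
  exact norm_nonneg M

theorem specNorm_transpose [DecidableEq ι] (M : Matrix ι κ ℝ) : specNorm Mᵀ = specNorm M := by
  open scoped Matrix.Norms.L2Operator in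
  have h := Matrix.l2_opNorm_conjTranspose M
  rwa [conjTranspose_eq_transpose_of_trivial] at h

theorem mulVec_dotProduct_self_le (M : Matrix ι κ ℝ) (x : κ → ℝ) :
    (M *ᵥ x) ⬝ᵥ (M *ᵥ x) ≤ specNorm M ^ 2 * (x ⬝ᵥ x) := by
  open scoped Matrix.Norms.L2Operator in
  have h := pow_le_pow_left₀ (norm_nonneg _) (Matrix.l2_opNorm_mulVec M (WithLp.toLp 2 x)) 2
  rw [mul_pow, EuclideanSpace.norm_sq_eq, EuclideanSpace.norm_sq_eq] at h
  simpa [dotProduct, sq, specNorm] using h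

theorem specNorm_sq_le (M : Matrix ι κ ℝ) : specNorm M ^ 2 ≤ ∑ i, ∑ j, M i j ^ 2 := by
  open scoped Matrix.Norms.L2Operator in
  have h0 : 0 ≤ ∑ i, ∑ j, M i j ^ 2 := by positivity
  have h : specNorm M ≤ √(∑ i, ∑ j, M i j ^ 2) := by
    change ‖M‖ ≤ _
    rw [Matrix.l2_opNorm_def]
    refine ContinuousLinearMap.opNorm_le_bound _ (Real.sqrt_nonneg _) fun x => ?_
    refine le_of_sq_le_sq ?_ (by positivity)
    rw [mul_pow, Real.sq_sqrt h0, EuclideanSpace.norm_sq_eq, EuclideanSpace.norm_sq_eq,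
      Finset.sum_mul]
    refine Finset.sum_le_sum fun i _ => ?_
    have := Finset.sum_mul_sq_le_sq_mul_sq Finset.univ (M i) x.ofLp
    simpa [Matrix.mulVec, dotProduct] using this
  have := pow_le_pow_left₀ (specNorm_nonneg M) h 2
  rwa [Real.sq_sqrt h0] at this

end SpectralNorm

/-! ### Vectors as column matrices -/

section Columns

open scoped Matrix.Norms.Frobenius

variable {ι κ : Type*} [Fintype ι] [Fintype κ]

/-- A vector as a column matrix. -/
def toCol (x : ι → ℝ) : Matrix ι Unit ℝ := Matrix.replicateCol Unit x

omit [Fintype ι] in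
@[simp] theorem col_apply (x : ι → ℝ) (i : ι) (j : Unit) : toCol x i j = x i := rfl

omit [Fintype ι] in
theorem mul_col (M : Matrix ι κ ℝ) (x : κ → ℝ) : M * toCol x = toCol (M *ᵥ x) :=
  (Matrix.replicateCol_mulVec M x).symm

theorem frobInner_col (x y : ι → ℝ) : frobInner (toCol x) (toCol y) = x ⬝ᵥ y := by
  simp [frobInner, dotProduct]

theorem norm_col_sq (x : ι → ℝ) : ‖toCol x‖ ^ 2 = x ⬝ᵥ x := by
  rw [← frobInner_self, frobInner_col]

theorem transpose_col_mul_col (x y : ι → ℝ) : (toCol x)ᵀ * toCol y = (x ⬝ᵥ y) • 1 := by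
  rw [transpose_mul_col, frobInner_col]

omit [Fintype ι] in
theorem col_smul (c : ℝ) (x : ι → ℝ) : toCol (c • x) = c • toCol x := rfl

omit [Fintype ι] in
theorem col_zero : toCol (0 : ι → ℝ) = 0 := rfl

theorem mul_transpose_of_subsingleton [DecidableEq ι] [Subsingleton ι] {x : Matrix ι Unit ℝ}
    (hx : xᵀ * x = 1) : x * xᵀ = 1 := by
  ext i j
  obtain rfl := Subsingleton.elim i j
  have h := congrFun (congrFun hx ()) ()
  rw [Matrix.mul_apply, Fintype.sum_eq_single i fun k hk => (hk (Subsingleton.elim k i)).elim] at h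
  simpa [Matrix.mul_apply] using h

end Columns

/-! ### Singular value decompositions -/

section SingularValueDecomposition

variable {p q : ℕ} {M : Matrix (Fin p) (Fin q) ℝ} {U : Matrix (Fin p) (Fin p) ℝ}
  {S : Matrix (Fin p) (Fin q) ℝ} {V : Matrix (Fin q) (Fin q) ℝ}

theorem dotProduct_of_mem_orthogonalGroup (hU : U ∈ Matrix.orthogonalGroup (Fin p) ℝ)
    (i j : Fin p) : U.col i ⬝ᵥ U.col j = if i = j then 1 else 0 := by
  rw [Matrix.mem_orthogonalGroup_iff'] at hU
  have := congrFun (congrFun hU i) j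
  rw [Matrix.mul_apply, Matrix.one_apply] at this
  simpa [dotProduct] using this

theorem IsSVD.transpose (hM : IsSVD M U S V) : IsSVD Mᵀ V Sᵀ U :=
  ⟨hM.2.1, hM.1, ⟨fun i j hij => hM.2.2.1.1 j i (Ne.symm hij), fun i j => hM.2.2.1.2 j i⟩, by
    rw [hM.2.2.2, transpose_mul, transpose_mul, transpose_transpose, Matrix.mul_assoc]⟩

theorem IsSVD.mulVec_eq (hM : IsSVD M U S V) (j : Fin q) :
    M *ᵥ V.col j = U *ᵥ S.col j := by
  have hV := (Matrix.mem_orthogonalGroup_iff' _ _).1 hM.2.1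
  have h1 : V.col j = V *ᵥ Pi.single j 1 := by simp
  have h2 : S.col j = S *ᵥ Pi.single j 1 := by simp
  rw [h1, h2, hM.2.2.2, Matrix.mulVec_mulVec, Matrix.mulVec_mulVec, Matrix.mul_assoc (U * S), hV,
    Matrix.mul_one]

theorem IsSVD.mulVec_col (hM : IsSVD M U S V) {i : Fin p} {j : Fin q} (hij : (i : ℕ) = j) :
    M *ᵥ V.col j = S i j • U.col i := by
  rw [hM.mulVec_eq]
  have : S.col j = S i j • Pi.single i 1 := by
    ext i'
    by_cases h : i' = i
    · subst h
      simp
    · have : S i' j = 0 := hM.2.2.1.1 _ _ fun h' => h (Fin.ext (h'.trans hij.symm))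
      simp [h, this]
  rw [this, Matrix.mulVec_smul]
  simp

theorem IsSVD.mulVec_col_eq_zero (hM : IsSVD M U S V) {j : Fin q} (hj : p ≤ j) :
    M *ᵥ V.col j = 0 := by
  rw [hM.mulVec_eq]
  have : S.col j = 0 := by
    ext i
    exact hM.2.2.1.1 _ _ (by omega)
  rw [this, Matrix.mulVec_zero]

/-- A matrix of rank one has a single nonzero singular value. -/
theorem IsSVD.eq_zero_of_rank_eq_one (hM : IsSVD M U S V) (hr : M.rank = 1) {i i' : Fin p}
    {j j' : Fin q} (hij : (i : ℕ) = j) (hij' : (i' : ℕ) = j') (hne : i ≠ i') (hS : S i j ≠ 0) :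
    S i' j' = 0 := by
  unfold Matrix.rank at hr
  obtain ⟨x, hx⟩ := finrank_le_one_iff.1 hr.le
  obtain ⟨c, hc⟩ := hx ⟨M *ᵥ V.col j, ⟨_, rfl⟩⟩
  obtain ⟨c', hc'⟩ := hx ⟨M *ᵥ V.col j', ⟨_, rfl⟩⟩
  have h1 : c • (x : Fin p → ℝ) = S i j • U.col i := by
    rw [← hM.mulVec_col hij]
    exact congrArg Subtype.val hc
  have h2 : c' • (x : Fin p → ℝ) = S i' j' • U.col i' := by
    rw [← hM.mulVec_col hij']
    exact congrArg Subtype.val hc'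
  have k1 := congrArg (fun z => z ⬝ᵥ U.col i) h1
  have k2 := congrArg (fun z => z ⬝ᵥ U.col i) h2
  have k3 := congrArg (fun z => z ⬝ᵥ U.col i') h2
  simp only [smul_dotProduct, dotProduct_of_mem_orthogonalGroup hM.1, if_pos, if_neg hne.symm,
    smul_eq_mul, mul_one, mul_zero] at k1 k2 k3
  rcases mul_eq_zero.1 k2 with h | h
  · rw [← k3, h, zero_mul]
  · exact absurd (by rw [← k1, h, mul_zero]) hS

end SingularValueDecomposition

/-! ### Reduction of the fine-tuning problem to the aligned model -/

namespace RankOneLoRA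

variable {m n h : ℕ} (P : RankOneLoRA m n h)

/-- The left singular vector of `Yft - Ypre`. -/
def u : Fin m → ℝ := P.U.col ⟨P.k, P.k_lt_m⟩

theorem v_eq : P.v = P.V.col ⟨P.k, P.k_lt_n⟩ := rfl

theorem g_eq : P.g = P.G.col ⟨P.k, P.k_lt_h⟩ := rfl

theorem u_dotProduct_u : P.u ⬝ᵥ P.u = 1 := by
  rw [u, dotProduct_of_mem_orthogonalGroup P.svd_pre.1, if_pos rfl]

theorem v_dotProduct_v : P.v ⬝ᵥ P.v = 1 := by
  rw [v_eq, dotProduct_of_mem_orthogonalGroup P.svd_pre.2.1, if_pos rfl]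

theorem g_dotProduct_g : P.g ⬝ᵥ P.g = 1 := by
  rw [g_eq, dotProduct_of_mem_orthogonalGroup P.svd_W₁.1, if_pos rfl]

theorem W₁_mul_v : P.W₁ * toCol P.v = P.σW₁ • toCol P.g := by
  rw [mul_col, v_eq, P.svd_W₁.mulVec_col (i := ⟨P.k, P.k_lt_h⟩) rfl, col_smul]
  rfl

theorem W₁t_mul_g : P.W₁ᵀ * toCol P.g = P.σW₁ • toCol P.v := by
  rw [mul_col, g_eq, P.svd_W₁.transpose.mulVec_col (i := ⟨P.k, P.k_lt_n⟩) rfl, col_smul]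
  rfl

theorem W₂_mul_g : P.W₂ * toCol P.g = P.σW₂ • toCol P.u := by
  rw [mul_col, g_eq, P.svd_W₂.mulVec_col (i := ⟨P.k, P.k_lt_m⟩) rfl, col_smul]
  rfl

theorem W₂t_mul_u : P.W₂ᵀ * toCol P.u = P.σW₂ • toCol P.g := by
  rw [mul_col, u, P.svd_W₂.transpose.mulVec_col (i := ⟨P.k, P.k_lt_h⟩) rfl, col_smul]
  rfl

/-- Rank one and a positive `k`-th singular value force all the others to vanish, in whatever order
they are listed. -/
theorem Yft_sub_Ypre : P.Yft - P.Ypre = P.σ • (toCol P.u * (toCol P.v)ᵀ) := by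
  have h0 : ∀ i j, ¬(i = ⟨P.k, P.k_lt_m⟩ ∧ j = ⟨P.k, P.k_lt_n⟩) → P.SΔ i j = 0 := by
    intro i j hij
    by_cases h : (i : ℕ) = j
    · refine P.svd_Δ.eq_zero_of_rank_eq_one P.rank_one (i := ⟨P.k, P.k_lt_m⟩)
        (j := ⟨P.k, P.k_lt_n⟩) rfl h (fun h' => hij ⟨h'.symm, ?_⟩) P.σ_pos.ne'
      rw [← h'] at h
      exact Fin.ext h.symm
    · exact P.svd_Δ.2.2.1.1 _ _ h
  rw [P.svd_Δ.2.2.2]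
  ext a b
  rw [Matrix.mul_apply, Finset.sum_eq_single ⟨P.k, P.k_lt_n⟩, Matrix.mul_apply,
    Finset.sum_eq_single ⟨P.k, P.k_lt_m⟩]
  · simp [Matrix.mul_apply, u, v, σ]
    ring
  · intro i _ hi
    rw [h0 i _ fun h' => hi h'.1, mul_zero]
  · simp
  · intro j _ hj
    rw [Matrix.mul_apply, Finset.sum_eq_zero, zero_mul]
    intro i _
    rw [h0 i j fun h' => hj h'.2, mul_zero]
  · simp

/-- The problem with the direction of the change singled out. -/
def model : AlignedModel m n h where
  u := toCol P.u
  g := toCol P.g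
  v := toCol P.v
  R₁ := P.W₁ - P.σW₁ • (toCol P.g * (toCol P.v)ᵀ)
  R₂ := P.W₂ - P.σW₂ • (toCol P.u * (toCol P.g)ᵀ)
  σ := P.σ
  σ₁ := P.σW₁
  σ₂ := P.σW₂
  uu := by rw [transpose_col_mul_col, u_dotProduct_u, one_smul]
  gg := by rw [transpose_col_mul_col, g_dotProduct_g, one_smul]
  vv := by rw [transpose_col_mul_col, v_dotProduct_v, one_smul]
  R₁_v := by
    rw [Matrix.sub_mul, W₁_mul_v, Matrix.smul_mul, Matrix.mul_assoc, transpose_col_mul_col,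
      v_dotProduct_v, one_smul, Matrix.mul_one, sub_self]
  g_R₁ := by
    have h1 : (toCol P.g)ᵀ * P.W₁ = P.σW₁ • (toCol P.v)ᵀ := by
      rw [← transpose_inj, transpose_mul, transpose_transpose, W₁t_mul_g, transpose_smul,
        transpose_transpose]
    rw [Matrix.mul_sub, h1, Matrix.mul_smul, ← Matrix.mul_assoc, transpose_col_mul_col,
      g_dotProduct_g, one_smul, Matrix.one_mul, sub_self]
  R₂_g := by
    rw [Matrix.sub_mul, W₂_mul_g, Matrix.smul_mul, Matrix.mul_assoc, transpose_col_mul_col,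
      g_dotProduct_g, one_smul, Matrix.mul_one, sub_self]
  u_R₂ := by
    have h1 : (toCol P.u)ᵀ * P.W₂ = P.σW₂ • (toCol P.g)ᵀ := by
      rw [← transpose_inj, transpose_mul, transpose_transpose, W₂t_mul_u, transpose_smul,
        transpose_transpose]
    rw [Matrix.mul_sub, h1, Matrix.mul_smul, ← Matrix.mul_assoc, transpose_col_mul_col,
      u_dotProduct_u, one_smul, Matrix.one_mul, sub_self]

theorem model_W₁ : P.model.W₁ = P.W₁ := by simp [AlignedModel.W₁, model]

theorem model_W₂ : P.model.W₂ = P.W₂ := by simp [AlignedModel.W₂, model]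

/-- A further singular vector of `W₂` is an eigenvector of `R₂ᵀ R₂`. -/
theorem exists_eigenvector {j : Fin h} (hj : j ≠ ⟨P.k, P.k_lt_h⟩) :
    ∃ τ : ℝ, P.model.R₂ᵀ * (P.model.R₂ * toCol (P.G.col j)) = τ • toCol (P.G.col j) := by
  have hg : P.g ⬝ᵥ P.G.col j = 0 := by
    rw [g_eq, dotProduct_of_mem_orthogonalGroup P.svd_W₁.1, if_neg hj.symm]
  have h1 : P.model.R₂ * toCol (P.G.col j) = toCol (P.W₂ *ᵥ P.G.col j) := by
    change (P.W₂ - P.σW₂ • (toCol P.u * (toCol P.g)ᵀ)) * _ = _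
    rw [Matrix.sub_mul, mul_col, Matrix.smul_mul, Matrix.mul_assoc, transpose_col_mul_col, hg,
      zero_smul, Matrix.mul_zero, smul_zero, sub_zero]
  rw [h1]
  -- Columns of `G` beyond the number of rows of `W₂` lie in its kernel and get the eigenvalue 0.
  rcases lt_or_ge (j : ℕ) m with hjm | hjm
  · have hu : P.u ⬝ᵥ P.U.col ⟨j, hjm⟩ = 0 := by
      rw [u, dotProduct_of_mem_orthogonalGroup P.svd_pre.1, if_neg]
      exact fun h' => hj (Fin.ext (Fin.mk.inj_iff.1 h').symm)
    refine ⟨P.S₂ ⟨j, hjm⟩ j * P.S₂ ⟨j, hjm⟩ j, ?_⟩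
    rw [P.svd_W₂.mulVec_col (i := ⟨j, hjm⟩) rfl, col_smul, Matrix.mul_smul]
    change P.S₂ ⟨j, hjm⟩ j • ((P.W₂ - P.σW₂ • (toCol P.u * (toCol P.g)ᵀ))ᵀ *
      toCol (P.U.col ⟨j, hjm⟩)) = _
    rw [transpose_sub, transpose_smul, transpose_mul, transpose_transpose, Matrix.sub_mul, mul_col,
      Matrix.smul_mul, Matrix.mul_assoc, transpose_col_mul_col, hu, zero_smul, Matrix.mul_zero,
      smul_zero, sub_zero, P.svd_W₂.transpose.mulVec_col (i := j) rfl, col_smul, smul_smul]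
    rfl
  · exact ⟨0, by rw [P.svd_W₂.mulVec_col_eq_zero hjm, col_zero, Matrix.mul_zero, zero_smul]⟩

end RankOneLoRA

/-! ### The gradient of the loss -/

section Gradient

open scoped Matrix.Norms.Frobenius

theorem frobInner_single {p q : ℕ} (D : Matrix (Fin p) (Fin q) ℝ) (i : Fin p) (j : Fin q) :
    frobInner D (Matrix.single i j 1) = D i j := by
  rw [frobInner, Finset.sum_eq_single i, Finset.sum_eq_single j]
  · simp
  · intro j' _ hj'
    simp [hj'.symm]
  · simp
  · intro i' _ hi'
    exact Finset.sum_eq_zero fun j' _ => by simp [hi'.symm]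
  · simp

/-- The partial derivatives of a least squares loss that depends affinely on a matrix. -/
theorem matrixPartial_eq {m n p q : ℕ} {f : Matrix (Fin p) (Fin q) ℝ → ℝ}
    {X D : Matrix (Fin p) (Fin q) ℝ} {E : Matrix (Fin m) (Fin n) ℝ}
    (L : Matrix (Fin p) (Fin q) ℝ → Matrix (Fin m) (Fin n) ℝ)
    (hL : ∀ (s : ℝ) Y, L (s • Y) = s • L Y) (hf : ∀ Y, f (X + Y) = 1 / 2 * ‖E - L Y‖ ^ 2)
    (hD : ∀ Y, frobInner E (L Y) = frobInner D Y) : matrixPartial f X = -D := by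
  ext i j
  rw [matrixPartial, Matrix.of_apply, Matrix.neg_apply, ← frobInner_single D, ← hD]
  set Y := Matrix.single i j (1 : ℝ)
  have h1 : (fun s : ℝ => f (X + s • Y)) = fun s =>
      1 / 2 * (‖E‖ ^ 2 - 2 * (s * frobInner E (L Y)) + s ^ 2 * ‖L Y‖ ^ 2) := by
    ext s
    rw [hf, hL, norm_sub_sq_frob, frobInner_smul_right, norm_smul, mul_pow, Real.norm_eq_abs,
      sq_abs]
  rw [h1]
  have h2 := (((((hasDerivAt_id (0 : ℝ)).mul_const (frobInner E (L Y))).const_mul 2).const_sub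
    (‖E‖ ^ 2)).add (((hasDerivAt_id (0 : ℝ)).pow 2).mul_const (‖L Y‖ ^ 2))).const_mul (1 / 2 : ℝ)
  refine HasDerivAt.deriv (h2.congr_deriv ?_)
  simp

namespace RankOneLoRA

variable {m n h r : ℕ} (P : RankOneLoRA m n h)

theorem residual_eq (w : LoRAWeights m n h r) :
    P.Yft - (P.W₂ + w.B₂ * w.A₂) * (P.W₁ + w.B₁ * w.A₁) = P.model.E w := by
  have h1 := P.Yft_sub_Ypre
  rw [AlignedModel.E, AlignedModel.X₁, model_W₁, model_W₂]
  change _ = P.σ • (toCol P.u * (toCol P.v)ᵀ) - _ - _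
  rw [← h1, P.factorization]
  simp only [Matrix.add_mul, Matrix.mul_add, Matrix.mul_assoc]
  abel

theorem loss_eq (w : LoRAWeights m n h r) : P.loss w = 1 / 2 * ‖P.model.E w‖ ^ 2 := by
  rw [loss, residual_eq, ← frobInner_self, frobInner]
  simp only [sq]

/-- The residual is affine in each weight matrix separately, so each partial gradient is the adjoint
of a linear map applied to the residual. -/
theorem isFlow {w : ℝ → LoRAWeights m n h r} (hw : IsGradientFlow P w) : P.model.IsFlow w := by
  have hX₂ : ∀ x : LoRAWeights m n h r, P.model.X₂ x = P.W₂ + x.B₂ * x.A₂ := fun x => by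
    rw [AlignedModel.X₂, model_W₂]
  have hX₁ : ∀ x : LoRAWeights m n h r, P.model.X₁ x = P.W₁ + x.B₁ * x.A₁ := fun x => by
    rw [AlignedModel.X₁, model_W₁]
  constructor
  · intro t ht i j
    have h1 := (hw t ht).1 i j
    rwa [matrixPartial_eq (E := P.model.E (w t)) (D := P.model.dA₁ (w t))
      (fun Y => P.model.X₂ (w t) * (w t).B₁ * Y) (fun s Y => Matrix.mul_smul _ _ _)
      (fun Y => by
        rw [loss_eq, ← residual_eq, ← residual_eq, hX₂]
        simp only [Matrix.mul_add, Matrix.mul_assoc, Matrix.add_mul]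
        congr 3
        abel)
      (fun Y => by rw [frobInner_comm, frobInner_mul_left, frobInner_comm, AlignedModel.dA₁]),
      Matrix.neg_apply, neg_neg] at h1
  · intro t ht i j
    have h1 := (hw t ht).2.1 i j
    rwa [matrixPartial_eq (E := P.model.E (w t)) (D := P.model.dB₁ (w t))
      (fun Y => P.model.X₂ (w t) * (Y * (w t).A₁))
      (fun s Y => by rw [Matrix.smul_mul, Matrix.mul_smul])
      (fun Y => by
        rw [loss_eq, ← residual_eq, ← residual_eq, hX₂]
        simp only [Matrix.mul_add, Matrix.mul_assoc, Matrix.add_mul]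
        congr 3
        abel)
      (fun Y => by
        rw [frobInner_comm, frobInner_mul_left, frobInner_mul_right, frobInner_comm,
          AlignedModel.dB₁, Matrix.mul_assoc]),
      Matrix.neg_apply, neg_neg] at h1
  · intro t ht i j
    have h1 := (hw t ht).2.2.1 i j
    rwa [matrixPartial_eq (E := P.model.E (w t)) (D := P.model.dA₂ (w t))
      (fun Y => (w t).B₂ * (Y * P.model.X₁ (w t)))
      (fun s Y => by rw [Matrix.smul_mul, Matrix.mul_smul])
      (fun Y => by
        rw [loss_eq, ← residual_eq, ← residual_eq, hX₁]
        simp only [Matrix.mul_add, Matrix.mul_assoc, Matrix.add_mul]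
        congr 3
        abel)
      (fun Y => by
        rw [frobInner_comm, frobInner_mul_left, frobInner_mul_right, frobInner_comm,
          AlignedModel.dA₂, Matrix.mul_assoc]),
      Matrix.neg_apply, neg_neg] at h1
  · intro t ht i j
    have h1 := (hw t ht).2.2.2 i j
    rwa [matrixPartial_eq (E := P.model.E (w t)) (D := P.model.dB₂ (w t))
      (fun Y => Y * ((w t).A₂ * P.model.X₁ (w t))) (fun s Y => Matrix.smul_mul _ _ _)
      (fun Y => by
        rw [loss_eq, ← residual_eq, ← residual_eq, hX₁]
        simp only [Matrix.mul_add, Matrix.mul_assoc, Matrix.add_mul]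
        congr 3
        abel)
      (fun Y => by
        rw [frobInner_comm, frobInner_mul_right, frobInner_comm, AlignedModel.dB₂]),
      Matrix.neg_apply, neg_neg] at h1

theorem model_p (w : LoRAWeights m n h r) :
    P.model.p w = P.g ⬝ᵥ ((w.B₁ * w.A₁) *ᵥ P.v) := by
  change frobInner (w.A₁ * toCol P.v) (w.B₁ᵀ * toCol P.g) = _
  rw [frobInner_comm, frobInner_mul_left, transpose_transpose, ← Matrix.mul_assoc, mul_col,
    frobInner_col]

theorem model_thr : P.model.thr = (1 - P.δw) * P.σ / (4 * P.σW₂) := rfl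

end RankOneLoRA

end Gradient

/-! ### Spectral data of the stacked weights -/

section SpectralData

open scoped Matrix.Norms.Frobenius

variable {m n h r : ℕ} (P : RankOneLoRA m n h) (x : LoRAWeights m n h r)

theorem Z₁t_mulVec (q : Fin h ⊕ Fin n → ℝ) :
    toCol (x.Z₁ᵀ *ᵥ q) = x.B₁ᵀ * toCol (q ∘ Sum.inl) + x.A₁ * toCol (q ∘ Sum.inr) := by
  rw [LoRAWeights.Z₁, transpose_fromRows, fromCols_mulVec, transpose_transpose, mul_col, mul_col]
  rfl

theorem dotProduct_sumType {ι κ : Type*} [Fintype ι] [Fintype κ] (q q' : ι ⊕ κ → ℝ) : q ⬝ᵥ q' =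
    (q ∘ Sum.inl) ⬝ᵥ (q' ∘ Sum.inl) + (q ∘ Sum.inr) ⬝ᵥ (q' ∘ Sum.inr) := by
  simp [dotProduct]

theorem γ₁_dotProduct_γ₁ : P.γ₁ ⬝ᵥ P.γ₁ = 2 := by
  rw [dotProduct_sumType]
  change P.g ⬝ᵥ P.g + P.v ⬝ᵥ P.v = 2
  rw [P.g_dotProduct_g, P.v_dotProduct_v]
  norm_num

/-- The vector `(g; v)` is a trial vector of squared norm 2, and its image under the transpose is `a
+ b`. -/
theorem norm_a_add_b_sq_le : ‖P.model.a x + P.model.b x‖ ^ 2 ≤ 2 * specNorm x.Z₁ ^ 2 := by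
  have h1 := mulVec_dotProduct_self_le x.Z₁ᵀ P.γ₁
  rw [specNorm_transpose, γ₁_dotProduct_γ₁, ← norm_col_sq, Z₁t_mulVec, add_comm] at h1
  rw [mul_comm]
  exact h1

theorem sum_sq_eq {ι κ : Type*} [Fintype ι] [Fintype κ] (X : Matrix ι κ ℝ) :
    ∑ i, ∑ j, X i j ^ 2 = ‖X‖ ^ 2 := by
  rw [← frobInner_self, frobInner]
  simp only [sq]

theorem specNorm_Z₁_sq_le : specNorm x.Z₁ ^ 2 ≤ ‖x.A₁‖ ^ 2 + ‖x.B₁‖ ^ 2 := by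
  refine (specNorm_sq_le _).trans_eq ?_
  rw [Fintype.sum_sum_type, add_comm, ← frobenius_norm_transpose x.A₁, ← sum_sq_eq, ← sum_sq_eq]
  rfl

theorem specNorm_Z₂_sq_le : specNorm x.Z₂ ^ 2 ≤ AlignedModel.size₂ x := by
  refine (specNorm_sq_le _).trans_eq ?_
  rw [AlignedModel.size₂, Fintype.sum_sum_type, add_comm, ← frobenius_norm_transpose x.A₂,
    ← sum_sq_eq, ← sum_sq_eq]
  rfl

theorem norm_A₂t_mul_le (z : Fin r → ℝ) : ‖x.A₂ᵀ * toCol z‖ ≤ specNorm x.Z₂ * ‖toCol z‖ := by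
  refine le_of_sq_le_sq ?_ (mul_nonneg (specNorm_nonneg _) (norm_nonneg _))
  have h1 := mulVec_dotProduct_self_le x.Z₂ z
  rw [LoRAWeights.Z₂, fromRows_mulVec, dotProduct_sumType] at h1
  rw [mul_pow, norm_col_sq, mul_col, norm_col_sq, LoRAWeights.Z₂]
  refine le_trans ?_ h1
  have : 0 ≤ (x.B₂ *ᵥ z) ⬝ᵥ (x.B₂ *ᵥ z) := by
    rw [← norm_col_sq]
    positivity
  change _ ≤ (x.B₂ *ᵥ z) ⬝ᵥ (x.B₂ *ᵥ z) + (x.A₂ᵀ *ᵥ z) ⬝ᵥ (x.A₂ᵀ *ᵥ z)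
  linarith

variable {P x}

theorem IsTopLeftSingularVector.isTop {q : Fin h ⊕ Fin n → ℝ}
    (hq : IsTopLeftSingularVector x.Z₁ q) : P.model.IsTop x (specNorm x.Z₁)
      (toCol (q ∘ Sum.inl)) (toCol (q ∘ Sum.inr)) where
  unit := by
    rw [norm_col_sq, norm_col_sq, ← dotProduct_sumType]
    exact hq.1
  mul_B := by
    have h1 := hq.2
    rw [← Matrix.mulVec_mulVec] at h1
    rw [← Z₁t_mulVec, mul_col, ← col_smul]
    congr 1
    ext i
    exact congrFun h1 (Sum.inl i)
  mul_A := by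
    have h1 := hq.2
    rw [← Matrix.mulVec_mulVec] at h1
    rw [← Z₁t_mulVec, mul_col, ← col_smul]
    congr 1
    ext i
    exact congrFun h1 (Sum.inr i)
  nonneg := specNorm_nonneg _
  le := norm_a_add_b_sq_le P x
  le_norm := specNorm_Z₁_sq_le x

theorem IsTopLeftSingularVector.cosSq_eq {q : Fin h ⊕ Fin n → ℝ}
    (hq : IsTopLeftSingularVector x.Z₁ q) : cosSq q P.γ₁ =
      1 - P.model.defect (toCol (q ∘ Sum.inl)) (toCol (q ∘ Sum.inr)) := by
  rw [cosSq, hq.1, γ₁_dotProduct_γ₁, dotProduct_sumType, AlignedModel.defect]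
  change _ = 1 - (1 - (frobInner (toCol P.g) _ + frobInner (toCol P.v) _) ^ 2 / 2)
  rw [frobInner_col, frobInner_col, dotProduct_comm P.g, dotProduct_comm P.v]
  change ((q ∘ Sum.inl) ⬝ᵥ P.g + (q ∘ Sum.inr) ⬝ᵥ P.v) ^ 2 / (1 * 2) = _
  ring

end SpectralData

/-! ### Choice of the constants and existence of the endgame -/

section Assembly

open scoped Matrix.Norms.Frobenius

theorem exists_forall_mem_le (l : List ℝ) : ∃ C, ∀ x ∈ l, x ≤ C := by
  induction l with
  | nil => exact ⟨0, by simp⟩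
  | cons a l ih =>
    obtain ⟨C, hC⟩ := ih
    refine ⟨max a C, fun x hx => ?_⟩
    rcases List.mem_cons.1 hx with h | h
    · exact h ▸ le_max_left _ _
    · exact (hC x h).trans (le_max_right _ _)

/-- Powers of `α` beat powers of logarithms as `α → 0`. -/
theorem eventually_mul_rpow_mul_log_sq_le (C A B : ℝ) {β : ℝ} (hβ : 0 < β) :
    ∀ᶠ α in nhdsWithin (0 : ℝ) (Ioi 0), C * α ^ β * (B + A * Real.log α) ^ 2 ≤ 1 := by
  have h1 := tendsto_log_mul_rpow_nhdsGT_zero (half_pos hβ)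
  have h2 : Filter.Tendsto (fun α : ℝ => α ^ (β / 2)) (nhdsWithin 0 (Ioi 0)) (nhds 0) := by
    have := (Real.continuousAt_rpow_const 0 (β / 2) (Or.inr (half_pos hβ).le)).tendsto
    rw [Real.zero_rpow (half_pos hβ).ne'] at this
    exact this.mono_left nhdsWithin_le_nhds
  have h3 := ((((h2.const_mul B).add (h1.const_mul A)).pow 2).const_mul C).eventually
    (eventually_le_nhds (show C * (B * 0 + A * 0) ^ 2 < 1 by norm_num))
  filter_upwards [h3, self_mem_nhdsWithin] with α h4 h5
  refine le_trans (le_of_eq ?_) h4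
  have h6 : α ^ β = (α ^ (β / 2)) ^ 2 := by
    rw [← Real.rpow_natCast, ← Real.rpow_mul (le_of_lt h5)]
    congr 1
    push_cast
    ring
  rw [h6]
  ring

namespace RankOneLoRA

variable {m n h r : ℕ} {P : RankOneLoRA m n h}

theorem A₁_mul_toCol {w : LoRAWeights m n h r} {α : ℝ}
    {N : (Fin r → Fin n → ℝ) × (Fin r → Fin h → ℝ)} (hw : w = loraInit α N) (x : Fin n → ℝ) :
    w.A₁ * toCol x = α • toCol fun i => N.1 i ⬝ᵥ x := by
  subst hw
  rw [mul_col, ← col_smul]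
  congr 1
  ext i
  simp only [loraInit, Matrix.mulVec]
  exact smul_dotProduct α (N.1 i) x

theorem A₂_mul_toCol {w : LoRAWeights m n h r} {α : ℝ}
    {N : (Fin r → Fin n → ℝ) × (Fin r → Fin h → ℝ)} (hw : w = loraInit α N) (x : Fin h → ℝ) :
    w.A₂ * toCol x = α • toCol fun i => N.2 i ⬝ᵥ x := by
  subst hw
  rw [mul_col, ← col_smul]
  congr 1
  ext i
  simp only [loraInit, Matrix.mulVec]
  exact smul_dotProduct α (N.2 i) x

/-- For a generic initialization, the trajectory has an endgame. -/
theorem exists_endgame (P : RankOneLoRA m n h) (hr : 0 < r) (M : ℝ) :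
    ∃ f : (Fin r → Fin n → ℝ) × (Fin r → Fin h → ℝ) → ℝ, Measurable f ∧
      (∀ᵐ N ∂(stdGaussianMatrix r n).prod (stdGaussianMatrix r h), f N ≠ 0) ∧
      ∀ K : ℝ, ∃ C₁ C₀ : ℝ, 1 ≤ C₀ ∧ ∀ N (w : ℝ → LoRAWeights m n h r) (α κ T C T₁ : ℝ),
        w 0 = loraInit α N → 1 / K ≤ |f N| → P.model.Setting w K M α κ T C → C₁ ≤ C →
        C * κ * (1 + T) ^ 2 ≤ 1 → P.model.AlignedAt w κ T T₁ →
        ∃ D, P.model.Endgame w α T T₁ C₀ D := by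
  -- Three mechanisms for the lower bound on the defect: another column direction if `n ≥ 2`,
  -- otherwise another direction of `G` if `h ≥ 2`, otherwise balance alone. Each asks for its own
  -- generic quantity `f`.
  rcases subsingleton_or_nontrivial (Fin n) with hn | hn
  · have hv : P.model.v * P.model.vᵀ = 1 := mul_transpose_of_subsingleton P.model.vv
    rcases subsingleton_or_nontrivial (Fin h) with hh | hh
    · have hg : P.model.g * P.model.gᵀ = 1 := mul_transpose_of_subsingleton P.model.gg
      refine ⟨fun _ => 1, measurable_const, Filter.Eventually.of_forall fun _ => one_ne_zero,
        fun K => ?_⟩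
      obtain ⟨C₁, hC₁⟩ := exists_forall_mem_le
        [4 * M ^ 3, 4 * M ^ 3 + 32 * M ^ 7 * K / P.model.rate]
      obtain ⟨C₀, hC₀⟩ := exists_forall_mem_le
        [1, (K ^ 2 / √(P.model.thr / 2)) ^ 2 / P.model.thr, 16 * K ^ 4 * M ^ 4]
      simp only [List.forall_mem_cons] at hC₁ hC₀
      refine ⟨C₁, C₀, hC₀.1, fun N w α κ T C T₁ _ _ S hC _ A => ⟨α ^ 2, ?_⟩⟩
      exact S.endgame_of_single_column_of_single_row A hv hg (hC₁.1.trans hC) (hC₁.2.1.trans hC)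
        hC₀.1 hC₀.2.1 hC₀.2.2.1
    · obtain ⟨j, hj⟩ := exists_ne (⟨P.k, P.k_lt_h⟩ : Fin h)
      have o1 : P.G.col j ⬝ᵥ P.G.col j = 1 := by
        rw [dotProduct_of_mem_orthogonalGroup P.svd_W₁.1, if_pos rfl]
      have o2 : P.G.col j ⬝ᵥ P.g = 0 := by
        rw [g_eq, dotProduct_of_mem_orthogonalGroup P.svd_W₁.1, if_neg hj]
      have o3 : P.g ⬝ᵥ P.G.col j = 0 := by rw [dotProduct_comm, o2]
      obtain ⟨τ, hτ⟩ := P.exists_eigenvector hj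
      refine ⟨fun N => ∑ i, (N.2 i ⬝ᵥ P.G.col j) * (N.2 i ⬝ᵥ P.g), by unfold dotProduct; fun_prop,
        -- The sum of the two orthonormal vectors has inner product 1 with each, so the quadratic
        -- coefficient does not vanish.
        ae_dotProduct_mul_ne_zero_right hr (e := P.g + P.G.col j)
          (by rw [add_dotProduct, o1, o3]; norm_num)
          (by rw [add_dotProduct, o2, g_dotProduct_g]; norm_num), fun K => ?_⟩
      obtain ⟨C₁, hC₁⟩ := exists_forall_mem_le [16 * AlignedModel.pairC M K ^ 2 * K ^ 2,
        40 * M ^ 3 * K + 16 * K * AlignedModel.pairC M K, 4 * M ^ 3,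
        4 * M ^ 3 + 32 * M ^ 7 * K / P.model.rate, 10 * K ^ 2 * AlignedModel.crossC M K,
        8 * K ^ 2 * AlignedModel.crossC M K / (P.model.σ * P.model.thr) * 4,
        2 * P.model.dragC M K / P.model.driveC M K]
      obtain ⟨C₀, hC₀⟩ := exists_forall_mem_le [2, 2 * M ^ 2 * P.model.tailBoundC M K,
        ((P.model.tailBoundC M K + 2 * K ^ 3) / √(P.model.thr / 2) +
          P.model.tailBoundC M K) ^ 2 / P.model.thr,
        2 * M ^ 2 / (P.model.driveC M K /
          (2 * Real.exp (8 * M ^ 3 / (P.model.σ * P.model.σ₂)))) ^ 2]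
      simp only [List.forall_mem_cons] at hC₁ hC₀
      refine ⟨C₁, C₀, by linarith [hC₀.1], fun N w α κ T C T₁ hw hN S hC hT A =>
        ⟨α * ‖P.model.c (w T₁) + P.model.y (w T₁)‖, ?_⟩⟩
      refine S.endgame_of_single_column A hv (hC₁.1.trans hC) (hC₁.2.1.trans hC)
        (hC₁.2.2.1.trans hC) (hC₁.2.2.2.1.trans hC) (hC₁.2.2.2.2.1.trans hC)
        (hC₁.2.2.2.2.2.1.trans hC) (le_trans ?_ hT) (d := toCol (P.G.col j)) ?_ ?_ hτ ?_
        hC₀.1 hC₀.2.1 hC₀.2.2.1 hC₀.2.2.2.1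
      · have := S.κ_pos
        gcongr
        exact hC₁.2.2.2.2.2.2.1.trans hC
      · have : (toCol P.g)ᵀ * toCol (P.G.col j) = 0 := by
          rw [transpose_col_mul_col, o3, zero_smul]
        exact this
      · have := norm_col_sq (P.G.col j)
        rw [o1] at this
        exact (pow_eq_one_iff_of_nonneg (norm_nonneg _) two_ne_zero).1 this
      · have e1 : frobInner ((w 0).A₂ * toCol (P.G.col j)) (P.model.c (w 0)) =
            α ^ 2 * ∑ i, (N.2 i ⬝ᵥ P.G.col j) * (N.2 i ⬝ᵥ P.g) := by
          change frobInner _ ((w 0).A₂ * toCol P.g) = _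
          rw [A₂_mul_toCol hw, A₂_mul_toCol hw, frobInner_smul_left, frobInner_smul_right,
            frobInner_col, dotProduct]
          ring
        rw [e1, abs_mul, abs_of_nonneg (sq_nonneg α), div_eq_mul_one_div]
        exact mul_le_mul_of_nonneg_left hN (sq_nonneg α)
  · obtain ⟨j, hj⟩ := exists_ne (⟨P.k, P.k_lt_n⟩ : Fin n)
    have o1 : P.V.col j ⬝ᵥ P.V.col j = 1 := by
      rw [dotProduct_of_mem_orthogonalGroup P.svd_pre.2.1, if_pos rfl]
    have o2 : P.V.col j ⬝ᵥ P.v = 0 := by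
      rw [v_eq, dotProduct_of_mem_orthogonalGroup P.svd_pre.2.1, if_neg hj]
    have o3 : P.v ⬝ᵥ P.V.col j = 0 := by rw [dotProduct_comm, o2]
    refine ⟨fun N => ∑ i, (N.1 i ⬝ᵥ P.v) * (N.1 i ⬝ᵥ P.V.col j), by unfold dotProduct; fun_prop,
      ae_dotProduct_mul_ne_zero_left hr (e := P.v + P.V.col j)
        (by rw [add_dotProduct, o2, v_dotProduct_v]; norm_num)
        (by rw [add_dotProduct, o1, o3]; norm_num), fun K => ?_⟩
    obtain ⟨C₁, hC₁⟩ := exists_forall_mem_le [2 * K ^ 4 * P.model.ratioC M K,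
      98 * K ^ 2 / P.model.thr]
    obtain ⟨C₀, hC₀⟩ := exists_forall_mem_le [1, 8 * M ^ 2 * K, 49 * K ^ 2 / P.model.thr,
      20 * M ^ 4 * K ^ 4 * Real.exp (2 * P.model.σ₂ / P.model.σ * (4 * M)) / P.model.thr]
    simp only [List.forall_mem_cons] at hC₁ hC₀
    refine ⟨C₁, C₀, hC₀.1, fun N w α κ T C T₁ hw hN S hC _ A => ⟨α, ?_⟩⟩
    refine S.endgame_of_transverse A (d := toCol (P.V.col j)) ?_ ?_ ?_ (hC₁.1.trans hC)
      (hC₁.2.1.trans hC) hC₀.1 hC₀.2.1 hC₀.2.2.1 hC₀.2.2.2.1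
    · have : (toCol P.v)ᵀ * toCol (P.V.col j) = 0 := by
        rw [transpose_col_mul_col, o3, zero_smul]
      exact this
    · have := norm_col_sq (P.V.col j)
      rw [o1] at this
      exact ((pow_eq_one_iff_of_nonneg (norm_nonneg _) two_ne_zero).1 this).le
    · have e1 : frobInner (P.model.a (w 0)) ((w 0).A₁ * toCol (P.V.col j)) =
          α ^ 2 * ∑ i, (N.1 i ⬝ᵥ P.v) * (N.1 i ⬝ᵥ P.V.col j) := by
        change frobInner ((w 0).A₁ * toCol P.v) _ = _
        rw [A₁_mul_toCol hw, A₁_mul_toCol hw, frobInner_smul_left, frobInner_smul_right,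
          frobInner_col, dotProduct]
        ring
      rw [e1, abs_mul, abs_of_nonneg (sq_nonneg α), div_eq_mul_one_div]
      exact mul_le_mul_of_nonneg_left hN (sq_nonneg α)

theorem σ_pos' (P : RankOneLoRA m n h) : 0 < P.σ := P.σ_pos

theorem σW₁_nonneg (P : RankOneLoRA m n h) : 0 ≤ P.σW₁ := P.svd_W₁.2.2.1.2 _ _

/-- The initial residual is `Yft - Ypre`. -/
theorem sqrt_loss_zero {w : LoRAWeights m n h r} {α : ℝ}
    {N : (Fin r → Fin n → ℝ) × (Fin r → Fin h → ℝ)} (hw : w = loraInit α N) :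
    √(2 * P.loss w) = P.σ := by
  have h1 : P.model.E w = P.σ • (toCol P.u * (toCol P.v)ᵀ) := by
    subst hw
    simp [AlignedModel.E, loraInit, model]
  have h2 : ‖toCol P.u * (toCol P.v)ᵀ‖ = 1 := by
    rw [norm_col_mul_row]
    exact (congrArg₂ _ P.model.norm_u P.model.norm_v).trans (one_mul 1)
  rw [loss_eq, h1, norm_smul, h2, mul_one, Real.norm_eq_abs, abs_of_pos P.σ_pos']
  rw [show 2 * (1 / 2 * P.σ ^ 2) = P.σ ^ 2 by ring, Real.sqrt_sq P.σ_pos'.le]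

end RankOneLoRA

end Assembly

/-! ### The estimates for the original problem -/

section LocalConvergenceTheorem

open scoped Matrix.Norms.Frobenius

namespace AlignedModel.Setting

variable {m n h r : ℕ} {P : RankOneLoRA m n h} {w : ℝ → LoRAWeights m n h r}
  {K M α κ T C T₁ : ℝ} (S : P.model.Setting w K M α κ T C) (A : P.model.AlignedAt w κ T T₁)

include S

theorem sizeC_pos : 0 < P.model.sizeC M K := by
  have := S.one_le_M
  have := S.one_le_K
  unfold sizeC
  positivity

theorem le_specNorm_Z₂ {t : ℝ} (ht : 0 ≤ t) : α / K ≤ specNorm (w t).Z₂ := by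
  have h1 := S.le_norm_A₂t_mul ht
  have hc : 0 < ‖P.model.c (w 0)‖ :=
    (div_pos S.α_pos (by linarith [S.one_le_K])).trans_le S.le_c
  have h2 := norm_A₂t_mul_le (w t) fun i => P.model.c (w 0) i ()
  have h3 : (toCol fun i => P.model.c (w 0) i ()) = P.model.c (w 0) := by
    ext i j
    rfl
  rw [h3] at h2
  exact le_of_mul_le_mul_right (h1.trans h2) hc

theorem specNorm_Z₂_pos {t : ℝ} (ht : 0 ≤ t) : 0 < specNorm (w t).Z₂ :=
  (div_pos S.α_pos (by linarith [S.one_le_K])).trans_le (S.le_specNorm_Z₂ ht)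

include A

theorem thr_le_specNorm_Z₁_sq {t : ℝ} (ht : t ∈ Icc T₁ T) :
    P.model.thr ≤ specNorm (w t).Z₁ ^ 2 := by
  linarith [S.thr_le_half_norm_sq A ht, norm_a_add_b_sq_le P (w t)]

/-- The size bound gives the exponent `-2(1 - δ)`, which implies the claim for every smaller `γ`. -/
theorem le_ratio_sq {γ : ℝ} (hγ : γ ≤ 2 * (1 - P.δw)) :
    P.model.thr / P.model.sizeC M K * α ^ (-γ) ≤
      specNorm (w T₁).Z₁ ^ 2 / specNorm (w T₁).Z₂ ^ 2 := by
  have h1 := S.thr_le_specNorm_Z₁_sq A ⟨le_rfl, A.le_T⟩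
  have h2 := (specNorm_Z₂_sq_le (w T₁)).trans (S.size_le A.nonneg A.le_T A.early)
  have h3 := S.specNorm_Z₂_pos A.nonneg
  have hs := S.sizeC_pos
  have hκ := S.κ_pos
  have h4 : α ^ (-γ) ≤ (κ ^ 4)⁻¹ := by
    have h5 : κ ^ 4 = α ^ (2 * (1 - P.δw)) := by
      rw [show κ ^ 4 = (κ ^ 2) ^ 2 by ring, S.κ_sq, ← Real.rpow_natCast, ← Real.rpow_mul S.α_pos.le,
        mul_comm]
      rfl
    rw [h5, ← Real.rpow_neg S.α_pos.le]
    exact Real.rpow_le_rpow_of_exponent_ge S.α_pos S.α_le_one (by linarith)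
  calc P.model.thr / P.model.sizeC M K * α ^ (-γ)
      ≤ P.model.thr / P.model.sizeC M K * (κ ^ 4)⁻¹ :=
        mul_le_mul_of_nonneg_left h4 (div_pos S.thr_pos hs).le
    _ = P.model.thr / (P.model.sizeC M K * κ ^ 4) := by
      rw [div_mul_eq_mul_div, div_eq_mul_inv, div_eq_mul_inv, mul_inv]
      ring
    _ ≤ _ := div_le_div₀ (sq_nonneg _) h1 (by positivity) h2

/-- At `T₁` the ratio is at most of order `α⁻¹`, since `Z₂` is at least of order `α`. Later it is at
least of order `κ⁻²`, so an exponent yielding `κ⁻¹` is safe. -/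
theorem ratio_rpow_le_ratio
    (hC : √(P.model.growC M * P.model.sizeC M K / P.model.thr) * (2 * M * K) ≤ C)
    {t : ℝ} (ht : t ∈ Icc T₁ T) :
    (specNorm (w T₁).Z₁ / specNorm (w T₁).Z₂) ^ ((1 - P.δw) / 2) ≤
      specNorm (w t).Z₁ / specNorm (w t).Z₂ := by
  have hκ := S.κ_pos
  have hM := S.one_le_M
  have hK := S.one_le_K
  have hthr := S.thr_pos
  have hs := S.sizeC_pos
  have hg : 0 < P.model.growC M := Real.exp_pos _
  have h0 : 0 ≤ t := A.nonneg.trans ht.1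
  have hδ1 : P.model.σ₁ / P.model.σ₂ < 1 := S.ratio_lt
  have hδ0 : 0 ≤ P.model.σ₁ / P.model.σ₂ := S.ratio_nonneg
  change P.δw < 1 at hδ1
  change 0 ≤ P.δw at hδ0
  set b := √(P.model.growC M * P.model.sizeC M K / P.model.thr) with hb
  have hb0 : 0 < b := by positivity
  refine AlignedModel.ratio_rpow_le (B := 2 * M * K) (b := b) S.α_pos (by linarith) (by linarith)
    hκ S.κ_sq (by nlinarith) (S.mul_κ_le hC) hb0 (specNorm_nonneg _)
    (S.specNorm_Z₂_pos A.nonneg) ?_ ?_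
  · have h1 : specNorm (w T₁).Z₁ ≤ 2 * M := by
      have hbd := S.bounded A.nonneg (A.early T₁ ⟨A.nonneg, le_rfl⟩).toGood
      refine le_of_sq_le_sq ((specNorm_Z₁_sq_le _).trans ?_) (by linarith)
      have := pow_le_pow_left₀ (norm_nonneg _) hbd.A₁ 2
      have := pow_le_pow_left₀ (norm_nonneg _) hbd.B₁ 2
      nlinarith
    have h2 := S.le_specNorm_Z₂ A.nonneg
    have hα := S.α_pos
    calc specNorm (w T₁).Z₁ / specNorm (w T₁).Z₂ ≤ 2 * M / (α / K) :=
          div_le_div₀ (by linarith) h1 (by positivity) h2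
      _ = 2 * M * K / α := by field_simp
  · have h1 := S.thr_le_specNorm_Z₁_sq A ht
    have h2 := (specNorm_Z₂_sq_le (w t)).trans (S.size_le_of_mem A ht)
    have h3 := S.specNorm_Z₂_pos h0
    have h4 := specNorm_nonneg (w t).Z₁
    refine le_of_sq_le_sq ?_ (by positivity)
    have hb2 : b ^ 2 = P.model.growC M * P.model.sizeC M K / P.model.thr :=
      Real.sq_sqrt (by positivity)
    rw [div_pow, hb2, mul_pow, div_pow, one_pow, one_div, inv_div, div_mul_eq_mul_div,
      div_le_div_iff₀ (by positivity) (by positivity)]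
    have h5 := mul_le_mul h1 h2 (sq_nonneg _) (sq_nonneg _)
    linarith

variable {C₀ D : ℝ} (G : P.model.Endgame w α T T₁ C₀ D)

include G

theorem one_sub_le_cosSq (hC₀ : 0 ≤ C₀) {q : Fin h ⊕ Fin n → ℝ}
    (hq : IsTopLeftSingularVector (w T₁).Z₁ q) {β : ℝ} (hβ : β ≤ 2) :
    1 - C₀ ^ 3 * α ^ β ≤ cosSq q P.γ₁ := by
  have h1 := S.defect_le_rpow A G hC₀ (hq.isTop (P := P)) hβ
  rw [hq.cosSq_eq]
  linarith

omit A in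
theorem cosSq_rpow_le (hC₀ : 1 ≤ C₀) (hC : 2 * C₀ ^ 3 ≤ C) {t : ℝ} (ht : t ∈ Icc T₁ T)
    {q q₁ : Fin h ⊕ Fin n → ℝ} (hq : IsTopLeftSingularVector (w t).Z₁ q)
    (hq₁ : IsTopLeftSingularVector (w T₁).Z₁ q₁) :
    cosSq q₁ P.γ₁ ^ (2 * C₀ ^ 2) ≤ cosSq q P.γ₁ := by
  rw [hq.cosSq_eq, hq₁.cosSq_eq]
  exact S.one_sub_defect_rpow_le G hC₀ hC ht (hq.isTop (P := P)) (hq₁.isTop (P := P))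

theorem loss_le {t : ℝ} (ht : t ∈ Icc T₁ T) {q₁ : Fin h ⊕ Fin n → ℝ}
    (hq₁ : IsTopLeftSingularVector (w T₁).Z₁ q₁) (τ : ℝ) :
    P.loss (w t) ≤ 2 * Real.exp (-((1 - specNorm (w T₁).Z₂ / specNorm (w τ).Z₁) * (1 - P.δw) *
      (P.σ * P.σW₂) * (t - T₁) / 16)) * P.loss (w T₁) +
        P.model.floorC M C₀ * C₀ * (1 - cosSq q₁ P.γ₁) := by
  have h1 := S.norm_E_sq_le_defect A G ht
    (div_nonneg (specNorm_nonneg (w T₁).Z₂) (specNorm_nonneg (w τ).Z₁)) (hq₁.isTop (P := P))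
  rw [hq₁.cosSq_eq, sub_sub_cancel, P.loss_eq, P.loss_eq, one_div_mul_eq_div, one_div_mul_eq_div]
  exact h1

theorem loss_le_rpow (hC : P.model.floorC M C₀ * C₀ ^ 2 ≤ C) {t : ℝ} (ht : t ∈ Icc T₁ T) :
    P.loss (w t) ≤ 2 * Real.exp (-((1 - P.δw) * (P.σ * P.σW₂) * (t - T₁) / 32)) *
      P.loss (w T₁) + 2 * α ^ (1 : ℝ) := by
  rw [P.loss_eq, P.loss_eq, one_div_mul_eq_div, one_div_mul_eq_div]
  exact S.norm_E_sq_le_rpow A G hC ht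

end AlignedModel.Setting

namespace RankOneLoRA

variable {m n h r : ℕ} {P : RankOneLoRA m n h}

theorem isAlignmentTime_iff {w : ℝ → LoRAWeights m n h r} {T₁ : ℝ} :
    IsAlignmentTime P w T₁ ↔ IsLeast {t : ℝ | 0 ≤ t ∧ P.model.thr ≤ P.model.p (w t)} T₁ := by
  simp only [model_p]
  rfl

/-- The bounds of a generic initialization. -/
theorem init_bounds {w : LoRAWeights m n h r} {α K : ℝ} (hα : 0 < α) (hK : 1 ≤ K)
    {N : (Fin r → Fin n → ℝ) × (Fin r → Fin h → ℝ)} (hw : w = loraInit α N)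
    (h0 : (∑ i, ∑ j, N.1 i j ^ 2) + ∑ i, ∑ j, N.2 i j ^ 2 ≤ K)
    (h1 : 1 / K ≤ |∑ i, (N.1 i ⬝ᵥ P.v) * (N.1 i ⬝ᵥ P.v)|)
    (h2 : 1 / K ≤ |∑ i, (N.2 i ⬝ᵥ P.g) * (N.2 i ⬝ᵥ P.g)|) :
    w.B₁ = 0 ∧ w.B₂ = 0 ∧ ‖w.A₁‖ ≤ K * α ∧ ‖w.A₂‖ ≤ K * α ∧ α / K ≤ ‖P.model.a w‖ ∧
      α / K ≤ ‖P.model.c w‖ := by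
  have hK0 : 0 < K := by linarith
  have h0 : ‖Matrix.of N.1‖ ^ 2 + ‖Matrix.of N.2‖ ^ 2 ≤ K := by
    rw [← sum_sq_eq, ← sum_sq_eq]
    exact h0
  have hle : ∀ {X : ℝ}, 0 ≤ X → X ^ 2 ≤ K → X ≤ K := fun hX h =>
    le_of_sq_le_sq (h.trans (by nlinarith)) hK0.le
  have hlow : ∀ z : Fin r → ℝ, 1 / K ≤ |∑ i, z i * z i| → α / K ≤ ‖α • toCol z‖ := by
    intro z hz
    have e1 : |∑ i, z i * z i| = ‖toCol z‖ ^ 2 := by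
      rw [norm_col_sq, dotProduct, abs_of_nonneg (Finset.sum_nonneg fun i _ => mul_self_nonneg _)]
    rw [e1] at hz
    rw [norm_smul, Real.norm_eq_abs, abs_of_pos hα, div_eq_mul_one_div]
    refine mul_le_mul_of_nonneg_left (le_of_sq_le_sq (le_trans ?_ hz) (norm_nonneg _)) hα.le
    have e2 : 1 / K ≤ 1 := (div_le_one hK0).2 hK
    have e3 : 0 < 1 / K := by positivity
    nlinarith
  refine ⟨by rw [hw]; rfl, by rw [hw]; rfl, ?_, ?_, ?_, ?_⟩
  · have e1 : w.A₁ = α • Matrix.of N.1 := by rw [hw]; rfl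
    rw [e1, norm_smul, Real.norm_eq_abs, abs_of_pos hα, mul_comm]
    exact mul_le_mul_of_nonneg_right
      (hle (norm_nonneg _) (by linarith [sq_nonneg ‖Matrix.of N.2‖])) hα.le
  · have e1 : w.A₂ = α • Matrix.of N.2 := by rw [hw]; rfl
    rw [e1, norm_smul, Real.norm_eq_abs, abs_of_pos hα, mul_comm]
    exact mul_le_mul_of_nonneg_right
      (hle (norm_nonneg _) (by linarith [sq_nonneg ‖Matrix.of N.1‖])) hα.le
  · change _ ≤ ‖w.A₁ * toCol P.v‖
    rw [A₁_mul_toCol hw]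
    exact hlow _ h1
  · change _ ≤ ‖w.A₂ * toCol P.g‖
    rw [A₂_mul_toCol hw]
    exact hlow _ h2

theorem bound_pos (P : RankOneLoRA m n h) (hσ₂ : 0 < P.σW₂) : 0 < P.model.bound := by
  have h1 : 0 < P.model.σ₂ := hσ₂
  have h2 : 0 < P.model.σ := P.σ_pos
  unfold AlignedModel.bound AlignedModel.sizeBound
  positivity

/-- The time horizon. -/
noncomputable def horizon (P : RankOneLoRA m n h) (c₂ α : ℝ) : ℝ :=
  6 * Real.log (1 / α) / (P.σ * P.σW₂) + c₂ * Real.log (P.σ / α) / (P.σ * P.σW₂)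

/-- The horizon is affine in `log α`, and any positive power of `α`, here the one defining `κ`,
beats its square. -/
theorem exists_scale (P : RankOneLoRA m n h) (hδ : P.δw < 1) (c₂ C C' : ℝ) : ∃ αstar : ℝ, 0 < αstar ∧ ∀ α, 0 < α → α ≤ αstar →
      α ≤ 1 ∧ α ≤ P.σ ∧ C' * α < 1 ∧
        C * α ^ ((1 - P.δw) / 2) * (1 + P.horizon c₂ α) ^ 2 ≤ 1 := by
  have hσ := P.σ_pos'
  have hlin := eventually_mul_rpow_mul_log_sq_le C (-((6 + c₂) / (P.σ * P.σW₂)))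
    (1 + c₂ * Real.log P.σ / (P.σ * P.σW₂)) (show 0 < (1 - P.δw) / 2 by linarith)
  have h1 : ∀ᶠ α in nhdsWithin (0 : ℝ) (Ioi 0), α ≤ 1 :=
    (eventually_le_nhds zero_lt_one).filter_mono nhdsWithin_le_nhds
  have h2 : ∀ᶠ α in nhdsWithin (0 : ℝ) (Ioi 0), α ≤ P.σ :=
    (eventually_le_nhds hσ).filter_mono nhdsWithin_le_nhds
  have h3 : ∀ᶠ α in nhdsWithin (0 : ℝ) (Ioi 0), C' * α < 1 := by
    have : Filter.Tendsto (fun α : ℝ => C' * α) (nhds 0) (nhds (C' * 0)) :=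
      (continuous_const.mul continuous_id).tendsto 0
    exact (this.eventually (eventually_lt_nhds (by simp))).filter_mono nhdsWithin_le_nhds
  obtain ⟨u, hu, hsub⟩ := mem_nhdsGT_iff_exists_Ioc_subset.1 (hlin.and (h1.and (h2.and h3)))
  refine ⟨u, hu, fun α hα hαu => ?_⟩
  obtain ⟨k1, k2, k3, k4⟩ := hsub ⟨hα, hαu⟩
  refine ⟨k2, k3, k4, ?_⟩
  have e1 : 1 + P.horizon c₂ α = 1 + c₂ * Real.log P.σ / (P.σ * P.σW₂) +
      -((6 + c₂) / (P.σ * P.σW₂)) * Real.log α := by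
    rw [horizon, Real.log_div one_ne_zero hα.ne', Real.log_div hσ.ne' hα.ne', Real.log_one]
    ring
  rw [e1]
  exact k1

end RankOneLoRA

end LocalConvergenceTheorem

theorem exponent_le_two {δ : ℝ} (hδ : 0 ≤ δ) : (1 + δ) / (3 + δ) ≤ 2 := by
  rw [div_le_iff₀ (by linarith)]
  linarith

/-- The stated imbalance exponent is weaker than the one proved, because `5 - δ > 2`. -/
theorem exponent_le {δ : ℝ} (hδ : δ < 1) : 4 * (1 - δ) / (5 - δ) ≤ 2 * (1 - δ) := by
  rw [div_le_iff₀ (by linarith)]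
  nlinarith

theorem theorem2 :
    ∃ c₁ c₃ : ℝ, 0 < c₁ ∧ 0 < c₃ ∧
    ∀ (m n h r : ℕ) (_ : 0 < r) (P : RankOneLoRA m n h) (_ : 0 < P.σW₂) (_ : P.δw < 1)
      (c₂ : ℝ) (_ : 0 < c₂) (ε : ℝ) (_ : 0 < ε),
    ∃ c₄ c₅ c₆ c₇ c₈ αstar : ℝ,
      0 < c₄ ∧ 0 < c₅ ∧ 0 < c₆ ∧ 0 < c₇ ∧ 0 < c₈ ∧ 0 < αstar ∧
    -- an event of probability at least `1 - ε` for the (normalized) random initialization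
    ∃ Ω : Set ((Fin r → Fin n → ℝ) × (Fin r → Fin h → ℝ)), MeasurableSet Ω ∧
      1 - ENNReal.ofReal ε ≤ ((stdGaussianMatrix r n).prod (stdGaussianMatrix r h)) Ω ∧
    ∀ N ∈ Ω, ∀ α : ℝ, 0 < α → α ≤ αstar →
    ∀ w : ℝ → LoRAWeights m n h r, w 0 = loraInit α N → IsGradientFlow P w →
    ∃ T₁ : ℝ, IsAlignmentTime P w T₁ ∧
      T₁ ≤ c₁ * Real.log (1 / α) / (P.σ * P.σW₂) ∧
      -- alignment and imbalance at the end of the alignment phase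
      (∀ q, IsTopLeftSingularVector (w T₁).Z₁ q →
        1 - c₄ * α ^ ((1 + P.δw) / (3 + P.δw)) ≤ cosSq q P.γ₁) ∧
      c₅ * α ^ (-(4 * (1 - P.δw) / (5 - P.δw))) ≤
        specNorm (w T₁).Z₁ ^ 2 / specNorm (w T₁).Z₂ ^ 2 ∧
      -- local convergence phase
      ∀ t ∈ Set.Icc T₁
          (T₁ + c₂ * Real.log (√(2 * P.loss (w 0)) / α) / (P.σ * P.σW₂)),
        (∀ q q₁, IsTopLeftSingularVector (w t).Z₁ q → IsTopLeftSingularVector (w T₁).Z₁ q₁ →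
          cosSq q₁ P.γ₁ ^ c₆ ≤ cosSq q P.γ₁) ∧
        (specNorm (w T₁).Z₁ / specNorm (w T₁).Z₂) ^ c₇ ≤
          specNorm (w t).Z₁ / specNorm (w t).Z₂ ∧
        (∀ q₁, IsTopLeftSingularVector (w T₁).Z₁ q₁ → ∀ τ : ℝ, 0 ≤ τ →
          P.loss (w t) ≤
            2 * Real.exp (-((1 - specNorm (w T₁).Z₂ / specNorm (w τ).Z₁) * (1 - P.δw) *
              (P.σ * P.σW₂) * (t - T₁) / 16)) * P.loss (w T₁) + c₈ * (1 - cosSq q₁ P.γ₁)) ∧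
        P.loss (w t) ≤
          2 * Real.exp (-((1 - P.δw) * (P.σ * P.σW₂) * (t - T₁) / 32)) * P.loss (w T₁) +
            2 * α ^ c₃ := by
  refine ⟨6, 1, by norm_num, one_pos, fun m n h r hr P hσ₂ hδ c₂ hc₂ ε hε => ?_⟩
  have hσ := P.σ_pos'
  have hδ0 : 0 ≤ P.δw := div_nonneg P.σW₁_nonneg hσ₂.le
  set M := P.model.bound with hM
  obtain ⟨f, hf, hf0, hend⟩ := P.exists_endgame hr M
  -- The event is chosen before `α`: the conditions on the normalized initialization are a size
  -- bound and lower bounds for `‖N₁ v‖²`, `‖N₂ g‖²` and the case-dependent quantity `f`.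
  obtain ⟨K, hK, Ω, hΩm, hΩ, hΩK⟩ := exists_event
    ((stdGaussianMatrix r n).prod (stdGaussianMatrix r h))
    (f := fun N => (∑ i, ∑ j, N.1 i j ^ 2) + ∑ i, ∑ j, N.2 i j ^ 2)
    (f₁ := fun N => ∑ i, (N.1 i ⬝ᵥ P.v) * (N.1 i ⬝ᵥ P.v))
    (f₂ := fun N => ∑ i, (N.2 i ⬝ᵥ P.g) * (N.2 i ⬝ᵥ P.g)) (f₃ := f)
    (by fun_prop) (by unfold dotProduct; fun_prop) (by unfold dotProduct; fun_prop) hf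
    (ae_dotProduct_mul_ne_zero_left hr (e := P.v) (by rw [P.v_dotProduct_v]; norm_num)
      (by rw [P.v_dotProduct_v]; norm_num))
    (ae_dotProduct_mul_ne_zero_right hr (e := P.g) (by rw [P.g_dotProduct_g]; norm_num)
      (by rw [P.g_dotProduct_g]; norm_num)) hf0 hε
  obtain ⟨C₁, C₀, hC₀, hend⟩ := hend K
  set F := P.model with hF
  -- One constant dominates every requirement of `Setting` and of the conclusions. None of the
  -- entries involves `α`, so `αstar` can be chosen afterwards.
  obtain ⟨C, hC⟩ := exists_forall_mem_le [0, 12 * M ^ 3, 4 * M / F.σ, 2 / F.σ₂, 2 * K,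
    8 * AlignedModel.errC M K / (F.σ * F.σ₂), 16 * AlignedModel.errC M K,
    4 * AlignedModel.errC M K + 20 * M ^ 3 * K, 2 * F.sizeC M K,
    8 * M ^ 4 / (F.σ₂ ^ 2 * F.thr),
    2 * (2 * M + 32 * M ^ 6 * K / F.rate) / (F.σ₂ * F.thr),
    128 * M ^ 8 * K / F.rate + 20 * M ^ 3 * K, 2 * (F.growC M * F.sizeC M K), C₁,
    F.floorC M C₀ * C₀ ^ 2, 2 * C₀ ^ 3,
    √(F.growC M * F.sizeC M K / F.thr) * (2 * M * K)]
  simp only [List.forall_mem_cons] at hC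
  obtain ⟨hC0, g1, g2, g3, g4, g5, g6, g7, g8, g9, g10, g11, g12, g13, g14, g15, g16, -⟩ := hC
  obtain ⟨αstar, hαs, hα⟩ := P.exists_scale hδ c₂ C (4 * M * K ^ 2)
  have hM0 : 0 < M := P.bound_pos hσ₂
  have hthr : 0 < F.thr := by
    rw [hF, P.model_thr]
    have : 0 < 1 - P.δw := by linarith
    positivity
  have hsize : 0 < F.sizeC M K := by
    unfold AlignedModel.sizeC
    have : 0 < K := by linarith
    positivity
  have hfloor : 0 < F.floorC M C₀ := by
    unfold AlignedModel.floorC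
    have : 0 < C₀ := by linarith
    positivity
  refine ⟨C₀ ^ 3, F.thr / F.sizeC M K, 2 * C₀ ^ 2, (1 - P.δw) / 2, F.floorC M C₀ * C₀, αstar,
    by positivity, by positivity, by positivity, by linarith, by positivity, hαs, Ω, hΩm, hΩ, ?_⟩
  intro N hN α hα0 hαle w hw hflow
  obtain ⟨n0, n1, n2, n3⟩ := hΩK N hN
  obtain ⟨a1, a2, a3, a4⟩ := hα α hα0 hαle
  obtain ⟨i1, i2, i3, i4, i5, i6⟩ := RankOneLoRA.init_bounds (P := P) hα0 hK hw n0 n1 n2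
  set κ := α ^ ((1 - P.δw) / 2) with hκ
  have hκ0 : 0 < κ := Real.rpow_pos_of_pos hα0 _
  have hκsq : κ ^ 2 = α ^ (1 - P.δw) := by
    rw [hκ, ← Real.rpow_natCast, ← Real.rpow_mul hα0.le]
    congr 1
    push_cast
    ring
  have hlog : 0 ≤ Real.log (1 / α) := Real.log_nonneg ((one_le_div hα0).2 a1)
  have hlog' : 0 ≤ c₂ * Real.log (P.σ / α) / (P.σ * P.σW₂) := by
    have := Real.log_nonneg ((one_le_div hα0).2 a2)
    positivity
  have hT : 6 * Real.log (1 / α) / (P.σ * P.σW₂) ≤ P.horizon c₂ α := by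
    unfold RankOneLoRA.horizon
    linarith
  have hT0 : 0 ≤ P.horizon c₂ α := le_trans (by positivity) hT
  have S : F.Setting w K M α κ (P.horizon c₂ α) C :=
    { flow := P.isFlow hflow
      σ_pos := hσ
      σ₂_pos := hσ₂
      σ₁_nonneg := P.σW₁_nonneg
      σ₁_lt := (div_lt_one hσ₂).1 hδ
      one_le_K := hK
      α_pos := hα0
      κ_pos := hκ0
      T_nonneg := hT0
      B₁_zero := i1
      B₂_zero := i2
      A₁_le := i3
      A₂_le := i4
      le_a := i5
      le_c := i6
      bound_le := le_rfl
      α_le := by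
        rw [hκsq]
        calc α = α ^ (1 : ℝ) := (Real.rpow_one α).symm
          _ ≤ α ^ (1 - P.δw) := Real.rpow_le_rpow_of_exponent_ge hα0 a1 (by linarith)
      κ_sq := hκsq
      small := by
        refine le_trans (mul_le_mul_of_nonneg_left ?_ (mul_nonneg hC0 hκ0.le)) a4
        nlinarith
      C_ge_off := g1
      C_ge_e := g2
      C_ge_σ₂ := g3
      C_ge_K := g4
      C_ge_err := g5
      C_ge_s := g6
      C_ge_size := g7
      C_ge_sizeC := g8
      C_ge_decay := g9
      C_ge_thr := g10
      C_ge_late := g11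
      C_ge_growC := g12 }
  obtain ⟨T₁, hT₁, hleast, hbefore⟩ := S.exists_alignmentTime hT a3
  have A : F.AlignedAt w κ (P.horizon c₂ α) T₁ :=
    { nonneg := hT₁.1
      le_T := hT₁.2.trans hT
      early := S.early (hT₁.2.trans hT) hbefore
      thr_le := hleast.1.2 }
  obtain ⟨D, G⟩ := hend N w α κ _ C T₁ hw n3 S g13 a4 A
  have hβ := exponent_le_two hδ0
  have hγ := exponent_le hδ
  refine ⟨T₁, RankOneLoRA.isAlignmentTime_iff.2 hleast, hT₁.2,
    fun q hq => S.one_sub_le_cosSq A G (by linarith) hq hβ, S.le_ratio_sq A hγ, fun t ht => ?_⟩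
  -- The initial loss is `σ² / 2`, so `T₂` is the second summand of the horizon, and the bound on
  -- `T₁` is the first.
  rw [RankOneLoRA.sqrt_loss_zero hw] at ht
  have ht' : t ∈ Icc T₁ (P.horizon c₂ α) := ⟨ht.1, ht.2.trans (add_le_add_left hT₁.2 _)⟩
  exact ⟨fun q q₁ hq hq₁ => S.cosSq_rpow_le G hC₀ g15 ht' hq hq₁, S.ratio_rpow_le_ratio A g16 ht',
    fun q₁ hq₁ τ _ => S.loss_le A G ht' hq₁ τ, S.loss_le_rpow A G g14 ht'⟩
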